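/- **Conventions.** Work over $\mathbb{Q}$. Red letters are called poles, blue letters strands. Braids are read from bottom to top; in a product $\beta\beta'$ the factor $\beta$ is at the bottom. *Mixed braids.* Let $o,o'$ be words in red and blue letters. A mixed braid from $o$ to $o'$ is a braid $\beta$ whose strands join letters of $o$ (bottom) with letters of $o'$ (top) of the same colour, and which becomes the trivial braid when its blue strands are removed. A mixed permutation from $o$ to $o'$ is a colour-preserving bijection of the letters of $o$ with those of $o'$ that preserves the order of the red letters; $\pi(\beta)$ denotes the mixed permutation underlying $\beta$. The objects of $\mathbf{PaMB}$ are the parenthesized words $O$ in red and blue letters (the empty word included). Let $o$ be the underlying word of $O$, and let $\overline O$ be the parenthesized red word obtained by removing the blue letters. If $\overline O\neq\overline{O'}$ or the words have different types, there is no morphism $O\to O'$; otherwise $\mathbf{PaMB}(O,O')$ is the set of pairs $(x,\sigma)$, where $\sigma$ is a mixed permutation from $o$ to $o'$ and $x$ is a $\mathbb{Q}$-linear combination of mixed braids $\beta$ from $o$ to $o'$ with $\pi(\beta)=\sigma$. Composition is the bilinear extension of the product of braids. Let $P_o$ be the group of mixed braids from $o$ to $o$ with trivial permutation, and let $I_o\subset\mathbb{Q}P_o$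 be its augmentation ideal. $\mathbf{PaMB}$ is filtered by the spaces $I_o^{\,n}\cdot\mathbf{PaMB}(O,O')_\sigma$. Let $J_o\subset\mathbb{Q}P_o$ be the two-sided ideal generated by the elements $\tau-1$, where $\tau$ runs over the full twists of two blue strands (the standard generators $\tau_{ij}$ of $P_{m,n}$, transported from the word with all poles on the left along mixed braids). For $k\ge 1$, $\mathbf{PaMB}^{/k}$ is the quotient of $\mathbf{PaMB}$ by the subspaces $J_o^{\,k}\cdot\mathbf{PaMB}(O,O')_\sigma$, with the induced filtration. *Mixed chord diagrams.* For a word $o$ let $\mathcal{A}_o$ be the associative algebra generated by $t_{ij}=t_{ji}$ for distinct positions $i,j$ of $o$ that are not both red, with relations $[t_{ij},t_{pq}]=0$ for $\{i,j\}\cap\{p,q\}=\emptyset$ and $[t_{ij}+t_{ip},t_{jp}]=0$ for distinct $i,j,p$, no two of which are red; it is graded by $\deg t_{ij}=1$, and it is the enveloping algebra of the Lie algebra $\mathsf{dk}_o$ with the same presentation. For $k\ge1$ let $\mathcal{A}_o^{/k}$ be the quotient of $\mathcal{A}_o$ by the span of the words in the $t_{ij}$ that contain at least $k$ letters $t_{ij}$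 with $i,j$ both blue, and let $\mathsf{dk}_o^{/k}$ be the image of $\mathsf{dk}_o$ in it. Hats denote degree completions. The category $\widehat{\mathbf{PaMCD}}$ (resp. $\widehat{\mathbf{PaMCD}^{/k}}$) has the same objects as $\mathbf{PaMB}$; its morphisms $O\to O'$ are the pairs $(u,\sigma)$, where $u\in\widehat{\mathcal{A}}_o$ (resp. $\widehat{\mathcal{A}}{}_o^{/k}$) and $\sigma$ is a mixed permutation from $o$ to $o'$, if $\overline O=\overline{O'}$, and there are none otherwise. Composition is $(u,\sigma)(u',\sigma')=(u\,\sigma(u'),\sigma\sigma')$, where $\sigma(u')$ is $u'$ with the top positions replaced by the bottom positions of the same strands. *Operadic operations.* On mixed braids: extension by a straight pole or strand, outermost on the left or on the right; cabling, which doubles the $i$-th pole or strand (the letter $a$ becomes $(aa)$ in the parenthesized words); and $\vartheta_i$, which turns a pole into a strand. On chord diagrams: chords are kept under extension and under $\vartheta_i$ (up to the relabelling of positions), and under cabling a chord ending on the doubled strand is replaced by the sum of the two chords ending on its two copies. *Homomorphic expansions.* A homomorphic expansion for $\mathbf{PaMB}$ (resp. $\mathbf{PaMB}^{/k}$) is a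 functor $Z$ to $\widehat{\mathbf{PaMCD}}$ (resp. $\widehat{\mathbf{PaMCD}^{/k}}$) that is the identity on objects and on underlying permutations, is $\mathbb{Q}$-linear on the morphisms with a given permutation, and satisfies: 1. $Z$ sends the $n$-th step of the filtration to series that begin in degree $\ge n$; 2. $Z$ induces the identity on the associated graded: for a mixed braid $\beta$ from $o$ and full twists $A_1,\dots,A_n\in P_o$ of pairs of positions $(i_1,j_1),\dots,(i_n,j_n)$, not both red, the degree $n$ part of $Z((A_1-1)\cdots(A_n-1)\beta)$ is $(t_{i_1j_1}\cdots t_{i_nj_n},\pi(\beta))$; 3. $Z$ commutes with all the operadic operations; 4. $Z$ is group-like: for each mixed braid $\beta$ from $o$ one has $Z(\beta)=(\exp(u),\pi(\beta))$ with $u\in\widehat{\mathsf{dk}}_o$ (resp. $\widehat{\mathsf{dk}}{}_o^{/k}$). *Drinfeld associators.* A Drinfeld associator is a series $\Phi(x,y)=\exp(\varphi(x,y))\in\mathbb{Q}\langle\langle x,y\rangle\rangle$ with $\varphi$ a Lie series (without constant term) such that, in the completed enveloping algebras of the Drinfeld–Kohno Lie algebras on four and three strands, for both signs, $$\Phi(t_{12},t_{23})\,\Phi(t_{12}+t_{13},t_{24}+t_{34})\,\Phi(t_{23},t_{34})=\Phi(t_{13}+t_{23},t_{34})\,\Phi(t_{12},t_{23}+t_{24}),$$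 $$e^{\pm(t_{13}+t_{23})/2}=\Phi(t_{12},t_{23})\,e^{\pm t_{23}/2}\,\Phi(t_{13},t_{23})^{-1}\,e^{\pm t_{13}/2}\,\Phi(t_{13},t_{12}).$$ **Proposition.** Every Drinfeld associator $\Phi$ gives rise to a homomorphic expansion $Z$ for $\mathbf{PaMB}$, whose values, after the colours are forgotten, are $\exp(t_{12}/2)$ on the elementary crossing $xy\to yx$ ($x,y$ not both red) and $\Phi(t_{12},t_{23})$ on the trivial braid $(xy)z\to x(yz)$ ($x,y,z$ not all red). Consequently, for every $k\ge1$ it gives rise to a homomorphic expansion for $\mathbf{PaMB}^{/k}$, namely the one induced by $Z$ on the quotients. -/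

import Mathlib

set_option linter.unusedSimpArgs false

namespace MixedBraids

/-! Mixed braids: the poles are coloured red, the strands are coloured blue.  All braids are read
from the bottom to the top, so that in a product `a * b` the factor `a` is at the bottom; positions
are numbered from the left, starting at `0`. -/

inductive Color
  | red
  | blue
  deriving DecidableEq

open Color

/-- Artin's relations between the generators `0, …, l - 2`. -/
def braidRels (l : ℕ) : Set (FreeGroup (Fin (l - 1))) :=
  {r | ∃ i j : Fin (l - 1), i.val + 1 < j.val ∧
      r = FreeGroup.of i * FreeGroup.of j * (FreeGroup.of j * FreeGroup.of i)⁻¹} ∪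
  {r | ∃ i j : Fin (l - 1), i.val + 1 = j.val ∧
      r = FreeGroup.of i * FreeGroup.of j * FreeGroup.of i *
        (FreeGroup.of j * FreeGroup.of i * FreeGroup.of j)⁻¹}

/-- The braid group on `l` strands. -/
abbrev BraidGroup (l : ℕ) : Type := PresentedGroup (braidRels l)

/-- The elementary braid that crosses the strands at the positions `j` and `j + 1`. -/
def sig (l j : ℕ) : BraidGroup l :=
  if h : j < l - 1 then PresentedGroup.of ⟨j, h⟩ else 1

section Basic

theorem sig_comm {l i j : ℕ} (h : i + 1 < j) : sig l i * sig l j = sig l j * sig l i := by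
  unfold sig
  by_cases hj : j < l - 1
  · have hi : i < l - 1 := by omega
    rw [dif_pos hi, dif_pos hj]
    have := PresentedGroup.one_of_mem (rels := braidRels l)
      (x := FreeGroup.of ⟨i, hi⟩ * FreeGroup.of ⟨j, hj⟩ *
        (FreeGroup.of ⟨j, hj⟩ * FreeGroup.of ⟨i, hi⟩)⁻¹) (Or.inl ⟨⟨i, hi⟩, ⟨j, hj⟩, h, rfl⟩)
    rw [map_mul, map_inv, mul_inv_eq_one] at this
    exact this
  · rw [dif_neg hj]; simp

theorem sig_braid {l i : ℕ} (h : i + 2 < l) :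
    sig l i * sig l (i + 1) * sig l i = sig l (i + 1) * sig l i * sig l (i + 1) := by
  have hi : i < l - 1 := by omega
  have hj : i + 1 < l - 1 := by omega
  unfold sig
  rw [dif_pos hi, dif_pos hj]
  have := PresentedGroup.one_of_mem (rels := braidRels l)
    (x := FreeGroup.of ⟨i, hi⟩ * FreeGroup.of ⟨i + 1, hj⟩ * FreeGroup.of ⟨i, hi⟩ *
        (FreeGroup.of ⟨i + 1, hj⟩ * FreeGroup.of ⟨i, hi⟩ * FreeGroup.of ⟨i + 1, hj⟩)⁻¹)
    (Or.inr ⟨⟨i, hi⟩, ⟨i + 1, hj⟩, rfl, rfl⟩)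
  rw [map_mul, map_inv, mul_inv_eq_one] at this
  exact this

theorem braid_induction {l : ℕ} {P : BraidGroup l → Prop} (one : P 1)
    (gen : ∀ j, j + 1 < l → P (sig l j)) (mul : ∀ a b, P a → P b → P (a * b))
    (inv : ∀ a, P a → P a⁻¹) (b : BraidGroup l) : P b := by
  induction b using PresentedGroup.induction_on with
  | _ z =>
    induction z using FreeGroup.induction_on with
    | C1 => simpa using one
    | of i =>
      have := gen i.val (by omega)
      rw [sig, dif_pos i.isLt] at this
      exact this
    | inv_of i h => rw [map_inv]; exact inv _ h
    | mul a b ha hb => rw [map_mul]; exact mul _ _ ha hb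

variable {G : Type*} [Group G]

/-- A family that satisfies Artin's relations defines a homomorphism. -/
def braidLift {l : ℕ} (f : ℕ → G)
    (hcomm : ∀ i j, i + 1 < j → j + 1 < l → f i * f j = f j * f i)
    (hbraid : ∀ i, i + 2 < l → f i * f (i + 1) * f i = f (i + 1) * f i * f (i + 1)) :
    BraidGroup l →* G :=
  PresentedGroup.toGroup (f := fun i : Fin (l - 1) => f i.val) (by
    rintro r (⟨i, j, hij, rfl⟩ | ⟨i, j, hij, rfl⟩)
    · simp only [map_mul, map_inv, FreeGroup.lift_apply_of, mul_inv_eq_one]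
      exact hcomm _ _ hij (by omega)
    · simp only [map_mul, map_inv, FreeGroup.lift_apply_of, mul_inv_eq_one]
      rw [← hij]; exact hbraid _ (by omega))

theorem braidLift_sig {l : ℕ} (f : ℕ → G) (hc hb) {j : ℕ} (h : j + 1 < l) :
    braidLift (l := l) f hc hb (sig l j) = f j := by
  rw [sig, dif_pos (by omega)]
  exact PresentedGroup.toGroup.of _

end Basic

/-- The transposition of the positions `j` and `j + 1`. -/
def sw (l j : ℕ) : Equiv.Perm (Fin l) :=
  if h : j + 1 < l then Equiv.swap ⟨j, by omega⟩ ⟨j + 1, h⟩ else 1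

theorem sw_val {l j : ℕ} (h : j + 1 < l) (x : Fin l) :
    (sw l j x).val = if x.val = j then j + 1 else if x.val = j + 1 then j else x.val := by
  rw [sw, dif_pos h, Equiv.swap_apply_def]
  simp only [Fin.ext_iff]
  split_ifs <;> rfl

theorem sw_inv {l : ℕ} (j : ℕ) : (sw l j)⁻¹ = sw l j := by
  unfold sw; split_ifs <;> simp

theorem sw_comm {l i j : ℕ} (h : i + 1 < j) (hj : j + 1 < l) :
    sw l i * sw l j = sw l j * sw l i := by
  ext x
  simp only [Equiv.Perm.mul_apply, sw_val (show i + 1 < l by omega), sw_val hj]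
  grind

theorem sw_braid {l i : ℕ} (h : i + 2 < l) :
    sw l i * sw l (i + 1) * sw l i = sw l (i + 1) * sw l i * sw l (i + 1) := by
  ext x
  simp only [Equiv.Perm.mul_apply, sw_val (show i + 1 < l by omega), sw_val (show i + 1 + 1 < l by omega)]
  grind

/-- The homomorphism to the symmetric group; it sends the position of a strand at the top to its
position at the bottom. -/
def topToBottom {l : ℕ} : BraidGroup l →* Equiv.Perm (Fin l) :=
  braidLift (sw l) (fun _ _ h hj => sw_comm h hj) (fun _ h => sw_braid h)

/-- The permutation underlying a braid: the strand that starts at the bottom position `i` ends at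
the top position `perm b i`. -/
def perm {l : ℕ} (b : BraidGroup l) : Equiv.Perm (Fin l) := (topToBottom b)⁻¹

theorem perm_sig {l j : ℕ} (h : j + 1 < l) : perm (sig l j) = sw l j := by
  rw [perm, topToBottom, braidLift_sig _ _ _ h, sw_inv]

theorem perm_one {l : ℕ} : perm (1 : BraidGroup l) = 1 := by simp [perm]

theorem perm_mul {l : ℕ} (a b : BraidGroup l) : perm (a * b) = (perm a).trans (perm b) := by
  rw [perm, map_mul, mul_inv_rev]; rfl

theorem perm_inv {l : ℕ} (a : BraidGroup l) : perm a⁻¹ = (perm a).symm := by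
  rw [perm, map_inv]; rfl

/-! A family `f j x` of values on the elementary braids extends, under the two conditions `hc` and `hb`,
to a function on all braids with `cocycle (a * b) x = cocycle a x * cocycle b (perm a x)`. -/

section Cocycle

variable {l : ℕ} {X G : Type*} [Group G]

def coAction (a : Equiv.Perm (Fin l) →* Equiv.Perm X) : Equiv.Perm (Fin l) →* MulAut (X → G) where
  toFun p :=
    { toFun := fun f x => f ((a p)⁻¹ x)
      invFun := fun f x => f (a p x)
      left_inv := fun f => by ext; simp
      right_inv := fun f => by ext; simp
      map_mul' := fun _ _ => rfl }
  map_one' := by ext f x; simp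
  map_mul' p q := by ext f x; simp

theorem coAction_apply (a : Equiv.Perm (Fin l) →* Equiv.Perm X) (p : Equiv.Perm (Fin l))
    (f : X → G) (x : X) : coAction a p f x = f (a p⁻¹ x) := by rw [map_inv]; rfl

def cocycleHom (a : Equiv.Perm (Fin l) →* Equiv.Perm X) (f : ℕ → X → G)
    (hc : ∀ i j, i + 1 < j → j + 1 < l → ∀ x,
      f i x * f j (a (sw l i) x) = f j x * f i (a (sw l j) x))
    (hb : ∀ i, i + 2 < l → ∀ x,
      f i x * f (i + 1) (a (sw l i) x) * f i (a (sw l (i + 1)) (a (sw l i) x)) =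
        f (i + 1) x * f i (a (sw l (i + 1)) x) * f (i + 1) (a (sw l i) (a (sw l (i + 1)) x))) :
    BraidGroup l →* (X → G) ⋊[coAction (G := G) a] Equiv.Perm (Fin l) :=
  braidLift (fun j => ⟨f j, sw l j⟩)
    (fun i j h hj => by
      ext x
      · simpa [coAction_apply, sw_inv, -SemidirectProduct.mk_eq_inl_mul_inr, -map_inv] using hc i j h hj x
      · simp [sw_comm h hj])
    (fun i h => by
      ext x
      · simpa [coAction_apply, sw_inv, -SemidirectProduct.mk_eq_inl_mul_inr, -map_inv] using hb i h x
      · simp [sw_braid h])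


variable (a : Equiv.Perm (Fin l) →* Equiv.Perm X) (f : ℕ → X → G)
    (hc : ∀ i j, i + 1 < j → j + 1 < l → ∀ x,
      f i x * f j (a (sw l i) x) = f j x * f i (a (sw l j) x))
    (hb : ∀ i, i + 2 < l → ∀ x,
      f i x * f (i + 1) (a (sw l i) x) * f i (a (sw l (i + 1)) (a (sw l i) x)) =
        f (i + 1) x * f i (a (sw l (i + 1)) x) * f (i + 1) (a (sw l i) (a (sw l (i + 1)) x)))

theorem cocycleHom_right (b : BraidGroup l) : (cocycleHom a f hc hb b).right = topToBottom b := by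
  induction b using braid_induction with
  | one => simp
  | gen j h => rw [cocycleHom, topToBottom, braidLift_sig _ _ _ h, braidLift_sig _ _ _ h]
  | mul b c hb hc => simp [hb, hc]
  | inv b hb => simp [hb]

def cocycle (b : BraidGroup l) (x : X) : G := (cocycleHom a f hc hb b).left x

theorem cocycle_one (x : X) : cocycle a f hc hb 1 x = 1 := by simp [cocycle]

theorem cocycle_sig {j : ℕ} (h : j + 1 < l) (x : X) : cocycle a f hc hb (sig l j) x = f j x := by
  rw [cocycle, cocycleHom, braidLift_sig _ _ _ h]

theorem cocycle_mul (b c : BraidGroup l) (x : X) :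
    cocycle a f hc hb (b * c) x = cocycle a f hc hb b x * cocycle a f hc hb c (a (perm b) x) := by
  simp [cocycle, coAction_apply, cocycleHom_right, perm, -map_inv]

theorem cocycle_inv (b : BraidGroup l) (x : X) :
    cocycle a f hc hb b⁻¹ x = (cocycle a f hc hb b (a (perm b)⁻¹ x))⁻¹ := by
  rw [eq_inv_iff_mul_eq_one]
  have := cocycle_mul a f hc hb b⁻¹ b x
  rw [inv_mul_cancel, cocycle_one, perm_inv] at this
  exact this.symm

end Cocycle

/-- The elementary braid `sig l j` with its strand starting at the position `i` doubled. -/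
def doubleGen (l j i : ℕ) : BraidGroup (l + 1) :=
  if i < j then sig (l + 1) (j + 1)
  else if i = j then sig (l + 1) (j + 1) * sig (l + 1) j
  else if i = j + 1 then sig (l + 1) j * sig (l + 1) (j + 1)
  else sig (l + 1) j

section
variable {l : ℕ}

theorem doubleGen_comm (i j : ℕ) (h : i + 1 < j) (hj : j + 1 < l) (x : Fin l) :
    doubleGen l i x * doubleGen l j (sw l i x) = doubleGen l j x * doubleGen l i (sw l j x) := by
  have c1 : Commute (sig (l + 1) i) (sig (l + 1) j) := sig_comm (by omega)
  have c2 : Commute (sig (l + 1) i) (sig (l + 1) (j + 1)) := sig_comm (by omega)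
  have c4 : Commute (sig (l + 1) (i + 1)) (sig (l + 1) (j + 1)) := sig_comm (by omega)
  have e1 : doubleGen l j (sw l i x) = doubleGen l j x := by
    rw [sw_val (by omega)]; unfold doubleGen; grind
  have e2 : doubleGen l i (sw l j x) = doubleGen l i x := by
    rw [sw_val (by omega)]; unfold doubleGen; grind
  rw [e1, e2]
  change Commute _ _
  by_cases hx : x.val ≤ i + 1
  · rw [show doubleGen l j x = sig (l + 1) (j + 1) by unfold doubleGen; grind]
    unfold doubleGen
    split_ifs
    exacts [c4, c4.mul_left c2, c2.mul_left c4, c2]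
  · rw [show doubleGen l i x = sig (l + 1) i by unfold doubleGen; grind]
    unfold doubleGen
    split_ifs
    exacts [c2, c2.mul_right c1, c1.mul_right c2, c1]

theorem doubleGen_braid (i : ℕ) (h : i + 2 < l) (x : Fin l) :
    doubleGen l i x * doubleGen l (i + 1) (sw l i x) *
        doubleGen l i (sw l (i + 1) (sw l i x)) =
      doubleGen l (i + 1) x * doubleGen l i (sw l (i + 1) x) *
        doubleGen l (i + 1) (sw l i (sw l (i + 1) x)) := by
  have b1 := sig_braid (l := l + 1) (i := i) (by omega)
  have b2 := sig_braid (l := l + 1) (i := i + 1) (by omega)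
  have c := sig_comm (l := l + 1) (i := i) (j := i + 1 + 1) (by omega)
  generalize hA : sig (l + 1) i = A at *
  generalize hB : sig (l + 1) (i + 1) = B at *
  generalize hC : sig (l + 1) (i + 1 + 1) = C at *
  have key : x.val < i ∨ x.val = i ∨ x.val = i + 1 ∨ x.val = i + 2 ∨ i + 2 < x.val := by omega
  simp only [sw_val (show i + 1 < l by omega), sw_val (show i + 1 + 1 < l by omega)]
  unfold doubleGen
  have b1' : ∀ z, A * (B * (A * z)) = B * (A * (B * z)) := fun z => by
    simpa [mul_assoc] using congrArg (· * z) b1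
  have b2' : ∀ z, B * (C * (B * z)) = C * (B * (C * z)) := fun z => by
    simpa [mul_assoc] using congrArg (· * z) b2
  have c' : ∀ z, C * (A * z) = A * (C * z) := fun z => by
    simpa [mul_assoc] using congrArg (· * z) c.symm
  have c2 := c.symm
  simp only [mul_assoc] at b1 b2
  rcases key with hx | hx | hx | hx | hx
  · simp [show x.val ≠ i by omega, show x.val ≠ i + 1 by omega, hx, show x.val < i + 1 by omega,
      show x.val ≠ i + 1 + 1 by omega, hB, hC, mul_assoc, b2]
  · simp only [hx, lt_irrefl, if_false, if_true, lt_add_iff_pos_right, zero_lt_one,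
      show i + 1 ≠ i by omega, show ¬ i + 1 + 1 < i by omega, show i + 1 + 1 ≠ i by omega,
      show i + 1 + 1 ≠ i + 1 by omega, show ¬ i + 1 < i by omega, hA, hB, hC, mul_assoc,
      show i ≠ i + 1 by omega, show i ≠ i + 1 + 1 by omega]
    rw [← c', b1, b2', c']
  · simp only [hx, lt_irrefl, if_false, if_true, lt_add_iff_pos_right, zero_lt_one,
      show i + 1 ≠ i by omega, show ¬ i + 1 + 1 < i by omega, show i + 1 + 1 ≠ i by omega,
      show i + 1 + 1 ≠ i + 1 by omega, show ¬ i + 1 < i by omega, hA, hB, hC, mul_assoc,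
      show i ≠ i + 1 by omega, show i ≠ i + 1 + 1 by omega, show ¬ i + 1 + 1 < i + 1 by omega]
    rw [b2', ← c', c2, b1']
  · simp only [hx, lt_irrefl, if_false, if_true, lt_add_iff_pos_right, zero_lt_one,
      show i + 1 ≠ i by omega, show ¬ i + 1 + 1 < i by omega, show i + 1 + 1 ≠ i by omega,
      show i + 1 + 1 ≠ i + 1 by omega, show ¬ i + 1 < i by omega, hA, hB, hC, mul_assoc,
      show i ≠ i + 1 by omega, show i ≠ i + 1 + 1 by omega, show ¬ i + 1 + 1 < i + 1 by omega,
      show i + 2 = i + 1 + 1 by omega]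
    rw [c', b1', b2, ← c']
  · simp [show x.val ≠ i by omega, show x.val ≠ i + 1 by omega, show ¬ x.val < i by omega,
      show ¬ x.val < i + 1 by omega, show x.val ≠ i + 1 + 1 by omega, hA, hB, mul_assoc, b1]

/-- Cabling: the strand of `b` that starts at the bottom position `i` is replaced by two parallel
strands. -/
def double (b : BraidGroup l) (i : Fin l) : BraidGroup (l + 1) :=
  cocycle (MonoidHom.id _) (fun j i => doubleGen l j i.val)
    (fun i j h hj x => doubleGen_comm i j h hj x) (fun i h x => doubleGen_braid i h x) b i

theorem double_sig {j : ℕ} (h : j + 1 < l) (i : Fin l) : double (sig l j) i = doubleGen l j i :=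
  cocycle_sig _ _ _ _ h _
theorem double_mul (b c : BraidGroup l) (i : Fin l) :
    double (b * c) i = double b i * double c (perm b i) := cocycle_mul _ _ _ _ _ _ _
/-- Extension by a straight strand on the left. -/
def addLeft : BraidGroup l →* BraidGroup (l + 1) :=
  braidLift (fun j => sig (l + 1) (j + 1)) (fun _ _ h _ => sig_comm (by omega))
    (fun _ h => sig_braid (by omega))

/-- Extension by a straight strand on the right. -/
def addRight : BraidGroup l →* BraidGroup (l + 1) :=
  braidLift (fun j => sig (l + 1) j) (fun _ _ h _ => sig_comm (by omega))
    (fun _ h => sig_braid (by omega))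

/-- The colour at a position. -/
def col (c : Fin l → Color) (p : ℕ) : Color := if h : p < l then c ⟨p, h⟩ else blue

/-- The number of red letters before the position `p`. -/
def rank (c : Fin l → Color) (p : ℕ) : ℕ := Nat.count (fun q => col c q = red) p

/-- The number of red letters. -/
def redCount (c : Fin l → Color) : ℕ := rank c l

/-- The colours at the top of a braid, given the colours at the bottom. -/
def colAct : Equiv.Perm (Fin l) →* Equiv.Perm (Fin l → Color) where
  toFun p := p.arrowCongr (Equiv.refl _)
  map_one' := rfl
  map_mul' _ _ := rfl

theorem colAct_apply (p : Equiv.Perm (Fin l)) (c : Fin l → Color) (x : Fin l) :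
    colAct p c x = c (p.symm x) := rfl

theorem rank_zero (c : Fin l → Color) : rank c 0 = 0 := rfl

theorem rank_succ (c : Fin l → Color) (p : ℕ) :
    rank c (p + 1) = rank c p + if col c p = red then 1 else 0 := Nat.count_succ _ _

theorem rank_mono (c : Fin l → Color) {p q : ℕ} (h : p ≤ q) : rank c p ≤ rank c q :=
  Nat.count_monotone _ h

theorem col_val (c : Fin l → Color) (x : Fin l) : col c x.val = c x := by simp [col]

theorem sw_symm (j : ℕ) : (sw l j).symm = sw l j := sw_inv j

theorem col_sw {j : ℕ} (h : j + 1 < l) (c : Fin l → Color) (p : ℕ) :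
    col (colAct (sw l j) c) p = col c (if p = j then j + 1 else if p = j + 1 then j else p) := by
  unfold col
  by_cases hp : p < l
  · rw [dif_pos hp, dif_pos (by grind), colAct_apply, sw_symm]
    congr 1
    ext
    rw [sw_val h]
  · rw [dif_neg hp, dif_neg (by grind)]

theorem rank_sw {j : ℕ} (h : j + 1 < l) (c : Fin l → Color) (p : ℕ) :
    rank (colAct (sw l j) c) p =
      if p = j + 1 then rank c j + (if col c (j + 1) = red then 1 else 0) else rank c p := by
  have H : ∀ p ≤ j, rank (colAct (sw l j) c) p = rank c p := by
    intro p hp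
    induction p with
    | zero => rfl
    | succ p ih =>
      rw [rank_succ, rank_succ, ih (by omega), col_sw h]
      simp only [show p ≠ j by omega, show p ≠ j + 1 by omega, if_false]
  have H1 : rank (colAct (sw l j) c) (j + 1) =
      rank c j + (if col c (j + 1) = red then 1 else 0) := by
    rw [rank_succ, H j le_rfl, col_sw h, if_pos rfl]
  have H2 : ∀ p, rank (colAct (sw l j) c) (j + 2 + p) = rank c (j + 2 + p) := by
    intro p
    induction p with
    | zero =>
      rw [add_zero, rank_succ, H1, col_sw h, rank_succ, rank_succ]
      simp only [show j + 1 ≠ j by omega, if_true, if_false]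
      omega
    | succ p ih =>
      rw [← add_assoc, rank_succ, rank_succ, ih, col_sw h]
      simp only [show j + 2 + p ≠ j by omega, show j + 2 + p ≠ j + 1 by omega, if_false]
  split_ifs with h1 h2
  · subst h1; rw [H1, if_pos h2]
  · subst h1; rw [H1, if_neg h2]
  · rcases Nat.lt_or_ge p (j + 1) with h2 | h2
    · exact H p (by omega)
    · obtain ⟨q, rfl⟩ := Nat.exists_eq_add_of_le (show j + 2 ≤ p by omega)
      exact H2 q

theorem redCount_sw {j : ℕ} (h : j + 1 < l) (c : Fin l → Color) :
    redCount (colAct (sw l j) c) = redCount c := by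
  rw [redCount, rank_sw h, if_neg (by omega)]; rfl

/-- The braid on `m` strands left from `sig l j` when the blue strands are removed.  The colours are those
at the bottom; the value is only meaningful if there are `m` red letters. -/
def forgetGen (l m j : ℕ) (c : Fin l → Color) : BraidGroup m :=
  if redCount c = m ∧ col c j = red ∧ col c (j + 1) = red then sig m (rank c j) else 1

theorem forgetGen_comm (m i j : ℕ) (h : i + 1 < j) (hj : j + 1 < l) (c : Fin l → Color) :
    forgetGen l m i c * forgetGen l m j (colAct (sw l i) c) =
      forgetGen l m j c * forgetGen l m i (colAct (sw l j) c) := by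
  have e1 : forgetGen l m j (colAct (sw l i) c) = forgetGen l m j c := by
    unfold forgetGen
    rw [redCount_sw (by omega), col_sw (by omega), col_sw (by omega), rank_sw (by omega)]
    simp only [show j ≠ i by omega, show j ≠ i + 1 by omega, show j + 1 ≠ i by omega,
      show j + 1 ≠ i + 1 by omega, if_false]
  have e2 : forgetGen l m i (colAct (sw l j) c) = forgetGen l m i c := by
    unfold forgetGen
    rw [redCount_sw (by omega), col_sw (by omega), col_sw (by omega), rank_sw (by omega)]
    simp only [show i ≠ j by omega, show i ≠ j + 1 by omega, show i + 1 ≠ j by omega,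
      show i + 1 ≠ j + 1 by omega, if_false]
  rw [e1, e2]
  unfold forgetGen
  split_ifs with h1 h2
  · refine sig_comm ?_
    have := rank_mono c (show i + 1 + 1 ≤ j by omega)
    rw [rank_succ, rank_succ, if_pos h1.2.1, if_pos h1.2.2] at this
    omega
  all_goals simp

theorem forgetGen_braid (m i : ℕ) (h : i + 2 < l) (c : Fin l → Color) :
    forgetGen l m i c * forgetGen l m (i + 1) (colAct (sw l i) c) *
        forgetGen l m i (colAct (sw l (i + 1)) (colAct (sw l i) c)) =
      forgetGen l m (i + 1) c * forgetGen l m i (colAct (sw l (i + 1)) c) *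
        forgetGen l m (i + 1) (colAct (sw l i) (colAct (sw l (i + 1)) c)) := by
  have h1 : i + 1 < l := by omega
  have h2 : i + 1 + 1 < l := by omega
  have hm : redCount c = m → col c i = red → col c (i + 1) = red → col c (i + 1 + 1) = red →
      rank c i + 2 < m := by
    intro e ha hb hc
    have := rank_mono c (show i + 1 + 1 + 1 ≤ l by omega)
    rw [rank_succ, rank_succ, rank_succ, if_pos ha, if_pos hb, if_pos hc] at this
    unfold redCount at e
    omega
  unfold forgetGen
  simp only [redCount_sw h1, redCount_sw h2, col_sw h1, col_sw h2, rank_sw h1, rank_sw h2,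
    show i ≠ i + 1 by omega, show i + 1 ≠ i by omega, show i + 1 + 1 ≠ i by omega,
    show i + 1 + 1 ≠ i + 1 by omega, show i ≠ i + 1 + 1 by omega, show i + 1 ≠ i + 1 + 1 by omega,
    if_true, if_false, rank_succ]
  by_cases e : redCount c = m
  · rcases ha : col c i <;> rcases hb : col c (i + 1) <;> rcases hd : col c (i + 1 + 1) <;>
      simp [e]
    exact sig_braid (hm e ha hb hd)
  · simp [e]

/-- The braid left from `b` when the strands that are blue for the colouring `c` of the bottom
positions are removed, where `m` is the number of red letters of `c`. -/
def forget (m : ℕ) (b : BraidGroup l) (c : Fin l → Color) : BraidGroup m :=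
  cocycle colAct (fun j c => forgetGen l m j c)
    (fun i j h hj x => forgetGen_comm m i j h hj x) (fun i h x => forgetGen_braid m i h x) b c

theorem forget_one (m : ℕ) (c : Fin l → Color) : forget m 1 c = 1 := cocycle_one _ _ _ _ _
theorem forget_sig (m : ℕ) {j : ℕ} (h : j + 1 < l) (c : Fin l → Color) :
    forget m (sig l j) c = forgetGen l m j c := cocycle_sig _ _ _ _ h _
theorem forget_mul (m : ℕ) (a b : BraidGroup l) (c : Fin l → Color) :
    forget m (a * b) c = forget m a c * forget m b (colAct (perm a) c) := cocycle_mul _ _ _ _ _ _ _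
theorem forget_inv (m : ℕ) (a : BraidGroup l) (c : Fin l → Color) :
    forget m a⁻¹ c = (forget m a (colAct (perm a).symm c))⁻¹ := cocycle_inv _ _ _ _ _ _

theorem redCount_perm (b : BraidGroup l) : ∀ c : Fin l → Color,
    redCount (colAct (perm b) c) = redCount c := by
  induction b using braid_induction with
  | one => intro c; rw [perm_one]; rfl
  | gen j h => intro c; rw [perm_sig h, redCount_sw h]
  | mul a b ha hb =>
    intro c
    rw [perm_mul, ← ha c, ← hb (colAct (perm a) c)]; rfl
  | inv a ha =>
    intro c
    rw [← ha, perm_inv]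
    congr 1
    ext x
    simp [colAct_apply]



/-! ### Parenthesised words -/

/-- The concatenation of two parenthesised words with the outermost bracket between them. -/
def join : Option (FreeMagma Color) → Option (FreeMagma Color) → Option (FreeMagma Color)
  | none, y => y
  | some x, none => some x
  | some x, some y => some (x * y)

/-- The letters of a parenthesised word, from left to right. -/
def letters : FreeMagma Color → List Color
  | .of a => [a]
  | .mul x y => letters x ++ letters y

/-- The letters of a parenthesised word that may be empty. -/
def lettersOpt : Option (FreeMagma Color) → List Color
  | none => []
  | some x => letters x

/-- Forgetting the blue letters. -/
def forgetBlue : FreeMagma Color → Option (FreeMagma Color)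
  | .of red => some (.of red)
  | .of blue => none
  | .mul x y => join (forgetBlue x) (forgetBlue y)

/-- Replacing the `i`-th letter `a` by the parenthesised word `g a`. -/
def subst (g : Color → FreeMagma Color) : FreeMagma Color → ℕ → FreeMagma Color
  | .of a, _ => g a
  | .mul x y, i =>
    if i < (letters x).length then .mul (subst g x i) y
    else .mul x (subst g y (i - (letters x).length))

theorem length_join (x y : Option (FreeMagma Color)) :
    (lettersOpt (join x y)).length = (lettersOpt x).length + (lettersOpt y).length := by
  cases x <;> cases y <;> simp [join, lettersOpt]
  exact List.length_append

theorem length_subst (g : Color → FreeMagma Color) (d : ℕ)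
    (hg : ∀ a, (letters (g a)).length = d + 1) (x : FreeMagma Color) :
    ∀ i, (letters (subst g x i)).length = (letters x).length + d := by
  induction x with
  | ih1 a => intro i; change (letters (g a)).length = 1 + d; rw [hg]; omega
  | ih2 x y hx hy =>
    intro i
    change (letters (subst g (.mul x y) i)).length = (letters x ++ letters y).length + d
    rw [subst]
    split_ifs
    · change (letters (subst g x i) ++ letters y).length = _
      rw [List.length_append, List.length_append, hx]; omega
    · change (letters x ++ letters (subst g y _)).length = _
      rw [List.length_append, List.length_append, hy]; omega

/-- Parenthesised words in the colours, with `l` letters; `none` stands for the empty word. -/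
@[ext]
structure Par (l : ℕ) where
  tree : Option (FreeMagma Color)
  len : (lettersOpt tree).length = l

namespace Par

/-- The word obtained by forgetting the parentheses. -/
def word (O : Par l) : Fin l → Color := fun i => (lettersOpt O.tree)[i.val]'(by rw [O.len]; exact i.isLt)

/-- The parenthesised word in red letters obtained by forgetting the blue letters. -/
def bar (O : Par l) : Option (FreeMagma Color) := O.tree.bind forgetBlue

/-- A new outermost letter on the left. -/
def addLeft (k : Color) (O : Par l) : Par (l + 1) where
  tree := join (some (.of k)) O.tree
  len := by rw [length_join, O.len]; exact Nat.add_comm _ _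

/-- A new outermost letter on the right. -/
def addRight (k : Color) (O : Par l) : Par (l + 1) where
  tree := join O.tree (some (.of k))
  len := by rw [length_join, O.len]; rfl

/-- The `i`-th letter `a` is replaced by `(aa)`. -/
def double (i : Fin l) (O : Par l) : Par (l + 1) where
  tree := O.tree.map fun x => subst (fun a => .of a * .of a) x i
  len := by
    obtain ⟨_ | x, h⟩ := O
    · subst h; exact i.elim0
    · subst h; exact length_subst _ 1 (fun _ => rfl) x i

/-- The `i`-th letter becomes blue. -/
def toBlue (i : Fin l) (O : Par l) : Par l where
  tree := O.tree.map fun x => subst (fun _ => .of blue) x i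
  len := by
    obtain ⟨_ | x, h⟩ := O
    · subst h; exact i.elim0
    · subst h; exact length_subst _ 0 (fun _ => rfl) x i

end Par

/-! ### Mixed braids and mixed permutations -/

/-- `b` is a mixed braid from the word `o` at the bottom to the word `o'` at the top: its strands
match the colours, and it becomes trivial when the blue strands are removed. -/
structure IsMixed (o o' : Fin l → Color) (b : BraidGroup l) : Prop where
  color : ∀ i, o' (perm b i) = o i
  trivial : forget (redCount o) b o = 1

/-- `σ` is a mixed permutation from `o` to `o'`: it matches the colours, and it becomes the identity
when the blue letters are removed. -/
structure IsMixedPerm (o o' : Fin l → Color) (σ : Equiv.Perm (Fin l)) : Prop where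
  color : ∀ i, o' (σ i) = o i
  rank : ∀ i, o i = red → rank o' (σ i) = rank o i

section Mixed

variable {o o' o'' : Fin l → Color}

theorem IsMixed.eq_colAct {b : BraidGroup l} (h : IsMixed o o' b) : o' = colAct (perm b) o := by
  ext i; rw [colAct_apply, ← h.color]; simp

theorem IsMixed.redCount_eq {b : BraidGroup l} (h : IsMixed o o' b) :
    redCount o' = redCount o := by rw [h.eq_colAct, redCount_perm]

theorem IsMixed.one : IsMixed o o 1 := ⟨fun _ => by rw [perm_one]; rfl, forget_one _ _⟩

theorem IsMixed.mul {a b : BraidGroup l} (ha : IsMixed o o' a) (hb : IsMixed o' o'' b) :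
    IsMixed o o'' (a * b) where
  color i := by rw [perm_mul, Equiv.trans_apply, hb.color, ha.color]
  trivial := by
    rw [forget_mul, ha.trivial, one_mul, ← ha.eq_colAct, ← ha.redCount_eq, hb.trivial]

theorem IsMixed.inv {a : BraidGroup l} (ha : IsMixed o o' a) : IsMixed o' o a⁻¹ where
  color i := by rw [perm_inv, ← ha.color]; simp
  trivial := by
    have : colAct (perm a).symm o' = o := by
      rw [ha.eq_colAct]; ext; simp [colAct_apply]
    rw [forget_inv, this, ha.redCount_eq, ha.trivial, inv_one]

theorem IsMixedPerm.one : IsMixedPerm o o 1 := ⟨fun _ => rfl, fun _ _ => rfl⟩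

theorem IsMixedPerm.mul {σ τ : Equiv.Perm (Fin l)} (h : IsMixedPerm o o' σ)
    (h' : IsMixedPerm o' o'' τ) : IsMixedPerm o o'' (σ.trans τ) where
  color i := by rw [Equiv.trans_apply, h'.color, h.color]
  rank i hi := by rw [Equiv.trans_apply, h'.rank _ (by rw [h.color, hi]), h.rank i hi]

end Mixed

/-- Mixed permutations between parenthesised words that agree once the blue letters are
forgotten. -/
@[ext]
structure PaPerm (O O' : Par l) where
  toPerm : Equiv.Perm (Fin l)
  mixed : IsMixedPerm O.word O'.word toPerm
  bar_eq : O.bar = O'.bar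

def PaPerm.one (O : Par l) : PaPerm O O := ⟨1, IsMixedPerm.one, rfl⟩

def PaPerm.comp {O O' O'' : Par l} (σ : PaPerm O O') (τ : PaPerm O' O'') : PaPerm O O'' :=
  ⟨σ.toPerm.trans τ.toPerm, σ.mixed.mul τ.mixed, σ.bar_eq.trans τ.bar_eq⟩

/-- Mixed braids between parenthesised words that agree once the blue letters are forgotten. -/
structure PaBraid (O O' : Par l) extends PaPerm O O' where
  braid : BraidGroup l
  isMixed : IsMixed O.word O'.word braid
  perm_eq : perm braid = toPerm

/-! ### Linear combinations of mixed braids -/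

abbrev BraidAlg (l : ℕ) : Type := MonoidAlgebra ℚ (BraidGroup l)

/-- A braid as an element of the group algebra. -/
noncomputable def br (b : BraidGroup l) : BraidAlg l := MonoidAlgebra.of ℚ (BraidGroup l) b

theorem br_mul (a b : BraidGroup l) : br (a * b) = br a * br b := map_mul _ _ _

theorem br_one : br (1 : BraidGroup l) = 1 := map_one _

/-- The space of linear combinations of the mixed braids from `o` to `o'` with underlying
permutation `σ`. -/
noncomputable def MB (o o' : Fin l → Color) (σ : Equiv.Perm (Fin l)) : Submodule ℚ (BraidAlg l) :=
  Submodule.span ℚ {x | ∃ b, IsMixed o o' b ∧ perm b = σ ∧ br b = x}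

section MB

variable {o o' o'' : Fin l → Color} {σ τ : Equiv.Perm (Fin l)}

theorem br_mem_MB {b : BraidGroup l} (h : IsMixed o o' b) (hσ : perm b = σ) : br b ∈ MB o o' σ :=
  Submodule.subset_span ⟨b, h, hσ, rfl⟩

theorem one_mem_MB : (1 : BraidAlg l) ∈ MB o o 1 := by
  rw [← br_one]; exact br_mem_MB .one perm_one

theorem mul_mem_MB {x y : BraidAlg l} (hx : x ∈ MB o o' σ) (hy : y ∈ MB o' o'' τ) :
    x * y ∈ MB o o'' (σ.trans τ) := by
  have : MB o o' σ * MB o' o'' τ ≤ MB o o'' (σ.trans τ) := by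
    rw [MB, MB, Submodule.span_mul_span, Submodule.span_le]
    rintro _ ⟨_, ⟨a, ha, rfl, rfl⟩, _, ⟨b, hb, rfl, rfl⟩, rfl⟩
    change br a * br b ∈ _
    rw [← br_mul]
    exact br_mem_MB (ha.mul hb) (perm_mul a b)
  exact this (Submodule.mul_mem_mul hx hy)

/-- The augmentation ideal of the group algebra of the group of pure mixed braids at `o`. -/
noncomputable def augIdeal (o : Fin l → Color) : Submodule ℚ (BraidAlg l) :=
  Submodule.span ℚ {x | ∃ p, IsMixed o o p ∧ perm p = 1 ∧ br p - 1 = x}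

/-- The filtration of the linear combinations of mixed braids induced by the powers of the augmentation ideal. -/
noncomputable def filt (n : ℕ) (o o' : Fin l → Color) (σ : Equiv.Perm (Fin l)) : Submodule ℚ (BraidAlg l) :=
  augIdeal o ^ n * MB o o' σ

/-- `m` red letters, followed by blue ones. -/
def stdWord (l m : ℕ) : Fin l → Color := fun i => if i.val < m then red else blue

/-- The pure braid in which the strand at `i + d + 1` is brought next to the strand at the position
`i`, makes a full twist with it, and goes back the same way. -/
def twistAux (l i : ℕ) : ℕ → BraidGroup l
  | 0 => sig l i * sig l i
  | d + 1 => sig l (i + d + 1) * twistAux l i d * (sig l (i + d + 1))⁻¹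

/-- The full twist of the strands at `i < j`. -/
def twist (i j : Fin l) : BraidGroup l := twistAux l i.val (j.val - i.val - 1)

/-- The two-sided ideal, in the group algebra of the pure mixed braids at `o`, that is generated by the
elements `τ - 1` for the full twists `τ` of two blue strands; these are taken at the standard word and
transported to `o` along mixed braids `w`. -/
noncomputable def idealJ (o : Fin l → Color) : Submodule ℚ (BraidAlg l) :=
  MB o o 1 * Submodule.span ℚ {x | ∃ (w : BraidGroup l) (i j : Fin l),
    IsMixed o (stdWord l (redCount o)) w ∧ redCount o ≤ i.val ∧ i < j ∧
      br (w * twist i j * w⁻¹) - 1 = x} * MB o o 1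

/-- The filtration of the linear combinations of mixed braids by the powers of the ideal `idealJ`.  The
value at `⊤` is set to zero, so that the quotient by it is the category without truncation. -/
noncomputable def filtJ (k : ℕ∞) (o o' : Fin l → Color) (σ : Equiv.Perm (Fin l)) : Submodule ℚ (BraidAlg l) :=
  match k with
  | ⊤ => ⊥
  | (k : ℕ) => idealJ o ^ k * MB o o' σ

/-- Conjugation by a braid. -/
noncomputable def conjHom (b : BraidGroup l) : BraidAlg l →ₐ[ℚ] BraidAlg l :=
  MonoidAlgebra.mapDomainAlgHom ℚ ℚ (MulAut.conj b).toMonoidHom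

theorem conjHom_br (b a : BraidGroup l) : conjHom b (br a) = br (b * a * b⁻¹) := by
  simp [conjHom, br, MonoidAlgebra.of_apply]

theorem br_mul_eq (b : BraidGroup l) (x : BraidAlg l) : br b * x = conjHom b x * br b := by
  induction x using MonoidAlgebra.induction_on with
  | of g =>
    change br b * br g = conjHom b (br g) * br b
    rw [conjHom_br, ← br_mul, ← br_mul]; group
  | add x y hx hy => rw [mul_add, map_add, add_mul, hx, hy]
  | smul r x hx => rw [mul_smul_comm, map_smul, smul_mul_assoc, hx]

theorem map_conj_MB {b : BraidGroup l} (hb : IsMixed o o' b) :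
    (MB o' o' 1).map (conjHom b).toLinearMap ≤ MB o o 1 := by
  rw [MB, Submodule.map_span, Submodule.span_le]
  rintro _ ⟨_, ⟨p, hp, hp1, rfl⟩, rfl⟩
  change conjHom b (br p) ∈ _
  rw [conjHom_br]
  refine br_mem_MB ((hb.mul hp).mul hb.inv) ?_
  rw [perm_mul, perm_mul, hp1, perm_inv]
  ext; simp

theorem map_conj_idealJ {b : BraidGroup l} (hb : IsMixed o o' b) :
    (idealJ o').map (conjHom b).toLinearMap ≤ idealJ o := by
  rw [idealJ, Submodule.map_mul, Submodule.map_mul, idealJ]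
  refine mul_le_mul' (mul_le_mul' (map_conj_MB hb) ?_) (map_conj_MB hb)
  rw [Submodule.map_span]
  refine Submodule.span_mono ?_
  rintro _ ⟨_, ⟨w, i, j, hw, hi, hij, rfl⟩, rfl⟩
  rw [hb.redCount_eq] at hw hi
  refine ⟨b * w, i, j, hb.mul hw, hi, hij, ?_⟩
  change _ = conjHom b (br (w * twist i j * w⁻¹) - 1)
  rw [map_sub, conjHom_br, map_one]
  congr 2
  group

theorem mul_filtJ {k : ℕ∞} {x y : BraidAlg l} (hx : x ∈ MB o o' σ) (hy : y ∈ filtJ k o' o'' τ) :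
    x * y ∈ filtJ k o o'' (σ.trans τ) := by
  match k with
  | ⊤ => 
    rw [show y = 0 from hy, mul_zero]; exact Submodule.zero_mem _
  | (k : ℕ) =>
    change y ∈ idealJ o' ^ k * MB o' o'' τ at hy
    change x * y ∈ idealJ o ^ k * MB o o'' (σ.trans τ)
    induction hx using Submodule.span_induction with
    | zero => rw [zero_mul]; exact Submodule.zero_mem _
    | add a b _ _ ha hb => rw [add_mul]; exact Submodule.add_mem _ ha hb
    | smul r a _ ha => rw [smul_mul_assoc]; exact Submodule.smul_mem _ _ ha
    | mem x hx =>
      obtain ⟨b, hb, hσ, rfl⟩ := hx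
      induction hy using Submodule.mul_induction_on' with
      | add a _ c _ ha hc => rw [mul_add]; exact Submodule.add_mem _ ha hc
      | mem_mul_mem u hu v hv =>
        rw [← mul_assoc, br_mul_eq, mul_assoc]
        refine Submodule.mul_mem_mul ?_ (mul_mem_MB (br_mem_MB hb hσ) hv)
        have h := Submodule.mem_map_of_mem (f := (conjHom b).toLinearMap) hu
        rw [Submodule.map_pow] at h
        exact pow_le_pow_left' (map_conj_idealJ hb) k h

theorem filtJ_mul {k : ℕ∞} {x y : BraidAlg l} (hx : x ∈ filtJ k o o' σ) (hy : y ∈ MB o' o'' τ) :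
    x * y ∈ filtJ k o o'' (σ.trans τ) := by
  match k with
  | ⊤ => 
    rw [show x = 0 from hx, zero_mul]; exact Submodule.zero_mem _
  | (k : ℕ) =>
    change x ∈ idealJ o ^ k * MB o o' σ at hx
    change x * y ∈ idealJ o ^ k * MB o o'' (σ.trans τ)
    induction hx using Submodule.mul_induction_on' with
    | add a _ c _ ha hc => rw [add_mul]; exact Submodule.add_mem _ ha hc
    | mem_mul_mem u hu v hv =>
      rw [mul_assoc]
      exact Submodule.mul_mem_mul hu (mul_mem_MB hv hy)

end MB

/-- Linear combinations of mixed braids with underlying permutation `σ`, modulo the `k`-th power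
of the ideal `idealJ`. -/
abbrev MBQuot (k : ℕ∞) (o o' : Fin l → Color) (σ : Equiv.Perm (Fin l)) : Type :=
  MB o o' σ ⧸ (filtJ k o o' σ).comap (MB o o' σ).subtype

/-- The class of a linear combination of mixed braids. -/
noncomputable def cls (k : ℕ∞) {o o' : Fin l → Color} {σ : Equiv.Perm (Fin l)} (x : BraidAlg l)
    (hx : x ∈ MB o o' σ) : MBQuot k o o' σ := Submodule.Quotient.mk ⟨x, hx⟩

/-- The class of a mixed braid. -/
noncomputable def PaBraid.cls (k : ℕ∞) {O O' : Par l} (β : PaBraid O O') :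
    MBQuot k O.word O'.word β.toPerm :=
  MixedBraids.cls k (br β.braid) (br_mem_MB β.isMixed β.perm_eq)

/-- The composition. -/
noncomputable def MBQuot.mul {k : ℕ∞} {o o' o'' : Fin l → Color} {σ τ : Equiv.Perm (Fin l)} 
    (x : MBQuot k o o' σ) (y : MBQuot k o' o'' τ) : MBQuot k o o'' (σ.trans τ) :=
  Quotient.map₂ (fun a b => ⟨a.val * b.val, mul_mem_MB a.2 b.2⟩) (by
    intro a a' ha b b' hb
    have ha' := (Submodule.quotientRel_def _).1 ha
    have hb' := (Submodule.quotientRel_def _).1 hb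
    refine (Submodule.quotientRel_def _).2 ?_
    change a.val * b.val - a'.val * b'.val ∈ filtJ k o o'' (σ.trans τ)
    have : a.val * b.val - a'.val * b'.val = (a.val - a'.val) * b.val + a'.val * (b.val - b'.val) := by
      rw [sub_mul, mul_sub]; abel
    rw [this]
    exact Submodule.add_mem _ (filtJ_mul ha' b.2) (mul_filtJ a'.2 hb')) x y


/-! ### Completions -/

section Completion

open PowerSeries

variable {A B : Type*} [Ring A] [Algebra ℚ A] [Ring B] [Algebra ℚ B]

/-- For a graded algebra `A` generated by the space `V` of its elements of degree one, the degree completion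
of `A`: the coefficient of `X ^ d` is the component of degree `d`, an element of `V ^ d`. -/
noncomputable def hat (V : Submodule ℚ A) : Subalgebra ℚ A⟦X⟧ where
  carrier := {f | ∀ d, coeff d f ∈ V ^ d}
  mul_mem' := by
    intro f g hf hg d
    rw [coeff_mul]
    refine Submodule.sum_mem _ fun p hp => ?_
    rw [← Finset.HasAntidiagonal.mem_antidiagonal.1 hp, pow_add]
    exact Submodule.mul_mem_mul (hf _) (hg _)
  add_mem' := by
    intro f g hf hg d
    rw [map_add]
    exact Submodule.add_mem _ (hf d) (hg d)
  algebraMap_mem' := by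
    intro r d
    rw [Algebra.algebraMap_eq_smul_one, PowerSeries.coeff_smul, coeff_one]
    refine Submodule.smul_mem _ _ ?_
    split_ifs with h
    · subst h; rw [pow_zero]; exact Submodule.one_le.1 le_rfl
    · exact Submodule.zero_mem _

attribute [local instance 100] LieRing.ofAssociativeRing
attribute [local instance 100] LieAlgebra.ofAssociativeAlgebra

/-- Elements, without constant term, of the degree completion of the Lie algebra generated by `V`. -/
def IsLieSeries (V : Submodule ℚ A) (u : A⟦X⟧) : Prop :=
  u ∈ hat V ∧ coeff 0 u = 0 ∧ ∀ d, coeff d u ∈ LieSubalgebra.lieSpan ℚ A (V : Set A)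

/-- The exponential of a series without constant term. -/
noncomputable def expSeries (u : A⟦X⟧) : A⟦X⟧ :=
  PowerSeries.mk fun d => ∑ n ∈ Finset.range (d + 1), (n.factorial : ℚ)⁻¹ • coeff d (u ^ n)

/-- The homomorphism of degree completions induced by a homomorphism of degree zero. -/
noncomputable def hatMap (V : Submodule ℚ A) (W : Submodule ℚ B) (f : A →ₐ[ℚ] B)
    (hf : V.map f.toLinearMap ≤ W) : hat V →+* hat W :=
  ((PowerSeries.map f.toRingHom).comp (hat V).val.toRingHom).codRestrict (hat W) fun x d => by
    change coeff d (PowerSeries.map f.toRingHom x.val) ∈ _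
    rw [PowerSeries.coeff_map]
    have := Submodule.mem_map_of_mem (f := f.toLinearMap) (x.2 d)
    rw [Submodule.map_pow] at this
    exact pow_le_pow_left' hf d this

theorem coeff_hatMap (V : Submodule ℚ A) (W : Submodule ℚ B) (f : A →ₐ[ℚ] B)
    (hf : V.map f.toLinearMap ≤ W) (x : hat V) (d : ℕ) :
    coeff d (hatMap V W f hf x).val = f (coeff d x.val) := 
  PowerSeries.coeff_map _ _ _

end Completion

/-! ### Mixed chord diagrams -/

/-- A chord may join two distinct positions that are not both red. -/
def Allowed (c : Fin l → Color) (i j : Fin l) : Prop := i ≠ j ∧ (c i = blue ∨ c j = blue)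

instance (c : Fin l → Color) (i j : Fin l) : Decidable (Allowed c i j) := by
  unfold Allowed; infer_instance

/-- The number of chords between two blue positions. -/
def blueCount (c : Fin l → Color) (w : List (Fin l × Fin l)) : ℕ :=
  w.countP fun p => c p.1 = blue ∧ c p.2 = blue

/-- Linear combinations of words in chords. -/
abbrev ChordWords (l : ℕ) : Type := FreeAlgebra ℚ (Fin l × Fin l)

noncomputable def chord {l : ℕ} (i j : Fin l) : ChordWords l := FreeAlgebra.ι ℚ (i, j)

/-- The relations of the enveloping algebra of the mixed Drinfeld–Kohno Lie algebra, for strands whose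
bottom positions are coloured by `c`; the words with at least `k` chords between blue strands are
set to zero. -/
inductive ChordRel (k : ℕ∞) (c : Fin l → Color) : ChordWords l → ChordWords l → Prop
  | notAllowed (i j : Fin l) (h : ¬ Allowed c i j) : ChordRel k c (chord i j) 0
  | symm (i j : Fin l) : ChordRel k c (chord i j) (chord j i)
  | comm (i j p q : Fin l) (h1 : i ≠ p) (h2 : i ≠ q) (h3 : j ≠ p) (h4 : j ≠ q) :
      ChordRel k c (chord i j * chord p q) (chord p q * chord i j)
  | fourTerm (i j p : Fin l) (h1 : Allowed c i j) (h2 : Allowed c i p) (h3 : Allowed c j p) :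
      ChordRel k c ((chord i j + chord i p) * chord j p) (chord j p * (chord i j + chord i p))
  | trunc (w : List (Fin l × Fin l)) (h : k ≤ blueCount c w) :
      ChordRel k c (w.map fun p => chord p.1 p.2).prod 0

/-- The algebra of horizontal chord diagrams on strands whose bottom positions are coloured by `c`, modulo
the diagrams with at least `k` chords between blue strands.  For `k = ⊤` this is the enveloping algebra
of the mixed Drinfeld–Kohno Lie algebra, where a chord is labelled by the positions of its two strands. -/
abbrev ChordAlg (k : ℕ∞) (c : Fin l → Color) : Type := RingQuot (ChordRel k c)

/-- The chord that joins the strands at `i` and `j`; it is zero unless such a chord is allowed. -/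
noncomputable def t (k : ℕ∞) (c : Fin l → Color) (i j : Fin l) : ChordAlg k c :=
  RingQuot.mkAlgHom ℚ (ChordRel k c) (chord i j)

/-- The elements of degree one. -/
noncomputable def chordSpace (k : ℕ∞) (c : Fin l → Color) : Submodule ℚ (ChordAlg k c) :=
  Submodule.span ℚ {x | ∃ i j, t k c i j = x}

section Chords

variable {k : ℕ∞} {c : Fin l → Color}

theorem t_notAllowed {i j : Fin l} (h : ¬ Allowed c i j) : t k c i j = 0 := by
  rw [t, RingQuot.mkAlgHom_rel ℚ (ChordRel.notAllowed i j h), map_zero]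

theorem t_symm (i j : Fin l) : t k c i j = t k c j i :=
  RingQuot.mkAlgHom_rel ℚ (ChordRel.symm i j)

theorem t_comm {i j p q : Fin l} (h1 : i ≠ p) (h2 : i ≠ q) (h3 : j ≠ p) (h4 : j ≠ q) :
    Commute (t k c i j) (t k c p q) := by
  have := RingQuot.mkAlgHom_rel ℚ (ChordRel.comm (k := k) (c := c) i j p q h1 h2 h3 h4)
  rwa [map_mul, map_mul] at this

theorem t_fourTerm {i j p : Fin l} (h1 : Allowed c i j) (h2 : Allowed c i p) (h3 : Allowed c j p) :
    Commute (t k c i j + t k c i p) (t k c j p) := by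
  have := RingQuot.mkAlgHom_rel ℚ (ChordRel.fourTerm (k := k) (c := c) i j p h1 h2 h3)
  rwa [map_mul, map_mul, map_add] at this

theorem t_trunc (w : List (Fin l × Fin l)) (h : k ≤ blueCount c w) :
    (w.map fun p => t k c p.1 p.2).prod = 0 := by
  have := RingQuot.mkAlgHom_rel ℚ (ChordRel.trunc (k := k) (c := c) w h)
  rw [map_zero, map_list_prod, List.map_map] at this
  exact this

/-- The span of the words with at least `n` chords between blue positions. -/
noncomputable def blueSpan (k : ℕ∞) (c : Fin l → Color) (n : ℕ) : Submodule ℚ (ChordAlg k c) :=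
  Submodule.span ℚ {x | ∃ w : List (Fin l × Fin l), n ≤ blueCount c w ∧
    (w.map fun p => t k c p.1 p.2).prod = x}

theorem blueSpan_mul (n n' : ℕ) :
    blueSpan k c n * blueSpan k c n' ≤ blueSpan k c (n + n') := by
  rw [blueSpan, blueSpan, Submodule.span_mul_span, Submodule.span_le]
  rintro _ ⟨_, ⟨w, hw, rfl⟩, _, ⟨w', hw', rfl⟩, rfl⟩
  refine Submodule.subset_span ⟨w ++ w', ?_, ?_⟩
  · rw [blueCount, List.countP_append]; exact add_le_add hw hw'
  · rw [List.map_append, List.prod_append]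

theorem blueSpan_eq_zero {n : ℕ} (h : k ≤ n) {x : ChordAlg k c} (hx : x ∈ blueSpan k c n) :
    x = 0 := by
  have : blueSpan k c n ≤ ⊥ := by
    rw [blueSpan, Submodule.span_le]
    rintro _ ⟨w, hw, rfl⟩
    exact t_trunc w (h.trans (by exact_mod_cast hw))
  exact this hx

end Chords

section Pull

variable {l l' : ℕ} (k : ℕ∞) (c : Fin l → Color) (c' : Fin l' → Color)
  (f : Fin l' → Option (Fin l))

/-- The sum of all the lifts of a chord along a partial map of positions. -/
noncomputable def pullGen (i j : Fin l) : ChordAlg k c' :=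
  if Allowed c i j then
    ∑ x with f x = some i, ∑ y with f y = some j, t k c' x y
  else 0

theorem allowed_of_pull (hf : ∀ x i, f x = some i → c i = blue → c' x = blue)
    {i j : Fin l} (h : Allowed c i j) {x y : Fin l'} (hx : f x = some i)
    (hy : f y = some j) : Allowed c' x y := by
  refine ⟨?_, h.2.imp (hf x i hx) (hf y j hy)⟩
  rintro rfl
  exact h.1 (Option.some.inj (hx.symm.trans hy))

theorem pullGen_mem (hf : ∀ x i, f x = some i → c i = blue → c' x = blue)
    (i j : Fin l) (n : ℕ) (hn : n ≤ if c i = blue ∧ c j = blue then 1 else 0) :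
    pullGen k c c' f i j ∈ blueSpan k c' n := by
  unfold pullGen
  split_ifs with h
  · refine Submodule.sum_mem _ fun x hx => Submodule.sum_mem _ fun y hy => ?_
    rw [Finset.mem_filter] at hx hy
    refine Submodule.subset_span ⟨[(x, y)], hn.trans ?_, by simp⟩
    split_ifs with hb
    · simp [blueCount, hf x i hx.2 hb.1, hf y j hy.2 hb.2]
    · exact Nat.zero_le _
  · exact Submodule.zero_mem _

theorem pullGen_fourTerm (hf : ∀ x i, f x = some i → c i = blue → c' x = blue)
    {i j p : Fin l} (h1 : Allowed c i j) (h2 : Allowed c i p)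
    (h3 : Allowed c j p) :
    Commute (pullGen k c c' f i j + pullGen k c c' f i p) (pullGen k c c' f j p) := by
  rw [pullGen, pullGen, pullGen, if_pos h1, if_pos h2, if_pos h3]
  refine Commute.sum_right _ _ _ fun y hy => Commute.sum_right _ _ _ fun z hz => ?_
  rw [← Finset.sum_add_distrib]
  refine Commute.sum_left _ _ _ fun x hx => ?_
  have hne : ∀ {a b : Fin l} {u v : Fin l'}, a ≠ b → u ∈ Finset.univ.filter (f · = some a) →
      v ∈ Finset.univ.filter (f · = some b) → u ≠ v := by
    rintro a b u _ hab hu hv rfl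
    rw [Finset.mem_filter] at hu hv
    exact hab (Option.some.inj (hu.2.symm.trans hv.2))
  rw [← Finset.add_sum_erase _ _ hy, ← Finset.add_sum_erase _ _ hz, add_add_add_comm]
  refine Commute.add_left ?_ (Commute.add_left ?_ ?_)
  · rw [Finset.mem_filter] at hx hy hz
    exact t_fourTerm (allowed_of_pull c c' f hf h1 hx.2 hy.2)
      (allowed_of_pull c c' f hf h2 hx.2 hz.2) (allowed_of_pull c c' f hf h3 hy.2 hz.2)
  · refine Commute.sum_left _ _ _ fun u hu => ?_
    exact t_comm (hne h1.1 hx hy) (hne h2.1 hx hz) (Finset.mem_erase.1 hu).1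
      (hne h3.1 (Finset.mem_erase.1 hu).2 hz)
  · refine Commute.sum_left _ _ _ fun u hu => ?_
    exact t_comm (hne h1.1 hx hy) (hne h2.1 hx hz)
      (hne h3.1 hy (Finset.mem_erase.1 hu).2).symm (Finset.mem_erase.1 hu).1

/-- Given positions labelled by `f` in another set of positions, a chord is sent to the sum of its lifts.
For a bijection this is the relabelling of chords, for a map with a fibre of two elements it is the
cabling of chords, and new positions (where `f` is `none`) receive no chord. -/
noncomputable def pull (hf : ∀ x i, f x = some i → c i = blue → c' x = blue) :
    ChordAlg k c →ₐ[ℚ] ChordAlg k c' :=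
  RingQuot.liftAlgHom ℚ ⟨FreeAlgebra.lift ℚ fun p => pullGen k c c' f p.1 p.2, by
    have e : ∀ i j : Fin l, FreeAlgebra.lift ℚ (fun p : Fin l × Fin l => pullGen k c c' f p.1 p.2)
        (chord i j) = pullGen k c c' f i j := fun i j => FreeAlgebra.lift_ι_apply _ _
    intro x y h
    induction h with
    | notAllowed i j h => rw [e, pullGen, if_neg h, map_zero]
    | symm i j =>
      rw [e, e, pullGen, pullGen, Finset.sum_comm]
      have : Allowed c i j ↔ Allowed c j i := by unfold Allowed; rw [ne_comm, or_comm]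
      simp only [this, t_symm]
    | comm i j p q h1 h2 h3 h4 =>
      rw [map_mul, map_mul, e, e]
      change Commute _ _
      rw [pullGen, pullGen]
      split_ifs
      · refine Commute.sum_right _ _ _ fun u hu => Commute.sum_right _ _ _ fun v hv =>
          Commute.sum_left _ _ _ fun x hx => Commute.sum_left _ _ _ fun y hy => ?_
        rw [Finset.mem_filter] at hu hv hx hy
        refine t_comm ?_ ?_ ?_ ?_ <;> rintro rfl <;> simp_all
      all_goals simp
    | fourTerm i j p h1 h2 h3 =>
      rw [map_mul, map_mul, map_add, e, e, e]
      exact pullGen_fourTerm k c c' f hf h1 h2 h3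
    | trunc w h =>
      rw [map_zero]
      refine blueSpan_eq_zero h ?_
      clear h
      induction w with
      | nil =>
        rw [List.map_nil, List.prod_nil, map_one]
        exact Submodule.subset_span ⟨[], le_rfl, rfl⟩
      | cons p w ih =>
        rw [List.map_cons, List.prod_cons, map_mul, e]
        have : blueCount c (p :: w) = (if c p.1 = blue ∧ c p.2 = blue then 1 else 0) +
            blueCount c w := by
          rw [blueCount, List.countP_cons, add_comm]; simp [blueCount]
        rw [this]
        exact blueSpan_mul _ _ (Submodule.mul_mem_mul (pullGen_mem k c c' f hf _ _ _ le_rfl) ih)⟩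

theorem pull_t (hf : ∀ x i, f x = some i → c i = blue → c' x = blue) (i j : Fin l) : pull k c c' f hf (t k c i j) = pullGen k c c' f i j := by
  rw [pull, t, RingQuot.liftAlgHom_mkAlgHom_apply]
  exact FreeAlgebra.lift_ι_apply _ _

theorem pull_space (hf : ∀ x i, f x = some i → c i = blue → c' x = blue) :
    (chordSpace k c).map (pull k c c' f hf).toLinearMap ≤ chordSpace k c' := by
  rw [chordSpace, Submodule.map_span, Submodule.span_le]
  rintro _ ⟨_, ⟨i, j, rfl⟩, rfl⟩
  change pull k c c' f hf (t k c i j) ∈ _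
  rw [pull_t, pullGen]
  split_ifs
  · exact Submodule.sum_mem _ fun x _ => Submodule.sum_mem _ fun y _ =>
      Submodule.subset_span ⟨x, y, rfl⟩
  · exact Submodule.zero_mem _

end Pull

theorem ChordAlg.hom_ext {k : ℕ∞} {c : Fin l → Color} {B : Type*} [Semiring B] [Algebra ℚ B]
    {f g : ChordAlg k c →ₐ[ℚ] B} (h : ∀ i j, f (t k c i j) = g (t k c i j)) : f = g :=
  RingQuot.ringQuot_ext' _ _ _ (FreeAlgebra.hom_ext (funext fun p => h p.1 p.2))

/-- The degree completion of the algebra of chord diagrams. -/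
noncomputable abbrev Hat (k : ℕ∞) (c : Fin l → Color) : Type := hat (chordSpace k c)

/-- The map `pull` on the completions. -/
noncomputable def pullHat {l l' : ℕ} (k : ℕ∞) (c : Fin l → Color) (c' : Fin l' → Color)
    (f : Fin l' → Option (Fin l)) (hf : ∀ x i, f x = some i → c i = blue → c' x = blue) :
    Hat k c →+* Hat k c' :=
  hatMap _ _ (pull k c c' f hf) (pull_space k c c' f hf)

/-- The action of a mixed permutation: chords labelled by the top positions are relabelled by the bottom
positions of the strands. -/
noncomputable def act (k : ℕ∞) {c c' : Fin l → Color} {σ : Equiv.Perm (Fin l)}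
    (h : ∀ i, c' (σ i) = c i) : Hat k c' →+* Hat k c :=
  pullHat k c' c (fun i => some (σ i)) fun x i hx hi => by
    rw [← h, Option.some.inj hx, hi]


section Act

variable {k : ℕ∞} {c c' c'' : Fin l → Color} {σ τ : Equiv.Perm (Fin l)}

theorem pull_perm_t (h : ∀ i, c' (σ i) = c i)
    (hf : ∀ x i, some (σ x) = some i → c' i = blue → c x = blue) (i j : Fin l) :
    pull k c' c (fun i => some (σ i)) hf (t k c' i j) = t k c (σ.symm i) (σ.symm j) := by
  have e : ∀ i, (Finset.univ.filter fun x => some (σ x) = some i) = {σ.symm i} := by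
    intro i; ext x; simp [Equiv.eq_symm_apply]
  have hA : Allowed c (σ.symm i) (σ.symm j) ↔ Allowed c' i j := by
    unfold Allowed; rw [← h, ← h]; simp
  rw [pull_t, pullGen, e, e]
  simp only [Finset.sum_singleton]
  split_ifs with h1
  · rfl
  · rw [t_notAllowed (hA.not.2 h1)]

theorem act_one (h : ∀ i, c ((1 : Equiv.Perm (Fin l)) i) = c i) (x : Hat k c) :
    act k h x = x := by
  have : pull k c c (fun i => some ((1 : Equiv.Perm (Fin l)) i)) (fun x i hx hi => by
      rw [← h, Option.some.inj hx, hi]) = AlgHom.id ℚ _ :=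
    ChordAlg.hom_ext fun i j => pull_perm_t h _ i j
  ext d
  unfold act pullHat
  rw [coeff_hatMap, this]; rfl

theorem act_trans (h : ∀ i, c' (σ i) = c i) (h' : ∀ i, c'' (τ i) = c' i)
    (h'' : ∀ i, c'' (σ.trans τ i) = c i) (x : Hat k c'') :
    act k h'' x = act k h (act k h' x) := by
  ext d
  unfold act pullHat
  rw [coeff_hatMap, coeff_hatMap, coeff_hatMap]
  rw [← AlgHom.comp_apply]
  congr 1
  refine ChordAlg.hom_ext fun i j => ?_
  rw [AlgHom.comp_apply, pull_perm_t h', pull_perm_t h, pull_perm_t h'']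
  rfl

end Act

/-! ### The categories -/

open CategoryTheory

/-- The category of parenthesised mixed braids modulo the `k`-th power of the ideal `idealJ` (for `k = ⊤`:
without truncation), restricted to the words of length `l`; there are no morphisms between words of
different lengths. -/
structure PaMB (k : ℕ∞) (l : ℕ) where
  par : Par l

/-- The completed category of parenthesised mixed chord diagrams, modulo the diagrams with at least `k` chords
between blue strands, restricted to the words of length `l`. -/
structure PaMCD (k : ℕ∞) (l : ℕ) where
  par : Par l

structure PaMB.Hom {k : ℕ∞} (O O' : PaMB k l) where
  perm : PaPerm O.par O'.par
  elt : MBQuot k O.par.word O'.par.word perm.toPerm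

structure PaMCD.Hom {k : ℕ∞} (O O' : PaMCD k l) where
  perm : PaPerm O.par O'.par
  elt : Hat k O.par.word

noncomputable instance (k : ℕ∞) (l : ℕ) : Category (PaMB k l) where
  Hom := PaMB.Hom
  id O := ⟨PaPerm.one O.par, cls k 1 one_mem_MB⟩
  comp f g := ⟨f.perm.comp g.perm, f.elt.mul g.elt⟩
  id_comp := by
    rintro O O' ⟨σ, x⟩
    induction x using Quotient.ind with
    | _ x => exact congrArg (PaMB.Hom.mk σ) (congrArg Submodule.Quotient.mk (Subtype.ext (one_mul _)))
  comp_id := by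
    rintro O O' ⟨σ, x⟩
    induction x using Quotient.ind with
    | _ x => exact congrArg (PaMB.Hom.mk σ) (congrArg Submodule.Quotient.mk (Subtype.ext (mul_one _)))
  assoc := by
    rintro O O' O'' O''' ⟨σ, x⟩ ⟨τ, y⟩ ⟨υ, z⟩
    induction x using Quotient.ind with
    | _ x =>
    induction y using Quotient.ind with
    | _ y =>
    induction z using Quotient.ind with
    | _ z => exact congrArg (PaMB.Hom.mk _) (congrArg Submodule.Quotient.mk (Subtype.ext (mul_assoc _ _ _)))

noncomputable instance (k : ℕ∞) (l : ℕ) : Category (PaMCD k l) where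
  Hom := PaMCD.Hom
  id O := ⟨PaPerm.one O.par, 1⟩
  comp f g := ⟨f.perm.comp g.perm, f.elt * act k f.perm.mixed.color g.elt⟩
  id_comp := by
    rintro O O' ⟨σ, x⟩
    refine congrArg (PaMCD.Hom.mk σ) ?_
    rw [one_mul]; exact act_one _ _
  comp_id := by
    rintro O O' ⟨σ, x⟩
    refine congrArg (PaMCD.Hom.mk σ) ?_
    rw [map_one, mul_one]
  assoc := by
    rintro O O' O'' O''' ⟨σ, x⟩ ⟨τ, y⟩ ⟨υ, z⟩
    refine congrArg (PaMCD.Hom.mk _) ?_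
    change x * act k σ.mixed.color y * act k (σ.comp τ).mixed.color z = _
    rw [map_mul, mul_assoc]
    congr 2
    exact act_trans σ.mixed.color τ.mixed.color (σ.comp τ).mixed.color z

/-! ### Operadic operations -/

/-- The operations that add a strand: extension by a strand of colour `a` on the left or on the right, and
cabling of the strand that starts at the position `i`. -/
inductive StrandOp (l : ℕ)
  | left (a : Color)
  | right (a : Color)
  | double (i : Fin l)

namespace StrandOp

/-- The same operation, described from the top of a strand diagram with underlying permutation `σ`. -/
def push (σ : Equiv.Perm (Fin l)) : StrandOp l → StrandOp l
  | left a => left a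
  | right a => right a
  | double i => double (σ i)

/-- The operation on parenthesised words. -/
def par : StrandOp l → Par l → Par (l + 1)
  | left a, O => O.addLeft a
  | right a, O => O.addRight a
  | double i, O => O.double i

/-- The operation on braids. -/
def braid : StrandOp l → BraidGroup l → BraidGroup (l + 1)
  | left _, b => addLeft b
  | right _, b => addRight b
  | double i, b => MixedBraids.double b i

/-- The old position from which a new position comes; `none` for the strand added by an extension. -/
def position : StrandOp l → Fin (l + 1) → Option (Fin l)
  | left _ => Fin.cases none some
  | right _ => Fin.lastCases none some
  | double i => fun x => some (i.predAbove x)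

end StrandOp

/-! ### Homomorphic expansions -/

/-- Homomorphic expansions for the parenthesised mixed braids modulo the `k`-th power of `idealJ`.  They are the
identity on objects and on the underlying permutations; `HomExpansion.toFunctor` below is the functor. -/
structure HomExpansion (k : ℕ∞) where
  val {l : ℕ} {O O' : Par l} (σ : PaPerm O O') :
    MBQuot k O.word O'.word σ.toPerm →ₗ[ℚ] Hat k O.word
  map_id {l : ℕ} (O : Par l) : val (PaPerm.one O) (cls k 1 one_mem_MB) = 1
  map_comp {l : ℕ} {O O' O'' : Par l} (σ : PaPerm O O') (τ : PaPerm O' O'')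
    (x : MBQuot k O.word O'.word σ.toPerm) (y : MBQuot k O'.word O''.word τ.toPerm) :
    val (σ.comp τ) (x.mul y) = val σ x * act k σ.mixed.color (val τ y)
  /-- The filtrations are preserved. -/
  filtered {l : ℕ} {O O' : Par l} (σ : PaPerm O O') (n : ℕ) (x : BraidAlg l)
    (hx : x ∈ MB O.word O'.word σ.toPerm) (hn : x ∈ filt n O.word O'.word σ.toPerm) (d : ℕ)
    (hd : d < n) : PowerSeries.coeff d (val σ (cls k x hx)).val = 0
  /-- The associated graded map is the identity: the canonical identification of the associated graded of the
  mixed braids with the mixed chord diagrams sends `(A₁ - 1) ⋯ (Aₙ - 1) β`, for full twists `A₁, …, Aₙ`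
  of pairs of strands, to the product of the `n` chords on the permutation of `β`. -/
  graded {l : ℕ} {O O' : Par l} (β : PaBraid O O') (w : List (Fin l × Fin l))
    (hw : ∀ p ∈ w, p.1 < p.2 ∧ Allowed O.word p.1 p.2) :
    ∃ hx : (w.map fun p => br (twist p.1 p.2) - 1).prod * br β.braid ∈
        MB O.word O'.word β.toPerm,
      PowerSeries.coeff w.length (val β.toPaPerm (cls k _ hx)).val =
        (w.map fun p => t k O.word p.1 p.2).prod
  groupLike {l : ℕ} {O O' : Par l} (β : PaBraid O O') :
    ∃ u, IsLieSeries (chordSpace k O.word) u ∧ (val β.toPaPerm (β.cls k)).val = expSeries u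
  /-- Extensions and cablings of a mixed braid are again mixed braids, and are respected. -/
  strandOp {l : ℕ} {O O' : Par l} (β : PaBraid O O') (θ : StrandOp l) :
    ∃ (γ : PaBraid (θ.par O) ((θ.push β.toPerm).par O'))
      (hθ : ∀ x i, θ.position x = some i → O.word i = blue → (θ.par O).word x = blue),
      γ.braid = θ.braid β.braid ∧
      val γ.toPaPerm (γ.cls k) =
        pullHat k O.word (θ.par O).word θ.position hθ (val β.toPaPerm (β.cls k))
  /-- Turning the `i`-th strand from red to blue gives again a mixed braid, and is respected. -/
  toBlue {l : ℕ} {O O' : Par l} (β : PaBraid O O') (i : Fin l) (hi : O.word i = red) :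
    ∃ (γ : PaBraid (O.toBlue i) (O'.toBlue (β.toPerm i)))
      (hθ : ∀ x j, some x = some j → O.word j = blue → (O.toBlue i).word x = blue),
      γ.braid = β.braid ∧
      val γ.toPaPerm (γ.cls k) =
        pullHat k O.word (O.toBlue i).word some hθ (val β.toPaPerm (β.cls k))

/-- The functor given by a homomorphic expansion. -/
noncomputable def HomExpansion.toFunctor {k : ℕ∞} (Z : HomExpansion k) (l : ℕ) :
    PaMB k l ⥤ PaMCD k l where
  obj O := ⟨O.par⟩
  map f := ⟨f.perm, Z.val f.perm f.elt⟩
  map_id O := congrArg (PaMCD.Hom.mk _) (Z.map_id O.par)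
  map_comp f g := congrArg (PaMCD.Hom.mk _) (Z.map_comp f.perm g.perm f.elt g.elt)

/-! ### Associators -/

section Associators

open PowerSeries

variable {A : Type*} [Ring A] [Algebra ℚ A]

/-- The value `Φ(a, b)` of a series in two noncommuting variables at elements `a`, `b` of degree one. -/
noncomputable def evalAt (Φ : (FreeAlgebra ℚ (Fin 2))⟦X⟧) (a b : A) : A⟦X⟧ :=
  PowerSeries.map (FreeAlgebra.lift ℚ ![a, b]).toRingHom Φ

/-- The exponential of an element of degree one. -/
noncomputable def expDeg (a : A) : A⟦X⟧ := expSeries (monomial 1 a)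

/-- The chords of the Drinfeld–Kohno Lie algebra, where all strands are of the same colour. -/
noncomputable abbrev tb {l : ℕ} (i j : Fin l) : ChordAlg ⊤ (fun _ : Fin l => blue) :=
  t ⊤ (fun _ => blue) i j

/-- Drinfeld associators (with coupling constant one). -/
structure IsAssociator (Φ : (FreeAlgebra ℚ (Fin 2))⟦X⟧) : Prop where
  groupLike : ∃ φ, IsLieSeries (Submodule.span ℚ (Set.range (FreeAlgebra.ι ℚ))) φ ∧
    Φ = expSeries φ
  pentagon : evalAt Φ (tb (0 : Fin 4) 1) (tb 1 2) *
      evalAt Φ (tb (0 : Fin 4) 1 + tb 0 2) (tb 1 3 + tb 2 3) * evalAt Φ (tb (1 : Fin 4) 2) (tb 2 3) =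
    evalAt Φ (tb (0 : Fin 4) 2 + tb 1 2) (tb 2 3) * evalAt Φ (tb (0 : Fin 4) 1) (tb 1 2 + tb 1 3)
  hexagon : ∀ r : ℚ, r = 1 / 2 ∨ r = -(1 / 2) →
    expDeg (r • (tb (0 : Fin 3) 2 + tb 1 2)) =
      evalAt Φ (tb (0 : Fin 3) 1) (tb 1 2) * expDeg (r • tb 1 2) *
        Ring.inverse (evalAt Φ (tb 0 2) (tb 1 2)) * expDeg (r • tb 0 2) *
        evalAt Φ (tb 0 2) (tb 0 1)

/-- The map that forgets the colours. -/
noncomputable def uncolour {l : ℕ} (c : Fin l → Color) : Hat ⊤ c →+* Hat ⊤ (fun _ : Fin l => blue) :=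
  pullHat ⊤ c (fun _ => blue) some fun _ _ _ _ => rfl

/-- The word `xy`. -/
def pair (x y : Color) : Par 2 := ⟨some (.of x * .of y), rfl⟩

/-- The word `(xy)z`. -/
def leftTriple (x y z : Color) : Par 3 := ⟨some (.of x * .of y * .of z), rfl⟩

/-- The word `x(yz)`. -/
def rightTriple (x y z : Color) : Par 3 := ⟨some (.of x * (.of y * .of z)), rfl⟩

/-- The expansion `Z` comes from `Φ`: up to colours, its values on a crossing and on a change of
parentheses are `exp (t / 2)` and `Φ`. -/
structure ComesFrom (Φ : (FreeAlgebra ℚ (Fin 2))⟦X⟧) (Z : HomExpansion ⊤) : Prop where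
  crossing (x y : Color) (h : x = blue ∨ y = blue) :
    ∃ β : PaBraid (pair x y) (pair y x), β.braid = sig 2 0 ∧
      (uncolour _ (Z.val β.toPaPerm (β.cls ⊤))).val = expDeg ((1 / 2 : ℚ) • tb 0 1)
  rebracketing (x y z : Color) (h : x = blue ∨ y = blue ∨ z = blue) :
    ∃ β : PaBraid (leftTriple x y z) (rightTriple x y z), β.braid = 1 ∧
      (uncolour _ (Z.val β.toPaPerm (β.cls ⊤))).val = evalAt Φ (tb 0 1) (tb 1 2)

end Associators

/-- The projection from chord diagrams to their truncation. -/
noncomputable def reduce (k : ℕ) (c : Fin l → Color) : ChordAlg ⊤ c →ₐ[ℚ] ChordAlg k c :=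
  RingQuot.liftAlgHom ℚ ⟨RingQuot.mkAlgHom ℚ (ChordRel k c), by
    intro x y h
    induction h with
    | notAllowed i j h => exact RingQuot.mkAlgHom_rel ℚ (.notAllowed i j h)
    | symm i j => exact RingQuot.mkAlgHom_rel ℚ (.symm i j)
    | comm i j p q h1 h2 h3 h4 => exact RingQuot.mkAlgHom_rel ℚ (.comm i j p q h1 h2 h3 h4)
    | fourTerm i j p h1 h2 h3 => exact RingQuot.mkAlgHom_rel ℚ (.fourTerm i j p h1 h2 h3)
    | trunc w h => exact absurd h (by simp)⟩

noncomputable def reduceHat (k : ℕ) (c : Fin l → Color) : Hat ⊤ c →+* Hat k c :=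
  hatMap _ _ (reduce k c) (by
    rw [chordSpace, Submodule.map_span, Submodule.span_le]
    rintro _ ⟨_, ⟨i, j, rfl⟩, rfl⟩
    refine Submodule.subset_span ⟨i, j, ?_⟩
    exact (RingQuot.liftAlgHom_mkAlgHom_apply _ _ _ _).symm)

/-- The expansion `Z'` of the truncated category is induced by `Z`. -/
def IsInducedBy {k : ℕ} (Z' : HomExpansion k) (Z : HomExpansion ⊤) : Prop :=
  ∀ {l : ℕ} {O O' : Par l} (σ : PaPerm O O') (x : BraidAlg l)
    (hx : x ∈ MB O.word O'.word σ.toPerm),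
    Z'.val σ (cls k x hx) = reduceHat k O.word (Z.val σ (cls ⊤ x hx))

end
end MixedBraids

/-! The expansion is computed in the ordinary Drinfeld–Kohno algebra `BlueAlg`, in which any two
strands may be joined by a chord; its values are then shown to lie in the algebra of mixed diagrams.

One colour. Braids are evaluated first between left-normed words. A crossing of `a` and `b` behind
the bundle `P` of everything to their left has the value Φ(P,a,b) · exp(t_ab/2) · Φ(P,b,a)⁻¹, called
`crossing`. Strands are labelled by disjoint sets of positions rather than by single positions: a
cable is then a strand like any other, and a strand with empty label is invisible, because an
associator is 1 when one of its arguments is 0. The pentagon and the two hexagons give the crossing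
of a cable with a strand (`crossing_cable_left`, `crossing_cable_right`); since such a crossing
commutes with an exchange inside the cable, Artin's relation follows (`crossing_braid`), so that the
values form a cocycle `braidValue`. Other parentheses are reached by `rebracket`. The operadic
operations amount to `braidValue_double`, `braidValue_addLeft` and `braidValue_addRight`; all
commutations come from one principle, that chords inside a bundle commute with a diagram that does
not separate the bundle (`commute_chords`).

Two colours. A chord between two poles r, s acts on mixed diagrams by the derivation that the
four-term relation dictates, [t_rs, t_rj] = [t_rj, t_sj]. Together with left multiplication by the
mixed chords this defines a representation `redAct` of the whole of `BlueAlg`, and evaluation at 1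
is a retraction of the forgetful map, which is therefore injective. The Lie algebra of all chords is
the sum of the mixed one, an ideal, and of the one generated by the chords between poles; removing
all chords that end on strands detects the second summand. For a mixed braid this removal leaves the
value of the trivial braid between equal words of poles, namely 1 (`dropBlue_value`), so the
logarithm is a mixed Lie series (`exists_mixed_lieSeries`). That the values are group-like at all is
the Baker–Campbell–Hausdorff property `isLieSeries_mul`.

Grading and truncation. The value of a full twist is conjugate to exp(t_ij), which gives the
filtration and the associated graded map. Chords between poles never destroy a chord between
strands, so the elements whose action adds at least `k` such chords form a two-sided ideal
`blueIdeal` of `BlueAlg`. The `k`-th power of the ideal generated by blue twists is sent into it,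
and the retraction carries it into the span that the truncation kills. -/

namespace MixedBraids

/-! ### Graded series: exponential, logarithm and the Baker–Campbell–Hausdorff property. -/

section Series

open PowerSeries

attribute [local instance 100] LieRing.ofAssociativeRing
attribute [local instance 100] LieAlgebra.ofAssociativeAlgebra

variable {A : Type*} [Ring A]

/-- The series `f` begins in degree `≥ n`. -/
def Vanish (n : ℕ) (f : A⟦X⟧) : Prop := ∀ d < n, coeff d f = 0

theorem Vanish.mono {m n : ℕ} (h : m ≤ n) {f : A⟦X⟧} (hf : Vanish n f) : Vanish m f :=
  fun d hd => hf d (hd.trans_le h)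

theorem Vanish.add {n : ℕ} {f g : A⟦X⟧} (hf : Vanish n f) (hg : Vanish n g) : Vanish n (f + g) :=
  fun d hd => by rw [map_add, hf d hd, hg d hd, add_zero]

theorem Vanish.neg {n : ℕ} {f : A⟦X⟧} (hf : Vanish n f) : Vanish n (-f) :=
  fun d hd => by rw [map_neg, hf d hd, neg_zero]

theorem Vanish.sub {n : ℕ} {f g : A⟦X⟧} (hf : Vanish n f) (hg : Vanish n g) : Vanish n (f - g) :=
  fun d hd => by rw [map_sub, hf d hd, hg d hd, sub_zero]

theorem Vanish.mul {m n : ℕ} {f g : A⟦X⟧} (hf : Vanish m f) (hg : Vanish n g) :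
    Vanish (m + n) (f * g) := fun d hd => by
  rw [coeff_mul]
  refine Finset.sum_eq_zero fun p hp => ?_
  have := Finset.HasAntidiagonal.mem_antidiagonal.1 hp
  rcases Nat.lt_or_ge p.1 m with h | h
  · rw [hf _ h, zero_mul]
  · rw [hg _ (by omega), mul_zero]

theorem Vanish.mul_left {m : ℕ} {f : A⟦X⟧} (hf : Vanish m f) (g : A⟦X⟧) : Vanish m (g * f) := by
  have : Vanish 0 g := fun _ h => absurd h (Nat.not_lt_zero _)
  simpa using this.mul hf

theorem Vanish.sum {ι : Type*} {n : ℕ} {s : Finset ι} {f : ι → A⟦X⟧}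
    (h : ∀ i ∈ s, Vanish n (f i)) : Vanish n (∑ i ∈ s, f i) := fun d hd => by
  rw [map_sum]; exact Finset.sum_eq_zero fun i hi => h i hi d hd

theorem vanish_one {u : A⟦X⟧} (h : coeff 0 u = 0) : Vanish 1 u := fun d hd => by
  rw [Nat.lt_one_iff.1 hd, h]

theorem Vanish.pow {u : A⟦X⟧} (h : coeff 0 u = 0) (n : ℕ) : Vanish n (u ^ n) := by
  induction n with
  | zero => exact fun _ h => absurd h (Nat.not_lt_zero _)
  | succ n ih => rw [pow_succ]; exact ih.mul (vanish_one h)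

variable [Algebra ℚ A]

theorem Vanish.smul {n : ℕ} {f : A⟦X⟧} (hf : Vanish n f) (r : ℚ) : Vanish n (r • f) :=
  fun d hd => by rw [PowerSeries.coeff_smul, hf d hd, smul_zero]

/-- The sum of a sequence of series whose `n`-th term begins in degree `≥ n`. -/
noncomputable def lsum (p : ℕ → A⟦X⟧) : A⟦X⟧ :=
  PowerSeries.mk fun d => ∑ n ∈ Finset.range (d + 1), coeff d (p n)

/-- Every cutoff beyond the degree gives the same coefficient, as later terms begin too late. This
allows the two factors of a product to be cut at one common place. -/
theorem coeff_lsum {p : ℕ → A⟦X⟧} (hp : ∀ n, Vanish n (p n)) {d N : ℕ} (h : d < N) :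
    coeff d (lsum p) = ∑ n ∈ Finset.range N, coeff d (p n) := by
  rw [lsum, coeff_mk]
  refine Finset.sum_subset (Finset.range_mono h) fun n _ hn => hp n d ?_
  simpa using hn

theorem lsum_mul {p q : ℕ → A⟦X⟧} (hp : ∀ n, Vanish n (p n)) (hq : ∀ n, Vanish n (q n)) :
    lsum p * lsum q = lsum fun k => ∑ x ∈ Finset.HasAntidiagonal.antidiagonal k, p x.1 * q x.2 := by
  ext d
  have h1 : coeff d (lsum p * lsum q) =
      ∑ n ∈ Finset.range (d + 1), ∑ m ∈ Finset.range (d + 1), coeff d (p n * q m) := by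
    rw [coeff_mul]
    simp only [coeff_mul]
    rw [Finset.sum_congr rfl fun n _ => Finset.sum_comm, Finset.sum_comm]
    refine Finset.sum_congr rfl fun x hx => ?_
    have := Finset.HasAntidiagonal.mem_antidiagonal.1 hx
    rw [coeff_lsum hp (N := d + 1) (by omega), coeff_lsum hq (N := d + 1) (by omega),
      Finset.sum_mul_sum]
  rw [h1, lsum, coeff_mk]
  simp only [map_sum]
  rw [← Finset.sum_product', Finset.sum_sigma']
  symm
  -- One side runs over the triangle `n + m ≤ d`, the other over a square containing it. The
  -- additional terms vanish for reasons of degree, so only nonzero terms need to be matched.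
  refine Finset.sum_bij_ne_zero (fun x _ _ => x.2) ?_ ?_ ?_ ?_
  · rintro ⟨k, x⟩ hx _
    simp only [Finset.mem_sigma, Finset.mem_range, Finset.HasAntidiagonal.mem_antidiagonal, Finset.mem_product] at *
    omega
  · rintro ⟨k, x⟩ hx _ ⟨k', x'⟩ hx' _ h
    simp only [Finset.mem_sigma, Finset.mem_range, Finset.HasAntidiagonal.mem_antidiagonal] at *
    subst h
    obtain ⟨_, rfl⟩ := hx
    obtain ⟨_, rfl⟩ := hx'
    rfl
  · rintro x hx hne
    refine ⟨⟨x.1 + x.2, x⟩, ?_, hne, rfl⟩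
    simp only [Finset.mem_sigma, Finset.mem_range, Finset.HasAntidiagonal.mem_antidiagonal, and_true]
    by_contra hlt
    exact hne (((hp _).mul (hq _)) d (by omega))
  · rintro ⟨k, x⟩ _ _; rfl

theorem mul_lsum {y : A⟦X⟧} {q : ℕ → A⟦X⟧} (hq : ∀ n, Vanish n (q n)) :
    y * lsum q = lsum fun k => y * q k := by
  ext d
  rw [coeff_mul, coeff_lsum (fun n => (hq n).mul_left y) (Nat.lt_succ_self d)]
  simp only [coeff_mul]
  rw [Finset.sum_comm]
  refine Finset.sum_congr rfl fun x hx => ?_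
  have := Finset.HasAntidiagonal.mem_antidiagonal.1 hx
  rw [coeff_lsum hq (N := d + 1) (by omega), Finset.mul_sum]

/-- The terms of the exponential series. -/
noncomputable def dpow (u : A⟦X⟧) (n : ℕ) : A⟦X⟧ := (n.factorial : ℚ)⁻¹ • u ^ n

theorem dpow_vanish {u : A⟦X⟧} (h : coeff 0 u = 0) (n : ℕ) : Vanish n (dpow u n) :=
  (Vanish.pow h n).smul _

theorem expSeries_eq (u : A⟦X⟧) : expSeries u = lsum (dpow u) := by
  ext d; rw [expSeries, lsum, coeff_mk, coeff_mk]; rfl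

theorem coeff_zero_expSeries (u : A⟦X⟧) : coeff 0 (expSeries u) = 1 := by
  rw [expSeries, coeff_mk]; simp

theorem expSeries_zero : expSeries (0 : A⟦X⟧) = 1 := by
  ext d
  rw [expSeries, coeff_mk, Finset.sum_range_succ']
  simp

theorem map_expSeries {B : Type*} [Ring B] [Algebra ℚ B] (f : A →ₐ[ℚ] B) (u : A⟦X⟧) :
    PowerSeries.map f.toRingHom (expSeries u) = expSeries (PowerSeries.map f.toRingHom u) := by
  ext d
  rw [coeff_map, expSeries, expSeries, coeff_mk, coeff_mk, map_sum]
  refine Finset.sum_congr rfl fun n _ => ?_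
  rw [← map_pow, coeff_map]
  exact map_smul f _ _

/-- Only powers of the single series `u` occur, so the identity exp(X) exp(-X) = 1 over ℚ supplies
all the coefficients. -/
theorem expSeries_mul_neg {u : A⟦X⟧} (h : coeff 0 u = 0) :
    expSeries u * expSeries (-u) = 1 := by
  have h' : coeff 0 (-u) = 0 := by rw [map_neg, h, neg_zero]
  rw [expSeries_eq, expSeries_eq, lsum_mul (dpow_vanish h) (dpow_vanish h')]
  have key : ∀ k, ∑ x ∈ Finset.HasAntidiagonal.antidiagonal k, dpow u x.1 * dpow (-u) x.2 =
      (if k = 0 then (1 : ℚ) else 0) • u ^ k := by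
    intro k
    have := congrArg (coeff k) (PowerSeries.exp_mul_exp_neg_eq_one (A := ℚ))
    rw [coeff_mul, coeff_one] at this
    rw [← this, Finset.sum_smul]
    refine Finset.sum_congr rfl fun x hx => ?_
    rw [← Finset.HasAntidiagonal.mem_antidiagonal.1 hx, dpow, dpow, neg_pow, evalNegHom, coeff_rescale, coeff_exp,
      coeff_exp, pow_add, smul_mul_smul_comm, ← mul_assoc]
    rcases Nat.even_or_odd x.2 with he | he <;>
      simp [he.neg_one_pow, mul_comm]
  simp only [key]
  ext d
  rw [lsum, coeff_mk, Finset.sum_range_succ']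
  simp

theorem expSeries_neg_mul {u : A⟦X⟧} (h : coeff 0 u = 0) :
    expSeries (-u) * expSeries u = 1 := by
  have := expSeries_mul_neg (u := -u) (by rw [map_neg, h, neg_zero])
  rwa [neg_neg] at this

/-! ### The logarithm -/

/-- The difference of powers telescopes into products with one factor `u - v` and `n` factors that
begin in degree one. -/
theorem pow_sub_pow_vanish {u v : A⟦X⟧} (hu : coeff 0 u = 0) (hv : coeff 0 v = 0) {d : ℕ}
    (h : Vanish d (u - v)) (n : ℕ) : Vanish (d + n) (u ^ (n + 1) - v ^ (n + 1)) := by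
  induction n with
  | zero => simpa using h
  | succ n ih =>
    have e : u ^ (n + 1 + 1) - v ^ (n + 1 + 1) =
        u ^ (n + 1) * (u - v) + (u ^ (n + 1) - v ^ (n + 1)) * v := by
      rw [pow_succ u (n + 1), pow_succ v (n + 1)]; noncomm_ring
    rw [e]
    refine Vanish.add ?_ (ih.mul (vanish_one hv))
    exact Vanish.mono (by omega) ((Vanish.pow hu (n + 1)).mul h)

/-- Among the terms of the exponential series only the linear one notices a change of the argument
in degree `d` up to that degree. Injectivity of the exponential, existence of logarithms and the
degreewise argument for products all rest on this. -/
theorem expSeries_sub_vanish {u v : A⟦X⟧} (hu : coeff 0 u = 0) (hv : coeff 0 v = 0) {d : ℕ}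
    (h : Vanish d (u - v)) : Vanish (d + 1) (expSeries u - expSeries v - (u - v)) := by
  intro m hm
  rw [map_sub, map_sub, expSeries_eq, expSeries_eq,
    coeff_lsum (dpow_vanish hu) (N := m + 2) (by omega),
    coeff_lsum (dpow_vanish hv) (N := m + 2) (by omega), ← Finset.sum_sub_distrib,
    Finset.sum_range_succ', Finset.sum_range_succ']
  rw [Finset.sum_eq_zero fun n hn => ?_]
  · simp [dpow]
  · rw [dpow, dpow, PowerSeries.coeff_smul, PowerSeries.coeff_smul, ← smul_sub, ← map_sub,
      pow_sub_pow_vanish hu hv h (n + 1) m (by omega), smul_zero]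

theorem expSeries_injective {u v : A⟦X⟧} (hu : coeff 0 u = 0) (hv : coeff 0 v = 0)
    (h : expSeries u = expSeries v) : u = v := by
  have : ∀ d, Vanish d (u - v) := by
    intro d
    induction d with
    | zero => exact fun _ h => absurd h (Nat.not_lt_zero _)
    | succ d ih =>
      have := (expSeries_sub_vanish hu hv ih).neg
      rwa [h, sub_self, zero_sub, neg_neg] at this
  rw [← sub_eq_zero]
  ext d
  exact this (d + 1) d (Nat.lt_succ_self d)

/-- The part of a series in degrees `< d`. -/
noncomputable def cut (d : ℕ) (u : A⟦X⟧) : A⟦X⟧ :=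
  PowerSeries.mk fun m => if m < d then coeff m u else 0

theorem coeff_cut (d m : ℕ) (u : A⟦X⟧) : coeff m (cut d u) = if m < d then coeff m u else 0 := by
  rw [cut, coeff_mk]

theorem cut_vanish (d : ℕ) (u : A⟦X⟧) : Vanish d (u - cut d u) := fun m hm => by
  rw [map_sub, coeff_cut, if_pos hm, sub_self]

theorem coeff_zero_cut {u : A⟦X⟧} (h : coeff 0 u = 0) (d : ℕ) : coeff 0 (cut d u) = 0 := by
  rw [coeff_cut, h, ite_self]

/-- The coefficients of a logarithm. -/
noncomputable def logCoeff (g : A⟦X⟧) : ℕ → A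
  | d => if d = 0 then 0 else coeff d g -
      coeff d (expSeries (PowerSeries.mk fun m => if h : m < d then logCoeff g m else 0))

/-- The coefficient of degree `d` of an exponential is that of the argument plus a quantity
depending only on the lower coefficients; `logCoeff` solves for them in turn. -/
theorem exists_log {g : A⟦X⟧} (h : coeff 0 g = 1) : ∃ u, coeff 0 u = 0 ∧ expSeries u = g := by
  refine ⟨PowerSeries.mk (logCoeff g), ?_, ?_⟩
  · rw [coeff_mk, logCoeff, if_pos rfl]
  set u := PowerSeries.mk (logCoeff g) with hu
  have h0 : coeff 0 u = 0 := by rw [hu, coeff_mk, logCoeff, if_pos rfl]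
  ext d
  rcases Nat.eq_zero_or_pos d with rfl | hd
  · rw [coeff_zero_expSeries, h]
  have h1 := expSeries_sub_vanish h0 (coeff_zero_cut h0 d) (cut_vanish d u) d (Nat.lt_succ_self d)
  rw [map_sub, map_sub, map_sub, coeff_cut, if_neg (lt_irrefl d), sub_zero] at h1
  have h2 : coeff d u = coeff d g - coeff d (expSeries (cut d u)) := by
    rw [hu, coeff_mk, logCoeff, if_neg hd.ne']
    congr 3
    ext m
    rw [coeff_mk, coeff_cut, coeff_mk]
    split_ifs <;> rfl
  rw [h2] at h1
  rw [sub_eq_zero] at h1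
  exact sub_left_injective h1

/-! ### Lie series and the Baker-Campbell-Hausdorff property -/

/-- The operator that multiplies the component of degree `d` by `d`. -/
noncomputable def euler : A⟦X⟧ →ₗ[ℚ] A⟦X⟧ where
  toFun f := PowerSeries.mk fun d => (d : ℚ) • coeff d f
  map_add' f g := by ext d; simp
  map_smul' r f := by ext d; simp [smul_comm r]

theorem coeff_euler (d : ℕ) (f : A⟦X⟧) : coeff d (euler f) = (d : ℚ) • coeff d f := by
  change coeff d (PowerSeries.mk fun d => (d : ℚ) • coeff d f) = _
  rw [coeff_mk]

theorem euler_mul (f g : A⟦X⟧) : euler (f * g) = euler f * g + f * euler g := by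
  ext d
  rw [coeff_euler, map_add, coeff_mul, coeff_mul, coeff_mul, Finset.smul_sum,
    ← Finset.sum_add_distrib]
  refine Finset.sum_congr rfl fun x hx => ?_
  rw [coeff_euler, coeff_euler, smul_mul_assoc, mul_smul_comm, ← add_smul,
    ← Finset.HasAntidiagonal.mem_antidiagonal.1 hx, Nat.cast_add]

theorem Vanish.euler {n : ℕ} {f : A⟦X⟧} (hf : Vanish n f) : Vanish n (euler f) := fun d hd => by
  rw [coeff_euler, hf d hd, smul_zero]

theorem euler_one : euler (1 : A⟦X⟧) = 0 := by
  ext d; rw [coeff_euler, coeff_one]; split_ifs with h <;> simp [h]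

theorem euler_lsum (p : ℕ → A⟦X⟧) : euler (lsum p) = lsum fun n => euler (p n) := by
  ext d
  rw [coeff_euler, lsum, lsum, coeff_mk, coeff_mk, Finset.smul_sum]
  simp only [coeff_euler]

/-- The iterated brackets `[⋯[[y, u], u]⋯, u]`. -/
noncomputable def iterBracket (u y : A⟦X⟧) : ℕ → A⟦X⟧
  | 0 => y
  | k + 1 => iterBracket u y k * u - u * iterBracket u y k

theorem iterBracket_vanish {u : A⟦X⟧} (h : coeff 0 u = 0) {y : A⟦X⟧} {m : ℕ} (hy : Vanish m y)
    (k : ℕ) : Vanish (m + k) (iterBracket u y k) := by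
  induction k with
  | zero => exact hy
  | succ k ih =>
    refine (ih.mul (vanish_one h)).sub ?_
    exact ((vanish_one h).mul ih).mono (by omega)

/-- Right multiplication by `u` is the sum of two commuting operators, left multiplication by `u`
and the bracket with `u`; the formula is the binomial theorem for them. -/
theorem mul_pow_iterBracket (u y : A⟦X⟧) (n : ℕ) : y * u ^ n =
    ∑ k ∈ Finset.range (n + 1), (n.choose k : ℚ) • (u ^ (n - k) * iterBracket u y k) := by
  induction n generalizing y with
  | zero => simp [iterBracket]
  | succ n ih =>
    have e : ∀ k, iterBracket u (y * u - u * y) k = iterBracket u y (k + 1) := by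
      intro k
      induction k with
      | zero => rfl
      | succ k ih => rw [iterBracket, ih]; rfl
    have e2 : y * u ^ (n + 1) = u * (y * u ^ n) + (y * u - u * y) * u ^ n := by
      rw [pow_succ']; noncomm_ring
    rw [e2, ih, ih, Finset.mul_sum, Finset.sum_range_succ' _ (n + 1), Finset.sum_range_succ']
    simp only [e, Nat.choose_succ_succ, Nat.cast_add, add_smul, Finset.sum_add_distrib]
    rw [Finset.sum_range_succ (fun k => (((n.choose (k + 1) : ℕ) : ℚ)) • _) n]
    have e3 : ∀ k ∈ Finset.range n, u * ((n.choose (k + 1) : ℚ) • (u ^ (n - (k + 1)) *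
        iterBracket u y (k + 1))) =
        (n.choose (k + 1) : ℚ) • (u ^ (n + 1 - (k + 1)) * iterBracket u y (k + 1)) := by
      intro k hk
      rw [mul_smul_comm, ← mul_assoc, ← pow_succ',
        show n - (k + 1) + 1 = n + 1 - (k + 1) by have := Finset.mem_range.1 hk; omega]
    rw [Finset.sum_congr rfl e3]
    simp only [Nat.choose_succ_self, Nat.cast_zero, zero_smul, add_zero, Nat.choose_zero_right,
      Nat.cast_one, one_smul, Nat.sub_zero, Nat.add_sub_add_right]
    rw [← mul_assoc, ← pow_succ']
    abel

/-- The Leibniz rule puts `euler u` in front of a lower power; moving it to the right by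
`mul_pow_iterBracket` produces binomial coefficients that add up by Pascal's rule. -/
theorem euler_pow (u : A⟦X⟧) (n : ℕ) : euler (u ^ n) = ∑ k ∈ Finset.range n,
    (n.choose (k + 1) : ℚ) • (u ^ (n - 1 - k) * iterBracket u (euler u) k) := by
  induction n with
  | zero => simp [euler_one]
  | succ n ih =>
    rw [pow_succ', euler_mul, mul_pow_iterBracket, ih, Finset.mul_sum]
    simp only [Nat.choose_succ_succ, Nat.cast_add, add_smul, Finset.sum_add_distrib]
    congr 1
    rw [Finset.sum_range_succ]
    simp only [Nat.choose_succ_self, Nat.cast_zero, zero_smul, add_zero]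
    refine Finset.sum_congr rfl fun k hk => ?_
    rw [mul_smul_comm, ← mul_assoc, ← pow_succ',
      show n - 1 - k + 1 = n + 1 - 1 - k by have := Finset.mem_range.1 hk; omega]

/-- Conjugation by an exponential is the exponential of the bracket. Only brackets occur on the
right, so conjugation preserves Lie series. -/
theorem mul_expSeries (u y : A⟦X⟧) (h : coeff 0 u = 0) :
    y * expSeries u = expSeries u *
      lsum fun k => (k.factorial : ℚ)⁻¹ • iterBracket u y k := by
  have hv : ∀ k, Vanish k ((k.factorial : ℚ)⁻¹ • iterBracket u y k) := fun k =>
    Vanish.smul ((iterBracket_vanish h (m := 0)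
      (fun _ h => absurd h (Nat.not_lt_zero _)) k).mono (by omega)) _
  rw [expSeries_eq, mul_lsum (dpow_vanish h), lsum_mul (dpow_vanish h) hv]
  congr 1
  ext1 n
  rw [dpow, mul_smul_comm, mul_pow_iterBracket, Finset.smul_sum,
    Finset.Nat.sum_antidiagonal_eq_sum_range_succ
      (fun i j => dpow u i * ((j.factorial : ℚ)⁻¹ • iterBracket u y j)) n,
    ← Finset.sum_range_reflect]
  refine Finset.sum_congr rfl fun k hk => ?_
  have hk' := Nat.lt_succ_iff.1 (Finset.mem_range.1 hk)
  have e : n + 1 - 1 - k = n - k := by omega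
  rw [e, Nat.sub_sub_self hk', dpow, smul_mul_smul_comm, smul_smul]
  congr 1
  rw [Nat.choose_symm hk', Nat.cast_choose ℚ hk']
  have := n.factorial_ne_zero
  field_simp

/-- The logarithmic derivative of an exponential is the series (e^x - 1)/x in the bracket with `u`,
applied to `euler u`. It is a Lie series if `u` is one. -/
theorem euler_expSeries (u : A⟦X⟧) (h : coeff 0 u = 0) :
    euler (expSeries u) = expSeries u *
      lsum fun k => ((k + 1).factorial : ℚ)⁻¹ • iterBracket u (euler u) k := by
  have hv1 : ∀ k, Vanish (k + 1) (((k + 1).factorial : ℚ)⁻¹ • iterBracket u (euler u) k) :=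
    fun k => Vanish.smul ((iterBracket_vanish h (vanish_one h).euler k).mono (by omega)) _
  have hv := fun k => (hv1 k).mono (Nat.le_succ k)
  rw [expSeries_eq, euler_lsum, lsum_mul (dpow_vanish h) hv]
  ext d
  rw [coeff_lsum (fun n => (dpow_vanish h n).euler) (show d < d + 1 + 1 by omega),
    Finset.sum_range_succ', coeff_lsum (N := d + 1) (fun n => Vanish.sum fun x hx => ?_)
      (Nat.lt_succ_self d)]
  · have : coeff d (euler (dpow u 0)) = 0 := by
      rw [dpow, pow_zero, map_smul, euler_one, smul_zero, map_zero]
    rw [this, add_zero]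
    refine Finset.sum_congr rfl fun n _ => ?_
    congr 1
    rw [dpow, map_smul, euler_pow, Finset.smul_sum,
      Finset.Nat.sum_antidiagonal_eq_sum_range_succ
        (fun i j => dpow u i * (((j + 1).factorial : ℚ)⁻¹ • iterBracket u (euler u) j)) n,
      ← Finset.sum_range_reflect]
    refine Finset.sum_congr rfl fun k hk => ?_
    have hk' := Nat.lt_succ_iff.1 (Finset.mem_range.1 hk)
    have e : n + 1 - 1 - k = n - k := by omega
    have e' : n - k + 1 ≤ n + 1 := by omega
    rw [e, show n + 1 - 1 - (n - k) = k by omega, dpow, smul_mul_smul_comm, smul_smul]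
    congr 1
    rw [Nat.cast_choose ℚ e', show n + 1 - (n - k + 1) = k by omega]
    have := (n + 1).factorial_ne_zero
    field_simp
  · rw [← Finset.HasAntidiagonal.mem_antidiagonal.1 hx]
    exact (dpow_vanish h _).mul (hv _)

variable (V : Submodule ℚ A)

/-- The Lie elements of degree `d`. -/
noncomputable def lieDeg (d : ℕ) : Submodule ℚ A :=
  V ^ d ⊓ (LieSubalgebra.lieSpan ℚ A (V : Set A)).toSubmodule

/-- Lie series; constant terms are not excluded. -/
def LieSeries : Submodule ℚ A⟦X⟧ where
  carrier := {u | ∀ d, coeff d u ∈ lieDeg V d}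
  zero_mem' d := by rw [map_zero]; exact Submodule.zero_mem _
  add_mem' hf hg d := by rw [map_add]; exact Submodule.add_mem _ (hf d) (hg d)
  smul_mem' r f hf d := by rw [PowerSeries.coeff_smul]; exact Submodule.smul_mem _ _ (hf d)

variable {V}

theorem isLieSeries_iff {u : A⟦X⟧} :
    IsLieSeries V u ↔ coeff 0 u = 0 ∧ u ∈ LieSeries V :=
  ⟨fun h => ⟨h.2.1, fun d => ⟨h.1 d, h.2.2 d⟩⟩, fun h => ⟨fun d => (h.2 d).1, h.1, fun d => (h.2 d).2⟩⟩

theorem lieSeries_bracket {u v : A⟦X⟧} (hu : u ∈ LieSeries V) (hv : v ∈ LieSeries V) :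
    u * v - v * u ∈ LieSeries V := by
  intro d
  rw [map_sub, coeff_mul, coeff_mul, ← Finset.Nat.sum_antidiagonal_swap (n := d)
    (f := fun p => coeff p.1 v * coeff p.2 u), ← Finset.sum_sub_distrib]
  refine Submodule.sum_mem _ fun p hp => ⟨?_, ?_⟩
  · rw [← Finset.HasAntidiagonal.mem_antidiagonal.1 hp]
    refine Submodule.sub_mem _ ?_ ?_
    · rw [pow_add]; exact Submodule.mul_mem_mul (hu _).1 (hv _).1
    · rw [add_comm, pow_add]; exact Submodule.mul_mem_mul (hv _).1 (hu _).1
  · exact LieSubalgebra.lie_mem _ (hu _).2 (hv _).2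

theorem lieSeries_euler {u : A⟦X⟧} (hu : u ∈ LieSeries V) : euler u ∈ LieSeries V := fun d => by
  rw [coeff_euler]; exact Submodule.smul_mem _ _ (hu d)

theorem lieSeries_lsum {p : ℕ → A⟦X⟧} (hp : ∀ n, p n ∈ LieSeries V) : lsum p ∈ LieSeries V :=
  fun d => by rw [lsum, coeff_mk]; exact Submodule.sum_mem _ fun n _ => hp n d

theorem lieSeries_iterBracket {u y : A⟦X⟧} (hu : u ∈ LieSeries V) (hy : y ∈ LieSeries V) (k : ℕ) :
    iterBracket u y k ∈ LieSeries V := by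
  induction k with
  | zero => exact hy
  | succ k ih => exact lieSeries_bracket ih hu

theorem exists_mul_expSeries {u y : A⟦X⟧} (h : coeff 0 u = 0) (hu : u ∈ LieSeries V)
    (hy : y ∈ LieSeries V) : ∃ y' ∈ LieSeries V, y * expSeries u = expSeries u * y' :=
  ⟨_, lieSeries_lsum fun k => Submodule.smul_mem _ _ (lieSeries_iterBracket hu hy k),
    mul_expSeries u y h⟩

theorem exists_euler_expSeries {u : A⟦X⟧} (h : coeff 0 u = 0) (hu : u ∈ LieSeries V) :
    ∃ y ∈ LieSeries V, euler (expSeries u) = expSeries u * y :=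
  ⟨_, lieSeries_lsum fun k => Submodule.smul_mem _ _
    (lieSeries_iterBracket hu (lieSeries_euler hu) k), euler_expSeries u h⟩

/-- A product of exponentials of Lie series is the exponential of a Lie series. -/
theorem isLieSeries_mul {u v : A⟦X⟧} (hu : IsLieSeries V u) (hv : IsLieSeries V v) :
    ∃ w, IsLieSeries V w ∧ expSeries w = expSeries u * expSeries v := by
  rw [isLieSeries_iff] at hu hv
  obtain ⟨w, hw0, hw⟩ := exists_log (g := expSeries u * expSeries v) (by
    rw [coeff_mul, Finset.Nat.antidiagonal_zero, Finset.sum_singleton, coeff_zero_expSeries,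
      coeff_zero_expSeries, one_mul])
  refine ⟨w, isLieSeries_iff.2 ⟨hw0, ?_⟩, hw⟩
  intro d
  -- The logarithm `w` is proved to be Lie one degree at a time. If `w'` is its part below degree
  -- `d`, then `h = exp(-w') exp(u) exp(v)` is 1 plus the component of degree `d` of `w` plus higher
  -- terms. The logarithmic Euler derivative of `h` is a Lie series, and in degree `d` it equals `d`
  -- times that component.
  induction d using Nat.strong_induction_on with
  | _ d ih =>
  rcases Nat.eq_zero_or_pos d with rfl | hd
  · rw [hw0]; exact Submodule.zero_mem _
  set w' := cut d w with hw'
  have hw'0 : coeff 0 w' = 0 := coeff_zero_cut hw0 d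
  have hw'L : w' ∈ LieSeries V := by
    intro m
    rw [hw', coeff_cut]
    split_ifs with h
    · exact ih m h
    · exact Submodule.zero_mem _
  have hn0 : coeff 0 (-w') = 0 := by rw [map_neg, hw'0, neg_zero]
  obtain ⟨a, ha, ea⟩ := exists_euler_expSeries hn0 (Submodule.neg_mem _ hw'L)
  obtain ⟨b, hb, eb⟩ := exists_euler_expSeries hu.1 hu.2
  obtain ⟨c, hc, ec⟩ := exists_euler_expSeries hv.1 hv.2
  obtain ⟨a', ha', ea'⟩ := exists_mul_expSeries hu.1 hu.2 ha
  obtain ⟨p, hp, ep⟩ := exists_mul_expSeries hv.1 hv.2 (Submodule.add_mem _ ha' hb)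
  set h := expSeries (-w') * (expSeries u * expSeries v) with hh
  -- The logarithmic derivative of each factor is moved to the right end past the later
  -- exponentials, which keeps it a Lie series.
  have eh : euler h = h * (p + c) := by
    rw [hh, euler_mul, euler_mul, ea, eb, ec]
    have : expSeries (-w') * a * (expSeries u * expSeries v) + expSeries (-w') *
        (expSeries u * b * expSeries v + expSeries u * (expSeries v * c)) =
        expSeries (-w') * ((a * expSeries u) * expSeries v + expSeries u * (b * expSeries v)
          + expSeries u * expSeries v * c) := by noncomm_ring
    rw [this, ea', mul_assoc (expSeries u) a', ← mul_add, ← add_mul, ep]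
    noncomm_ring
  have h1 : h = 1 + expSeries (-w') * (expSeries w - expSeries w') := by
    rw [mul_sub, expSeries_neg_mul hw'0, hh, hw]; abel
  have h2 : Vanish (d + 1) (expSeries w - expSeries w' - (w - w')) :=
    expSeries_sub_vanish hw0 hw'0 (cut_vanish d w)
  have h3 : Vanish d (expSeries w - expSeries w') := by
    have := (h2.mono (Nat.le_succ d)).add (cut_vanish d w)
    rwa [sub_add_cancel] at this
  have hw1 : Vanish (d + 1) (h - 1 - (w - w')) := by
    have h4 : Vanish 1 (expSeries (-w') - 1) := vanish_one (by
      rw [map_sub, coeff_zero_expSeries]; simp)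
    have h5 := (h4.mul h3).mono (show d + 1 ≤ 1 + d by omega)
    have : h - 1 - (w - w') = (expSeries (-w') - 1) * (expSeries w - expSeries w') +
        (expSeries w - expSeries w' - (w - w')) := by rw [h1]; noncomm_ring
    rw [this]
    exact h5.add h2
  have hsub : Vanish d (h - 1) := by
    have := (hw1.mono (Nat.le_succ d)).add (cut_vanish d w)
    rwa [sub_add_cancel] at this
  have hcd : coeff d h = coeff d w := by
    have := hw1 d (Nat.lt_succ_self d)
    rw [map_sub, map_sub, map_sub, hw', coeff_cut, if_neg (lt_irrefl d), sub_zero, coeff_one,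
      if_neg hd.ne', sub_zero, sub_eq_zero] at this
    exact this
  clear_value h
  have hpc : coeff 0 (p + c) = 0 := by
    have := congrArg (coeff 0) eh
    rw [coeff_euler, coeff_mul, Finset.Nat.antidiagonal_zero, Finset.sum_singleton] at this
    have h0 := hsub 0 hd
    rw [map_sub, coeff_zero_one, sub_eq_zero] at h0
    rw [h0, one_mul] at this
    rw [← this]; simp
  -- Since `h - 1` begins in degree `d` and `p + c` in degree one, `h * (p + c)` and `p + c` agree
  -- in degree `d`.
  have key : (d : ℚ) • coeff d w = coeff d (p + c) := by
    have := (hsub.mul (vanish_one hpc)) d (Nat.lt_succ_self d)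
    rw [sub_mul, one_mul, ← eh, map_sub, coeff_euler, hcd, sub_eq_zero] at this
    exact this
  have hd' : (d : ℚ) ≠ 0 := by exact_mod_cast hd.ne'
  rw [show coeff d w = (d : ℚ)⁻¹ • coeff d (p + c) by rw [← key, smul_smul, inv_mul_cancel₀ hd', one_smul]]
  exact Submodule.smul_mem _ _ (Submodule.add_mem _ hp hc d)

theorem IsLieSeries.neg {u : A⟦X⟧} (hu : IsLieSeries V u) : IsLieSeries V (-u) := by
  rw [isLieSeries_iff] at hu ⊢
  exact ⟨by rw [map_neg, hu.1, neg_zero], Submodule.neg_mem _ hu.2⟩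

/-- The exponential as a unit. -/
noncomputable def expUnit (u : A⟦X⟧) (h : coeff 0 u = 0) : A⟦X⟧ˣ :=
  ⟨expSeries u, expSeries (-u), expSeries_mul_neg h, expSeries_neg_mul h⟩

variable (V) in
/-- The group of the exponentials of Lie series. -/
noncomputable def lieGroup : Subgroup A⟦X⟧ˣ where
  carrier := {g | ∃ u, IsLieSeries V u ∧ (g : A⟦X⟧) = expSeries u}
  mul_mem' := by
    rintro g h ⟨u, hu, eu⟩ ⟨v, hv, ev⟩
    obtain ⟨w, hw, e⟩ := isLieSeries_mul hu hv
    exact ⟨w, hw, by rw [Units.val_mul, eu, ev, e]⟩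
  one_mem' := ⟨0, isLieSeries_iff.2 ⟨map_zero _, Submodule.zero_mem _⟩, expSeries_zero.symm⟩
  inv_mem' := by
    rintro g ⟨u, hu, eu⟩
    refine ⟨-u, hu.neg, ?_⟩
    have : g = expUnit u hu.2.1 := Units.ext eu
    rw [this]; rfl

theorem expSeries_mem_hat {u : A⟦X⟧} (hu : u ∈ hat V) : expSeries u ∈ hat V := by
  intro d
  rw [expSeries, coeff_mk]
  exact Submodule.sum_mem _ fun n _ => Submodule.smul_mem _ _ (Subalgebra.pow_mem _ hu n d)

end Series

/-! ### The derivation by which a chord between two poles acts on mixed diagrams. -/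

section Derivations

variable {l : ℕ}

open Color

section Identities

variable {R : Type*} [Ring R]

/-- The Leibniz expansion of the relation `a b' = b' a`. Here `a, a'` join one strand to two poles,
`b, b'` join another strand to the same two poles, and `w` joins the strands. The difference of the
two sides is a sum of brackets of the hypotheses. -/
theorem comm_deriv_identity {a a' b b' w : R} (h : a * b' = b' * a)
    (e2 : (b + w) * a = a * (b + w)) (e3 : (a' + w) * b' = b' * (a' + w)) :
    (a * a' - a' * a) * b' + a * (b' * b - b * b') =
      (b' * b - b * b') * a + b' * (a * a' - a' * a) := by
  have h0 : a * b' - b' * a = 0 := sub_eq_zero.2 h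
  have e1' : a' * b' - b' * a' - (b' * w - w * b') = 0 := by
    rw [← sub_eq_zero] at e3
    rw [← e3]; noncomm_ring
  have e2' : a * b - b * a - (w * a - a * w) = 0 := by
    rw [← sub_eq_zero] at e2
    rw [← neg_eq_zero, ← e2]; noncomm_ring
  rw [← sub_eq_zero]
  have : (a * a' - a' * a) * b' + a * (b' * b - b * b') -
      ((b' * b - b * b') * a + b' * (a * a' - a' * a)) =
      (a * b' - b' * a) * a' - a' * (a * b' - b' * a) +
      (a * (a' * b' - b' * a' - (b' * w - w * b')) -
        (a' * b' - b' * a' - (b' * w - w * b')) * a) +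
      ((a * b' - b' * a) * b - b * (a * b' - b' * a)) +
      (b' * (a * b - b * a - (w * a - a * w)) - (a * b - b * a - (w * a - a * w)) * b') -
      (w * (a * b' - b' * a) - (a * b' - b' * a) * w) := by noncomm_ring
  rw [this, h0, e1', e2']
  simp

/-- As the mixed terms commute, the sum of the two brackets is the bracket of `u + u'` with `v +
v'`, and both of these commute with `w`. -/
theorem fourTerm_deriv_identity {u u' v v' w : R} (h1 : u * v' = v' * u) (h2 : u' * v = v * u')
    (e1 : (u + u') * w = w * (u + u')) (e2 : (v + v') * w = w * (v + v')) :
    (u * v - v * u + (u' * v' - v' * u')) * w = w * (u * v - v * u + (u' * v' - v' * u')) := by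
  have e : u * v - v * u + (u' * v' - v' * u') = (u + u') * (v + v') - (v + v') * (u + u') := by
    have h1' : u * v' - v' * u = 0 := sub_eq_zero.2 h1
    have h2' : u' * v - v * u' = 0 := sub_eq_zero.2 h2
    have : (u + u') * (v + v') - (v + v') * (u + u') = u * v - v * u + (u' * v' - v' * u') +
      (u * v' - v' * u) + (u' * v - v * u') := by noncomm_ring
    rw [this, h1', h2', add_zero, add_zero]
  have c1 : Commute (u + u') w := e1
  have c2 : Commute (v + v') w := e2
  rw [e]
  exact ((c1.mul_left c2).sub_left (c2.mul_left c1)).eq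

/-- The chords `a, b` end on one pole, `a', b'` on the other, and `w` joins the two strands. Again
the difference of the sides is a sum of brackets of the hypotheses. -/
theorem fourTerm_deriv_identity' {a a' b b' w : R} (h : a * b' = b' * a) (h' : a' * b = b * a')
    (e1 : (a + w) * b = b * (a + w)) (e2 : (a' + w) * b' = b' * (a' + w))
    (e3 : (w + b') * a' = a' * (w + b')) :
    (a * a' - a' * a) * b + (a + w) * (b * b' - b' * b) =
      (b * b' - b' * b) * (a + w) + b * (a * a' - a' * a) := by
  rw [← sub_eq_zero] at h h' e1 e2 e3 ⊢
  generalize hH : a * b' - b' * a = H at h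
  generalize hH' : a' * b - b * a' = H' at h'
  generalize hE1 : (a + w) * b - b * (a + w) = E1 at e1
  generalize hE2 : (a' + w) * b' - b' * (a' + w) = E2 at e2
  generalize hE3 : (w + b') * a' - a' * (w + b') = E3 at e3
  have : (a * a' - a' * a) * b + (a + w) * (b * b' - b' * b) -
      ((b * b' - b' * b) * (a + w) + b * (a * a' - a' * a)) =
      (E1 * b' - b' * E1) + (b * H - H * b) + (b * E2 - E2 * b) + (E1 * a' - a' * E1) -
      (E3 * b - b * E3) + (w * H' - H' * w) + (a * H' - H' * a) := by
    rw [← hH, ← hH', ← hE1, ← hE2, ← hE3]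
    noncomm_ring
  rw [this, h, h', e1, e2, e3]
  simp

end Identities

theorem ChordAlg.induction {k : ℕ∞} {c : Fin l → Color} {P : ChordAlg k c → Prop}
    (scalar : ∀ r : ℚ, P (algebraMap ℚ _ r)) (gen : ∀ i j, P (t k c i j))
    (mul : ∀ x y, P x → P y → P (x * y)) (add : ∀ x y, P x → P y → P (x + y))
    (x : ChordAlg k c) : P x := by
  obtain ⟨y, rfl⟩ := RingQuot.mkAlgHom_surjective ℚ (ChordRel k c) x
  induction y using FreeAlgebra.induction with
  | grade0 r => rw [AlgHom.commutes]; exact scalar r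
  | grade1 p => exact gen p.1 p.2
  | mul a b ha hb => rw [map_mul]; exact mul _ _ ha hb
  | add a b ha hb => rw [map_add]; exact add _ _ ha hb

variable {c : Fin l → Color}

/-- The bracket of a chord with its image under the exchange of the positions `r` and `s`. -/
noncomputable def bracketSwap (c : Fin l → Color) (r s i j : Fin l) : ChordAlg ⊤ c :=
  t ⊤ c i j * t ⊤ c (Equiv.swap r s i) (Equiv.swap r s j) -
    t ⊤ c (Equiv.swap r s i) (Equiv.swap r s j) * t ⊤ c i j

theorem bracketSwap_symm (r s i j : Fin l) : bracketSwap c r s i j = bracketSwap c r s j i := by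
  rw [bracketSwap, bracketSwap, t_symm i j, t_symm (Equiv.swap r s i)]

theorem bracketSwap_of_ne {r s i j : Fin l} (h1 : i ≠ r) (h2 : i ≠ s) (h3 : j ≠ r) (h4 : j ≠ s) :
    bracketSwap c r s i j = 0 := by
  rw [bracketSwap, Equiv.swap_apply_of_ne_of_ne h1 h2, Equiv.swap_apply_of_ne_of_ne h3 h4, sub_self]

theorem ne_of_color {i r : Fin l} (hi : c i = blue) (hr : c r = red) : i ≠ r := by
  rintro rfl; rw [hi] at hr; cases hr

theorem bracketSwap_notAllowed {r s i j : Fin l} (h : ¬ Allowed c i j) :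
    bracketSwap c r s i j = 0 := by
  rw [bracketSwap, t_notAllowed h]; simp

/-- Only chords that end on `r` or `s` have a nonzero image. The commutation of disjoint chords is
enough unless one chord ends on `r` and the other on `s`, which is the case of
`comm_deriv_identity`. -/
theorem bracketSwap_comm_aux {r s : Fin l} (hr : c r = red) (hs : c s = red) {i j p q : Fin l}
    (hj : c j = blue) (hq : c q = blue) (h1 : i ≠ p) (h2 : i ≠ q) (h3 : j ≠ p) (h4 : j ≠ q) :
    bracketSwap c r s i j * t ⊤ c p q + t ⊤ c i j * bracketSwap c r s p q =
      bracketSwap c r s p q * t ⊤ c i j + t ⊤ c p q * bracketSwap c r s i j := by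
  have jr := ne_of_color hj hr
  have js := ne_of_color hj hs
  have qr := ne_of_color hq hr
  have qs := ne_of_color hq hs
  by_cases hi : i = r ∨ i = s
  · by_cases hp : p = r ∨ p = s
    · have si : Equiv.swap r s i = p := by
        rcases hi with rfl | rfl <;> rcases hp with rfl | rfl <;> simp_all
      have sp : Equiv.swap r s p = i := by rw [← si]; simp
      have ci : c i = red := by rcases hi with rfl | rfl <;> assumption
      have cp : c p = red := by rcases hp with rfl | rfl <;> assumption
      rw [bracketSwap, bracketSwap, si, sp, Equiv.swap_apply_of_ne_of_ne jr js,
        Equiv.swap_apply_of_ne_of_ne qr qs]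
      have aij : Allowed c i j := ⟨(ne_of_color hj ci).symm, Or.inr hj⟩
      have aiq : Allowed c i q := ⟨(ne_of_color hq ci).symm, Or.inr hq⟩
      have apj : Allowed c p j := ⟨h3.symm, Or.inr hj⟩
      have apq : Allowed c p q := ⟨(ne_of_color hq cp).symm, Or.inr hq⟩
      have ajq : Allowed c j q := ⟨h4, Or.inr hq⟩
      have sy : ∀ {x y}, Allowed c x y → Allowed c y x := fun h => ⟨h.1.symm, h.2.symm⟩
      refine comm_deriv_identity (w := t ⊤ c j q) (t_comm h1 h2 h3 h4) ?_ ?_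
      · have := t_fourTerm (k := ⊤) (sy aiq) (sy ajq) aij
        rw [t_symm q i, t_symm q j] at this
        exact this
      · have := t_fourTerm (k := ⊤) (sy apj) ajq apq
        rw [t_symm j p] at this
        exact this
    · push Not at hp
      rw [bracketSwap_of_ne hp.1 hp.2 qr qs, mul_zero, zero_mul, add_zero, zero_add]
      refine Commute.eq ?_
      have c1 : Commute (t ⊤ c i j) (t ⊤ c p q) := t_comm h1 h2 h3 h4
      have c2 : Commute (t ⊤ c (Equiv.swap r s i) (Equiv.swap r s j)) (t ⊤ c p q) := by
        rw [Equiv.swap_apply_of_ne_of_ne jr js]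
        refine t_comm ?_ ?_ h3 h4
        · rcases hi with rfl | rfl <;> simp <;> grind
        · rcases hi with rfl | rfl <;> simp <;> grind
      exact (c1.mul_left c2).sub_left (c2.mul_left c1)
  · push Not at hi
    rw [bracketSwap_of_ne hi.1 hi.2 jr js, mul_zero, zero_mul, add_zero, zero_add]
    refine Commute.eq ?_
    have c1 : Commute (t ⊤ c i j) (t ⊤ c p q) := t_comm h1 h2 h3 h4
    have c2 : Commute (t ⊤ c i j) (t ⊤ c (Equiv.swap r s p) (Equiv.swap r s q)) := by
      rw [Equiv.swap_apply_of_ne_of_ne qr qs]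
      refine t_comm ?_ h2 ?_ h4
      · rw [Equiv.swap_apply_def]; split_ifs <;> grind
      · rw [Equiv.swap_apply_def]; split_ifs <;> grind
    exact (c1.mul_right c2).sub_right (c2.mul_right c1)

theorem bracketSwap_comm {r s : Fin l} (hr : c r = red) (hs : c s = red) {i j p q : Fin l}
    (h1 : i ≠ p) (h2 : i ≠ q) (h3 : j ≠ p) (h4 : j ≠ q) :
    bracketSwap c r s i j * t ⊤ c p q + t ⊤ c i j * bracketSwap c r s p q =
      bracketSwap c r s p q * t ⊤ c i j + t ⊤ c p q * bracketSwap c r s i j := by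
  by_cases a1 : Allowed c i j
  swap
  · rw [bracketSwap_notAllowed a1, t_notAllowed a1]; simp
  by_cases a2 : Allowed c p q
  swap
  · rw [bracketSwap_notAllowed a2, t_notAllowed a2]; simp
  rcases a1.2 with hi | hj <;> rcases a2.2 with hp | hq
  · rw [bracketSwap_symm r s i, bracketSwap_symm r s p, t_symm i, t_symm p]
    exact bracketSwap_comm_aux hr hs hi hp h4 h3 h2 h1
  · rw [bracketSwap_symm r s i, t_symm i]
    exact bracketSwap_comm_aux hr hs hi hq h3 h4 h1 h2
  · rw [bracketSwap_symm r s p, t_symm p]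
    exact bracketSwap_comm_aux hr hs hj hp h2 h1 h4 h3
  · exact bracketSwap_comm_aux hr hs hj hq h1 h2 h3 h4

theorem bracketSwap_fourTerm_aux {r s : Fin l} (hr : c r = red) (hs : c s = red) {i j p : Fin l}
    (hip : Allowed c i p) (hi : c i = blue) (hp : c p = blue) (hj : j = r ∨ j = s) :
    bracketSwap c r s j i * t ⊤ c j p + (t ⊤ c j i + t ⊤ c i p) * bracketSwap c r s j p =
      bracketSwap c r s j p * (t ⊤ c j i + t ⊤ c i p) + t ⊤ c j p * bracketSwap c r s j i := by
  have cj : c j = red := by rcases hj with rfl | rfl <;> assumption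
  have cj' : c (Equiv.swap r s j) = red := by
    rcases hj with rfl | rfl <;> simp <;> assumption
  have aij : Allowed c i j := ⟨ne_of_color hi cj, Or.inl hi⟩
  have apj : Allowed c p j := ⟨ne_of_color hp cj, Or.inl hp⟩
  have aij' : Allowed c i (Equiv.swap r s j) := ⟨ne_of_color hi cj', Or.inl hi⟩
  have apj' : Allowed c p (Equiv.swap r s j) := ⟨ne_of_color hp cj', Or.inl hp⟩
  have sy : ∀ {x y}, Allowed c x y → Allowed c y x := fun h => ⟨h.1.symm, h.2.symm⟩
  rw [bracketSwap, bracketSwap, Equiv.swap_apply_of_ne_of_ne (ne_of_color hi hr) (ne_of_color hi hs),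
    Equiv.swap_apply_of_ne_of_ne (ne_of_color hp hr) (ne_of_color hp hs)]
  -- For `r = s` the exchange is the identity and the brackets vanish; otherwise there are two
  -- distinct poles.
  by_cases hne : Equiv.swap r s j = j
  · rw [hne]; simp
  refine fourTerm_deriv_identity' (t_comm (Ne.symm hne) (sy apj).1 aij'.1 hip.1)
    (t_comm hne (sy apj').1 aij.1 hip.1) ?_ ?_ ?_
  · have := t_fourTerm (k := ⊤) aij hip (sy apj)
    rw [t_symm i j] at this
    exact this
  · have := t_fourTerm (k := ⊤) aij' hip (sy apj')
    rw [t_symm i] at this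
    exact this
  · have := t_fourTerm (k := ⊤) (sy hip) apj' aij'
    rw [t_symm p i, t_symm p, t_symm i (Equiv.swap r s j)] at this
    exact this

/-- At most one of `i`, `j`, `p` is red, so the relation meets the exchanged poles at most once. The
pole at `i` has an argument of its own; those at `j` and at `p` are mirror images. -/
theorem bracketSwap_fourTerm {r s : Fin l} (hr : c r = red) (hs : c s = red) {i j p : Fin l}
    (h1 : Allowed c i j) (h2 : Allowed c i p) (h3 : Allowed c j p) :
    (bracketSwap c r s i j + bracketSwap c r s i p) * t ⊤ c j p +
        (t ⊤ c i j + t ⊤ c i p) * bracketSwap c r s j p =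
      bracketSwap c r s j p * (t ⊤ c i j + t ⊤ c i p) +
        t ⊤ c j p * (bracketSwap c r s i j + bracketSwap c r s i p) := by
  have cases : ∀ x : Fin l, (x = r ∨ x = s) ∨ (x ≠ r ∧ x ≠ s) := fun x => by tauto
  have hred : ∀ x : Fin l, (x = r ∨ x = s) → c x = red := by rintro x (rfl | rfl) <;> assumption
  have hb : ∀ {x y : Fin l}, c x = red → Allowed c x y → c y = blue := by
    rintro x y hx ⟨_, h | h⟩
    · rw [hx] at h; cases h
    · exact h
  have sy : ∀ {x y}, Allowed c x y → Allowed c y x := fun h => ⟨h.1.symm, h.2.symm⟩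
  rcases cases i with hi | hi
  · have cj := hb (hred i hi) h1
    have cp := hb (hred i hi) h2
    have cij := hred i hi
    rw [bracketSwap_of_ne (ne_of_color cj hr) (ne_of_color cj hs) (ne_of_color cp hr)
      (ne_of_color cp hs), mul_zero, zero_mul, add_zero, zero_add]
    have cj' : c (Equiv.swap r s i) = red := by
      rcases hi with rfl | rfl <;> simp <;> assumption
    rw [bracketSwap, bracketSwap,
      Equiv.swap_apply_of_ne_of_ne (ne_of_color cj hr) (ne_of_color cj hs),
      Equiv.swap_apply_of_ne_of_ne (ne_of_color cp hr) (ne_of_color cp hs)]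
    by_cases hne : Equiv.swap r s i = i
    · rw [hne]; simp
    have a1 : Allowed c (Equiv.swap r s i) j := ⟨(ne_of_color cj cj').symm, Or.inr cj⟩
    have a2 : Allowed c (Equiv.swap r s i) p := ⟨(ne_of_color cp cj').symm, Or.inr cp⟩
    exact fourTerm_deriv_identity (t_comm (Ne.symm hne) h2.1 a1.1.symm h3.1)
      (t_comm (Ne.symm hne) h1.1 a2.1.symm h3.1.symm) (t_fourTerm h1 h2 h3) (t_fourTerm a1 a2 h3)
  rcases cases j with hj | hj
  · have ci := hb (hred j hj) (sy h1)
    have cp := hb (hred j hj) h3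
    rw [bracketSwap_of_ne hi.1 hi.2 (ne_of_color cp hr) (ne_of_color cp hs), add_zero,
      bracketSwap_symm r s i j, t_symm i j]
    exact bracketSwap_fourTerm_aux hr hs h2 ci cp hj
  rcases cases p with hp | hp
  · have ci := hb (hred p hp) (sy h2)
    have cj := hb (hred p hp) (sy h3)
    rw [bracketSwap_of_ne hi.1 hi.2 hj.1 hj.2, zero_add, bracketSwap_symm r s i p, t_symm i p,
      bracketSwap_symm r s j p, t_symm j p, add_comm (t ⊤ c i j)]
    exact bracketSwap_fourTerm_aux hr hs h1 ci cj hp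
  · rw [bracketSwap_of_ne hi.1 hi.2 hj.1 hj.2, bracketSwap_of_ne hi.1 hi.2 hp.1 hp.2,
      bracketSwap_of_ne hj.1 hj.2 hp.1 hp.2]
    simp

/-- An element of the dual numbers, given by its components. -/
def dualMk {R : Type*} (a b : R) : TrivSqZeroExt R R := (a, b)

/-- The homomorphism to the dual numbers whose second component is the derivation `redDer`. -/
noncomputable def redDerHom {r s : Fin l} (hr : c r = red) (hs : c s = red) :
    ChordAlg ⊤ c →ₐ[ℚ] TrivSqZeroExt (ChordAlg ⊤ c) (ChordAlg ⊤ c) :=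
  RingQuot.liftAlgHom ℚ ⟨FreeAlgebra.lift ℚ fun p =>
      dualMk (t ⊤ c p.1 p.2) (bracketSwap c r s p.1 p.2), by
    have e : ∀ i j : Fin l, FreeAlgebra.lift ℚ (fun p : Fin l × Fin l =>
        (dualMk (t ⊤ c p.1 p.2) (bracketSwap c r s p.1 p.2) :
          TrivSqZeroExt (ChordAlg ⊤ c) (ChordAlg ⊤ c)))
        (chord i j) = dualMk (t ⊤ c i j) (bracketSwap c r s i j) := fun i j => FreeAlgebra.lift_ι_apply _ _
    intro x y h
    -- In the dual numbers a relation has two components: the relation itself, and its Leibniz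
    -- expansion with `bracketSwap` as the derivative of a chord.
    induction h with
    | notAllowed i j h =>
      rw [e, map_zero, t_notAllowed h, bracketSwap_notAllowed h]; rfl
    | symm i j => rw [e, e, t_symm, bracketSwap_symm]
    | comm i j p q h1 h2 h3 h4 =>
      rw [map_mul, map_mul, e, e]
      refine TrivSqZeroExt.ext ?_ ?_
      · exact t_comm h1 h2 h3 h4
      · have := bracketSwap_comm hr hs h1 h2 h3 h4
        rw [TrivSqZeroExt.snd_mul, TrivSqZeroExt.snd_mul]
        rw [add_comm] at this
        exact this.trans (add_comm _ _)
    | fourTerm i j p h1 h2 h3 =>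
      rw [map_mul, map_mul, map_add, e, e, e]
      refine TrivSqZeroExt.ext ?_ ?_
      · exact t_fourTerm h1 h2 h3
      · have := bracketSwap_fourTerm hr hs h1 h2 h3
        rw [TrivSqZeroExt.snd_mul, TrivSqZeroExt.snd_mul]
        rw [add_comm] at this
        exact this.trans (add_comm _ _)
    | trunc w h => exact absurd h (by simp)⟩

theorem redDerHom_t {r s : Fin l} (hr : c r = red) (hs : c s = red) (i j : Fin l) :
    redDerHom hr hs (t ⊤ c i j) = dualMk (t ⊤ c i j) (bracketSwap c r s i j) := by
  rw [redDerHom, t, RingQuot.liftAlgHom_mkAlgHom_apply]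
  exact FreeAlgebra.lift_ι_apply _ _

theorem fst_redDerHom {r s : Fin l} (hr : c r = red) (hs : c s = red) (x : ChordAlg ⊤ c) :
    (redDerHom hr hs x).fst = x := by
  have : (TrivSqZeroExt.fstHom ℚ (ChordAlg ⊤ c) (ChordAlg ⊤ c)).comp (redDerHom hr hs) =
      AlgHom.id ℚ _ := ChordAlg.hom_ext fun i j => by
    rw [AlgHom.comp_apply, redDerHom_t]; rfl
  exact DFunLike.congr_fun this x

/-- The derivation by which the chord between the red positions `r` and `s` acts. -/
noncomputable def redDer {r s : Fin l} (hr : c r = red) (hs : c s = red) :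
    Module.End ℚ (ChordAlg ⊤ c) :=
  (TrivSqZeroExt.sndHom (ChordAlg ⊤ c) (ChordAlg ⊤ c)).restrictScalars ℚ ∘ₗ (redDerHom hr hs).toLinearMap

theorem redDer_mul {r s : Fin l} (hr : c r = red) (hs : c s = red) (x y : ChordAlg ⊤ c) :
    redDer hr hs (x * y) = x * redDer hr hs y + redDer hr hs x * y := by
  change (redDerHom hr hs (x * y)).snd = _
  rw [map_mul, TrivSqZeroExt.snd_mul, fst_redDerHom, fst_redDerHom]; rfl

theorem redDer_t {r s : Fin l} (hr : c r = red) (hs : c s = red) (i j : Fin l) :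
    redDer hr hs (t ⊤ c i j) = bracketSwap c r s i j := by
  change (redDerHom hr hs _).snd = _
  rw [redDerHom_t]; rfl

end Derivations

/-! ### The mixed diagrams as a retract of the algebra of all chords. -/

section Retraction

variable {l : ℕ} {c : Fin l → Color}

open Color

theorem redDer_algebraMap {r s : Fin l} (hr : c r = red) (hs : c s = red) (q : ℚ) :
    redDer hr hs (algebraMap ℚ _ q) = 0 := by
  have h1 : redDer hr hs (1 : ChordAlg ⊤ c) = 0 := by
    have := redDer_mul hr hs (1 : ChordAlg ⊤ c) 1
    simp only [mul_one, one_mul] at this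
    exact left_eq_add.1 this
  rw [Algebra.algebraMap_eq_smul_one, map_smul, h1, smul_zero]

theorem redDer_sub_mul {r s : Fin l} (hr : c r = red) (hs : c s = red) (x y : ChordAlg ⊤ c) :
    redDer hr hs (x * y - y * x) =
      (redDer hr hs x * y - y * redDer hr hs x) + (x * redDer hr hs y - redDer hr hs y * x) := by
  rw [map_sub, redDer_mul, redDer_mul]; abel

/-- A derivation that vanishes on the chords is zero. -/
theorem derivation_eq_zero {F : Module.End ℚ (ChordAlg ⊤ c)}
    (hmul : ∀ x y, F (x * y) = x * F y + F x * y) (ht : ∀ i j, F (t ⊤ c i j) = 0) : F = 0 := by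
  have h1 : F 1 = 0 := by
    have := hmul 1 1
    simp only [mul_one, one_mul] at this
    exact left_eq_add.1 this
  ext x
  induction x using ChordAlg.induction with
  | scalar r => rw [Algebra.algebraMap_eq_smul_one, map_smul, h1, smul_zero]; rfl
  | gen i j => exact ht i j
  | mul x y hx hy => rw [hmul, hx, hy]; simp
  | add x y hx hy => rw [map_add, hx, hy]; simp

/-- A chord between arbitrary positions acts on the chord diagrams by multiplication, or by a
derivation if both positions are red. -/
noncomputable def redActGen (c : Fin l → Color) (i j : Fin l) : Module.End ℚ (ChordAlg ⊤ c) :=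
  if h : c i = red ∧ c j = red then redDer h.1 h.2 else LinearMap.mulLeft ℚ (t ⊤ c i j)

theorem redActGen_red {i j : Fin l} (h1 : c i = red) (h2 : c j = red) :
    redActGen c i j = redDer h1 h2 := dif_pos ⟨h1, h2⟩

theorem redActGen_not {i j : Fin l} (h : ¬ (c i = red ∧ c j = red)) :
    redActGen c i j = LinearMap.mulLeft ℚ (t ⊤ c i j) := dif_neg h

theorem redActGen_blue {i j : Fin l} (h : c i = blue ∨ c j = blue) :
    redActGen c i j = LinearMap.mulLeft ℚ (t ⊤ c i j) :=
  redActGen_not (by rintro ⟨h1, h2⟩; rcases h with h | h <;> simp_all)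

theorem redDer_comp_mulLeft {r s : Fin l} (hr : c r = red) (hs : c s = red) (x : ChordAlg ⊤ c) :
    redDer hr hs * LinearMap.mulLeft ℚ x =
      LinearMap.mulLeft ℚ x * redDer hr hs + LinearMap.mulLeft ℚ (redDer hr hs x) := by
  ext y
  exact redDer_mul hr hs x y

theorem redDer_symm {r s : Fin l} (hr : c r = red) (hs : c s = red) :
    redDer hr hs = redDer hs hr := by
  rw [← sub_eq_zero]
  refine derivation_eq_zero (fun x y => ?_) fun i j => ?_
  · simp only [LinearMap.sub_apply, redDer_mul]; (simp only [mul_sub, sub_mul, mul_add, add_mul, mul_assoc, neg_mul, mul_neg]; abel)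
  · rw [LinearMap.sub_apply, redDer_t, redDer_t, bracketSwap, bracketSwap, Equiv.swap_comm, sub_self]

/-- A commutator of derivations is a derivation, so it may be tested on chords; a chord with one end
on a strand meets at most one of the two disjoint pairs of poles. -/
theorem redDer_comm {r s p q : Fin l} (hr : c r = red) (hs : c s = red) (hp : c p = red)
    (hq : c q = red) (h1 : r ≠ p) (h2 : r ≠ q) (h3 : s ≠ p) (h4 : s ≠ q) :
    redDer hr hs * redDer hp hq = redDer hp hq * redDer hr hs := by
  rw [← sub_eq_zero]
  refine derivation_eq_zero (fun x y => ?_) ?_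
  · simp only [LinearMap.sub_apply, Module.End.mul_apply, redDer_mul, map_add]; (simp only [mul_sub, sub_mul, mul_add, add_mul, mul_assoc, neg_mul, mul_neg]; abel)
  have key : ∀ i j, c j = blue →
      (redDer hr hs * redDer hp hq - redDer hp hq * redDer hr hs) (t ⊤ c i j) = 0 := by
    intro i j hj
    simp only [LinearMap.sub_apply, Module.End.mul_apply, redDer_t, bracketSwap, redDer_sub_mul,
      Equiv.swap_apply_of_ne_of_ne (ne_of_color hj hr) (ne_of_color hj hs),
      Equiv.swap_apply_of_ne_of_ne (ne_of_color hj hp) (ne_of_color hj hq)]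
    by_cases hi : i = r ∨ i = s
    · have e1 : Equiv.swap p q i = i := Equiv.swap_apply_of_ne_of_ne (by grind) (by grind)
      have e2 : Equiv.swap p q (Equiv.swap r s i) = Equiv.swap r s i := by
        rcases hi with rfl | rfl <;> simp <;> exact Equiv.swap_apply_of_ne_of_ne (by grind) (by grind)
      rw [e1, e2]; (simp only [mul_sub, sub_mul, mul_add, add_mul, mul_assoc, neg_mul, mul_neg]; abel)
    · have e1 : Equiv.swap r s i = i := Equiv.swap_apply_of_ne_of_ne (by grind) (by grind)
      have e2 : Equiv.swap r s (Equiv.swap p q i) = Equiv.swap p q i := by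
        by_cases hi : i = p ∨ i = q
        · rcases hi with rfl | rfl <;> simp <;>
            exact Equiv.swap_apply_of_ne_of_ne (by grind) (by grind)
        · rw [Equiv.swap_apply_of_ne_of_ne (a := p) (by grind) (by grind), e1]
      rw [e1, e2]; (simp only [mul_sub, sub_mul, mul_add, add_mul, mul_assoc, neg_mul, mul_neg]; abel)
  intro i j
  by_cases ha : Allowed c i j
  · rcases ha.2 with h | h
    · rw [t_symm]; exact key j i h
    · exact key i j h
  · rw [t_notAllowed ha, map_zero]

/-- Both sides differ by a derivation. On a chord from a strand to one of the three poles the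
iterated brackets cancel; other chords are killed by all three derivations. -/
theorem redDer_fourTerm {i j p : Fin l} (hi : c i = red) (hj : c j = red) (hp : c p = red)
    (hij : i ≠ j) (hip : i ≠ p) (hjp : j ≠ p) :
    (redDer hi hj + redDer hi hp) * redDer hj hp = redDer hj hp * (redDer hi hj + redDer hi hp) := by
  rw [← sub_eq_zero]
  refine derivation_eq_zero (fun x y => ?_) ?_
  · simp only [LinearMap.sub_apply, LinearMap.add_apply, Module.End.mul_apply, redDer_mul, map_add]
    (simp only [mul_sub, sub_mul, mul_add, add_mul, mul_assoc, neg_mul, mul_neg]; abel)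
  have key : ∀ x y, c y = blue → ((redDer hi hj + redDer hi hp) * redDer hj hp -
      redDer hj hp * (redDer hi hj + redDer hi hp)) (t ⊤ c x y) = 0 := by
    intro x y hy
    simp only [LinearMap.sub_apply, LinearMap.add_apply, Module.End.mul_apply, redDer_t, map_add,
      bracketSwap, redDer_sub_mul,
      Equiv.swap_apply_of_ne_of_ne (ne_of_color hy hi) (ne_of_color hy hj),
      Equiv.swap_apply_of_ne_of_ne (ne_of_color hy hj) (ne_of_color hy hp),
      Equiv.swap_apply_of_ne_of_ne (ne_of_color hy hi) (ne_of_color hy hp)]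
    have e1 : Equiv.swap i j p = p := Equiv.swap_apply_of_ne_of_ne hip.symm hjp.symm
    have e2 : Equiv.swap i p j = j := Equiv.swap_apply_of_ne_of_ne hij.symm hjp
    have e3 : Equiv.swap j p i = i := Equiv.swap_apply_of_ne_of_ne hij hip
    by_cases h1 : x = i
    · subst h1; simp only [Equiv.swap_apply_left, Equiv.swap_apply_right, e1, e2, e3]; (simp only [mul_sub, sub_mul, mul_add, add_mul, mul_assoc, neg_mul, mul_neg]; abel)
    by_cases h2 : x = j
    · subst h2; simp only [Equiv.swap_apply_left, Equiv.swap_apply_right, e1, e2, e3]; (simp only [mul_sub, sub_mul, mul_add, add_mul, mul_assoc, neg_mul, mul_neg]; abel)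
    by_cases h3 : x = p
    · subst h3; simp only [Equiv.swap_apply_left, Equiv.swap_apply_right, e1, e2, e3]; (simp only [mul_sub, sub_mul, mul_add, add_mul, mul_assoc, neg_mul, mul_neg]; abel)
    · simp only [Equiv.swap_apply_of_ne_of_ne h1 h2, Equiv.swap_apply_of_ne_of_ne h1 h3,
        Equiv.swap_apply_of_ne_of_ne h2 h3]
      (simp only [mul_sub, sub_mul, mul_add, add_mul, mul_assoc, neg_mul, mul_neg]; abel)
  intro x y
  by_cases ha : Allowed c x y
  · rcases ha.2 with h | h
    · rw [t_symm]; exact key y x h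
    · exact key x y h
  · rw [t_notAllowed ha, map_zero]

theorem red_or_blue (x : Color) : x = red ∨ x = blue := by cases x <;> simp

theorem mulLeft_add' {R : Type*} [Ring R] [Algebra ℚ R] (x y : R) : LinearMap.mulLeft ℚ (x + y) =
    LinearMap.mulLeft ℚ x + LinearMap.mulLeft ℚ y := by
  ext z; exact add_mul x y z

theorem mulLeft_mul' {R : Type*} [Ring R] [Algebra ℚ R] (x y : R) : LinearMap.mulLeft ℚ (x * y) =
    LinearMap.mulLeft ℚ x * LinearMap.mulLeft ℚ y := by
  ext z; exact mul_assoc x y z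

theorem redActGen_comm {i j p q : Fin l} (h1 : i ≠ p) (h2 : i ≠ q) (h3 : j ≠ p) (h4 : j ≠ q) :
    redActGen c i j * redActGen c p q = redActGen c p q * redActGen c i j := by
  have hD : ∀ {i j p q : Fin l} (h1 : i ≠ p) (h2 : i ≠ q) (h3 : j ≠ p) (h4 : j ≠ q)
      (ha : c i = red ∧ c j = red), redDer ha.1 ha.2 (t ⊤ c p q) = 0 := fun h1 h2 h3 h4 ha => by
    rw [redDer_t, bracketSwap_of_ne h1.symm h3.symm h2.symm h4.symm]
  by_cases ha : c i = red ∧ c j = red <;> by_cases hb : c p = red ∧ c q = red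
  · rw [redActGen_red ha.1 ha.2, redActGen_red hb.1 hb.2]
    exact redDer_comm _ _ _ _ h1 h2 h3 h4
  · rw [redActGen_red ha.1 ha.2, redActGen_not hb, redDer_comp_mulLeft, hD h1 h2 h3 h4 ha]
    simp
  · rw [redActGen_not ha, redActGen_red hb.1 hb.2, redDer_comp_mulLeft,
      hD h1.symm h3.symm h2.symm h4.symm hb]
    simp
  · rw [redActGen_not ha, redActGen_not hb, ← mulLeft_mul', ← mulLeft_mul',
      (t_comm h1 h2 h3 h4).eq]

theorem redActGen_symm (i j : Fin l) : redActGen c i j = redActGen c j i := by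
  by_cases ha : c i = red ∧ c j = red
  · rw [redActGen_red ha.1 ha.2, redActGen_red ha.2 ha.1, redDer_symm]
  · rw [redActGen_not ha, redActGen_not (mt And.symm ha), t_symm]

/-- With three poles this is the relation between derivations, and with at most one pole it holds in
the mixed algebra. With two poles it expresses how a derivation passes a multiplication: `[t_ij,
t_jp] = [t_jp, t_ip]` for poles `i, j`, its mirror image, and the vanishing of the derivation on
`t_ij + t_ip` for poles `j, p`. -/
theorem redActGen_fourTerm {i j p : Fin l} (hij : i ≠ j) (hip : i ≠ p) (hjp : j ≠ p) :
    (redActGen c i j + redActGen c i p) * redActGen c j p =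
      redActGen c j p * (redActGen c i j + redActGen c i p) := by
  rcases red_or_blue (c i) with hi | hi <;> rcases red_or_blue (c j) with hj | hj <;>
    rcases red_or_blue (c p) with hp | hp
  · rw [redActGen_red hi hj, redActGen_red hi hp, redActGen_red hj hp]
    exact redDer_fourTerm hi hj hp hij hip hjp
  · rw [redActGen_red hi hj, redActGen_blue (Or.inr hp), redActGen_blue (Or.inr hp), add_mul, mul_add,
      redDer_comp_mulLeft, redDer_t, bracketSwap, Equiv.swap_apply_right,
      Equiv.swap_apply_of_ne_of_ne hip.symm hjp.symm]
    rw [← mulLeft_mul', ← mulLeft_mul', add_assoc, ← mulLeft_add']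
    congr 2; abel
  · rw [redActGen_red hi hp, redActGen_blue (Or.inr hj), redActGen_blue (Or.inl hj), add_mul, mul_add,
      redDer_comp_mulLeft, redDer_t, bracketSwap, Equiv.swap_apply_right,
      Equiv.swap_apply_of_ne_of_ne hij.symm hjp, ← mulLeft_mul', ← mulLeft_mul',
      add_left_comm, ← mulLeft_add', add_comm, t_symm j i]
    congr 2; abel
  · rw [redActGen_blue (Or.inr hj), redActGen_blue (Or.inr hp), redActGen_blue (Or.inl hj),
      ← mulLeft_add', ← mulLeft_mul', ← mulLeft_mul']
    rw [(t_fourTerm (k := ⊤) ⟨hij, Or.inr hj⟩ ⟨hip, Or.inr hp⟩ ⟨hjp, Or.inr hp⟩).eq]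
  · rw [redActGen_blue (Or.inl hi), redActGen_blue (Or.inl hi), redActGen_red hj hp, mul_add, add_mul,
      redDer_comp_mulLeft, redDer_comp_mulLeft, redDer_t, redDer_t, bracketSwap, bracketSwap,
      Equiv.swap_apply_right, Equiv.swap_apply_left, Equiv.swap_apply_of_ne_of_ne hij hip,
      add_add_add_comm, ← mulLeft_add']
    rw [show ∀ x y : ChordAlg ⊤ c, x - y + (y - x) = 0 by intro x y; abel]
    simp
  · rw [redActGen_blue (Or.inl hi), redActGen_blue (Or.inr hp), redActGen_blue (Or.inr hp),
      ← mulLeft_add', ← mulLeft_mul', ← mulLeft_mul']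
    rw [(t_fourTerm (k := ⊤) ⟨hij, Or.inl hi⟩ ⟨hip, Or.inr hp⟩ ⟨hjp, Or.inr hp⟩).eq]
  · rw [redActGen_blue (Or.inl hi), redActGen_blue (Or.inl hi), redActGen_blue (Or.inl hj),
      ← mulLeft_add', ← mulLeft_mul', ← mulLeft_mul']
    rw [(t_fourTerm (k := ⊤) ⟨hij, Or.inl hi⟩ ⟨hip, Or.inl hi⟩ ⟨hjp, Or.inl hj⟩).eq]
  · rw [redActGen_blue (Or.inl hi), redActGen_blue (Or.inl hi), redActGen_blue (Or.inl hj),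
      ← mulLeft_add', ← mulLeft_mul', ← mulLeft_mul']
    rw [(t_fourTerm (k := ⊤) ⟨hij, Or.inl hi⟩ ⟨hip, Or.inl hi⟩ ⟨hjp, Or.inl hj⟩).eq]

/-- The algebra of chord diagrams in which all strands have the same colour. -/
abbrev BlueAlg (l : ℕ) : Type := ChordAlg ⊤ (fun _ : Fin l => blue)

/-- The action of all chords on the mixed chord diagrams. -/
noncomputable def redAct (c : Fin l → Color) : BlueAlg l →ₐ[ℚ] Module.End ℚ (ChordAlg ⊤ c) :=
  RingQuot.liftAlgHom ℚ ⟨FreeAlgebra.lift ℚ fun p => redActGen c p.1 p.2, by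
    have e : ∀ i j : Fin l, FreeAlgebra.lift ℚ (fun p : Fin l × Fin l => redActGen c p.1 p.2)
        (chord i j) = redActGen c i j := fun i j => FreeAlgebra.lift_ι_apply _ _
    intro x y h
    induction h with
    | notAllowed i j h =>
      have hij : i = j := by
        by_contra hne; exact h ⟨hne, Or.inl rfl⟩
      subst hij
      rw [e, map_zero]
      by_cases hi : c i = red
      · rw [redActGen_red hi hi]
        refine derivation_eq_zero (redDer_mul _ _) fun x y => ?_
        rw [redDer_t, bracketSwap, Equiv.swap_self]; simp
      · rw [redActGen_not (fun h => hi h.1), t_notAllowed fun h => h.1 rfl]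
        ext; simp
    | symm i j => rw [e, e, redActGen_symm]
    | comm i j p q h1 h2 h3 h4 =>
      rw [map_mul, map_mul, e, e]
      exact redActGen_comm h1 h2 h3 h4
    | fourTerm i j p h1 h2 h3 =>
      rw [map_mul, map_mul, map_add, e, e, e]
      exact redActGen_fourTerm h1.1 h2.1 h3.1
    | trunc w h => exact absurd h (by simp)⟩

theorem redAct_t (c : Fin l → Color) (i j : Fin l) : redAct c (tb i j) = redActGen c i j := by
  rw [redAct, tb, t, RingQuot.liftAlgHom_mkAlgHom_apply]
  exact FreeAlgebra.lift_ι_apply _ _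

/-- Forgetting the colours. -/
noncomputable def toBlueAlg (c : Fin l → Color) : ChordAlg ⊤ c →ₐ[ℚ] BlueAlg l :=
  pull ⊤ c (fun _ => blue) some fun _ _ _ _ => rfl

theorem toBlueAlg_t (i j : Fin l) : toBlueAlg c (t ⊤ c i j) =
    if Allowed c i j then tb i j else 0 := by
  rw [toBlueAlg, pull_t, pullGen]
  simp only [Option.some.injEq, Finset.filter_eq', Finset.mem_univ, if_true, Finset.sum_singleton]

theorem toBlueAlg_allowed {i j : Fin l} (h : Allowed c i j) :
    toBlueAlg c (t ⊤ c i j) = tb i j := by rw [toBlueAlg_t, if_pos h]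

/-- No mixed chord acts by a derivation. Evaluating the action at `1` thus recovers the diagram, and
the forgetful map is injective. -/
theorem redAct_toBlueAlg (x : ChordAlg ⊤ c) :
    redAct c (toBlueAlg c x) = LinearMap.mulLeft ℚ x := by
  have : (redAct c).comp (toBlueAlg c) = Algebra.lmul ℚ (ChordAlg ⊤ c) :=
    ChordAlg.hom_ext fun i j => by
      rw [AlgHom.comp_apply, toBlueAlg_t]
      split_ifs with h
      · rw [redAct_t, redActGen_blue h.2]; rfl
      · rw [t_notAllowed h, map_zero, map_zero]
  exact DFunLike.congr_fun this x

/-- A retraction of `toBlueAlg`. -/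
noncomputable def retract (c : Fin l → Color) (y : BlueAlg l) : ChordAlg ⊤ c := redAct c y 1

theorem retract_toBlueAlg (x : ChordAlg ⊤ c) : retract c (toBlueAlg c x) = x := by
  rw [retract, redAct_toBlueAlg]; simp

theorem toBlueAlg_injective : Function.Injective (toBlueAlg c) :=
  Function.LeftInverse.injective retract_toBlueAlg

noncomputable abbrev blueSpace (l : ℕ) : Submodule ℚ (BlueAlg l) := chordSpace ⊤ (fun _ : Fin l => blue)

theorem t_mem_chordSpace {k : ℕ∞} (i j : Fin l) : t k c i j ∈ chordSpace k c :=
  Submodule.subset_span ⟨i, j, rfl⟩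

theorem redDer_mem {r s : Fin l} (hr : c r = red) (hs : c s = red) {d : ℕ} {x : ChordAlg ⊤ c}
    (hx : x ∈ chordSpace ⊤ c ^ d) : redDer hr hs x ∈ chordSpace ⊤ c ^ (d + 1) := by
  induction d generalizing x with
  | zero =>
    rw [pow_zero, Submodule.mem_one] at hx
    obtain ⟨q, rfl⟩ := hx
    rw [redDer_algebraMap]; exact Submodule.zero_mem _
  | succ d ih =>
    rw [pow_succ] at hx
    induction hx using Submodule.mul_induction_on' with
    | add a _ b _ ha hb => rw [map_add]; exact Submodule.add_mem _ ha hb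
    | mem_mul_mem a ha b hb =>
      rw [redDer_mul]
      refine Submodule.add_mem _ ?_ ?_
      · rw [pow_succ, pow_succ, mul_assoc]
        refine Submodule.mul_mem_mul ha ?_
        induction hb using Submodule.span_induction with
        | zero => rw [map_zero]; exact Submodule.zero_mem _
        | add u v _ _ hu hv => rw [map_add]; exact Submodule.add_mem _ hu hv
        | smul q u _ hu => rw [map_smul]; exact Submodule.smul_mem _ _ hu
        | mem u hu =>
          obtain ⟨i, j, rfl⟩ := hu
          rw [redDer_t, bracketSwap]
          exact Submodule.sub_mem _
            (Submodule.mul_mem_mul (t_mem_chordSpace _ _) (t_mem_chordSpace _ _))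
            (Submodule.mul_mem_mul (t_mem_chordSpace _ _) (t_mem_chordSpace _ _))
      · rw [pow_succ _ (d + 1)]
        exact Submodule.mul_mem_mul (ih ha) hb

/-- The derivations raise the degree by one, as multiplication by a chord does. The action is
therefore graded, and so is the retraction. -/
theorem redAct_mem {y : BlueAlg l} {d e : ℕ} (hy : y ∈ blueSpace l ^ d) {x : ChordAlg ⊤ c}
    (hx : x ∈ chordSpace ⊤ c ^ e) : redAct c y x ∈ chordSpace ⊤ c ^ (e + d) := by
  induction d generalizing y e x with
  | zero =>
    rw [pow_zero, Submodule.mem_one] at hy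
    obtain ⟨q, rfl⟩ := hy
    rw [AlgHom.commutes, Module.algebraMap_end_apply]
    exact Submodule.smul_mem _ _ hx
  | succ d ih =>
    rw [pow_succ] at hy
    induction hy using Submodule.mul_induction_on' with
    | add a _ b _ ha hb => rw [map_add]; exact Submodule.add_mem _ ha hb
    | mem_mul_mem a ha b hb =>
      rw [map_mul, Module.End.mul_apply, show e + (d + 1) = e + 1 + d by omega]
      refine ih ha ?_
      induction hb using Submodule.span_induction with
      | zero => rw [map_zero]; exact Submodule.zero_mem _
      | add u v _ _ hu hv => rw [map_add]; exact Submodule.add_mem _ hu hv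
      | smul q u _ hu => rw [map_smul]; exact Submodule.smul_mem _ _ hu
      | mem u hu =>
        obtain ⟨i, j, rfl⟩ := hu
        rw [redAct_t]
        by_cases h : c i = red ∧ c j = red
        · rw [redActGen_red h.1 h.2]; exact redDer_mem _ _ hx
        · rw [redActGen_not h, pow_succ']
          exact Submodule.mul_mem_mul (t_mem_chordSpace _ _) hx

theorem retract_mem {y : BlueAlg l} {d : ℕ} (hy : y ∈ blueSpace l ^ d) :
    retract c y ∈ chordSpace ⊤ c ^ d := by
  have := redAct_mem (c := c) (e := 0) (x := 1) hy (by rw [pow_zero]; exact Submodule.one_le.1 le_rfl)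
  rwa [zero_add] at this

/-! ### Lie elements -/

attribute [local instance 100] LieRing.ofAssociativeRing
attribute [local instance 100] LieAlgebra.ofAssociativeAlgebra

/-- The Lie algebra of mixed chord diagrams. -/
noncomputable def mixedLie (c : Fin l → Color) : LieSubalgebra ℚ (ChordAlg ⊤ c) :=
  LieSubalgebra.lieSpan ℚ _ (chordSpace ⊤ c : Set (ChordAlg ⊤ c))

/-- Once chords between poles are available the derivation is inner: the four-term relation gives
`[t_rs, t_rj] = [t_rj, t_sj]`, which is where `bracketSwap` comes from. -/
theorem chord_bracket_toBlueAlg {r s : Fin l} (hr : c r = red) (hs : c s = red) (hrs : r ≠ s)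
    (x : ChordAlg ⊤ c) :
    tb r s * toBlueAlg c x - toBlueAlg c x * tb r s = toBlueAlg c (redDer hr hs x) := by
  induction x using ChordAlg.induction with
  | scalar q =>
    rw [redDer_algebraMap, map_zero, AlgHom.commutes, (Algebra.commutes q (tb r s)).symm, sub_self]
  | mul x y hx hy =>
    rw [redDer_mul, map_add, map_mul, map_mul, map_mul, ← hx, ← hy]; (simp only [mul_sub, sub_mul, mul_add, add_mul, mul_assoc, neg_mul, mul_neg]; abel)
  | add x y hx hy => rw [map_add, map_add, map_add, ← hx, ← hy]; (simp only [mul_sub, sub_mul, mul_add, add_mul, mul_assoc, neg_mul, mul_neg]; abel)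
  | gen i j =>
    have key : ∀ i j, Allowed c i j → c j = blue →
        tb r s * toBlueAlg c (t ⊤ c i j) - toBlueAlg c (t ⊤ c i j) * tb r s =
          toBlueAlg c (redDer hr hs (t ⊤ c i j)) := by
      intro i j ha hj
      have jr := ne_of_color hj hr
      have js := ne_of_color hj hs
      rw [redDer_t]
      by_cases hi : i = r ∨ i = s
      · have ci : c (Equiv.swap r s i) = red := by rcases hi with rfl | rfl <;> simp <;> assumption
        have ha' : Allowed c (Equiv.swap r s i) j := ⟨(ne_of_color hj ci).symm, Or.inr hj⟩
        rw [bracketSwap, Equiv.swap_apply_of_ne_of_ne jr js, map_sub, map_mul, map_mul,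
          toBlueAlg_allowed ha, toBlueAlg_allowed ha']
        have hne : Equiv.swap r s i ≠ i := by rcases hi with rfl | rfl <;> simp [hrs, hrs.symm]
        have f : Commute (tb (Equiv.swap r s i) i + tb (Equiv.swap r s i) j) (tb i j) :=
          t_fourTerm ⟨hne, Or.inl rfl⟩ ⟨ha'.1, Or.inl rfl⟩ ⟨ha.1, Or.inl rfl⟩
        have e : tb (Equiv.swap r s i) i = tb r s := by
          rcases hi with rfl | rfl
          · rw [Equiv.swap_apply_left]; exact t_symm _ _
          · rw [Equiv.swap_apply_right]
        rw [e] at f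
        have := f.eq
        rw [add_mul, mul_add] at this
        rw [sub_eq_sub_iff_add_eq_add, this]; abel
      · push Not at hi
        rw [bracketSwap_of_ne hi.1 hi.2 jr js, map_zero, toBlueAlg_allowed ha, sub_eq_zero]
        exact (t_comm hi.1.symm jr.symm hi.2.symm js.symm).eq
    by_cases ha : Allowed c i j
    · rcases ha.2 with h | h
      · rw [t_symm]; exact key j i ⟨ha.1.symm, ha.2.symm⟩ h
      · exact key i j ha h
    · rw [t_notAllowed ha]; simp

theorem redDer_mem_mixedLie {r s : Fin l} (hr : c r = red) (hs : c s = red) {x : ChordAlg ⊤ c}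
    (hx : x ∈ mixedLie c) : redDer hr hs x ∈ mixedLie c := by
  induction hx using LieSubalgebra.lieSpan_induction with
  | zero => rw [map_zero]; exact zero_mem _
  | add u v _ _ hu hv => rw [map_add]; exact add_mem hu hv
  | smul q u _ hu => rw [map_smul]; exact (mixedLie c).smul_mem _ hu
  | lie u v hu hv hu' hv' =>
    change redDer hr hs (u * v - v * u) ∈ _
    rw [redDer_sub_mul]
    exact add_mem ((mixedLie c).lie_mem hu' hv) ((mixedLie c).lie_mem hu hv')
  | mem u hu =>
    induction hu using Submodule.span_induction with
    | zero => rw [map_zero]; exact zero_mem _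
    | add u v _ _ hu hv => rw [map_add]; exact add_mem hu hv
    | smul q u _ hu => rw [map_smul]; exact (mixedLie c).smul_mem _ hu
    | mem u hu =>
      obtain ⟨i, j, rfl⟩ := hu
      rw [redDer_t]
      exact (mixedLie c).lie_mem (LieSubalgebra.subset_lieSpan (t_mem_chordSpace _ _))
        (LieSubalgebra.subset_lieSpan (t_mem_chordSpace _ _))

/-- The Lie algebra generated by the chords between red positions. -/
noncomputable def redLie (c : Fin l → Color) : LieSubalgebra ℚ (BlueAlg l) :=
  LieSubalgebra.lieSpan ℚ _ {x | ∃ r s, c r = red ∧ c s = red ∧ r ≠ s ∧ tb r s = x}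

/-- The mixed Lie algebra is normalised by the chords between poles, which act on it through
`redDer`, and then by their iterated brackets through the Jacobi identity. -/
theorem redLie_bracket {x : BlueAlg l} (hx : x ∈ redLie c) : ∀ a ∈ mixedLie c, ∃ b ∈ mixedLie c,
    ⁅x, toBlueAlg c a⁆ = toBlueAlg c b := by
  induction hx using LieSubalgebra.lieSpan_induction with
  | mem x hx =>
    obtain ⟨r, s, hr, hs, hrs, rfl⟩ := hx
    exact fun a ha => ⟨_, redDer_mem_mixedLie hr hs ha, chord_bracket_toBlueAlg hr hs hrs a⟩
  | zero => exact fun a _ => ⟨0, zero_mem _, by rw [zero_lie, map_zero]⟩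
  | add x y _ _ hx hy =>
    intro a ha
    obtain ⟨b, hb, e⟩ := hx a ha
    obtain ⟨b', hb', e'⟩ := hy a ha
    exact ⟨b + b', add_mem hb hb', by rw [add_lie, e, e', map_add]⟩
  | smul q x _ hx =>
    intro a ha
    obtain ⟨b, hb, e⟩ := hx a ha
    exact ⟨q • b, (mixedLie c).smul_mem _ hb, by rw [smul_lie, e, map_smul]⟩
  | lie x y _ _ hx hy =>
    intro a ha
    obtain ⟨b, hb, e⟩ := hx a ha
    obtain ⟨b', hb', e'⟩ := hy a ha
    obtain ⟨d, hd, f⟩ := hx b' hb'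
    obtain ⟨d', hd', f'⟩ := hy b hb
    exact ⟨d - d', sub_mem hd hd', by rw [lie_lie, e', f, e, f', map_sub]⟩

/-- Every Lie element is the sum of a mixed one and of one in the chords between red positions. -/
theorem exists_mixedLie_add_redLie {x : BlueAlg l}
    (hx : x ∈ LieSubalgebra.lieSpan ℚ (BlueAlg l) (blueSpace l : Set (BlueAlg l))) :
    ∃ a ∈ mixedLie c, ∃ b ∈ redLie c, x = toBlueAlg c a + b := by
  induction hx using LieSubalgebra.lieSpan_induction with
  | zero => exact ⟨0, zero_mem _, 0, zero_mem _, by rw [map_zero, add_zero]⟩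
  | add x y _ _ hx hy =>
    obtain ⟨a, ha, b, hb, rfl⟩ := hx
    obtain ⟨a', ha', b', hb', rfl⟩ := hy
    exact ⟨a + a', add_mem ha ha', b + b', add_mem hb hb', by rw [map_add]; abel⟩
  | smul q x _ hx =>
    obtain ⟨a, ha, b, hb, rfl⟩ := hx
    exact ⟨q • a, (mixedLie c).smul_mem _ ha, q • b, (redLie c).smul_mem _ hb,
      by rw [map_smul, smul_add]⟩
  | lie x y _ _ hx hy =>
    obtain ⟨a, ha, b, hb, rfl⟩ := hx
    obtain ⟨a', ha', b', hb', rfl⟩ := hy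
    -- Brackets of a mixed with a red summand are mixed again, so only `⁅b, b'⁆` contributes to the
    -- red part.
    obtain ⟨d, hd, e⟩ := redLie_bracket hb a' ha'
    obtain ⟨d', hd', e'⟩ := redLie_bracket hb' a ha
    refine ⟨⁅a, a'⁆ - d' + d, add_mem (sub_mem ((mixedLie c).lie_mem ha ha') hd') hd, ⁅b, b'⁆,
      (redLie c).lie_mem hb hb', ?_⟩
    have e1 : ⁅toBlueAlg c a, toBlueAlg c a'⁆ = toBlueAlg c ⁅a, a'⁆ := by
      change _ = toBlueAlg c (a * a' - a' * a)
      rw [map_sub, map_mul, map_mul]; rfl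
    rw [add_lie, lie_add, lie_add, e1, e, ← lie_skew (toBlueAlg c a), e', map_add, map_sub]
    abel
  | mem x hx =>
    induction hx using Submodule.span_induction with
    | zero => exact ⟨0, zero_mem _, 0, zero_mem _, by rw [map_zero, add_zero]⟩
    | add x y _ _ hx hy =>
      obtain ⟨a, ha, b, hb, rfl⟩ := hx
      obtain ⟨a', ha', b', hb', rfl⟩ := hy
      exact ⟨a + a', add_mem ha ha', b + b', add_mem hb hb', by rw [map_add]; abel⟩
    | smul q x _ hx =>
      obtain ⟨a, ha, b, hb, rfl⟩ := hx
      exact ⟨q • a, (mixedLie c).smul_mem _ ha, q • b, (redLie c).smul_mem _ hb,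
        by rw [map_smul, smul_add]⟩
    | mem x hx =>
      obtain ⟨i, j, rfl⟩ := hx
      by_cases hij : i = j
      · exact ⟨0, zero_mem _, 0, zero_mem _, by
          rw [map_zero, add_zero, t_notAllowed fun h => h.1 hij]⟩
      by_cases h : c i = red ∧ c j = red
      · exact ⟨0, zero_mem _, tb i j, LieSubalgebra.subset_lieSpan ⟨i, j, h.1, h.2, hij, rfl⟩,
          by rw [map_zero, zero_add]⟩
      · refine ⟨t ⊤ c i j, LieSubalgebra.subset_lieSpan (t_mem_chordSpace _ _), 0, zero_mem _, ?_⟩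
        rw [add_zero, toBlueAlg_allowed]
        refine ⟨hij, ?_⟩
        rcases red_or_blue (c i) with hi | hi
        · exact Or.inr ((red_or_blue (c j)).resolve_left fun hj => h ⟨hi, hj⟩)
        · exact Or.inl hi

/-- The removal of all chords that end on a blue position. -/
noncomputable def dropBlue (c : Fin l → Color) : BlueAlg l →ₐ[ℚ] BlueAlg l :=
  pull ⊤ _ _ (fun x => if c x = red then some x else none) fun _ _ _ _ => rfl

theorem dropBlue_red {r s : Fin l} (hr : c r = red) (hs : c s = red) :
    dropBlue c (tb r s) = tb r s := by
  rw [dropBlue, pull_t, pullGen]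
  have e : ∀ i, c i = red → (Finset.univ.filter fun x =>
      (if c x = red then some x else none) = some i) = {i} := by
    intro i hi; ext x
    simp only [Finset.mem_filter, Finset.mem_univ, true_and, Finset.mem_singleton]
    split_ifs with h
    · simp
    · simp; rintro rfl; exact h hi
  rw [e r hr, e s hs]
  simp only [Finset.sum_singleton]
  split_ifs with h
  · rfl
  · exact (t_notAllowed h).symm

theorem dropBlue_blue {r s : Fin l} (h : c r = blue ∨ c s = blue) :
    dropBlue c (tb r s) = 0 := by
  rw [dropBlue, pull_t, pullGen]
  have e : ∀ i, c i = blue → (Finset.univ.filter fun x =>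
      (if c x = red then some x else none) = some i) = ∅ := by
    intro i hi; ext x
    simp only [Finset.mem_filter, Finset.mem_univ, true_and, Finset.notMem_empty, iff_false]
    split_ifs with h
    · simp; rintro rfl; rw [hi] at h; cases h
    · simp
  split_ifs
  · rcases h with h | h
    · rw [e r h]; simp
    · rw [e s h]; simp
  · rfl

theorem dropBlue_toBlueAlg {a : ChordAlg ⊤ c} (ha : a ∈ mixedLie c) :
    dropBlue c (toBlueAlg c a) = 0 := by
  induction ha using LieSubalgebra.lieSpan_induction with
  | zero => rw [map_zero, map_zero]
  | add u v _ _ hu hv => rw [map_add, map_add, hu, hv, add_zero]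
  | smul q u _ hu => rw [map_smul, map_smul, hu, smul_zero]
  | lie u v _ _ hu hv =>
    change dropBlue c (toBlueAlg c (u * v - v * u)) = 0
    simp only [map_sub, map_mul, hu, hv, mul_zero, sub_self]
  | mem u hu =>
    induction hu using Submodule.span_induction with
    | zero => rw [map_zero, map_zero]
    | add u v _ _ hu hv => rw [map_add, map_add, hu, hv, add_zero]
    | smul q u _ hu => rw [map_smul, map_smul, hu, smul_zero]
    | mem u hu =>
      obtain ⟨i, j, rfl⟩ := hu
      rw [toBlueAlg_t]
      split_ifs with h
      · exact dropBlue_blue h.2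
      · rw [map_zero]

theorem dropBlue_redLie {b : BlueAlg l} (hb : b ∈ redLie c) : dropBlue c b = b := by
  induction hb using LieSubalgebra.lieSpan_induction with
  | zero => rw [map_zero]
  | add u v _ _ hu hv => rw [map_add, hu, hv]
  | smul q u _ hu => rw [map_smul, hu]
  | lie u v _ _ hu hv =>
    change dropBlue c (u * v - v * u) = u * v - v * u
    rw [map_sub, map_mul, map_mul, hu, hv]
  | mem u hu =>
    obtain ⟨r, s, hr, hs, _, rfl⟩ := hu
    exact dropBlue_red hr hs

/-- Dropping the chords at blue positions kills the mixed summand and fixes the other, which must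
then vanish. The decomposition does not keep track of degrees; homogeneity is recovered from the
graded retraction. -/
theorem exists_mixedLie {x : BlueAlg l} {d : ℕ} (hx : x ∈ lieDeg (blueSpace l) d)
    (h0 : dropBlue c x = 0) : ∃ a ∈ lieDeg (chordSpace ⊤ c) d, toBlueAlg c a = x := by
  obtain ⟨a, ha, b, hb, e⟩ := exists_mixedLie_add_redLie (c := c) hx.2
  rw [e, map_add, dropBlue_toBlueAlg ha, dropBlue_redLie hb, zero_add] at h0
  rw [h0, add_zero] at e
  refine ⟨a, ⟨?_, ha⟩, e.symm⟩
  rw [← retract_toBlueAlg a, ← e]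
  exact retract_mem hx.1

open PowerSeries

/-- The exponential of a Lie series is the exponential of a mixed Lie series if it becomes trivial when the
chords that end on blue positions are removed. -/
theorem exists_mixed_lieSeries {g : (BlueAlg l)⟦X⟧ˣ} (hg : g ∈ lieGroup (blueSpace l))
    (h : PowerSeries.map (dropBlue c).toRingHom (g : (BlueAlg l)⟦X⟧) = 1) :
    ∃ u, IsLieSeries (chordSpace ⊤ c) u ∧
      PowerSeries.map (toBlueAlg c).toRingHom (expSeries u) = (g : (BlueAlg l)⟦X⟧) := by
  obtain ⟨v, hv, e⟩ := hg
  rw [isLieSeries_iff] at hv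
  rw [e, map_expSeries] at h
  -- The exponential commutes with the removal of chords and is injective, so the logarithm itself
  -- vanishes after the removal.
  have h0 : PowerSeries.map (dropBlue c).toRingHom v = 0 := by
    refine expSeries_injective ?_ (map_zero _) (h.trans expSeries_zero.symm)
    rw [coeff_map, hv.1, map_zero]
  have h0' : ∀ d, dropBlue c (coeff d v) = 0 := fun d => by
    have := congrArg (coeff d) h0
    rwa [coeff_map, map_zero] at this
  choose a ha ea using fun d => exists_mixedLie (hv.2 d) (h0' d)
  refine ⟨PowerSeries.mk a, isLieSeries_iff.2 ⟨?_, fun d => ?_⟩, ?_⟩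
  · rw [coeff_mk]
    apply toBlueAlg_injective
    rw [ea, hv.1, map_zero]
  · rw [coeff_mk]; exact ha d
  · rw [map_expSeries, e]
    congr 1
    ext d
    rw [coeff_map, coeff_mk]; exact ea d

end Retraction

section

open Color PowerSeries

/-! ### Evaluation of associators. -/

section EvalAt

variable {A B : Type*} [Ring A] [Algebra ℚ A] [Ring B] [Algebra ℚ B]

theorem lift_comp (f : A →ₐ[ℚ] B) (a b : A) :
    f.comp (FreeAlgebra.lift ℚ ![a, b]) = FreeAlgebra.lift ℚ ![f a, f b] :=
  FreeAlgebra.hom_ext (funext fun i => by fin_cases i <;> simp)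

theorem map_evalAt (f : A →ₐ[ℚ] B) (φ : (FreeAlgebra ℚ (Fin 2))⟦X⟧) (a b : A) :
    PowerSeries.map f.toRingHom (evalAt φ a b) = evalAt φ (f a) (f b) := by
  ext d
  rw [evalAt, evalAt, coeff_map, coeff_map, coeff_map, ← lift_comp]; rfl

theorem evalAt_expSeries (φ : (FreeAlgebra ℚ (Fin 2))⟦X⟧) (a b : A) :
    evalAt (expSeries φ) a b = expSeries (evalAt φ a b) := map_expSeries _ _

theorem coeff_zero_evalAt {φ : (FreeAlgebra ℚ (Fin 2))⟦X⟧} (h : coeff 0 φ = 0) (a b : A) :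
    coeff 0 (evalAt φ a b) = 0 := by rw [evalAt, coeff_map, h, map_zero]

theorem commute_coeff_evalAt (φ : (FreeAlgebra ℚ (Fin 2))⟦X⟧) {a b p : A} (ha : Commute p a)
    (hb : Commute p b) (d : ℕ) : Commute p (coeff d (evalAt φ a b)) := by
  rw [evalAt, coeff_map]
  generalize coeff d φ = z
  change Commute p (FreeAlgebra.lift ℚ ![a, b] z)
  induction z using FreeAlgebra.induction with
  | grade0 r => rw [AlgHom.commutes]; exact (Algebra.commutes r p).symm
  | grade1 i => rw [FreeAlgebra.lift_ι_apply]; fin_cases i <;> assumption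
  | mul x y hx hy => rw [map_mul]; exact hx.mul_right hy
  | add x y hx hy => rw [map_add]; exact hx.add_right hy

theorem commute_of_coeff {f g : A⟦X⟧} (h : ∀ d e, Commute (coeff d f) (coeff e g)) :
    Commute f g := by
  refine PowerSeries.ext fun d => ?_
  rw [coeff_mul, coeff_mul, ← Finset.Nat.sum_antidiagonal_swap]
  exact Finset.sum_congr rfl fun p _ => h _ _

theorem commute_coeff_expSeries {p : A} {u : A⟦X⟧} (h : ∀ d, Commute p (coeff d u)) (d : ℕ) :
    Commute p (coeff d (expSeries u)) := by
  rw [expSeries, coeff_mk]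
  suffices key : ∀ n d, Commute p (coeff d (u ^ n)) from
    Commute.sum_right _ _ _ fun n _ => Commute.smul_right (key n d) _
  intro n
  induction n with
  | zero =>
    intro d
    rw [pow_zero, coeff_one]
    split_ifs
    · exact Commute.one_right p
    · exact Commute.zero_right p
  | succ n ih =>
    intro d
    rw [pow_succ, coeff_mul]
    exact Commute.sum_right _ _ _ fun x _ => (ih _).mul_right (h _)

end EvalAt

section

attribute [local instance 100] LieRing.ofAssociativeRing
attribute [local instance 100] LieAlgebra.ofAssociativeAlgebra

theorem IsLieSeries.map {A B : Type*} [Ring A] [Algebra ℚ A] [Ring B] [Algebra ℚ B]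
    {V : Submodule ℚ A} {W : Submodule ℚ B} {u : A⟦X⟧} (hu : IsLieSeries V u) (f : A →ₐ[ℚ] B)
    (hf : V.map f.toLinearMap ≤ W) : IsLieSeries W (PowerSeries.map f.toRingHom u) := by
  refine ⟨fun d => ?_, ?_, fun d => ?_⟩
  · rw [coeff_map]
    have := Submodule.mem_map_of_mem (f := f.toLinearMap) (hu.1 d)
    rw [Submodule.map_pow] at this
    exact pow_le_pow_left' hf d this
  · rw [coeff_map, hu.2.1, map_zero]
  · rw [coeff_map]
    change f (coeff d u) ∈ _
    have h := hu.2.2 d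
    generalize coeff d u = z at h ⊢
    induction h using LieSubalgebra.lieSpan_induction with
    | zero => rw [map_zero]; exact zero_mem _
    | add u v _ _ hu hv => rw [map_add]; exact add_mem hu hv
    | smul q u _ hu => rw [map_smul]; exact (LieSubalgebra.lieSpan ℚ B (W : Set B)).smul_mem _ hu
    | lie u w _ _ hu hw =>
      change f (u * w - w * u) ∈ _
      rw [map_sub, map_mul, map_mul]
      exact LieSubalgebra.lie_mem _ hu hw
    | mem u hu => exact LieSubalgebra.subset_lieSpan (hf (Submodule.mem_map_of_mem hu))

end

/-- A Drinfeld associator together with its logarithm. -/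
structure Associator where
  log : (FreeAlgebra ℚ (Fin 2))⟦X⟧
  lie : IsLieSeries (Submodule.span ℚ (Set.range (FreeAlgebra.ι ℚ))) log
  isAssociator : IsAssociator (expSeries log)

section Character

/-- Chords may be sent to arbitrary scalars with a symmetric choice that vanishes for `i = j`,
because the other relations are trivial in a commutative ring. The character reads off the
coefficient of one chord in a linear term. -/
theorem exists_character {n : ℕ} {a b : Fin n} (hab : a ≠ b) : ∃ χ : BlueAlg n →ₐ[ℚ] ℚ,
    ∀ i j, χ (tb i j) = if (i = a ∧ j = b) ∨ (i = b ∧ j = a) then 1 else 0 := by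
  have e : ∀ i j : Fin n, FreeAlgebra.lift ℚ (fun p : Fin n × Fin n =>
      if (p.1 = a ∧ p.2 = b) ∨ (p.1 = b ∧ p.2 = a) then (1 : ℚ) else 0) (chord i j) =
      if (i = a ∧ j = b) ∨ (i = b ∧ j = a) then (1 : ℚ) else 0 :=
    fun i j => FreeAlgebra.lift_ι_apply _ _
  refine ⟨RingQuot.liftAlgHom ℚ ⟨FreeAlgebra.lift ℚ fun p =>
    if (p.1 = a ∧ p.2 = b) ∨ (p.1 = b ∧ p.2 = a) then 1 else 0, ?_⟩, fun i j => ?_⟩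
  · intro x y h
    induction h with
    | notAllowed i j h =>
      have : i = j := by by_contra hne; exact h ⟨hne, Or.inl rfl⟩
      subst this
      rw [e, map_zero, if_neg]
      rintro (⟨h1, h2⟩ | ⟨h1, h2⟩)
      · exact hab (h1.symm.trans h2)
      · exact hab (h2.symm.trans h1)
    | symm i j =>
      rw [e, e]
      congr 1
      rw [eq_iff_iff]; tauto
    | comm => rw [map_mul, map_mul, mul_comm]
    | fourTerm => rw [map_mul, map_mul, mul_comm]
    | trunc w h => exact absurd h (by simp)
  · rw [tb, t, RingQuot.liftAlgHom_mkAlgHom_apply]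
    exact e i j

end Character

namespace Associator

attribute [local instance 100] LieRing.ofAssociativeRing
attribute [local instance 100] LieAlgebra.ofAssociativeAlgebra

variable (Φ : Associator)

section

variable {A : Type*} [Ring A] [Algebra ℚ A]

/-- The value of an associator at two elements, as a unit. -/
noncomputable def val (a b : A) : A⟦X⟧ˣ :=
  expUnit (evalAt Φ.log a b) (coeff_zero_evalAt Φ.lie.2.1 a b)

theorem coe_val (a b : A) : (Φ.val a b : A⟦X⟧) = evalAt (expSeries Φ.log) a b :=
  (evalAt_expSeries _ _ _).symm

end

theorem coeff_one_expSeries {A : Type*} [Ring A] [Algebra ℚ A] (u : A⟦X⟧) :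
    coeff 1 (expSeries u) = coeff 1 u := by
  rw [expSeries, coeff_mk]; simp [Finset.sum_range_succ, coeff_one]

theorem coeff_one_mul {A : Type*} [Ring A] {f g : A⟦X⟧} (hf : coeff 0 f = 1) (hg : coeff 0 g = 1) :
    coeff 1 (f * g) = coeff 1 f + coeff 1 g := by
  rw [coeff_mul, Finset.Nat.antidiagonal_succ]
  simp [hf, hg, add_comm]

theorem coeff_zero_mul {A : Type*} [Ring A] {f g : A⟦X⟧} (hf : coeff 0 f = 1) (hg : coeff 0 g = 1) :
    coeff 0 (f * g) = 1 := by
  rw [coeff_mul, Finset.Nat.antidiagonal_zero]; simp [hf, hg]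

/-- An associator has no linear term. -/
theorem coeff_one_log : coeff 1 Φ.log = 0 := by
  have h1 := Φ.lie.1 1
  rw [pow_one] at h1
  have hr : Set.range (FreeAlgebra.ι ℚ : Fin 2 → _) =
      {FreeAlgebra.ι ℚ (0 : Fin 2), FreeAlgebra.ι ℚ 1} := by
    ext x; simp [Fin.exists_fin_two, eq_comm]
  rw [hr, Submodule.mem_span_pair] at h1
  obtain ⟨α, β, h1⟩ := h1
  have hv : ∀ {A : Type} [Ring A] [Algebra ℚ A] (a b : A),
      coeff 1 (evalAt (expSeries Φ.log) a b) = α • a + β • b := by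
    intro A _ _ a b
    rw [evalAt_expSeries, coeff_one_expSeries, evalAt, coeff_map, ← h1]
    change FreeAlgebra.lift ℚ ![a, b] _ = _
    simp
  have h0 : ∀ {A : Type} [Ring A] [Algebra ℚ A] (a b : A),
      coeff 0 (evalAt (expSeries Φ.log) a b) = 1 := by
    intro A _ _ a b
    rw [evalAt_expSeries, coeff_zero_expSeries]
  have hp := congrArg (coeff 1) Φ.isAssociator.pentagon
  rw [coeff_one_mul (coeff_zero_mul (h0 _ _) (h0 _ _)) (h0 _ _), coeff_one_mul (h0 _ _) (h0 _ _),
    coeff_one_mul (h0 _ _) (h0 _ _), hv, hv, hv, hv, hv] at hp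
  -- In degree one the pentagon reduces to `α t₀₁ + β t₂₃ = 0`; the characters belonging to these
  -- two chords give `α = 0` and `β = 0`.
  obtain ⟨χ, hχ⟩ := exists_character (n := 4) (a := 0) (b := 1) (by decide)
  obtain ⟨ψ, hψ⟩ := exists_character (n := 4) (a := 2) (b := 3) (by decide)
  have e1 := congrArg χ hp
  have e2 := congrArg ψ hp
  simp only [map_add, map_smul, hχ, hψ] at e1 e2
  simp at e1 e2
  rw [← h1, e1, e2]; simp

/-- With one argument equal to zero the evaluation factors through the commutative ring ℚ[X].
Brackets die there, leaving multiples of `X`, whereas homogeneity leaves multiples of `X ^ d`; only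
the linear term could survive, and an associator has none. Hence Φ(a,0) = Φ(0,b) = 1, which makes
empty bundles invisible. -/
theorem evalAt_log_eq_zero {A : Type*} [Ring A] [Algebra ℚ A] {v : Fin 2 → Polynomial ℚ}
    (hv : v = ![0, Polynomial.X] ∨ v = ![Polynomial.X, 0]) (a : A) :
    PowerSeries.map ((Polynomial.aeval a).comp (FreeAlgebra.lift ℚ v)).toRingHom Φ.log = 0 := by
  ext d
  rw [coeff_map, map_zero]
  change Polynomial.aeval a (FreeAlgebra.lift ℚ v (coeff d Φ.log)) = 0
  have hvi : ∀ i, v i ∈ Submodule.span ℚ {(Polynomial.X : Polynomial ℚ)} := by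
    intro i
    rcases hv with rfl | rfl <;> fin_cases i <;> simp [Submodule.mem_span_singleton_self]
  have hspan : (Submodule.span ℚ (Set.range (FreeAlgebra.ι ℚ : Fin 2 → _))).map
      (FreeAlgebra.lift ℚ v).toLinearMap ≤ Submodule.span ℚ {Polynomial.X} := by
    rw [Submodule.map_span, Submodule.span_le]
    rintro _ ⟨_, ⟨i, rfl⟩, rfl⟩
    change FreeAlgebra.lift ℚ v (FreeAlgebra.ι ℚ i) ∈ _
    rw [FreeAlgebra.lift_ι_apply]; exact hvi i
  have h1 : FreeAlgebra.lift ℚ v (coeff d Φ.log) ∈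
      Submodule.span ℚ {(Polynomial.X : Polynomial ℚ)} := by
    have h := Φ.lie.2.2 d
    generalize coeff d Φ.log = z at h ⊢
    induction h using LieSubalgebra.lieSpan_induction with
    | zero => rw [map_zero]; exact Submodule.zero_mem _
    | add u v _ _ hu hv => rw [map_add]; exact Submodule.add_mem _ hu hv
    | smul q u _ hu => rw [map_smul]; exact Submodule.smul_mem _ _ hu
    | lie u w _ _ _ _ =>
      have : FreeAlgebra.lift ℚ v (u * w - w * u) = 0 := by
        rw [map_sub, map_mul, map_mul, mul_comm, sub_self]
      change FreeAlgebra.lift ℚ v (u * w - w * u) ∈ _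
      rw [this]; exact Submodule.zero_mem _
    | mem u hu => exact hspan (Submodule.mem_map_of_mem hu)
  have h2 : FreeAlgebra.lift ℚ v (coeff d Φ.log) ∈
      Submodule.span ℚ {(Polynomial.X : Polynomial ℚ) ^ d} := by
    have := Submodule.mem_map_of_mem (f := (FreeAlgebra.lift ℚ v).toLinearMap) (Φ.lie.1 d)
    rw [Submodule.map_pow] at this
    have h := pow_le_pow_left' hspan d this
    rwa [Submodule.span_pow, Set.singleton_pow] at h
  rcases eq_or_ne d 1 with rfl | hd
  · rw [coeff_one_log, map_zero, map_zero]
  obtain ⟨p, hp⟩ := Submodule.mem_span_singleton.1 h1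
  obtain ⟨q, hq⟩ := Submodule.mem_span_singleton.1 h2
  have : p = 0 := by
    have := congrArg (fun z => Polynomial.coeff z 1) (hp.trans hq.symm)
    simpa [Polynomial.coeff_X_pow, hd.symm] using this
  rw [← hp, this]; simp

variable {A : Type*} [Ring A] [Algebra ℚ A]

theorem val_zero_left (b : A) : Φ.val 0 b = 1 := by
  have h := Φ.evalAt_log_eq_zero (v := ![0, Polynomial.X]) (Or.inl rfl) b
  rw [lift_comp_vec] at h
  refine Units.ext ?_
  change expSeries (evalAt Φ.log 0 b) = 1
  rw [evalAt, h, expSeries_zero]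
where
  lift_comp_vec : (Polynomial.aeval b).comp (FreeAlgebra.lift ℚ ![0, Polynomial.X]) =
      FreeAlgebra.lift ℚ ![0, b] := by rw [lift_comp]; simp

theorem val_zero_right (a : A) : Φ.val a 0 = 1 := by
  have h := Φ.evalAt_log_eq_zero (v := ![Polynomial.X, 0]) (Or.inr rfl) a
  have e : (Polynomial.aeval a).comp (FreeAlgebra.lift ℚ ![Polynomial.X, 0]) =
      FreeAlgebra.lift ℚ ![a, 0] := by rw [lift_comp]; simp
  rw [e] at h
  refine Units.ext ?_
  change expSeries (evalAt Φ.log a 0) = 1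
  rw [evalAt, h, expSeries_zero]

theorem val_mem_lieGroup {V : Submodule ℚ A} {a b : A} (ha : a ∈ V) (hb : b ∈ V) :
    Φ.val a b ∈ lieGroup V := by
  refine ⟨evalAt Φ.log a b, Φ.lie.map _ ?_, rfl⟩
  rw [Submodule.map_span, Submodule.span_le]
  rintro _ ⟨_, ⟨i, rfl⟩, rfl⟩
  change FreeAlgebra.lift ℚ ![a, b] (FreeAlgebra.ι ℚ i) ∈ _
  rw [FreeAlgebra.lift_ι_apply]; fin_cases i <;> assumption

theorem map_val {B : Type*} [Ring B] [Algebra ℚ B] (f : A →ₐ[ℚ] B) (a b : A) :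
    Units.map (PowerSeries.map f.toRingHom).toMonoidHom (Φ.val a b) = Φ.val (f a) (f b) := by
  refine Units.ext ?_
  change PowerSeries.map f.toRingHom (expSeries (evalAt Φ.log a b)) = expSeries _
  rw [map_expSeries, map_evalAt]

end Associator

end

section

open Color PowerSeries

/-! ### Bundles of strands, and the pentagon and hexagon relations for them. -/

section Bundles

variable {N : ℕ}

/-- The sum of the chords between two sets of positions. -/
noncomputable def chords (S T : Finset (Fin N)) : BlueAlg N := ∑ s ∈ S, ∑ u ∈ T, tb s u

theorem tb_symm (i j : Fin N) : tb i j = tb j i := t_symm i j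

theorem chords_symm (S T : Finset (Fin N)) : chords S T = chords T S := by
  rw [chords, chords, Finset.sum_comm]
  simp only [tb, t_symm]

theorem chords_empty_left (T : Finset (Fin N)) : chords ∅ T = 0 := by simp [chords]

theorem chords_empty_right (T : Finset (Fin N)) : chords T ∅ = 0 := by simp [chords]

theorem chords_union_left {S S' : Finset (Fin N)} (h : Disjoint S S') (T : Finset (Fin N)) :
    chords (S ∪ S') T = chords S T + chords S' T := Finset.sum_union h

theorem chords_union_right {T T' : Finset (Fin N)} (h : Disjoint T T') (S : Finset (Fin N)) :
    chords S (T ∪ T') = chords S T + chords S T' := by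
  rw [chords_symm, chords_union_left h, chords_symm, chords_symm T']

theorem chords_mem (S T : Finset (Fin N)) : chords S T ∈ blueSpace N :=
  Submodule.sum_mem _ fun _ _ => Submodule.sum_mem _ fun _ _ => t_mem_chordSpace _ _

/-- Every set in question contains `Q` or is disjoint from it. -/
def Sat (Q S : Finset (Fin N)) : Prop := Q ⊆ S ∨ Disjoint Q S

/-- For every `u` in `T` the chords from `u` to `i` and to `j` are taken together and commute with
`tb i j` by the four-term relation; the remaining chords are disjoint from it. -/
theorem commute_chords_aux {i j : Fin N} {S T : Finset (Fin N)} (hST : Disjoint S T)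
    (hi : i ∈ S) (hj : j ∈ S) : Commute (tb i j) (chords S T) := by
  by_cases hij : i = j
  · rw [tb, t_notAllowed fun h => h.1 hij]; exact Commute.zero_left _
  rw [chords, Finset.sum_comm]
  refine Commute.sum_right _ _ _ fun u hu => ?_
  rw [← Finset.add_sum_erase _ _ hi, ← Finset.add_sum_erase _ _ (Finset.mem_erase.2 ⟨Ne.symm hij, hj⟩),
    ← add_assoc]
  have iu : i ≠ u := fun h => Finset.disjoint_left.1 hST hi (h ▸ hu)
  have ju : j ≠ u := fun h => Finset.disjoint_left.1 hST hj (h ▸ hu)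
  refine Commute.add_right ?_ (Commute.sum_right _ _ _ fun x hx => ?_)
  · have := t_fourTerm (k := ⊤) (c := fun _ : Fin N => blue) (i := u) (j := i) (p := j)
      ⟨iu.symm, Or.inl rfl⟩ ⟨ju.symm, Or.inl rfl⟩ ⟨hij, Or.inl rfl⟩
    rw [t_symm u i, t_symm u j] at this
    exact this.symm
  · rw [Finset.mem_erase, Finset.mem_erase] at hx
    exact t_comm hx.2.1.symm iu hx.1.symm ju

/-- The locality principle behind all later commutations: a chord inside `Q` slides through any sum
of chords between bundles that do not cut `Q`. -/
theorem commute_chords {i j : Fin N} {Q S T : Finset (Fin N)} (hST : Disjoint S T)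
    (hi : i ∈ Q) (hj : j ∈ Q) (hS : Sat Q S) (hT : Sat Q T) : Commute (tb i j) (chords S T) := by
  rcases hS with hS | hS
  · exact commute_chords_aux hST (hS hi) (hS hj)
  rcases hT with hT | hT
  · rw [chords_symm]; exact commute_chords_aux hST.symm (hT hi) (hT hj)
  refine Commute.sum_right _ _ _ fun s hs => Commute.sum_right _ _ _ fun u hu => ?_
  have a : ∀ {x y}, x ∈ Q → y ∈ S → x ≠ y := fun hx hy h => Finset.disjoint_left.1 hS hx (h ▸ hy)
  have b : ∀ {x y}, x ∈ Q → y ∈ T → x ≠ y := fun hx hy h => Finset.disjoint_left.1 hT hx (h ▸ hy)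
  exact t_comm (a hi hs) (b hi hu) (a hj hs) (b hj hu)

/-- The units of the completed algebra. -/
abbrev GrpN (N : ℕ) : Type := (BlueAlg N)⟦X⟧ˣ

/-- The series `g` commutes with the chords between positions in `Q`. -/
def Away (Q : Finset (Fin N)) (g : GrpN N) : Prop :=
  ∀ i ∈ Q, ∀ j ∈ Q, Commute (PowerSeries.C (tb i j)) (g : (BlueAlg N)⟦X⟧)

/-- The series `g` commutes with everything that commutes with the chords between positions
in `Q`. -/
def Inside (Q : Finset (Fin N)) (g : GrpN N) : Prop := ∀ h, Away Q h → Commute g h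

theorem Away.mul {Q : Finset (Fin N)} {g h : GrpN N} (hg : Away Q g) (hh : Away Q h) :
    Away Q (g * h) := fun i hi j hj => by
  rw [Units.val_mul]; exact (hg i hi j hj).mul_right (hh i hi j hj)

theorem Away.inv {Q : Finset (Fin N)} {g : GrpN N} (hg : Away Q g) : Away Q g⁻¹ :=
  fun i hi j hj => (hg i hi j hj).units_inv_right

theorem Away.one {Q : Finset (Fin N)} : Away Q (1 : GrpN N) := fun _ _ _ _ => Commute.one_right _

theorem Inside.mul {Q : Finset (Fin N)} {g h : GrpN N} (hg : Inside Q g) (hh : Inside Q h) :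
    Inside Q (g * h) := fun x hx => (hg x hx).mul_left (hh x hx)

theorem Inside.inv {Q : Finset (Fin N)} {g : GrpN N} (hg : Inside Q g) : Inside Q g⁻¹ :=
  fun x hx => (hg x hx).inv_left

theorem Inside.one {Q : Finset (Fin N)} : Inside Q (1 : GrpN N) := fun x _ => Commute.one_left x

theorem commute_C_iff {A : Type*} [Ring A] {p : A} {f : A⟦X⟧} :
    Commute (PowerSeries.C p) f ↔ ∀ d, Commute p (coeff d f) := by
  constructor
  · intro h d
    have := congrArg (coeff d) h.eq
    rwa [coeff_C_mul, coeff_mul_C] at this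
  · intro h
    ext d
    rw [coeff_C_mul, coeff_mul_C]; exact h d

theorem Away.chords {Q S T : Finset (Fin N)} {g : GrpN N} (hg : Away Q g) (hS : S ⊆ Q)
    (hT : T ⊆ Q) (d : ℕ) : Commute (coeff d (g : (BlueAlg N)⟦X⟧)) (chords S T) :=
  Commute.sum_right _ _ _ fun s hs => Commute.sum_right _ _ _ fun u hu =>
    (commute_C_iff.1 (hg s (hS hs) u (hT hu)) d).symm

variable (Φ : Associator)

/-- The change of parentheses `(ST)U → S(TU)`. -/
noncomputable def phi (S T U : Finset (Fin N)) : GrpN N := Φ.val (chords S T) (chords T U)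

/-- The exponential of an element of degree one. -/
noncomputable def expOne {A : Type*} [Ring A] [Algebra ℚ A] (a : A) : A⟦X⟧ˣ :=
  expUnit (monomial 1 a) (by rw [coeff_monomial, if_neg zero_ne_one])

theorem expOne_neg {A : Type*} [Ring A] [Algebra ℚ A] (a : A) : expOne (-a) = (expOne a)⁻¹ := by
  refine Units.ext ?_
  change expSeries _ = expSeries _
  rw [map_neg]

theorem expOne_neg_smul {A : Type*} [Ring A] [Algebra ℚ A] (q : ℚ) (a : A) :
    expOne ((-q) • a) = (expOne (q • a))⁻¹ := by rw [neg_smul, expOne_neg]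

/-- The crossing of two bundles of strands. -/
noncomputable def cross (S T : Finset (Fin N)) : GrpN N := expOne ((1 / 2 : ℚ) • chords S T)

theorem cross_symm (S T : Finset (Fin N)) : cross S T = cross T S := by
  rw [cross, cross, chords_symm]

theorem expOne_zero {A : Type*} [Ring A] [Algebra ℚ A] : expOne (0 : A) = 1 := by
  refine Units.ext ?_
  change expSeries _ = 1
  rw [map_zero, expSeries_zero]

theorem cross_empty_left (S : Finset (Fin N)) : cross ∅ S = 1 := by
  rw [cross, chords_empty_left, smul_zero, expOne_zero]

theorem cross_empty_right (S : Finset (Fin N)) : cross S ∅ = 1 := by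
  rw [cross_symm, cross_empty_left]

theorem phi_empty_left (S T : Finset (Fin N)) : phi Φ ∅ S T = 1 := by
  rw [phi, chords_empty_left, Φ.val_zero_left]

theorem phi_empty_middle (S T : Finset (Fin N)) : phi Φ S ∅ T = 1 := by
  rw [phi, chords_empty_left, Φ.val_zero_right]

theorem phi_empty_right (S T : Finset (Fin N)) : phi Φ S T ∅ = 1 := by
  rw [phi, chords_empty_right, Φ.val_zero_right]

theorem coeff_monomial_commute {A : Type*} [Ring A] {p a : A} (h : Commute p a) (d : ℕ) :
    Commute p (coeff d (monomial 1 a)) := by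
  rw [coeff_monomial]; split_ifs
  · exact h
  · exact Commute.zero_right _

theorem phi_away {Q S T U : Finset (Fin N)} (h1 : Disjoint S T) (h2 : Disjoint T U)
    (hS : Sat Q S) (hT : Sat Q T) (hU : Sat Q U) : Away Q (phi Φ S T U) :=
  fun i hi j hj => commute_C_iff.2 (commute_coeff_expSeries (commute_coeff_evalAt _
    (commute_chords h1 hi hj hS hT) (commute_chords h2 hi hj hT hU)))

theorem cross_away {Q S T : Finset (Fin N)} (h1 : Disjoint S T)
    (hS : Sat Q S) (hT : Sat Q T) : Away Q (cross S T) :=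
  fun i hi j hj => commute_C_iff.2 (commute_coeff_expSeries (coeff_monomial_commute
    (Commute.smul_right (commute_chords h1 hi hj hS hT) _)))

/-- A series that commutes with all chords inside `Q` commutes with both arguments of the
associator, hence with its value. Pairing this with `phi_away` replaces the geometric argument that
a small diagram passes through a cable. -/
theorem phi_inside {Q S T U : Finset (Fin N)} (hS : S ⊆ Q) (hT : T ⊆ Q) (hU : U ⊆ Q) :
    Inside Q (phi Φ S T U) := by
  intro g hg
  have := commute_of_coeff (f := (g : (BlueAlg N)⟦X⟧))
    (g := (phi Φ S T U : (BlueAlg N)⟦X⟧)) fun d =>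
      commute_coeff_expSeries (commute_coeff_evalAt _ (hg.chords hS hT d) (hg.chords hT hU d))
  exact (Units.ext this.eq : Commute g _).symm

theorem cross_inside {Q S T : Finset (Fin N)} (hS : S ⊆ Q) (hT : T ⊆ Q) :
    Inside Q (cross S T) := by
  intro g hg
  have := commute_of_coeff (f := (g : (BlueAlg N)⟦X⟧))
    (g := (cross S T : (BlueAlg N)⟦X⟧)) fun d =>
      commute_coeff_expSeries (coeff_monomial_commute (Commute.smul_right (hg.chords hS hT d) _))
  exact (Units.ext this.eq : Commute g _).symm

theorem phi_mem (S T U : Finset (Fin N)) : phi Φ S T U ∈ lieGroup (blueSpace N) :=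
  Φ.val_mem_lieGroup (chords_mem _ _) (chords_mem _ _)

attribute [local instance 100] LieRing.ofAssociativeRing
attribute [local instance 100] LieAlgebra.ofAssociativeAlgebra

theorem expOne_mem {A : Type*} [Ring A] [Algebra ℚ A] {V : Submodule ℚ A} {a : A} (h : a ∈ V) :
    expOne a ∈ lieGroup V := by
  refine ⟨_, ⟨fun d => ?_, by rw [coeff_monomial, if_neg zero_ne_one], fun d => ?_⟩, rfl⟩
  · rw [coeff_monomial]
    split_ifs with hd
    · rw [hd, pow_one]; exact h
    · exact Submodule.zero_mem _
  · rw [coeff_monomial]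
    split_ifs with hd
    · exact LieSubalgebra.subset_lieSpan h
    · exact zero_mem _

theorem cross_mem (S T : Finset (Fin N)) : cross S T ∈ lieGroup (blueSpace N) :=
  expOne_mem (Submodule.smul_mem _ _ (chords_mem _ _))

/-! ### Partial maps of positions -/

section Pull

variable {M : ℕ}

/-- The homomorphism induced by a partial map of positions. -/
noncomputable def bluePull (f : Fin N → Option (Fin M)) : BlueAlg M →ₐ[ℚ] BlueAlg N :=
  pull ⊤ _ _ f fun _ _ _ _ => rfl

/-- The preimage of a set of positions under a partial map. -/
def preim (f : Fin N → Option (Fin M)) (S : Finset (Fin M)) : Finset (Fin N) :=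
  Finset.univ.filter fun x => ∃ i ∈ S, f x = some i

theorem mem_preim {f : Fin N → Option (Fin M)} {S : Finset (Fin M)} {x : Fin N} :
    x ∈ preim f S ↔ ∃ i ∈ S, f x = some i := by simp [preim]

theorem preim_disjoint (f : Fin N → Option (Fin M)) {S T : Finset (Fin M)} (h : Disjoint S T) :
    Disjoint (preim f S) (preim f T) := by
  rw [Finset.disjoint_left] at h ⊢
  intro x hx hx'
  obtain ⟨i, hi, e⟩ := mem_preim.1 hx
  obtain ⟨j, hj, e'⟩ := mem_preim.1 hx'
  rw [e] at e'
  rw [← Option.some.inj e'] at hj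
  exact h hi hj

theorem preim_union (f : Fin N → Option (Fin M)) (S T : Finset (Fin M)) :
    preim f (S ∪ T) = preim f S ∪ preim f T := by
  ext x; simp only [mem_preim, Finset.mem_union]; grind

theorem preim_empty (f : Fin N → Option (Fin M)) : preim f ∅ = ∅ := by
  ext x; simp [mem_preim]

/-- Disjointness matters: for a common position the chord on the left is zero, while on the right
its two copies under a cabling would be joined by a chord. -/
theorem bluePull_chords (f : Fin N → Option (Fin M)) {S T : Finset (Fin M)} (h : Disjoint S T) :
    bluePull f (chords S T) = chords (preim f S) (preim f T) := by
  have e : ∀ (S : Finset (Fin M)) (g : Fin N → BlueAlg N), ∑ x ∈ preim f S, g x =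
      ∑ s ∈ S, ∑ x with f x = some s, g x := by
    intro S g
    rw [← Finset.sum_biUnion]
    · congr 1; ext x; simp [mem_preim]
    · intro a _ b _ hab
      refine Finset.disjoint_left.2 fun x hx hx' => hab ?_
      simp only [Finset.mem_filter] at hx hx'
      exact Option.some.inj (hx.2.symm.trans hx'.2)
  rw [chords, chords, map_sum, e]
  refine Finset.sum_congr rfl fun s hs => ?_
  rw [map_sum, Finset.sum_congr rfl fun x _ => e T _, Finset.sum_comm]
  refine Finset.sum_congr rfl fun u hu => ?_
  rw [bluePull, pull_t, pullGen, if_pos ⟨fun h' => Finset.disjoint_left.1 h hs (h' ▸ hu), Or.inl rfl⟩]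

/-- The homomorphism of completions induced by a partial map of positions. -/
noncomputable def unitPull (f : Fin N → Option (Fin M)) : GrpN M →* GrpN N :=
  Units.map (PowerSeries.map (bluePull f).toRingHom).toMonoidHom

theorem unitPull_phi (f : Fin N → Option (Fin M)) {S T U : Finset (Fin M)} (h1 : Disjoint S T)
    (h2 : Disjoint T U) : unitPull f (phi Φ S T U) = phi Φ (preim f S) (preim f T) (preim f U) := by
  rw [unitPull, phi, Φ.map_val, bluePull_chords f h1, bluePull_chords f h2]; rfl

theorem map_expOne {A B : Type*} [Ring A] [Algebra ℚ A] [Ring B] [Algebra ℚ B] (f : A →ₐ[ℚ] B)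
    (a : A) : Units.map (PowerSeries.map f.toRingHom).toMonoidHom (expOne a) = expOne (f a) := by
  refine Units.ext ?_
  change PowerSeries.map f.toRingHom (expSeries _) = expSeries _
  rw [map_expSeries]
  congr 1
  ext d
  rw [coeff_map, coeff_monomial, coeff_monomial]
  split_ifs
  · rfl
  · exact map_zero _

theorem unitPull_cross (f : Fin N → Option (Fin M)) {S T : Finset (Fin M)} (h1 : Disjoint S T) :
    unitPull f (cross S T) = cross (preim f S) (preim f T) := by
  rw [unitPull, cross, map_expOne, map_smul, bluePull_chords f h1]; rfl

open Classical in
/-- The map that sends each element of `x i` to `i`. -/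
noncomputable def position (x : Fin M → Finset (Fin N)) (y : Fin N) : Option (Fin M) :=
  if h : ∃ i, y ∈ x i then some h.choose else none

/-- Disjoint bundles determine a partial map to the index set whose fibres they are. Pulling back
along it carries a relation on three or four strands to a relation on bundles. -/
theorem preim_position {x : Fin M → Finset (Fin N)} (hx : Pairwise (Function.onFun Disjoint x))
    (i : Fin M) : preim (position x) {i} = x i := by
  ext y
  rw [mem_preim]
  constructor
  · rintro ⟨j, hj, e⟩
    rw [Finset.mem_singleton] at hj
    subst hj
    unfold position at e
    split_ifs at e with h
    rw [← Option.some.inj e]; exact h.choose_spec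
  · intro hy
    refine ⟨i, Finset.mem_singleton_self i, ?_⟩
    have h : ∃ i, y ∈ x i := ⟨i, hy⟩
    rw [position, dif_pos h]
    congr 1
    by_contra hne
    exact Finset.disjoint_left.1 (hx hne) h.choose_spec hy

end Pull

theorem chords_singleton (i j : Fin N) : chords {i} {j} = tb i j := by simp [chords]

section Relations

variable {S T U W : Finset (Fin N)}

theorem pentagon (hWS : Disjoint W S) (hWT : Disjoint W T) (hWU : Disjoint W U) (hST : Disjoint S T)
    (hSU : Disjoint S U) (hTU : Disjoint T U) :
    phi Φ W S T * phi Φ W (S ∪ T) U * phi Φ S T U = phi Φ (W ∪ S) T U * phi Φ W S (T ∪ U) := by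
  have hx : Pairwise (Function.onFun Disjoint ![W, S, T, U]) := by
    intro i j hij
    fin_cases i <;> fin_cases j <;> simp_all [Function.onFun, disjoint_comm]
  have base : phi Φ ({0} : Finset (Fin 4)) {1} {2} * phi Φ {0} ({1} ∪ {2}) {3} * phi Φ {1} {2} {3} =
      phi Φ ({0} ∪ {1}) {2} {3} * phi Φ {0} {1} ({2} ∪ {3}) := by
    refine Units.ext ?_
    simp only [Units.val_mul, phi, Φ.coe_val]
    rw [chords_union_left (by decide), chords_union_right (by decide), chords_union_left (by decide),
      chords_union_right (by decide)]
    simp only [chords_singleton]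
    exact Φ.isAssociator.pentagon
  have := congrArg (unitPull (position ![W, S, T, U])) base
  rw [map_mul, map_mul, map_mul, unitPull_phi Φ _ (by decide) (by decide),
    unitPull_phi Φ _ (by decide) (by decide), unitPull_phi Φ _ (by decide) (by decide),
    unitPull_phi Φ _ (by decide) (by decide), unitPull_phi Φ _ (by decide) (by decide)] at this
  simp only [preim_union, preim_position hx] at this
  exact this

/-- Both signs are needed: `1 / 2` resolves a cable crossing on the left, and inverting the relation
for `-(1 / 2)` resolves one on the right. -/
theorem hexagon_aux (hST : Disjoint S T) (hSU : Disjoint S U) (hTU : Disjoint T U) (r : ℚ)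
    (hr : r = 1 / 2 ∨ r = -(1 / 2)) : expOne (r • chords (S ∪ T) U) =
      phi Φ S T U * expOne (r • chords T U) * (phi Φ S U T)⁻¹ * expOne (r • chords S U) *
        phi Φ U S T := by
  have hx : Pairwise (Function.onFun Disjoint ![S, T, U]) := by
    intro i j hij
    fin_cases i <;> fin_cases j <;> simp_all [Function.onFun, disjoint_comm]
  have base : expOne (r • chords ({0} ∪ {1} : Finset (Fin 3)) {2}) =
      phi Φ {0} {1} {2} * expOne (r • chords {1} {2}) * (phi Φ {0} {2} {1})⁻¹ *
        expOne (r • chords {0} {2}) * phi Φ {2} {0} {1} := by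
    refine Units.ext ?_
    rw [chords_union_left (by decide)]
    have h := Φ.isAssociator.hexagon r hr
    rw [← Φ.coe_val (tb 0 2), Ring.inverse_unit, ← Φ.coe_val, ← Φ.coe_val] at h
    simp only [phi, Units.val_mul, chords_singleton]
    rw [tb_symm (2 : Fin 3) 1, tb_symm (2 : Fin 3) 0]
    exact h
  have := congrArg (unitPull (position ![S, T, U])) base
  rw [map_mul, map_mul, map_mul, map_mul, map_inv, unitPull_phi Φ _ (by decide) (by decide),
    unitPull_phi Φ _ (by decide) (by decide), unitPull_phi Φ _ (by decide) (by decide)] at this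
  simp only [unitPull, map_expOne, map_smul] at this
  rw [bluePull_chords _ (by decide), bluePull_chords _ (by decide),
    bluePull_chords _ (by decide)] at this
  simp only [preim_union, preim_position hx] at this
  exact this

theorem hexagon_left (hST : Disjoint S T) (hSU : Disjoint S U) (hTU : Disjoint T U) :
    cross (S ∪ T) U = phi Φ S T U * cross T U * (phi Φ S U T)⁻¹ * cross S U * phi Φ U S T :=
  hexagon_aux Φ hST hSU hTU _ (Or.inl rfl)

theorem hexagon_right (hST : Disjoint S T) (hSU : Disjoint S U) (hTU : Disjoint T U) :
    cross U (S ∪ T) =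
      (phi Φ U S T)⁻¹ * cross U S * phi Φ S U T * cross U T * (phi Φ S T U)⁻¹ := by
  have := hexagon_aux Φ hST hSU hTU _ (Or.inr rfl)
  rw [expOne_neg_smul, expOne_neg_smul, expOne_neg_smul] at this
  rw [cross_symm, cross, cross_symm U, cross_symm U, cross, cross, ← inv_inv (expOne ((1 / 2 : ℚ) • chords (S ∪ T) U)), this]
  group

end Relations

end Bundles

end

section

open Color PowerSeries

/-! ### Crossings behind a bundle: cabling and the braid relation. -/

section GroupIdentities

variable {G : Type*} [Group G]

/-- The computation common to both cabling formulas, in an arbitrary group. `pa`, `pc`, `pd` are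
pentagons on four bundles in three orders, `hex` is the hexagon for the last three bundles, and
`hr`, `hs` slide a crossing through an associator that sees its two strands as one bundle. -/
theorem cable_identity {a1 a2 a3 a4 a5 c1 c2 c3 c4 c5 d1 d3 d4 r s x : G}
    (pa : a1 * a2 * a3 = a4 * a5) (pc : c1 * c2 * c3 = c4 * c5) (pd : d1 * c2 * d3 = d4 * a5)
    (hex : x = a3 * r * d3⁻¹ * s * c3) (hr : Commute a5 r) (hs : Commute c2 s) :
    a2 * x * c5⁻¹ = a1⁻¹ * (a4 * r * d4⁻¹ * (d1 * s * c1⁻¹)) * c4 := by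
  have e1 : a2 * a3 = a1⁻¹ * a4 * a5 := by rw [mul_assoc, ← pa]; group
  have e2 : c3 * c5⁻¹ = c2⁻¹ * c1⁻¹ * c4 := by
    rw [mul_inv_eq_iff_eq_mul, mul_assoc, ← pc]; group
  have e3 : a5 * d3⁻¹ = d4⁻¹ * d1 * c2 := by
    rw [mul_inv_eq_iff_eq_mul, mul_assoc, mul_assoc, ← mul_assoc d1, pd]; group
  calc a2 * x * c5⁻¹ = (a2 * a3) * r * d3⁻¹ * s * (c3 * c5⁻¹) := by rw [hex]; group
    _ = a1⁻¹ * a4 * (a5 * r) * d3⁻¹ * s * (c2⁻¹ * c1⁻¹ * c4) := by rw [e1, e2]; group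
    _ = a1⁻¹ * a4 * r * (a5 * d3⁻¹) * s * (c2⁻¹ * c1⁻¹ * c4) := by rw [hr.eq]; group
    _ = a1⁻¹ * a4 * r * d4⁻¹ * d1 * (c2 * s) * (c2⁻¹ * c1⁻¹ * c4) := by rw [e3]; group
    _ = _ := by rw [hs.eq]; group

end GroupIdentities

section Crossings

variable {N : ℕ} (Φ : Associator)

/-- The crossing of two bundles next to each other, behind the bundle `P` in a left-normed word. -/
noncomputable def crossing (P a b : Finset (Fin N)) : GrpN N :=
  phi Φ P a b * cross a b * (phi Φ P b a)⁻¹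

section

variable {L P a b c : Finset (Fin N)}

/-- The cable is split at the bottom by an associator, its strands pass `c` one after the other, `b`
before `a`, and the cable is joined again at the top. -/
theorem crossing_cable_left (hPa : Disjoint P a) (hPb : Disjoint P b) (hPc : Disjoint P c)
    (hab : Disjoint a b) (hac : Disjoint a c) (hbc : Disjoint b c) :
    crossing Φ P (a ∪ b) c =
      (phi Φ P a b)⁻¹ * (crossing Φ (P ∪ a) b c * crossing Φ P a c) * phi Φ (P ∪ c) a b := by
  refine cable_identity (pentagon Φ hPa hPb hPc hab hac hbc)
    (pentagon Φ hPc hPa hPb hac.symm hbc.symm hab) ?_ (hexagon_left Φ hab hac hbc) ?_ ?_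
  · have := pentagon Φ hPa hPc hPb hac hab hbc.symm
    rwa [Finset.union_comm a c, Finset.union_comm c b] at this
  · refine (cross_inside (Q := b ∪ c) ?_ ?_ _ (phi_away Φ hPa ?_ ?_ ?_ ?_)).symm
    · exact Finset.subset_union_left
    · exact Finset.subset_union_right
    · simp [*]
    · right; simp [hPb.symm, hPc.symm]
    · right; simp [hab.symm, hac.symm]
    · left; rfl
  · refine (cross_inside (Q := a ∪ c) ?_ ?_ _ (phi_away Φ ?_ ?_ ?_ ?_ ?_)).symm
    · exact Finset.subset_union_left
    · exact Finset.subset_union_right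
    · simp [*]
    · simp [hab, hbc.symm]
    · right; simp [hPa.symm, hPc.symm]
    · left; rw [Finset.union_comm]
    · right; simp [hab, hbc.symm]

/-- The hexagon for the inverse crossings has the form required by `cable_identity`, so the formula
is obtained for the inverses and inverted. -/
theorem crossing_cable_right (hPa : Disjoint P a) (hPb : Disjoint P b) (hPc : Disjoint P c)
    (hab : Disjoint a b) (hac : Disjoint a c) (hbc : Disjoint b c) :
    crossing Φ P c (a ∪ b) =
      (phi Φ (P ∪ c) a b)⁻¹ * (crossing Φ P c a * crossing Φ (P ∪ a) c b) * phi Φ P a b := by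
  have key := cable_identity (r := (cross c b)⁻¹) (s := (cross c a)⁻¹) (x := (cross c (a ∪ b))⁻¹)
    (pentagon Φ hPa hPb hPc hab hac hbc)
    (pentagon Φ hPc hPa hPb hac.symm hbc.symm hab) (d3 := phi Φ a c b) (d1 := phi Φ P a c)
    (d4 := phi Φ (P ∪ a) c b) ?_ ?_ ?_ ?_
  · rw [← inv_inj]
    simp only [crossing, mul_inv_rev, inv_inv] at key ⊢
    rw [← mul_assoc, key]
    group
  · have := pentagon Φ hPa hPc hPb hac hab hbc.symm
    rwa [Finset.union_comm a c, Finset.union_comm c b] at this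
  · rw [hexagon_right Φ hab hac hbc]; group
  · refine ((cross_inside (Q := b ∪ c) ?_ ?_ _ (phi_away Φ hPa ?_ ?_ ?_ ?_)).inv_left).symm
    · exact Finset.subset_union_right
    · exact Finset.subset_union_left
    · simp [*]
    · right; simp [hPb.symm, hPc.symm]
    · right; simp [hab.symm, hac.symm]
    · left; rfl
  · refine ((cross_inside (Q := a ∪ c) ?_ ?_ _ (phi_away Φ ?_ ?_ ?_ ?_ ?_)).inv_left).symm
    · exact Finset.subset_union_right
    · exact Finset.subset_union_left
    · simp [*]
    · simp [hab, hbc.symm]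
    · right; simp [hPa.symm, hPc.symm]
    · left; rw [Finset.union_comm]
    · right; simp [hab, hbc.symm]

/-- Two pentagons, one for each order of `a` and `b`; the associator that is left between them has
`a ∪ b` as its last bundle and passes through the crossing. This is the local form of adding a
strand on the left. -/
theorem crossing_prefix (hLP : Disjoint L P) (hLa : Disjoint L a) (hLb : Disjoint L b)
    (hPa : Disjoint P a) (hPb : Disjoint P b) (hab : Disjoint a b) :
    phi Φ L P a * phi Φ L (P ∪ a) b * crossing Φ P a b * (phi Φ L (P ∪ b) a)⁻¹ * (phi Φ L P b)⁻¹ =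
      crossing Φ (L ∪ P) a b := by
  have p1 := pentagon Φ hLP hLa hLb hPa hPb hab
  have p2 := pentagon Φ hLP hLb hLa hPb hPa hab.symm
  rw [Finset.union_comm b a] at p2
  have hc : Commute (phi Φ L P (a ∪ b)) (cross a b) := by
    refine (cross_inside (Q := a ∪ b) ?_ ?_ _ (phi_away Φ ?_ ?_ ?_ ?_ ?_)).symm
    · exact Finset.subset_union_left
    · exact Finset.subset_union_right
    · exact hLP
    · simp [*]
    · right; simp [hLa.symm, hLb.symm]
    · right; simp [hPa.symm, hPb.symm]
    · left; rfl
  have e2 : (phi Φ P b a)⁻¹ * (phi Φ L (P ∪ b) a)⁻¹ * (phi Φ L P b)⁻¹ =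
      (phi Φ L P (a ∪ b))⁻¹ * (phi Φ (L ∪ P) b a)⁻¹ := by
    rw [← mul_inv_rev, ← mul_inv_rev, ← mul_inv_rev, ← p2, mul_assoc]
  calc _ = phi Φ L P a * phi Φ L (P ∪ a) b * phi Φ P a b * cross a b *
        ((phi Φ P b a)⁻¹ * (phi Φ L (P ∪ b) a)⁻¹ * (phi Φ L P b)⁻¹) := by rw [crossing]; group
    _ = phi Φ (L ∪ P) a b * (phi Φ L P (a ∪ b) * cross a b) *
        ((phi Φ L P (a ∪ b))⁻¹ * (phi Φ (L ∪ P) b a)⁻¹) := by rw [p1, e2]; group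
    _ = _ := by rw [hc.eq, crossing]; group

theorem crossing_away {Q : Finset (Fin N)} (hPa : Disjoint P a) (hPb : Disjoint P b)
    (hab : Disjoint a b) (hP : Sat Q P) (ha : Sat Q a) (hb : Sat Q b) : Away Q (crossing Φ P a b) :=
  ((phi_away Φ hPa hab hP ha hb).mul (cross_away hab ha hb)).mul
    (phi_away Φ hPb hab.symm hP hb ha).inv

theorem crossing_inside {Q : Finset (Fin N)} (hP : P ⊆ Q) (ha : a ⊆ Q) (hb : b ⊆ Q) :
    Inside Q (crossing Φ P a b) :=
  ((phi_inside Φ hP ha hb).mul (cross_inside ha hb)).mul (phi_inside Φ hP hb ha).inv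

/-- The cable `a ∪ b = b ∪ a` crosses `c` in a way that commutes with exchanging `a` and `b` inside
it. Resolving the crossing by `crossing_cable_left` in both orders turns this into Artin's relation.
-/
theorem crossing_braid (hPa : Disjoint P a) (hPb : Disjoint P b) (hPc : Disjoint P c)
    (hab : Disjoint a b) (hac : Disjoint a c) (hbc : Disjoint b c) :
    crossing Φ P a b * crossing Φ (P ∪ b) a c * crossing Φ P b c =
      crossing Φ (P ∪ a) b c * crossing Φ P a c * crossing Φ (P ∪ c) a b := by
  have h1 := crossing_cable_left Φ hPa hPb hPc hab hac hbc
  have h2 := crossing_cable_left Φ hPb hPa hPc hab.symm hbc hac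
  rw [Finset.union_comm b a, h1] at h2
  have hc : Commute (crossing Φ P (a ∪ b) c) (cross a b) := by
    refine (cross_inside (Q := a ∪ b) ?_ ?_ _ (crossing_away Φ ?_ hPc ?_ ?_ ?_ ?_)).symm
    · exact Finset.subset_union_left
    · exact Finset.subset_union_right
    · simp [*]
    · simp [*]
    · right; simp [hPa.symm, hPb.symm]
    · left; rfl
    · right; simp [*]
  rw [h1] at hc
  have e1 : crossing Φ (P ∪ b) a c * crossing Φ P b c = phi Φ P b a *
      ((phi Φ P a b)⁻¹ * (crossing Φ (P ∪ a) b c * crossing Φ P a c) * phi Φ (P ∪ c) a b) *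
      (phi Φ (P ∪ c) b a)⁻¹ := by rw [h2]; group
  rw [mul_assoc, e1]
  set u := (phi Φ P a b)⁻¹ * (crossing Φ (P ∪ a) b c * crossing Φ P a c) * phi Φ (P ∪ c) a b with hu
  have e2 : crossing Φ (P ∪ a) b c * crossing Φ P a c =
      phi Φ P a b * u * (phi Φ (P ∪ c) a b)⁻¹ := by rw [hu]; group
  rw [e2]
  calc _ = phi Φ P a b * (cross a b * u) * (phi Φ (P ∪ c) b a)⁻¹ := by rw [crossing]; group
    _ = _ := by rw [← hc.eq, crossing]; group

theorem crossing_mem (P a b : Finset (Fin N)) : crossing Φ P a b ∈ lieGroup (blueSpace N) :=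
  mul_mem (mul_mem (phi_mem Φ _ _ _) (cross_mem _ _)) (inv_mem (phi_mem Φ _ _ _))

end

/-! ### Labellings of the positions -/

/-- The union of the labels at the positions `k, …, k + n - 1`. -/
def seg (x : ℕ → Finset (Fin N)) (k : ℕ) : ℕ → Finset (Fin N)
  | 0 => ∅
  | n + 1 => seg x k n ∪ x (k + n)

/-- Distinct positions have disjoint labels. -/
def Disj (x : ℕ → Finset (Fin N)) : Prop := ∀ p q, p ≠ q → Disjoint (x p) (x q)

section

variable {x : ℕ → Finset (Fin N)}

theorem mem_seg {k n : ℕ} {y : Fin N} : y ∈ seg x k n ↔ ∃ q, k ≤ q ∧ q < k + n ∧ y ∈ x q := by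
  induction n with
  | zero => simp [seg]; intros; omega
  | succ n ih =>
    rw [seg, Finset.mem_union, ih]
    constructor
    · rintro (⟨q, h1, h2, h3⟩ | h)
      · exact ⟨q, h1, by omega, h3⟩
      · exact ⟨k + n, by omega, by omega, h⟩
    · rintro ⟨q, h1, h2, h3⟩
      rcases Nat.lt_or_ge q (k + n) with h | h
      · exact Or.inl ⟨q, h1, h, h3⟩
      · right
        rwa [show k + n = q by omega]

theorem seg_add (x : ℕ → Finset (Fin N)) (k m n : ℕ) :
    seg x k (m + n) = seg x k m ∪ seg x (k + m) n := by
  induction n with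
  | zero => simp [seg]
  | succ n ih => rw [← add_assoc, seg, ih, seg, Finset.union_assoc, add_assoc]

theorem seg_one (x : ℕ → Finset (Fin N)) (k : ℕ) : seg x k 1 = x k := by simp [seg]

theorem seg_congr {x x' : ℕ → Finset (Fin N)} {k k' n : ℕ}
    (h : ∀ q < n, x (k + q) = x' (k' + q)) : seg x k n = seg x' k' n := by
  induction n with
  | zero => rfl
  | succ n ih => rw [seg, seg, ih fun q hq => h q (by omega), h n (by omega)]

theorem seg_subset {k n k' n' : ℕ} (h1 : k' ≤ k) (h2 : k + n ≤ k' + n') :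
    seg x k n ⊆ seg x k' n' := fun y hy => by
  obtain ⟨q, h3, h4, h5⟩ := mem_seg.1 hy
  exact mem_seg.2 ⟨q, by omega, by omega, h5⟩

theorem point_subset {k n q : ℕ} (h1 : k ≤ q) (h2 : q < k + n) : x q ⊆ seg x k n :=
  fun y hy => mem_seg.2 ⟨q, h1, h2, hy⟩

theorem Disj.seg_seg (hx : Disj x) {k n k' n' : ℕ} (h : k + n ≤ k' ∨ k' + n' ≤ k) :
    Disjoint (seg x k n) (seg x k' n') := by
  rw [Finset.disjoint_left]
  intro y hy hy'
  obtain ⟨q, h1, h2, h3⟩ := mem_seg.1 hy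
  obtain ⟨q', h1', h2', h3'⟩ := mem_seg.1 hy'
  exact Finset.disjoint_left.1 (hx q q' (by omega)) h3 h3'

theorem Disj.seg_point (hx : Disj x) {k n q : ℕ} (h : k + n ≤ q ∨ q < k) :
    Disjoint (seg x k n) (x q) := by
  rw [← seg_one x q]; exact hx.seg_seg (by omega)

end

/-- The extension of permutations of the first `l` positions to all positions. -/
def extPerm {l : ℕ} : Equiv.Perm (Fin l) →* Equiv.Perm ℕ :=
  Equiv.Perm.extendDomainHom (p := fun i => i < l) Fin.equivSubtype

theorem extPerm_val {l : ℕ} (σ : Equiv.Perm (Fin l)) (i : Fin l) : extPerm σ i.val = (σ i).val :=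
  Equiv.Perm.extendDomain_apply_image σ Fin.equivSubtype i

theorem extPerm_ge {l : ℕ} (σ : Equiv.Perm (Fin l)) {p : ℕ} (h : l ≤ p) : extPerm σ p = p :=
  Equiv.Perm.extendDomain_apply_not_subtype σ Fin.equivSubtype (by simpa using h)

/-- The labels at the top of a braid, given the labels at the bottom. -/
def labAct {l : ℕ} {β : Type*} : Equiv.Perm (Fin l) →* Equiv.Perm (ℕ → β) where
  toFun σ := (extPerm σ).arrowCongr (Equiv.refl _)
  map_one' := by
    rw [map_one]; rfl
  map_mul' σ τ := by
    rw [map_mul]; rfl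

theorem labAct_apply {l : ℕ} {β : Type*} (σ : Equiv.Perm (Fin l)) (x : ℕ → β) (p : ℕ) :
    labAct σ x p = x (extPerm σ⁻¹ p) := by rw [map_inv]; rfl

theorem labAct_perm {l : ℕ} {β : Type*} (σ : Equiv.Perm (Fin l)) (x : ℕ → β) (i : Fin l) :
    labAct σ x (σ i).val = x i.val := by
  rw [labAct_apply, extPerm_val]; simp

theorem labAct_ge {l : ℕ} {β : Type*} (σ : Equiv.Perm (Fin l)) (x : ℕ → β) {p : ℕ} (h : l ≤ p) :
    labAct σ x p = x p := by rw [labAct_apply, extPerm_ge _ h]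

theorem extPerm_sw {l j : ℕ} (h : j + 1 < l) (p : ℕ) :
    extPerm (sw l j) p = if p = j then j + 1 else if p = j + 1 then j else p := by
  rcases Nat.lt_or_ge p l with hp | hp
  · have := extPerm_val (sw l j) ⟨p, hp⟩
    rw [sw_val h] at this
    exact this
  · rw [extPerm_ge _ hp, if_neg (by omega), if_neg (by omega)]

theorem labAct_sw {l j : ℕ} {β : Type*} (h : j + 1 < l) (x : ℕ → β) (p : ℕ) :
    labAct (sw l j) x p = x (if p = j then j + 1 else if p = j + 1 then j else p) := by
  rw [labAct_apply, sw_inv, extPerm_sw h]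

section

variable {l : ℕ} {x : ℕ → Finset (Fin N)}

theorem Disj.labAct (hx : Disj x) (σ : Equiv.Perm (Fin l)) : Disj (labAct σ x) := fun p q h => by
  rw [labAct_apply, labAct_apply]
  exact hx _ _ fun h' => h ((extPerm σ⁻¹).injective h')

theorem disj_labAct_iff (σ : Equiv.Perm (Fin l)) : Disj (MixedBraids.labAct σ x) ↔ Disj x :=
  ⟨fun h => by
    have := h.labAct σ⁻¹
    rwa [← Equiv.Perm.mul_apply, ← map_mul, inv_mul_cancel, map_one] at this, fun h => h.labAct σ⟩

theorem seg_labAct_sw_of_not_mem {j : ℕ} (h : j + 1 < l) {k n : ℕ} (hk : k + n ≤ j ∨ j + 2 ≤ k) :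
    seg (labAct (sw l j) x) k n = seg x k n :=
  seg_congr fun q hq => by rw [labAct_sw h, if_neg (by omega), if_neg (by omega)]

theorem seg_labAct_sw_of_mem {j : ℕ} (h : j + 1 < l) {k n : ℕ} (h1 : k ≤ j) (h2 : j + 2 ≤ k + n) :
    seg (labAct (sw l j) x) k n = seg x k n := by
  obtain ⟨m, rfl⟩ := Nat.exists_eq_add_of_le h1
  obtain ⟨r, rfl⟩ := Nat.exists_eq_add_of_le (show m + 2 ≤ n by omega)
  rw [seg_add, seg_add x k, seg_labAct_sw_of_not_mem h (k := k + (m + 2)) (by omega),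
    seg_add (labAct (sw l (k + m)) x) k m 2, seg_add x k m 2,
    seg_labAct_sw_of_not_mem h (k := k) (n := m) (by omega)]
  congr 2
  simp only [seg, Finset.empty_union, labAct_sw h, add_zero, if_true,
    show k + m + 1 ≠ k + m by omega, if_false]
  rw [Finset.union_comm]

theorem seg_succ_labAct_sw {j : ℕ} (h : j + 1 < l) :
    seg (labAct (sw l j) x) 0 (j + 1) = seg x 0 j ∪ x (j + 1) := by
  rw [seg, seg_labAct_sw_of_not_mem h (by omega), zero_add, labAct_sw h, if_pos rfl]

open Classical in
/-- The values of the expansion on the elementary braids, for left-normed words. -/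
noncomputable def genValue (j : ℕ) (x : ℕ → Finset (Fin N)) : GrpN N :=
  if Disj x then crossing Φ (seg x 0 j) (x j) (x (j + 1)) else 1

theorem genValue_of_disj (hx : Disj x) (j : ℕ) :
    genValue Φ j x = crossing Φ (seg x 0 j) (x j) (x (j + 1)) := if_pos hx

/-- A cocycle has to be defined for all labellings, while the relations between crossings need
disjoint ones. Permuting labels preserves disjointness, so the placeholder `1` satisfies the
relations and never mixes with the genuine values. -/
theorem genValue_of_not_disj (hx : ¬ Disj x) (j : ℕ) : genValue Φ j x = 1 := if_neg hx

/-- The left crossing lies inside the bundle of the first `j` positions, which the right crossing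
sees only as a whole. -/
theorem genValue_comm (i j : ℕ) (h : i + 1 < j) (hj : j + 1 < l) (x : ℕ → Finset (Fin N)) :
    genValue Φ i x * genValue Φ j (labAct (sw l i) x) =
      genValue Φ j x * genValue Φ i (labAct (sw l j) x) := by
  by_cases hx : Disj x
  swap
  · have hl : ∀ σ : Equiv.Perm (Fin l), ¬ Disj (labAct σ x) := fun σ => (disj_labAct_iff σ).not.2 hx
    simp only [genValue_of_not_disj Φ hx, genValue_of_not_disj Φ (hl _)]
  have hi : i + 1 < l := by omega
  rw [genValue_of_disj Φ hx, genValue_of_disj Φ hx, genValue_of_disj Φ (hx.labAct _),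
    genValue_of_disj Φ (hx.labAct _), seg_labAct_sw_of_mem hi (by omega) (by omega),
    seg_labAct_sw_of_not_mem hj (by omega)]
  simp only [labAct_sw hi, labAct_sw hj, show j ≠ i by omega, show j ≠ i + 1 by omega,
    show j + 1 ≠ i by omega, show j + 1 ≠ i + 1 by omega, show i ≠ j by omega,
    show i ≠ j + 1 by omega, show i + 1 ≠ j by omega,
    show i + 1 ≠ j + 1 by omega, if_false]
  refine crossing_inside Φ (Q := seg x 0 j) ?_ ?_ ?_ _ (crossing_away Φ ?_ ?_ ?_ ?_ ?_ ?_)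
  · exact seg_subset le_rfl (by omega)
  · exact point_subset (by omega) (by omega)
  · exact point_subset (by omega) (by omega)
  · exact hx.seg_point (by omega)
  · exact hx.seg_point (by omega)
  · exact hx _ _ (by omega)
  · left; rfl
  · right; exact hx.seg_point (by omega)
  · right; exact hx.seg_point (by omega)

/-- After the labels have been followed through the transpositions, this is `crossing_braid` for the
bundle of the first `i` positions and the three labels that follow it. -/
theorem genValue_braid (i : ℕ) (h : i + 2 < l) (x : ℕ → Finset (Fin N)) :
    genValue Φ i x * genValue Φ (i + 1) (labAct (sw l i) x) *
        genValue Φ i (labAct (sw l (i + 1)) (labAct (sw l i) x)) =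
      genValue Φ (i + 1) x * genValue Φ i (labAct (sw l (i + 1)) x) *
        genValue Φ (i + 1) (labAct (sw l i) (labAct (sw l (i + 1)) x)) := by
  by_cases hx : Disj x
  swap
  · have hl : ∀ σ : Equiv.Perm (Fin l), ¬ Disj (labAct σ x) := fun σ => (disj_labAct_iff σ).not.2 hx
    have hl' : ∀ σ τ : Equiv.Perm (Fin l), ¬ Disj (labAct σ (labAct τ x)) :=
      fun σ τ => (disj_labAct_iff σ).not.2 (hl τ)
    simp only [genValue_of_not_disj Φ hx, genValue_of_not_disj Φ (hl _),
      genValue_of_not_disj Φ (hl' _ _)]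
  have h1 : i + 1 < l := by omega
  have h2 : i + 1 + 1 < l := by omega
  simp only [genValue_of_disj Φ hx, genValue_of_disj Φ (hx.labAct _),
    genValue_of_disj Φ ((hx.labAct _).labAct _), seg_succ_labAct_sw h1]
  rw [seg_labAct_sw_of_not_mem h2 (by omega), seg_labAct_sw_of_not_mem h1 (by omega),
    seg_labAct_sw_of_not_mem h2 (by omega)]
  simp only [labAct_sw h1, labAct_sw h2, seg, zero_add,
    show i ≠ i + 1 by omega, show i + 1 ≠ i by omega, show i + 1 + 1 ≠ i by omega,
    show i + 1 + 1 ≠ i + 1 by omega, show i ≠ i + 1 + 1 by omega, show i + 1 ≠ i + 1 + 1 by omega,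
    if_true, if_false]
  exact crossing_braid Φ (hx.seg_point (by omega)) (hx.seg_point (by omega))
    (hx.seg_point (by omega)) (hx _ _ (by omega)) (hx _ _ (by omega)) (hx _ _ (by omega))

/-- The value of the expansion on a braid between left-normed words, with labels `x` at the
bottom. -/
noncomputable def braidValue (b : BraidGroup l) (x : ℕ → Finset (Fin N)) : GrpN N :=
  cocycle labAct (genValue Φ) (fun i j h hj x => genValue_comm Φ i j h hj x)
    (fun i h x => genValue_braid Φ i h x) b x

theorem braidValue_one : braidValue Φ (1 : BraidGroup l) x = 1 := cocycle_one _ _ _ _ _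

theorem braidValue_sig {j : ℕ} (h : j + 1 < l) : braidValue Φ (sig l j) x = genValue Φ j x :=
  cocycle_sig _ _ _ _ h _

theorem braidValue_mul (a b : BraidGroup l) : braidValue Φ (a * b) x =
    braidValue Φ a x * braidValue Φ b (labAct (perm a) x) := cocycle_mul _ _ _ _ _ _ _

theorem braidValue_inv (b : BraidGroup l) : braidValue Φ b⁻¹ x =
    (braidValue Φ b (labAct (perm b)⁻¹ x))⁻¹ := cocycle_inv _ _ _ _ _ _

theorem braidValue_mem (b : BraidGroup l) (x : ℕ → Finset (Fin N)) :
    braidValue Φ b x ∈ lieGroup (blueSpace N) := by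
  induction b using braid_induction generalizing x with
  | one => rw [braidValue_one]; exact one_mem _
  | gen j h =>
    rw [braidValue_sig Φ h, genValue]
    split_ifs
    · exact crossing_mem Φ _ _ _
    · exact one_mem _
  | mul a b ha hb => rw [braidValue_mul]; exact mul_mem (ha _) (hb _)
  | inv a ha => rw [braidValue_inv]; exact inv_mem (ha _)

end

end Crossings

end

section

open Color PowerSeries

/-! ### Changes of parentheses, and values of cabled and extended braids. -/

section Words

variable {N : ℕ} (Φ : Associator)

/-- The value of the change of parentheses from a parenthesised word, placed at the positions `k, …` behind
the left-normed word of the first `k` positions, to the left-normed word. -/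
noncomputable def rebracket (x : ℕ → Finset (Fin N)) : FreeMagma Color → ℕ → GrpN N
  | .of _, _ => 1
  | .mul u v, k => (phi Φ (seg x 0 k) (seg x k (letters u).length)
      (seg x (k + (letters u).length) (letters v).length))⁻¹ *
      rebracket x u k * rebracket x v (k + (letters u).length)

theorem rebracket_mul (x : ℕ → Finset (Fin N)) (u v : FreeMagma Color) (k : ℕ) :
    rebracket Φ x (u * v) k = (phi Φ (seg x 0 k) (seg x k (letters u).length)
      (seg x (k + (letters u).length) (letters v).length))⁻¹ *
      rebracket Φ x u k * rebracket Φ x v (k + (letters u).length) := rfl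

theorem rebracket_of (x : ℕ → Finset (Fin N)) (a : Color) (k : ℕ) :
    rebracket Φ x (.of a) k = 1 := rfl

theorem letters_mul (u v : FreeMagma Color) : letters (u * v) = letters u ++ letters v := rfl

theorem rebracket_mem (x : ℕ → Finset (Fin N)) (u : FreeMagma Color) :
    ∀ k, rebracket Φ x u k ∈ lieGroup (blueSpace N) := by
  induction u with
  | ih1 a => intro k; exact one_mem _
  | ih2 u v hu hv =>
    intro k
    exact mul_mem (mul_mem (inv_mem (phi_mem Φ _ _ _)) (hu _)) (hv _)

theorem rebracket_congr {x x' : ℕ → Finset (Fin N)} {u : FreeMagma Color} {k : ℕ}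
    (h : ∀ q < k + (letters u).length, x q = x' q) : rebracket Φ x u k = rebracket Φ x' u k := by
  induction u generalizing k with
  | ih1 a => rfl
  | ih2 u v hu hv =>
    change ∀ q < k + (letters u ++ letters v).length, _ at h
    rw [List.length_append] at h
    rw [rebracket_mul, rebracket_mul, hu fun q hq => h q (by omega), hv fun q hq => h q (by omega),
      seg_congr (x := x) (x' := x') (k' := 0) fun q hq => by simpa using h q (by omega),
      seg_congr (x := x) (x' := x') (k' := k) fun q hq => h _ (by omega),
      seg_congr (x := x) (x' := x') (k' := k + (letters u).length) fun q hq => h _ (by omega)]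

section

variable {x : ℕ → Finset (Fin N)}

/-- Each associator involved has the whole prefix inside its first bundle, and its other two bundles
lie behind the prefix. -/
theorem rebracket_away (hx : Disj x) (u : FreeMagma Color) {k j : ℕ} (h : j ≤ k) :
    Away (seg x 0 j) (rebracket Φ x u k) := by
  induction u generalizing k with
  | ih1 a => exact Away.one
  | ih2 u v hu hv =>
    refine (Away.mul (phi_away Φ ?_ ?_ ?_ ?_ ?_).inv (hu h)).mul (hv (by omega))
    · exact hx.seg_seg (by omega)
    · exact hx.seg_seg (by omega)
    · exact Or.inl (seg_subset le_rfl (by omega))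
    · exact Or.inr (hx.seg_seg (by omega))
    · exact Or.inr (hx.seg_seg (by omega))

theorem rebracket_inside (u : FreeMagma Color) {k j : ℕ} (h : k + (letters u).length ≤ j) :
    Inside (seg x 0 j) (rebracket Φ x u k) := by
  induction u generalizing k with
  | ih1 a => exact Inside.one
  | ih2 u v hu hv =>
    change k + (letters u ++ letters v).length ≤ j at h
    rw [List.length_append] at h
    refine (Inside.mul (phi_inside Φ ?_ ?_ ?_).inv (hu (by omega))).mul (hv (by omega))
    · exact seg_subset le_rfl (by omega)
    · exact seg_subset (by omega) (by omega)
    · exact seg_subset (by omega) (by omega)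

end

/-! ### Naturality -/

section

variable {M l : ℕ} (f : Fin M → Option (Fin N)) {x : ℕ → Finset (Fin N)}

theorem preim_seg (k n : ℕ) : preim f (seg x k n) = seg (fun p => preim f (x p)) k n := by
  induction n with
  | zero => exact preim_empty f
  | succ n ih => rw [seg, preim_union, ih]; rfl

theorem Disj.preim (hx : Disj x) : Disj fun p => preim f (x p) :=
  fun p q h => preim_disjoint f (hx p q h)

theorem unitPull_genValue (hx : Disj x) (j : ℕ) :
    unitPull f (genValue Φ j x) = genValue Φ j fun p => preim f (x p) := by
  rw [genValue_of_disj Φ hx, genValue_of_disj Φ (hx.preim f), crossing, crossing, map_mul, map_mul,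
    map_inv, unitPull_phi, unitPull_phi, unitPull_cross, preim_seg]
  all_goals first | exact hx.seg_point (by omega) | exact hx _ _ (by omega)

theorem labAct_comp {α β : Type*} (σ : Equiv.Perm (Fin l)) (y : ℕ → α) (g : α → β) :
    labAct σ (fun p => g (y p)) = fun p => g (labAct σ y p) := by
  ext p; simp only [labAct_apply]

theorem unitPull_braidValue (b : BraidGroup l) (hx : Disj x) :
    unitPull f (braidValue Φ b x) = braidValue Φ b fun p => preim f (x p) := by
  induction b using braid_induction generalizing x with
  | one => rw [braidValue_one, braidValue_one, map_one]
  | gen j h => rw [braidValue_sig Φ h, braidValue_sig Φ h, unitPull_genValue Φ f hx]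
  | mul a b ha hb =>
    rw [braidValue_mul, braidValue_mul, map_mul, ha hx, hb (hx.labAct _),
      labAct_comp _ x (MixedBraids.preim f)]
  | inv a ha =>
    rw [braidValue_inv, braidValue_inv, map_inv, ha (hx.labAct _),
      labAct_comp _ x (MixedBraids.preim f)]

theorem unitPull_rebracket (hx : Disj x) (u : FreeMagma Color) (k : ℕ) :
    unitPull f (rebracket Φ x u k) = rebracket Φ (fun p => preim f (x p)) u k := by
  induction u generalizing k with
  | ih1 a => exact map_one _
  | ih2 u v hu hv =>
    rw [rebracket_mul, rebracket_mul, map_mul, map_mul, map_inv, hu, hv, unitPull_phi, preim_seg,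
      preim_seg, preim_seg]
    all_goals exact hx.seg_seg (by omega)

end

section

variable {l : ℕ} {x x' : ℕ → Finset (Fin N)}

/-- Labels are functions on all of ℕ, but a braid on `l` strands only uses the first `l` of them.
The lemma absorbs the arbitrary choice beyond. -/
theorem braidValue_congr (b : BraidGroup l) (hx : Disj x) (hx' : Disj x')
    (h : ∀ p < l, x p = x' p) : braidValue Φ b x = braidValue Φ b x' := by
  have H : ∀ (σ : Equiv.Perm (Fin l)) (x x' : ℕ → Finset (Fin N)), (∀ p < l, x p = x' p) →
      ∀ p < l, labAct σ x p = labAct σ x' p := by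
    intro σ x x' h p hp
    rw [labAct_apply, labAct_apply]
    rw [show p = (⟨p, hp⟩ : Fin l).val from rfl, extPerm_val]
    exact h _ (Fin.isLt _)
  induction b using braid_induction generalizing x x' with
  | one => rw [braidValue_one, braidValue_one]
  | gen j hj =>
    rw [braidValue_sig Φ hj, braidValue_sig Φ hj, genValue_of_disj Φ hx, genValue_of_disj Φ hx',
      h j (by omega), h _ hj, seg_congr fun q hq => h _ (by omega)]
  | mul a b ha hb =>
    rw [braidValue_mul, braidValue_mul, ha hx hx' h, hb (hx.labAct _) (hx'.labAct _) (H _ _ _ h)]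
  | inv a ha =>
    rw [braidValue_inv, braidValue_inv,
      ha (hx.labAct _) (hx'.labAct _) (H _ _ _ h)]

end

/-! ### Cabling -/

/-- The labels at the positions `i` and `i + 1` are united. -/
def merge (i : ℕ) (y : ℕ → Finset (Fin N)) (p : ℕ) : Finset (Fin N) :=
  if p < i then y p else if p = i then y i ∪ y (i + 1) else y (p + 1)

/-- The change of parentheses that joins the positions `i` and `i + 1`. -/
noncomputable def mergePhi (i : ℕ) (y : ℕ → Finset (Fin N)) : GrpN N :=
  phi Φ (seg y 0 i) (y i) (y (i + 1))

section

variable {l : ℕ} {y : ℕ → Finset (Fin N)}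

theorem Disj.merge (hy : Disj y) (i : ℕ) : Disj (merge i y) := by
  intro p q h
  unfold MixedBraids.merge
  split_ifs <;> first
    | exact hy _ _ (by omega)
    | exact Finset.disjoint_union_left.2 ⟨hy _ _ (by omega), hy _ _ (by omega)⟩
    | exact Finset.disjoint_union_right.2 ⟨hy _ _ (by omega), hy _ _ (by omega)⟩
    | omega

theorem seg_merge_of_le {i k n : ℕ} (h : k + n ≤ i) : seg (merge i y) k n = seg y k n :=
  seg_congr fun q hq => by rw [merge, if_pos (by omega)]

theorem seg_merge_of_lt {i k n : ℕ} (h : i < k) : seg (merge i y) k n = seg y (k + 1) n :=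
  seg_congr fun q hq => by
    rw [merge, if_neg (by omega), if_neg (by omega)]; congr 1; omega

theorem seg_merge_of_mem {i k n : ℕ} (h : k ≤ i) (h' : i < k + n) :
    seg (merge i y) k n = seg y k (n + 1) := by
  obtain ⟨m, rfl⟩ := Nat.exists_eq_add_of_le h
  obtain ⟨r, rfl⟩ := Nat.exists_eq_add_of_le (show m + 1 ≤ n by omega)
  rw [show m + 1 + r + 1 = m + 2 + r by omega, seg_add, seg_add y k (m + 2), seg_add _ k m 1,
    seg_add y k m 2, seg_merge_of_le (k := k) (n := m) (by omega),
    seg_merge_of_lt (k := k + (m + 1)) (by omega)]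
  simp [seg, merge, add_assoc]

theorem mergePhi_away (hy : Disj y) {i j : ℕ} (h : j ≤ i) : Away (seg y 0 j) (mergePhi Φ i y) := by
  refine phi_away Φ ?_ ?_ ?_ ?_ ?_
  · exact hy.seg_point (by omega)
  · exact hy _ _ (by omega)
  · exact Or.inl (seg_subset le_rfl (by omega))
  · exact Or.inr (hy.seg_point (by omega))
  · exact Or.inr (hy.seg_point (by omega))

theorem mergePhi_inside {i j : ℕ} (h : i + 2 ≤ j) : Inside (seg y 0 j) (mergePhi Φ i y) :=
  phi_inside Φ (seg_subset le_rfl (by omega)) (point_subset (by omega) (by omega))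
    (point_subset (by omega) (by omega))

theorem double_one (i : Fin l) : double (1 : BraidGroup l) i = 1 := cocycle_one _ _ _ _ _

theorem double_inv (b : BraidGroup l) (i : Fin l) :
    double b⁻¹ i = (double b ((perm b)⁻¹ i))⁻¹ := cocycle_inv _ _ _ _ _ _

theorem doubleGen_lt {j i : ℕ} (h : i < j) : doubleGen l j i = sig (l + 1) (j + 1) := if_pos h

theorem doubleGen_left {j : ℕ} : doubleGen l j j = sig (l + 1) (j + 1) * sig (l + 1) j := by
  rw [doubleGen, if_neg (by omega), if_pos rfl]

theorem doubleGen_right {j : ℕ} :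
    doubleGen l j (j + 1) = sig (l + 1) j * sig (l + 1) (j + 1) := by
  rw [doubleGen, if_neg (by omega), if_neg (by omega), if_pos rfl]

theorem doubleGen_gt {j i : ℕ} (h : j + 1 < i) : doubleGen l j i = sig (l + 1) j := by
  rw [doubleGen, if_neg (by omega), if_neg (by omega), if_neg (by omega)]

theorem labAct_perm_mul {α : Type*} (a b : BraidGroup l) (x : ℕ → α) :
    labAct (perm (a * b)) x = labAct (perm b) (labAct (perm a) x) := by
  rw [perm_mul, show (perm a).trans (perm b) = perm b * perm a from rfl, map_mul]; rfl

theorem labAct_inv_right {α : Type*} (σ : Equiv.Perm (Fin l)) (x : ℕ → α) :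
    labAct σ (labAct σ⁻¹ x) = x := by
  rw [← Equiv.Perm.mul_apply, ← map_mul, mul_inv_cancel, map_one]; rfl

/-- Needed to chain the cabling formula over a product: the labels that the second factor meets must
again be merged labels, at the place to which the first factor has carried the cable. -/
theorem merge_labAct_double (b : BraidGroup l) (i : Fin l) (y : ℕ → Finset (Fin N)) :
    merge (perm b i) (labAct (perm (double b i)) y) = labAct (perm b) (merge i y) := by
  induction b using braid_induction generalizing i y with
  | one => rw [double_one, perm_one, perm_one, map_one, map_one]; rfl
  | gen j h =>
    rw [double_sig h, perm_sig h]
    have hj : j + 1 < l + 1 := by omega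
    have hj' : j + 1 + 1 < l + 1 := by omega
    ext1 p
    rw [labAct_sw h]
    unfold merge
    rw [sw_val h]
    rcases lt_trichotomy i.val j with hi | hi | hi
    · rw [doubleGen_lt hi, perm_sig hj']
      simp only [labAct_sw hj']
      grind
    · rw [hi, doubleGen_left, labAct_perm_mul, perm_sig hj', perm_sig hj]
      simp only [labAct_sw hj', labAct_sw hj]
      grind [Finset.union_comm]
    · rcases Nat.lt_or_ge (j + 1) i with hi' | hi'
      · rw [doubleGen_gt hi', perm_sig hj]
        simp only [labAct_sw hj]
        grind
      · rw [show i.val = j + 1 by omega, doubleGen_right, labAct_perm_mul, perm_sig hj', perm_sig hj]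
        simp only [labAct_sw hj', labAct_sw hj]
        grind [Finset.union_comm]
  | mul a b ha hb =>
    rw [double_mul, labAct_perm_mul, labAct_perm_mul, ← ha, ← hb, perm_mul]; rfl
  | inv a ha =>
    rw [double_inv, perm_inv, perm_inv]
    have := ha ((perm a)⁻¹ i) (labAct (perm (double a ((perm a)⁻¹ i)))⁻¹ y)
    rw [← Equiv.Perm.mul_apply (perm a), mul_inv_cancel, labAct_inv_right] at this
    refine (labAct (perm a)).injective ?_
    rw [← Equiv.Perm.inv_def (perm a), labAct_inv_right, ← Equiv.Perm.inv_def, ← this]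
    rfl

/-- For a generator there are four places for the cable. To the left of the crossing its associator
lies inside the prefix of the crossing, and to the right the crossing lies inside the prefix of the
associator; in both cases the two commute. At the crossing the two cabling formulas apply. In a
product the associators in the middle cancel. -/
theorem braidValue_double (b : BraidGroup l) (i : Fin l) (hy : Disj y) :
    braidValue Φ b (merge i y) = (mergePhi Φ i y)⁻¹ * braidValue Φ (double b i) y *
      mergePhi Φ (perm b i) (labAct (perm (double b i)) y) := by
  induction b using braid_induction generalizing i y with
  | one => rw [double_one, perm_one, perm_one, map_one, braidValue_one, braidValue_one]; simp
  | gen j h =>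
    have hj : j + 1 < l + 1 := by omega
    have hj' : j + 1 + 1 < l + 1 := by omega
    rw [double_sig h, perm_sig h, braidValue_sig Φ h, genValue_of_disj Φ (hy.merge _), sw_val h]
    rcases lt_trichotomy i.val j with hi | hi | hi
    · have e : mergePhi Φ i (labAct (sw (l + 1) (j + 1)) y) = mergePhi Φ i y := by
        unfold mergePhi
        rw [seg_labAct_sw_of_not_mem hj' (by omega), labAct_sw hj', labAct_sw hj']
        congr 2 <;> grind
      have c := mergePhi_inside Φ (y := y) (show i.val + 2 ≤ j + 1 by omega) _
        (crossing_away Φ (P := seg y 0 (j + 1)) (a := y (j + 1)) (b := y (j + 1 + 1))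
          (hy.seg_point (by omega)) (hy.seg_point (by omega)) (hy _ _ (by omega)) (.inl le_rfl)
          (.inr (hy.seg_point (by omega))) (.inr (hy.seg_point (by omega))))
      rw [doubleGen_lt hi, perm_sig hj', braidValue_sig Φ hj', genValue_of_disj Φ hy,
        seg_merge_of_mem (by omega) (by omega), if_neg (by omega), if_neg (by omega), e, mul_assoc,
        ← c.eq, inv_mul_cancel_left]
      congr 2 <;> (unfold merge; grind)
    · have := crossing_cable_left Φ (P := seg y 0 j) (a := y j) (b := y (j + 1)) (c := y (j + 2))
        (hy.seg_point (by omega)) (hy.seg_point (by omega)) (hy.seg_point (by omega))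
        (hy _ _ (by omega)) (hy _ _ (by omega)) (hy _ _ (by omega))
      rw [hi, doubleGen_left, labAct_perm_mul, perm_sig hj', perm_sig hj, braidValue_mul,
        braidValue_sig Φ hj', braidValue_sig Φ hj, perm_sig hj', genValue_of_disj Φ hy,
        genValue_of_disj Φ (hy.labAct _), seg_merge_of_le (by omega), if_pos rfl]
      rw [seg_labAct_sw_of_not_mem hj' (by omega), mergePhi, mergePhi, seg_succ_labAct_sw hj,
        seg_labAct_sw_of_not_mem hj' (by omega)]
      simp only [merge, seg, labAct_sw hj, labAct_sw hj', lt_irrefl, if_true, if_false,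
        show j ≠ j + 1 by omega, show j ≠ j + 1 + 1 by omega, show j + 1 ≠ j by omega,
        show j + 1 + 1 ≠ j by omega, show j + 1 + 1 ≠ j + 1 by omega, show ¬ j + 1 < j by omega,
        show j + 1 ≠ j + 1 + 1 by omega, show j < j + 1 by omega, zero_add]
      exact this
    · rcases Nat.lt_or_ge (j + 1) i with hi' | hi'
      · have e : mergePhi Φ i (labAct (sw (l + 1) j) y) = mergePhi Φ i y := by
          unfold mergePhi
          rw [seg_labAct_sw_of_mem hj (by omega) (by omega), labAct_sw hj, labAct_sw hj]
          congr 2 <;> grind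
        have c := crossing_inside Φ (P := seg y 0 j) (a := y j) (b := y (j + 1))
          (seg_subset le_rfl (by omega)) (point_subset (by omega) (by omega))
          (point_subset (by omega) (by omega)) _
          (mergePhi_away Φ hy (i := i.val) (j := j + 2) (by omega))
        rw [doubleGen_gt hi', perm_sig hj, braidValue_sig Φ hj, genValue_of_disj Φ hy,
          seg_merge_of_le (by omega), if_neg (by omega), if_neg (by omega), e, mul_assoc,
          c.eq, inv_mul_cancel_left, merge, if_pos hi, merge, if_pos hi']
      · have := crossing_cable_right Φ (P := seg y 0 j) (c := y j) (a := y (j + 1)) (b := y (j + 1 + 1))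
          (hy.seg_point (by omega)) (hy.seg_point (by omega)) (hy.seg_point (by omega))
          (hy _ _ (by omega)) (hy _ _ (by omega)) (hy _ _ (by omega))
        rw [show i.val = j + 1 by omega, doubleGen_right, labAct_perm_mul, perm_sig hj', perm_sig hj,
          braidValue_mul, braidValue_sig Φ hj', braidValue_sig Φ hj, perm_sig hj,
          genValue_of_disj Φ hy, genValue_of_disj Φ (hy.labAct _), seg_merge_of_le (by omega),
          if_neg (by omega), if_pos rfl]
        rw [seg_succ_labAct_sw hj, mergePhi, mergePhi, seg_labAct_sw_of_not_mem hj' (by omega),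
          seg_labAct_sw_of_not_mem hj (by omega)]
        simp only [merge, seg, labAct_sw hj, labAct_sw hj', lt_irrefl, if_true, if_false,
        show j ≠ j + 1 by omega, show j ≠ j + 1 + 1 by omega, show j + 1 ≠ j by omega,
        show j + 1 + 1 ≠ j by omega, show j + 1 + 1 ≠ j + 1 by omega, show ¬ j + 1 < j by omega,
        show j + 1 ≠ j + 1 + 1 by omega, show j < j + 1 by omega, zero_add]
        exact this
  | mul a b ha hb =>
    rw [double_mul, braidValue_mul, braidValue_mul, labAct_perm_mul, ← merge_labAct_double, ha _ hy,
      hb _ (hy.labAct _), perm_mul]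
    simp only [mul_assoc, mul_inv_cancel_left]; rfl
  | inv a ha =>
    have h1 := ha ((perm a)⁻¹ i) (hy.labAct (perm (double a ((perm a)⁻¹ i)))⁻¹)
    have h2 := merge_labAct_double a ((perm a)⁻¹ i) (labAct (perm (double a ((perm a)⁻¹ i)))⁻¹ y)
    rw [← Equiv.Perm.mul_apply (perm a), mul_inv_cancel, labAct_inv_right, Equiv.Perm.one_apply]
      at h1 h2
    have h3 : merge ((perm a)⁻¹ i) (labAct (perm (double a ((perm a)⁻¹ i)))⁻¹ y) =
        labAct (perm a)⁻¹ (merge i y) := by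
      refine (labAct (perm a)).injective ?_
      rw [← h2, labAct_inv_right]
    rw [double_inv, braidValue_inv, braidValue_inv, perm_inv, perm_inv, ← h3, h1, mul_inv_rev,
      mul_inv_rev, inv_inv, mul_assoc]
    rfl

theorem rebracket_merge_of_le (u : FreeMagma Color) {i k : ℕ} (h : k + (letters u).length ≤ i) :
    rebracket Φ (merge i y) u k = rebracket Φ y u k :=
  rebracket_congr Φ fun q hq => by rw [merge, if_pos (by omega)]

theorem rebracket_merge_of_lt (u : FreeMagma Color) {i k : ℕ} (h : i < k) :
    rebracket Φ (merge i y) u k = rebracket Φ y u (k + 1) := by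
  induction u generalizing k with
  | ih1 a => rfl
  | ih2 u v hu hv =>
    rw [rebracket_mul, rebracket_mul, hu h, hv (by omega),
      seg_merge_of_mem (k := 0) (n := k) (by omega) (by omega), seg_merge_of_lt h,
      seg_merge_of_lt (k := k + (letters u).length) (by omega), add_right_comm]

/-- The word in which the letter at a given position is doubled. -/
abbrev doubleWord : FreeMagma Color → ℕ → FreeMagma Color := subst fun a => .of a * .of a

theorem length_doubleWord (u : FreeMagma Color) (i : ℕ) :
    (letters (doubleWord u i)).length = (letters u).length + 1 := length_subst _ 1 (fun _ => rfl) u i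

theorem subst_mul (g : Color → FreeMagma Color) (u v : FreeMagma Color) (i : ℕ) :
    subst g (u * v) i = if i < (letters u).length then subst g u i * v
      else u * subst g v (i - (letters u).length) := rfl

/-- The associators of the original word see the pair `(aa)` as one bundle; the only new one is the
innermost, inverse to `mergePhi`. It is brought to the end past the changes of parentheses further
to the right, for which the pair belongs to the prefix. -/
theorem rebracket_double (hy : Disj y) (u : FreeMagma Color) {i k : ℕ}
    (h : i < (letters u).length) : rebracket Φ y (doubleWord u i) k =
      rebracket Φ (merge (k + i) y) u k * (mergePhi Φ (k + i) y)⁻¹ := by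
  induction u generalizing i k with
  | ih1 a =>
    change i < 1 at h
    obtain rfl : i = 0 := by omega
    change rebracket Φ y (.of a * .of a) k = _
    rw [rebracket_mul, rebracket_of, rebracket_of, rebracket_of]
    simp [letters, seg_one, mergePhi]
  | ih2 u v hu hv =>
    change rebracket Φ y (subst _ (u * v) i) k = rebracket Φ _ (u * v) k * _
    rw [subst_mul]
    split_ifs with hi
    · have c := mergePhi_inside Φ (y := y) (i := k + i) le_rfl _
        (rebracket_away Φ hy v (j := k + i + 2) (k := k + ((letters u).length + 1)) (by omega))
      rw [rebracket_mul, rebracket_mul, hu hi, length_doubleWord, rebracket_merge_of_lt Φ v (by omega),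
        seg_merge_of_le (by omega), seg_merge_of_mem (by omega) (by omega),
        seg_merge_of_lt (by omega), ← mul_assoc, mul_assoc _ _ (rebracket Φ y v _), c.inv_left.eq]
      simp only [← mul_assoc, ← add_assoc]
    · change i < (letters u ++ letters v).length at h
      rw [List.length_append] at h
      rw [rebracket_mul, rebracket_mul, hv (by omega), length_doubleWord,
        rebracket_merge_of_le Φ u (by omega),
        seg_merge_of_le (by omega), seg_merge_of_le (by omega),
        seg_merge_of_mem (by omega) (by omega), ← mul_assoc,
        show k + (letters u).length + (i - (letters u).length) = k + i by omega]

end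

/-! ### Extension on the left and on the right -/

section

variable {l : ℕ} {y : ℕ → Finset (Fin N)}

theorem addLeft_sig {j : ℕ} (h : j + 1 < l) : addLeft (sig l j) = sig (l + 1) (j + 1) :=
  braidLift_sig _ _ _ h

theorem addRight_sig {j : ℕ} (h : j + 1 < l) : addRight (sig l j) = sig (l + 1) j :=
  braidLift_sig _ _ _ h

/-- The labels without the first one. -/
def tail {β : Type*} (y : ℕ → β) (p : ℕ) : β := y (p + 1)

/-- The change of parentheses that moves the first letter behind the left-normed word of the letters that
follow it, restricted to the letters `k, …, k + n - 1`. -/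
noncomputable def tailPhi (y : ℕ → Finset (Fin N)) (k : ℕ) : ℕ → GrpN N
  | 0 => 1
  | n + 1 => tailPhi y k n * phi Φ (y 0) (seg y 1 (k + n)) (y (k + n + 1))

theorem tailPhi_add (y : ℕ → Finset (Fin N)) (k m n : ℕ) :
    tailPhi Φ y k (m + n) = tailPhi Φ y k m * tailPhi Φ y (k + m) n := by
  induction n with
  | zero => simp [tailPhi]
  | succ n ih => rw [← add_assoc, tailPhi, ih, tailPhi, mul_assoc, ← add_assoc]

theorem tailPhi_one (y : ℕ → Finset (Fin N)) (k : ℕ) :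
    tailPhi Φ y k 1 = phi Φ (y 0) (seg y 1 k) (y (k + 1)) := by
  simp [tailPhi]

theorem tailPhi_inside {k n j : ℕ} (h : k + n + 1 ≤ j) : Inside (seg y 0 j) (tailPhi Φ y k n) := by
  induction n with
  | zero => exact Inside.one
  | succ n ih =>
    exact (ih (by omega)).mul (phi_inside Φ (point_subset (by omega) (by omega))
      (seg_subset (by omega) (by omega)) (point_subset (by omega) (by omega)))

theorem tailPhi_away (hy : Disj y) {k n j : ℕ} (h : j ≤ k) : Away (seg y 1 j) (tailPhi Φ y k n) := by
  induction n with
  | zero => exact Away.one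
  | succ n ih =>
    refine ih.mul (phi_away Φ ?_ ?_ ?_ ?_ ?_)
    · exact (hy.seg_point (by omega)).symm
    · exact hy.seg_point (by omega)
    · exact Or.inr (hy.seg_point (by omega))
    · exact Or.inl (seg_subset le_rfl (by omega))
    · exact Or.inr (hy.seg_point (by omega))

theorem seg_tail (y : ℕ → Finset (Fin N)) (k n : ℕ) : seg (tail y) k n = seg y (k + 1) n :=
  seg_congr fun q hq => by rw [tail, add_right_comm]

theorem Disj.tail (hy : Disj y) : Disj (tail y) := fun p q h => hy _ _ (by omega)

theorem tail_labAct_addLeft {α : Type*} (b : BraidGroup l) (y : ℕ → α) :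
    tail (labAct (perm (addLeft b)) y) = labAct (perm b) (tail y) ∧
      labAct (perm (addLeft b)) y 0 = y 0 := by
  induction b using braid_induction generalizing y with
  | one => rw [map_one, perm_one, perm_one, map_one, map_one]; exact ⟨rfl, rfl⟩
  | gen j h =>
    have hj : j + 1 + 1 < l + 1 := by omega
    rw [addLeft_sig h, perm_sig h, perm_sig hj]
    refine ⟨?_, ?_⟩
    · ext1 p
      unfold tail
      rw [labAct_sw h, labAct_sw hj]
      grind
    · rw [labAct_sw hj]; grind
  | mul a b ha hb =>
    rw [map_mul, labAct_perm_mul, labAct_perm_mul, (hb _).1, (hb _).2, (ha _).1, (ha _).2]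
    exact ⟨rfl, rfl⟩
  | inv a ha =>
    have := ha (labAct (perm (addLeft a))⁻¹ y)
    rw [labAct_inv_right] at this
    rw [map_inv, perm_inv, perm_inv]
    refine ⟨(labAct (perm a)).injective ?_, this.2.symm⟩
    rw [← Equiv.Perm.inv_def (perm a), labAct_inv_right, ← Equiv.Perm.inv_def, ← this.1]

theorem tailPhi_congr {y y' : ℕ → Finset (Fin N)} {k n : ℕ} (h0 : y 0 = y' 0)
    (h1 : ∀ q < n, seg y 1 (k + q) = seg y' 1 (k + q))
    (h2 : ∀ q < n, y (k + q + 1) = y' (k + q + 1)) : tailPhi Φ y k n = tailPhi Φ y' k n := by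
  induction n with
  | zero => rfl
  | succ n ih =>
    rw [tailPhi, tailPhi, ih (fun q hq => h1 q (by omega)) fun q hq => h2 q (by omega), h0,
      h1 n (by omega), h2 n (by omega)]

/-- `tailPhi` takes the new letter out of the left-normed word, one associator per letter. At a
crossing, the earlier associators lie inside its prefix, the later ones see its two strands in one
bundle, and the two in between are absorbed by `crossing_prefix`. -/
theorem braidValue_addLeft (b : BraidGroup l) (hy : Disj y) :
    braidValue Φ (addLeft b) y = tailPhi Φ y 0 l * braidValue Φ b (tail y) *
      (tailPhi Φ (labAct (perm (addLeft b)) y) 0 l)⁻¹ := by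
  induction b using braid_induction generalizing y with
  | one => rw [map_one, perm_one, map_one, braidValue_one, braidValue_one]; simp
  | gen j h =>
    have hj : j + 1 + 1 < l + 1 := by omega
    -- Writing `l = j + 2 + r` cuts `tailPhi` into the factors before, at and after the crossing.
    obtain ⟨r, rfl⟩ := Nat.exists_eq_add_of_le (show j + 2 ≤ l by omega)
    have e : tailPhi Φ (labAct (sw (j + 2 + r + 1) (j + 1)) y) 0 j = tailPhi Φ y 0 j := by
      refine tailPhi_congr Φ ?_ (fun q hq => seg_labAct_sw_of_not_mem hj (by omega)) fun q hq => ?_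
      · rw [labAct_sw hj]; grind
      · rw [labAct_sw hj]; grind
    have e' : tailPhi Φ (labAct (sw (j + 2 + r + 1) (j + 1)) y) (j + 2) r =
        tailPhi Φ y (j + 2) r := by
      refine tailPhi_congr Φ ?_ (fun q hq => seg_labAct_sw_of_mem hj (by omega) (by omega))
        fun q hq => ?_
      · rw [labAct_sw hj]; grind
      · rw [labAct_sw hj]; grind
    have c := tailPhi_inside Φ (y := y) (k := 0) (n := j) (j := j + 1) (by omega) _
      (crossing_away Φ (P := seg y 0 (j + 1)) (a := y (j + 1)) (b := y (j + 1 + 1))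
          (hy.seg_point (by omega)) (hy.seg_point (by omega)) (hy _ _ (by omega)) (.inl le_rfl)
          (.inr (hy.seg_point (by omega))) (.inr (hy.seg_point (by omega))))
    have c' := crossing_inside Φ (P := seg y 1 j) (a := y (j + 1)) (b := y (j + 1 + 1))
      (seg_subset le_rfl (by omega)) (point_subset (by omega) (by omega))
      (point_subset (by omega) (by omega)) _
      (tailPhi_away Φ hy (j := j + 2) (k := j + 2) (n := r) (by omega))
    have := crossing_prefix Φ (L := y 0) (P := seg y 1 j) (a := y (j + 1)) (b := y (j + 1 + 1))
      (hy.seg_point (by omega)).symm (hy _ _ (by omega)) (hy _ _ (by omega))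
      (hy.seg_point (by omega)) (hy.seg_point (by omega)) (hy _ _ (by omega))
    rw [← seg_one y 0, ← seg_add y 0 1 j, seg_one, add_comm 1 j] at this
    have t1 : tailPhi Φ y j 2 =
        phi Φ (y 0) (seg y 1 j) (y (j + 1)) * phi Φ (y 0) (seg y 1 j ∪ y (j + 1)) (y (j + 1 + 1)) := by
      simp only [tailPhi, seg, add_zero, one_mul, add_comm 1 j]
    have t2 : tailPhi Φ (labAct (sw (j + 2 + r + 1) (j + 1)) y) j 2 =
        phi Φ (y 0) (seg y 1 j) (y (j + 1 + 1)) *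
          phi Φ (y 0) (seg y 1 j ∪ y (j + 1 + 1)) (y (j + 1)) := by
      simp only [tailPhi, seg, add_zero, one_mul, add_comm 1 j, labAct_sw hj, if_true,
        show 0 ≠ j + 1 by omega, show 0 ≠ j + 1 + 1 by omega, show j + 1 + 1 ≠ j + 1 by omega,
        if_false, seg_labAct_sw_of_not_mem hj (show 1 + j ≤ j + 1 ∨ j + 1 + 2 ≤ 1 by omega)]
    rw [addLeft_sig h, perm_sig hj, braidValue_sig Φ hj, braidValue_sig Φ h, genValue_of_disj Φ hy,
      genValue_of_disj Φ hy.tail, tailPhi_add Φ y 0 (j + 2) r, tailPhi_add Φ y 0 j 2,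
      tailPhi_add Φ _ 0 (j + 2) r, tailPhi_add Φ _ 0 j 2, e, zero_add, zero_add, e', seg_tail, t1, t2]
    change _ = _ * crossing Φ (seg y 1 j) (y (j + 1)) (y (j + 1 + 1)) * _
    rw [← this] at c ⊢
    rw [mul_assoc _ (tailPhi Φ y (j + 2) r), ← c'.eq]
    symm
    calc _ = tailPhi Φ y 0 j * (phi Φ (y 0) (seg y 1 j) (y (j + 1)) *
            phi Φ (y 0) (seg y 1 j ∪ y (j + 1)) (y (j + 1 + 1)) *
            crossing Φ (seg y 1 j) (y (j + 1)) (y (j + 1 + 1)) *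
            (phi Φ (y 0) (seg y 1 j ∪ y (j + 1 + 1)) (y (j + 1)))⁻¹ *
            (phi Φ (y 0) (seg y 1 j) (y (j + 1 + 1)))⁻¹) * (tailPhi Φ y 0 j)⁻¹ := by group
      _ = _ := by rw [c.eq, mul_inv_cancel_right]
  | mul a b ha hb =>
    rw [map_mul, braidValue_mul, braidValue_mul, labAct_perm_mul, ha hy, hb (hy.labAct _),
      (tail_labAct_addLeft a y).1]
    group
  | inv a ha =>
    have h1 := ha (hy.labAct (perm (addLeft a))⁻¹)
    have h2 := (tail_labAct_addLeft a (labAct (perm (addLeft a))⁻¹ y)).1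
    rw [labAct_inv_right] at h1 h2
    have h3 : tail (labAct (perm (addLeft a))⁻¹ y) = labAct (perm a)⁻¹ (tail y) := by
      refine (labAct (perm a)).injective ?_
      rw [← h2, labAct_inv_right]
    rw [map_inv, braidValue_inv, braidValue_inv, ← h3, h1, perm_inv]
    simp only [mul_inv_rev, inv_inv, mul_assoc]
    rfl

/-- The inductive step for a product of two words, in an arbitrary group: `p` is a pentagon, and
`c1`, `c2` exchange changes of parentheses of which one sees the other inside a bundle. -/
theorem rebracket_tail_aux {G : Type*} [Group G] {ru rv tu tv q a b e f ru' rv' : G}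
    (h1 : ru * tu = a * ru') (h2 : rv * tv = b * rv') (c1 : Commute tu rv) (c2 : Commute ru' b)
    (p : a * b * f = q * e) : q⁻¹ * ru * rv * (tu * tv) = e * (f⁻¹ * ru' * rv') := by
  calc q⁻¹ * ru * rv * (tu * tv) = q⁻¹ * ru * (rv * tu) * tv := by group
    _ = q⁻¹ * (ru * tu) * (rv * tv) := by rw [← c1.eq]; group
    _ = q⁻¹ * a * (ru' * b) * rv' := by rw [h1, h2]; group
    _ = q⁻¹ * (a * b * f) * f⁻¹ * ru' * rv' := by rw [c2.eq]; group
    _ = _ := by rw [p]; group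

/-- Coherence of two routes: the letter `y 0` is taken out after the word `u` has been made
left-normed, or before. For `k = 0` the associator on the right is trivial, which is the case used
for extensions on the left. -/
theorem rebracket_tail (hy : Disj y) (u : FreeMagma Color) (k : ℕ) :
    rebracket Φ y u (k + 1) * tailPhi Φ y k (letters u).length =
      phi Φ (y 0) (seg y 1 k) (seg y (k + 1) (letters u).length) * rebracket Φ (tail y) u k := by
  induction u generalizing k with
  | ih1 a =>
    change 1 * tailPhi Φ y k 1 = phi Φ (y 0) _ (seg y (k + 1) 1) * 1
    rw [tailPhi_one, seg_one, one_mul, mul_one]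
  | ih2 u v hu hv =>
    change rebracket Φ y (u * v) (k + 1) * tailPhi Φ y k (letters u ++ letters v).length =
      phi Φ (y 0) _ (seg y (k + 1) (letters u ++ letters v).length) * rebracket Φ (tail y) (u * v) k
    have p := pentagon Φ (W := y 0) (S := seg y 1 k) (T := seg y (k + 1) (letters u).length)
      (U := seg y (k + 1 + (letters u).length) (letters v).length)
      (hy.seg_point (by omega)).symm (hy.seg_point (by omega)).symm (hy.seg_point (by omega)).symm
      (hy.seg_seg (by omega)) (hy.seg_seg (by omega)) (hy.seg_seg (by omega))
    have c1 := tailPhi_inside Φ (y := y) (k := k) (n := (letters u).length) le_rfl _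
      (rebracket_away Φ hy v (k := k + 1 + (letters u).length) (by omega))
    have c2 := rebracket_inside Φ (x := tail y) u (k := k) le_rfl _ (phi_away Φ (S := y 0)
      (T := seg (tail y) 0 (k + (letters u).length))
      (U := seg y (k + 1 + (letters u).length) (letters v).length) ?_ ?_ ?_ (.inl le_rfl) ?_)
    have h1 := hu k
    have h2 := hv (k + (letters u).length)
    rw [seg_tail, zero_add] at c2
    rw [show k + (letters u).length + 1 = k + 1 + (letters u).length by omega] at h2
    have e : seg y 0 (k + 1) = y 0 ∪ seg y 1 k := by rw [add_comm k, seg_add, seg_one]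
    have e' : seg y 1 k ∪ seg y (k + 1) (letters u).length = seg y 1 (k + (letters u).length) := by
      rw [seg_add, add_comm k 1]
    rw [e'] at p
    rw [List.length_append, tailPhi_add, seg_add y (k + 1), rebracket_mul, rebracket_mul, seg_tail, seg_tail,
      seg_tail, zero_add, e, add_right_comm k _ 1]
    · exact rebracket_tail_aux h1 h2 c1 c2 p
    · rw [seg_tail, zero_add]; exact (hy.seg_point (by omega)).symm
    · rw [seg_tail, zero_add]; exact hy.seg_seg (by omega)
    · rw [seg_tail, zero_add]; exact .inr (hy.seg_point (by omega))
    · rw [seg_tail, zero_add]; exact .inr (hy.seg_seg (by omega))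

theorem labAct_addRight {α : Type*} (b : BraidGroup l) (y : ℕ → α) :
    labAct (perm (addRight b)) y = labAct (perm b) y := by
  induction b using braid_induction generalizing y with
  | one => rw [map_one, perm_one, perm_one, map_one, map_one]
  | gen j h =>
    have hj : j + 1 < l + 1 := by omega
    rw [addRight_sig h, perm_sig h, perm_sig hj]
    ext1 p
    rw [labAct_sw h, labAct_sw hj]
  | mul a b ha hb => rw [map_mul, labAct_perm_mul, labAct_perm_mul, ha, hb]
  | inv a ha =>
    rw [map_inv, perm_inv, perm_inv]
    refine (labAct (perm a)).injective ?_
    rw [← Equiv.Perm.inv_def (perm a), labAct_inv_right, ← Equiv.Perm.inv_def, ← ha,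
      labAct_inv_right]

/-- No associator appears, because a crossing only depends on what lies to its left. -/
theorem braidValue_addRight (b : BraidGroup l) (y : ℕ → Finset (Fin N)) :
    braidValue Φ (addRight b) y = braidValue Φ b y := by
  induction b using braid_induction generalizing y with
  | one => rw [map_one, braidValue_one, braidValue_one]
  | gen j h => rw [addRight_sig h, braidValue_sig Φ h, braidValue_sig Φ (by omega)]
  | mul a b ha hb => rw [map_mul, braidValue_mul, braidValue_mul, ha, hb, labAct_addRight]
  | inv a ha =>
    rw [map_inv, braidValue_inv, braidValue_inv, ha]
    congr 2
    refine (labAct (perm a)).injective ?_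
    rw [labAct_inv_right, ← labAct_addRight, labAct_inv_right]

end

end Words

end

section

open Color

/-! ### Removing strands, and its compatibility with extension and cabling. -/

section Forget

variable {l m : ℕ} {β : Type*}

theorem labAct_injective_iff (σ : Equiv.Perm (Fin l)) {x y : ℕ → β} :
    labAct σ x = labAct σ y ↔ x = y := (labAct σ).injective.eq_iff

theorem col_colAct (σ : Equiv.Perm (Fin l)) (c : Fin l → Color) :
    col (colAct σ c) = labAct σ (col c) := by
  ext1 p
  rcases Nat.lt_or_ge p l with h | h
  · rw [labAct_apply, show p = (⟨p, h⟩ : Fin l).val from rfl, extPerm_val, col_val, col_val]; rfl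
  · rw [labAct_ge _ _ h, col, col, dif_neg (by omega), dif_neg (by omega)]

theorem rank_lt {c : Fin l → Color} {p q : ℕ} (h : p < q) (hp : col c p = red) :
    rank c p < rank c q := by
  have := rank_mono c h
  rw [rank_succ, if_pos hp] at this; omega

theorem lt_of_red {c : Fin l → Color} {p : ℕ} (h : col c p = red) : p < l := by
  by_contra h'
  rw [col, dif_neg h'] at h; cases h

theorem rank_lt_redCount {c : Fin l → Color} {p : ℕ} (hp : col c p = red) :
    rank c p < redCount c := rank_lt (lt_of_red hp) hp

/-- The labelling of the positions of a word for which the red letters are labelled by `z` and the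
other letters by `e`. -/
def expand (e : β) (c : Fin l → Color) (z : ℕ → β) (p : ℕ) : β :=
  if col c p = red then z (rank c p) else e

theorem forgetGen_red {c : Fin l → Color} {j : ℕ} (hm : redCount c = m) (h1 : col c j = red)
    (h2 : col c (j + 1) = red) : forgetGen l m j c = sig m (rank c j) := if_pos ⟨hm, h1, h2⟩

theorem forgetGen_one {c : Fin l → Color} {j : ℕ} (h : ¬ (col c j = red ∧ col c (j + 1) = red)) :
    forgetGen l m j c = 1 := if_neg fun h' => h h'.2

theorem colAct_inv_right (σ : Equiv.Perm (Fin l)) (c : Fin l → Color) :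
    colAct σ (colAct σ.symm c) = c := by ext x; simp [colAct_apply]

/-- Labels attached to the red letters through their ranks move along `b` as they move along the
braid that remains of it. A crossing of two red strands exchanges two consecutive ranks; any other
crossing leaves the order of the red letters as it is. -/
theorem expand_labAct (e : β) (b : BraidGroup l) (c : Fin l → Color) (z : ℕ → β)
    (hm : redCount c = m) : labAct (perm b) (expand e c z) =
      expand e (colAct (perm b) c) (labAct (perm (forget m b c)) z) := by
  induction b using braid_induction generalizing c z with
  | one => rw [forget_one, perm_one, perm_one, map_one, map_one, map_one]; rfl
  | gen j h =>
    rw [forget_sig m h, perm_sig h]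
    ext1 p
    rw [labAct_sw h, expand, expand, col_sw h, rank_sw h]
    have r1 := rank_succ c j
    have r2 := rank_succ c (j + 1)
    by_cases hc : col c j = red ∧ col c (j + 1) = red
    · have hj := rank_lt_redCount hc.2
      rw [if_pos hc.1] at r1
      rw [forgetGen_red hm hc.1 hc.2, perm_sig (by omega), labAct_sw (by omega)]
      rw [if_pos hc.2] at r2
      have m1 : ∀ p, p < j → col c p = red → rank c p < rank c j := fun p h h' => rank_lt h h'
      have m2 : ∀ p, j + 1 < p → rank c (j + 1 + 1) ≤ rank c p := fun p h => rank_mono c h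
      grind
    · rw [forgetGen_one hc, perm_one, map_one, Equiv.Perm.one_apply]
      grind
  | mul a b ha hb =>
    rw [forget_mul, labAct_perm_mul, ha c z hm, hb _ _ ((redCount_perm a c).trans hm), labAct_perm_mul,
      perm_mul]
    rfl
  | inv a ha =>
    have hm' : redCount (colAct (perm a).symm c) = m := by
      rw [← redCount_perm a, colAct_inv_right, hm]
    rw [perm_inv, ← labAct_injective_iff (perm a), ha _ _ hm', forget_inv, perm_inv,
      colAct_inv_right]
    exact (labAct_inv_right _ _).trans (congrArg (expand e c) (labAct_inv_right _ _).symm)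

/-- Taking the ranks themselves as labels in `expand_labAct` turns it into a statement about ranks.
The filler `l + 1` on the blue positions plays no role. -/
theorem rank_perm (b : BraidGroup l) (c : Fin l → Color) (hm : redCount c = m) {i : Fin l}
    (hi : c i = red) :
    rank (colAct (perm b) c) (perm b i) = extPerm (perm (forget m b c)) (rank c i) := by
  have h := congrFun (expand_labAct (m := m) (l + 1) b c id hm) (perm b i).val
  rw [labAct_perm, expand, expand, col_val, col_val, if_pos hi, colAct_apply, Equiv.symm_apply_apply,
    if_pos hi, labAct_apply, id, id, map_inv] at h
  rw [h]; simp

theorem IsMixed.isMixedPerm {o o' : Fin l → Color} {b : BraidGroup l} (h : IsMixed o o' b) :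
    IsMixedPerm o o' (perm b) where
  color := h.color
  rank i hi := by
    rw [h.eq_colAct, rank_perm b o rfl hi, h.trivial, perm_one, map_one]; rfl

/-! ### Forgetting some of the poles -/

theorem expand_one {c c' : Fin l → Color} {d : Fin m → Color} (h : col c' = expand blue c (col d))
    (p : ℕ) : rank c' p = rank d (rank c p) := by
  induction p with
  | zero => rfl
  | succ p ih =>
    rw [rank_succ, ih, rank_succ, h, expand]
    by_cases h1 : col c p = red
    · simp only [if_pos h1, rank_succ]
    · simp [if_neg h1]

/-- Strands may be removed in two stages, `d` being the colouring for the second. For turning a pole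
into a strand the first stage already leaves the trivial braid. -/
theorem forget_forget {m' : ℕ} (b : BraidGroup l) (c c' : Fin l → Color) (d : Fin m → Color)
    (hm : redCount c = m) (h : col c' = expand blue c (col d)) :
    forget m' b c' = forget m' (forget m b c) d := by
  induction b using braid_induction generalizing c c' d with
  | one => rw [forget_one, forget_one, forget_one]
  | gen j hj =>
    rw [forget_sig _ hj, forget_sig _ hj]
    have r := expand_one h
    have e : redCount c' = redCount d := by
      rw [redCount, r, show rank c l = m from hm]; rfl
    by_cases hc : col c j = red ∧ col c (j + 1) = red
    · have hj' := rank_lt_redCount hc.2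
      have r1 := rank_succ c j
      rw [if_pos hc.1] at r1
      rw [forgetGen_red hm hc.1 hc.2, forget_sig _ (by omega), forgetGen, forgetGen, e, h, expand,
        expand, r, if_pos hc.1, if_pos hc.2, r1]
    · rw [forgetGen_one hc, forget_one, forgetGen_one]
      rw [h, expand, expand]
      rintro ⟨h1, h2⟩
      split_ifs at h1 h2 with h3 h4
      exact hc ⟨h3, h4⟩
  | mul a b ha hb =>
    rw [forget_mul, forget_mul, forget_mul, ha c c' d hm h]
    congr 1
    refine hb _ _ _ ((redCount_perm a c).trans hm) ?_
    rw [col_colAct, h, expand_labAct _ _ _ _ hm, col_colAct]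
  | inv a ha =>
    have hm' : redCount (colAct (perm a).symm c) = m := by
      rw [← redCount_perm a, colAct_inv_right, hm]
    rw [forget_inv, forget_inv, forget_inv, ha _ _ _ hm']
    rw [← labAct_injective_iff (perm a), ← col_colAct, colAct_inv_right, expand_labAct _ _ _ _ hm',
      colAct_inv_right, h, ← col_colAct, colAct_inv_right]

/-! ### Extension and cabling -/

theorem rank_tail {c : Fin l → Color} {c' : Fin (l + 1) → Color} (h : tail (col c') = col c)
    (p : ℕ) : rank c' (p + 1) = rank c p + rank c' 1 := by
  induction p with
  | zero => rw [rank_zero, zero_add, zero_add]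
  | succ p ih =>
    rw [rank_succ, ih, rank_succ c p, ← h, tail]; omega

theorem colAct_inv_redCount (b : BraidGroup l) {c : Fin l → Color} (hm : redCount c = m) :
    redCount (colAct (perm b).symm c) = m := by
  rw [← redCount_perm b, colAct_inv_right, hm]

theorem col_colAct_symm (σ : Equiv.Perm (Fin l)) (c : Fin l → Color) :
    col (colAct σ.symm c) = labAct σ⁻¹ (col c) := by
  rw [← col_colAct]; rfl

theorem forget_addLeft_red (b : BraidGroup l) (c : Fin l → Color) (c' : Fin (l + 1) → Color)
    (hm : redCount c = m) (h : tail (col c') = col c) (h0 : col c' 0 = red) :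
    forget (m + 1) (addLeft b) c' = addLeft (forget m b c) := by
  induction b using braid_induction generalizing c c' with
  | one => rw [map_one, forget_one, forget_one, map_one]
  | gen j hj =>
    have r1 : rank c' 1 = 1 := by rw [rank_succ, rank_zero, if_pos h0]
    rw [addLeft_sig hj, forget_sig _ (by omega), forget_sig _ hj]
    have e : ∀ p, col c p = col c' (p + 1) := fun p => by rw [← h]; rfl
    by_cases hc : col c j = red ∧ col c (j + 1) = red
    · have hj' := rank_lt_redCount hc.2
      have r := rank_succ c j
      rw [if_pos hc.1] at r
      rw [forgetGen_red hm hc.1 hc.2, forgetGen_red _ (by rw [← e, hc.1]) (by rw [← e, hc.2]),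
        addLeft_sig (by omega), rank_tail h, r1]
      rw [redCount, rank_tail h, r1, show rank c l = m from hm]
    · rw [forgetGen_one hc, map_one, forgetGen_one (by rwa [← e, ← e])]
  | mul a b ha hb =>
    have ht := tail_labAct_addLeft a (col c')
    rw [map_mul, forget_mul, forget_mul, map_mul, ha c c' hm h h0,
      hb _ _ ((redCount_perm a c).trans hm)]
    · rw [col_colAct, col_colAct, ht.1, h]
    · rw [col_colAct, ht.2, h0]
  | inv a ha =>
    have ht := tail_labAct_addLeft a (labAct (perm (addLeft a))⁻¹ (col c'))
    rw [labAct_inv_right] at ht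
    rw [map_inv, forget_inv, forget_inv, map_inv, ha _ _ (colAct_inv_redCount a hm)]
    · rw [col_colAct_symm, col_colAct_symm, ← labAct_injective_iff (perm a), labAct_inv_right,
        ← ht.1, h]
    · rw [col_colAct_symm, ← ht.2, h0]

theorem forget_addLeft_blue (b : BraidGroup l) (c : Fin l → Color) (c' : Fin (l + 1) → Color)
    (hm : redCount c = m) (h : tail (col c') = col c) (h0 : col c' 0 = blue) :
    forget m (addLeft b) c' = forget m b c := by
  induction b using braid_induction generalizing c c' with
  | one => rw [map_one, forget_one, forget_one]
  | gen j hj =>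
    have r1 : rank c' 1 = 0 := by rw [rank_succ, rank_zero, h0]; rfl
    rw [addLeft_sig hj, forget_sig _ (by omega), forget_sig _ hj]
    have e : ∀ p, col c p = col c' (p + 1) := fun p => by rw [← h]; rfl
    rw [forgetGen, forgetGen, e, e, rank_tail h, r1, redCount, rank_tail h, r1, add_zero, add_zero]
    rfl
  | mul a b ha hb =>
    have ht := tail_labAct_addLeft a (col c')
    rw [map_mul, forget_mul, forget_mul, ha c c' hm h h0,
      hb _ _ ((redCount_perm a c).trans hm)]
    · rw [col_colAct, col_colAct, ht.1, h]
    · rw [col_colAct, ht.2, h0]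
  | inv a ha =>
    have ht := tail_labAct_addLeft a (labAct (perm (addLeft a))⁻¹ (col c'))
    rw [labAct_inv_right] at ht
    rw [map_inv, forget_inv, forget_inv, ha _ _ (colAct_inv_redCount a hm)]
    · rw [col_colAct_symm, col_colAct_symm, ← labAct_injective_iff (perm a), labAct_inv_right,
        ← ht.1, h]
    · rw [col_colAct_symm, ← ht.2, h0]

theorem rank_congr {l' : ℕ} {c : Fin l → Color} {c' : Fin l' → Color} {p : ℕ}
    (h : ∀ q < p, col c' q = col c q) : rank c' p = rank c p := by
  induction p with
  | zero => rfl
  | succ p ih => rw [rank_succ, rank_succ, ih fun q hq => h q (by omega), h p (by omega)]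

theorem labAct_addRight_inv {α : Type*} (b : BraidGroup l) (y : ℕ → α) :
    labAct (perm (addRight b))⁻¹ y = labAct (perm b)⁻¹ y := by
  rw [← labAct_injective_iff (perm b), ← labAct_addRight, labAct_inv_right, labAct_inv_right]

theorem labAct_lt {α : Type*} (σ : Equiv.Perm (Fin l)) {x y : ℕ → α} (h : ∀ p < l, x p = y p) :
    ∀ p < l, labAct σ x p = labAct σ y p := fun p hp => by
  rw [labAct_apply, labAct_apply, show p = (⟨p, hp⟩ : Fin l).val from rfl, extPerm_val]
  exact h _ (Fin.isLt _)

theorem forget_addRight (b : BraidGroup l) (c : Fin l → Color) (c' : Fin (l + 1) → Color) {m' : ℕ}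
    (hm : redCount c = m) (hm' : redCount c' = m') (h : ∀ p < l, col c' p = col c p)
    (h0 : m' = m + 1 ∨ m' = m) (h1 : forget m b c = 1) : forget m' (addRight b) c' = 1 := by
  -- Both colours of the new strand are covered at once: `f` is the extension on the right for a
  -- pole and the identity for a strand, and only its values on generators matter.
  have H : (∃ f : BraidGroup m →* BraidGroup m', ∀ j, j + 1 < m → f (sig m j) = sig m' j) := by
    rcases h0 with rfl | rfl
    · exact ⟨addRight, fun j hj => addRight_sig hj⟩
    · exact ⟨MonoidHom.id _, fun _ _ => rfl⟩
  obtain ⟨f, hf⟩ := H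
  suffices forget m' (addRight b) c' = f (forget m b c) by rw [this, h1, map_one]
  clear h1
  induction b using braid_induction generalizing c c' with
  | one => rw [map_one, forget_one, forget_one, map_one]
  | gen j hj =>
    rw [addRight_sig hj, forget_sig _ (by omega), forget_sig _ hj]
    by_cases hc : col c j = red ∧ col c (j + 1) = red
    · have hj' := rank_lt_redCount hc.2
      have r := rank_succ c j
      rw [if_pos hc.1] at r
      rw [forgetGen_red hm hc.1 hc.2, forgetGen_red hm' (by rw [h _ (by omega), hc.1])
        (by rw [h _ (by omega), hc.2]), hf _ (by omega), rank_congr fun q hq => h q (by omega)]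
    · rw [forgetGen_one hc, map_one, forgetGen_one (by rwa [h _ (by omega), h _ (by omega)])]
  | mul a b ha hb =>
    rw [map_mul, forget_mul, forget_mul, map_mul, ha c c' hm hm' h,
      hb _ _ ((redCount_perm a c).trans hm) ((redCount_perm _ c').trans hm')]
    rw [col_colAct, col_colAct, labAct_addRight]
    exact labAct_lt _ h
  | inv a ha =>
    rw [map_inv, forget_inv, forget_inv, map_inv, ha _ _ (colAct_inv_redCount a hm)
      (colAct_inv_redCount _ hm')]
    rw [col_colAct_symm, col_colAct_symm, labAct_addRight_inv]
    exact labAct_lt _ h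

/-- The labels for which the label at the position `i` is repeated. -/
def dup {α : Type*} (i : ℕ) (z : ℕ → α) (p : ℕ) : α := if p ≤ i then z p else z (p - 1)

/-- The counterpart of `merge_labAct_double` for colours, which are repeated along the cable instead
of being united. -/
theorem dup_labAct_double {α : Type*} (b : BraidGroup l) (i : Fin l) (z : ℕ → α) :
    labAct (perm (double b i)) (dup i z) = dup (perm b i) (labAct (perm b) z) := by
  induction b using braid_induction generalizing i z with
  | one => rw [double_one, perm_one, perm_one, map_one, map_one]; rfl
  | gen j h =>
    rw [double_sig h, perm_sig h]
    have hj : j + 1 < l + 1 := by omega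
    have hj' : j + 1 + 1 < l + 1 := by omega
    ext1 p
    unfold dup
    rw [sw_val h]
    simp only [labAct_sw h]
    rcases lt_trichotomy i.val j with hi | hi | hi
    · rw [doubleGen_lt hi, perm_sig hj']
      simp only [labAct_sw hj']
      grind
    · rw [hi, doubleGen_left, labAct_perm_mul, perm_sig hj', perm_sig hj]
      simp only [labAct_sw hj', labAct_sw hj]
      grind
    · rcases Nat.lt_or_ge (j + 1) i with hi' | hi'
      · rw [doubleGen_gt hi', perm_sig hj]
        simp only [labAct_sw hj]
        grind
      · rw [show i.val = j + 1 by omega, doubleGen_right, labAct_perm_mul, perm_sig hj', perm_sig hj]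
        simp only [labAct_sw hj', labAct_sw hj]
        grind
  | mul a b ha hb =>
    rw [double_mul, labAct_perm_mul, labAct_perm_mul, ha, hb, perm_mul]; rfl
  | inv a ha =>
    have := ha ((perm a)⁻¹ i) (labAct (perm a)⁻¹ z)
    rw [← Equiv.Perm.mul_apply (perm a), mul_inv_cancel, labAct_inv_right] at this
    rw [double_inv, perm_inv, perm_inv]
    refine (labAct_injective_iff (perm (double a ((perm a)⁻¹ i)))).1 ?_
    exact (labAct_inv_right _ _).trans this.symm

theorem dup_labAct_double_inv {α : Type*} (b : BraidGroup l) (i : Fin l) (z : ℕ → α) :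
    labAct (perm (double b ((perm b)⁻¹ i)))⁻¹ (dup i z) =
      dup ((perm b)⁻¹ i) (labAct (perm b)⁻¹ z) := by
  rw [← labAct_injective_iff (perm (double b ((perm b)⁻¹ i))), labAct_inv_right, dup_labAct_double,
    labAct_inv_right, ← Equiv.Perm.mul_apply (perm b), mul_inv_cancel]; rfl

theorem rank_dup {c : Fin l → Color} {c' : Fin (l + 1) → Color} {i : ℕ}
    (h : col c' = dup i (col c)) : (∀ p ≤ i + 1, rank c' p = rank c p) ∧
      ∀ p, i ≤ p → rank c' (p + 1) = rank c p + if col c i = red then 1 else 0 := by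
  have H : ∀ p ≤ i + 1, rank c' p = rank c p := fun p hp => rank_congr fun q hq => by
    rw [h, dup, if_pos (by omega)]
  refine ⟨H, fun p hp => ?_⟩
  obtain ⟨n, rfl⟩ := Nat.exists_eq_add_of_le hp
  induction n with
  | zero => rw [add_zero, H _ le_rfl, rank_succ]
  | succ n ih =>
    have e : col c' (i + n + 1) = col c (i + n) := by
      rw [h, dup, if_neg (by omega), Nat.add_sub_cancel]
    rw [← add_assoc, rank_succ, ih (by omega), e, rank_succ c, add_right_comm]

/-- Where the doubled pole crosses another pole both new crossings survive, and where it crosses a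
strand both disappear; the result is a cabling at the pole whose index is the rank of `i`. -/
theorem forget_double_red (b : BraidGroup l) (c : Fin l → Color) (c' : Fin (l + 1) → Color)
    (i : Fin l) (r : Fin m) (hm : redCount c = m) (h : col c' = dup i (col c)) (hi : c i = red)
    (hr : r.val = rank c i) : forget (m + 1) (double b i) c' = double (forget m b c) r := by
  induction b using braid_induction generalizing c c' i r with
  | one => rw [double_one, forget_one, forget_one, double_one]
  | gen j hj =>
    obtain ⟨R1, R2⟩ := rank_dup h
    have hci : col c i = red := by rw [col_val, hi]
    rw [if_pos hci] at R2
    have hm' : redCount c' = m + 1 := by rw [redCount, R2 l (by omega), ← hm]; rfl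
    have c1 : ∀ p ≤ i.val, col c' p = col c p := fun p hp => by rw [h, dup, if_pos hp]
    have c2 : ∀ p, i.val ≤ p → col c' (p + 1) = col c p := fun p hp => by
      rw [h, dup, if_neg (by omega), Nat.add_sub_cancel]
    have hj1 : j + 1 < l + 1 := by omega
    have hj2 : j + 1 + 1 < l + 1 := by omega
    have r1 := rank_succ c j
    have r2 := fun h => rank_lt_redCount (c := c) (p := j + 1) h
    rw [double_sig hj, forget_sig _ hj]
    rcases lt_trichotomy i.val j with hij | hij | hij
    · rw [doubleGen_lt hij, forget_sig _ hj2]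
      by_cases hc : col c j = red ∧ col c (j + 1) = red
      · rw [if_pos hc.1] at r1
        have := r2 hc.2
        rw [forgetGen_red hm hc.1 hc.2, forgetGen_red hm' (by rw [c2 _ (by omega), hc.1])
          (by rw [c2 _ (by omega), hc.2]), R2 _ (by omega), double_sig (by omega), doubleGen_lt]
        rw [hr]; exact rank_lt hij hci
      · rw [forgetGen_one hc, double_one, forgetGen_one]
        rwa [c2 _ (by omega), c2 _ (by omega)]
    · have e1 : col c' j = red := by rw [c1 _ (by omega), ← hij, hci]
      have e2 : col c' (j + 1) = red := by rw [c2 _ (by omega), ← hij, hci]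
      have e3 : col c' (j + 1 + 1) = col c (j + 1) := c2 _ (by omega)
      rw [hij] at hci
      rw [hij, doubleGen_left, forget_mul, forget_sig _ hj2, forget_sig _ hj1, perm_sig hj2]
      rw [if_pos hci] at r1
      by_cases hc : col c (j + 1) = red
      · have := r2 hc
        rw [forgetGen_red hm hci hc, forgetGen_red hm' e2 (e3.trans hc), forgetGen_red, rank_sw hj2,
          if_neg (by omega), R1 j (by omega), R2 j (by omega), double_sig (by omega), hr, hij,
          doubleGen_left]
        · rw [redCount_sw hj2, hm']
        · rw [col_sw hj2, if_neg (by omega), if_neg (by omega), e1]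
        · rw [col_sw hj2, if_pos rfl, e3, hc]
      · rw [forgetGen_one fun h => hc h.2, double_one, forgetGen_one fun h => hc (e3.symm.trans h.2),
          forgetGen_one, one_mul]
        rw [col_sw hj2 _ (j + 1), if_pos rfl, e3]
        exact fun h => hc h.2
    · rcases Nat.lt_or_ge (j + 1) i with hij' | hij'
      · rw [doubleGen_gt hij', forget_sig _ hj1]
        by_cases hc : col c j = red ∧ col c (j + 1) = red
        · rw [if_pos hc.1] at r1
          have := r2 hc.2
          rw [forgetGen_red hm hc.1 hc.2, forgetGen_red hm' (by rw [c1 _ (by omega), hc.1])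
            (by rw [c1 _ (by omega), hc.2]), R1 _ (by omega), double_sig (by omega), doubleGen_gt]
          rw [hr, ← r1]; exact rank_lt hij' hc.2
        · rw [forgetGen_one hc, double_one, forgetGen_one]
          rwa [c1 _ (by omega), c1 _ (by omega)]
      · obtain hij : i.val = j + 1 := by omega
        have e1 : col c' j = col c j := c1 _ (by omega)
        have e2 : col c' (j + 1) = red := by rw [c1 _ (by omega), ← hij, hci]
        have e3 : col c' (j + 1 + 1) = red := by rw [c2 _ (by omega), ← hij, hci]
        rw [hij] at hci
        rw [hij, doubleGen_right, forget_mul, forget_sig _ hj1, forget_sig _ hj2, perm_sig hj1]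
        by_cases hc : col c j = red
        · rw [if_pos hc] at r1
          have := r2 hci
          rw [forgetGen_red hm hc hci, forgetGen_red hm' (e1.trans hc) e2, forgetGen_red, rank_sw hj1,
            if_pos rfl, if_pos e2, R1 _ (by omega), double_sig (by omega), hr, hij, r1,
            doubleGen_right]
          · rw [redCount_sw hj1, hm']
          · rw [col_sw hj1, if_neg (by omega), if_pos rfl, e1, hc]
          · rw [col_sw hj1, if_neg (by omega), if_neg (by omega), e3]
        · rw [forgetGen_one fun h => hc h.1, double_one, forgetGen_one fun h => hc (e1.symm.trans h.1),
            forgetGen_one, one_mul]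
          rw [col_sw hj1 _ (j + 1), if_neg (by omega), if_pos rfl, e1]
          exact fun h => hc h.1
  | mul a b ha hb =>
    rw [double_mul, forget_mul, forget_mul, double_mul, ha c c' i r hm h hi hr]
    congr 1
    refine hb _ _ _ _ ((redCount_perm a c).trans hm) ?_ ?_ ?_
    · rw [col_colAct, col_colAct, h, dup_labAct_double]
    · rw [colAct_apply, Equiv.symm_apply_apply, hi]
    · rw [rank_perm a c hm hi, ← hr, extPerm_val]
  | inv a ha =>
    have hi' : colAct (perm a).symm c ((perm a)⁻¹ i) = red := by
      rw [colAct_apply]; simpa using hi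
    have hr' := rank_perm (m := m) a (colAct (perm a).symm c) (colAct_inv_redCount a hm) hi'
    rw [colAct_inv_right, ← Equiv.Perm.mul_apply (perm a), mul_inv_cancel, Equiv.Perm.one_apply,
      ← hr] at hr'
    rw [double_inv, forget_inv, forget_inv, double_inv]
    rw [ha _ _ _ _ (colAct_inv_redCount a hm) _ hi' _]
    · rw [col_colAct_symm, col_colAct_symm, h, dup_labAct_double_inv]
    · rw [← extPerm_val, map_inv, hr']; simp

theorem forget_double_blue (b : BraidGroup l) (c : Fin l → Color) (c' : Fin (l + 1) → Color)
    (i : Fin l) (hm : redCount c = m) (h : col c' = dup i (col c)) (hi : c i = blue) :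
    forget m (double b i) c' = forget m b c := by
  induction b using braid_induction generalizing c c' i with
  | one => rw [double_one, forget_one, forget_one]
  | gen j hj =>
    obtain ⟨R1, R2⟩ := rank_dup h
    have hci : col c i = blue := by rw [col_val, hi]
    rw [if_neg (by rw [hci]; exact Color.noConfusion)] at R2
    have hm' : redCount c' = m := by rw [redCount, R2 l (by omega), ← hm]; rfl
    have c1 : ∀ p ≤ i.val, col c' p = col c p := fun p hp => by rw [h, dup, if_pos hp]
    have c2 : ∀ p, i.val ≤ p → col c' (p + 1) = col c p := fun p hp => by
      rw [h, dup, if_neg (by omega), Nat.add_sub_cancel]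
    have hj1 : j + 1 < l + 1 := by omega
    have hj2 : j + 1 + 1 < l + 1 := by omega
    rw [double_sig hj, forget_sig _ hj]
    rcases lt_trichotomy i.val j with hij | hij | hij
    · rw [doubleGen_lt hij, forget_sig _ hj2, forgetGen, forgetGen, c2 _ (by omega), c2 _ (by omega),
        R2 _ (by omega), hm, hm', add_zero]
    · have e1 : col c' (j + 1) ≠ red := by
        rw [c2 _ (by omega), ← hij, hci]; exact Color.noConfusion
      have e2 : col c' j ≠ red := by rw [c1 _ (by omega), ← hij, hci]; exact Color.noConfusion
      rw [hij, doubleGen_left, forget_mul, forget_sig _ hj2, forget_sig _ hj1, perm_sig hj2,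
        forgetGen_one fun h => e1 h.1, forgetGen_one, forgetGen_one, one_mul]
      · rw [← hij, hci]; exact fun h => Color.noConfusion h.1
      · rw [col_sw hj2, if_neg (by omega), if_neg (by omega)]; exact fun h => e2 h.1
    · rcases Nat.lt_or_ge (j + 1) i with hij' | hij'
      · rw [doubleGen_gt hij', forget_sig _ hj1, forgetGen, forgetGen, c1 _ (by omega),
          c1 _ (by omega), R1 _ (by omega), hm, hm']
      · obtain hij : i.val = j + 1 := by omega
        have e1 : col c' (j + 1) ≠ red := by
          rw [c1 _ (by omega), ← hij, hci]; exact Color.noConfusion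
        have e2 : col c' (j + 1 + 1) ≠ red := by
          rw [c2 _ (by omega), ← hij, hci]; exact Color.noConfusion
        rw [hij, doubleGen_right, forget_mul, forget_sig _ hj1, forget_sig _ hj2, perm_sig hj1,
          forgetGen_one fun h => e1 h.2, forgetGen_one, forgetGen_one, one_mul]
        · rw [← hij, hci]; exact fun h => Color.noConfusion h.2
        · rw [col_sw hj1 _ (j + 1 + 1), if_neg (by omega), if_neg (by omega)]; exact fun h => e2 h.2
  | mul a b ha hb =>
    rw [double_mul, forget_mul, forget_mul, ha c c' i hm h hi]
    congr 1
    refine hb _ _ _ ((redCount_perm a c).trans hm) ?_ ?_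
    · rw [col_colAct, col_colAct, h, dup_labAct_double]
    · rw [colAct_apply, Equiv.symm_apply_apply, hi]
  | inv a ha =>
    have hi' : colAct (perm a).symm c ((perm a)⁻¹ i) = blue := by
      rw [colAct_apply]; simpa using hi
    rw [double_inv, forget_inv, forget_inv]
    rw [ha _ _ _ (colAct_inv_redCount a hm) _ hi']
    rw [col_colAct_symm, col_colAct_symm, h, dup_labAct_double_inv]

end Forget

end

section

open Color

/-! ### The words of poles that remain after doubling or recolouring a letter. -/

section Bars

/-- The `i`-th entry of a list of colours. -/
abbrev entry (L : List Color) (p : ℕ) : Color := L.getD p blue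

theorem col_word {l : ℕ} (O : Par l) : col O.word = entry (lettersOpt O.tree) := by
  ext1 p
  rcases Nat.lt_or_ge p l with h | h
  · rw [col, dif_pos h]
    exact (List.getD_eq_getElem _ _ (by rw [O.len]; exact h)).symm
  · rw [col, dif_neg (by omega)]
    exact (List.getD_eq_default _ _ (by rw [O.len]; exact h)).symm

/-- The number of red entries before the position `p`. -/
def redsBefore (L : List Color) (p : ℕ) : ℕ := (L.take p).count red

theorem redsBefore_succ (L : List Color) (p : ℕ) :
    redsBefore L (p + 1) = redsBefore L p + if entry L p = red then 1 else 0 := by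
  unfold redsBefore
  rcases Nat.lt_or_ge p L.length with h | h
  · rw [List.take_add_one, List.count_append, List.getElem?_eq_getElem h, entry,
      List.getD_eq_getElem _ _ h]
    simp [List.count_singleton]
  · rw [List.take_of_length_le h, List.take_of_length_le (by omega), entry,
      List.getD_eq_default _ _ h]
    rfl

theorem rank_word {l : ℕ} (O : Par l) (p : ℕ) :
    rank O.word p = redsBefore (lettersOpt O.tree) p := by
  induction p with
  | zero => rfl
  | succ p ih => rw [rank_succ, ih, redsBefore_succ, col_word]

theorem entry_append_left {L L' : List Color} {p : ℕ} (h : p < L.length) :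
    entry (L ++ L') p = entry L p := List.getD_append _ _ _ _ h

theorem entry_append_right {L L' : List Color} {p : ℕ} (h : L.length ≤ p) :
    entry (L ++ L') p = entry L' (p - L.length) := List.getD_append_right _ _ _ _ h

theorem redsBefore_append_left {L L' : List Color} {p : ℕ} (h : p ≤ L.length) :
    redsBefore (L ++ L') p = redsBefore L p := by
  rw [redsBefore, List.take_append_of_le_length h]; rfl

theorem redsBefore_append_right {L L' : List Color} {p : ℕ} (h : L.length ≤ p) :
    redsBefore (L ++ L') p = L.count red + redsBefore L' (p - L.length) := by
  rw [redsBefore, List.take_append, List.take_of_length_le h, List.count_append]; rfl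

theorem join_none (x : Option (FreeMagma Color)) : join x none = x := by cases x <;> rfl

theorem lettersOpt_join (x y : Option (FreeMagma Color)) :
    lettersOpt (join x y) = lettersOpt x ++ lettersOpt y := by
  cases x <;> cases y <;> simp [join, lettersOpt]; rfl

theorem forgetBlue_mul (u v : FreeMagma Color) :
    forgetBlue (u * v) = join (forgetBlue u) (forgetBlue v) := rfl

theorem forgetBlue_join (x y : Option (FreeMagma Color)) :
    (join x y).bind forgetBlue = join (x.bind forgetBlue) (y.bind forgetBlue) := by
  rcases x with _ | x <;> rcases y with _ | y
  · rfl
  · rfl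
  · exact (join_none _).symm
  · rfl

theorem lettersOpt_forgetBlue (u : FreeMagma Color) :
    (lettersOpt (forgetBlue u)) = (letters u).filter (· = red) := by
  induction u with
  | ih1 a => cases a <;> rfl
  | ih2 u v hu hv =>
    change lettersOpt (join (forgetBlue u) (forgetBlue v)) = (letters u ++ letters v).filter _
    rw [lettersOpt_join, hu, hv, List.filter_append]

theorem length_forgetBlue (u : FreeMagma Color) :
    (lettersOpt (forgetBlue u)).length = (letters u).count red := by
  rw [lettersOpt_forgetBlue, List.count_eq_length_filter]
  congr 1

theorem redsBefore_lt {L : List Color} {i : ℕ} (h : entry L i = red) :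
    redsBefore L i < L.count red := by
  have h1 := redsBefore_succ L i
  rw [if_pos h] at h1
  have : redsBefore L (i + 1) ≤ L.count red := (List.take_sublist _ _).count_le _
  omega

theorem lt_length_of_red {L : List Color} {i : ℕ} (h : entry L i = red) : i < L.length := by
  by_contra h'
  rw [entry, List.getD_eq_default _ _ (by omega)] at h; cases h

/-- The doubled letter is found in the word of poles by counting the red letters before it. The
cases arise because a factor without red letters leaves no factor behind. -/
theorem forgetBlue_double_red (u : FreeMagma Color) (i : ℕ) (h : entry (letters u) i = red) :
    forgetBlue (doubleWord u i) =
      (forgetBlue u).map fun w => doubleWord w (redsBefore (letters u) i) := by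
  induction u generalizing i with
  | ih1 a =>
    have := lt_length_of_red h
    change i < 1 at this
    obtain rfl : i = 0 := by omega
    cases a
    · rfl
    · cases h
  | ih2 u v hu hv =>
    change entry (letters u ++ letters v) i = red at h
    change forgetBlue (subst _ (u * v) i) = (join (forgetBlue u) (forgetBlue v)).map fun w =>
      doubleWord w (redsBefore (letters u ++ letters v) i)
    rw [subst_mul]
    have lu := length_forgetBlue u
    split_ifs with hi
    · rw [entry_append_left hi] at h
      rw [redsBefore_append_left hi.le, forgetBlue_mul, hu i h]
      have := redsBefore_lt h
      generalize forgetBlue u = xu at *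
      rcases xu with _ | u'
      · simp [lettersOpt] at lu; omega
      · change (letters u').length = _ at lu
        generalize forgetBlue v = xv at *
        rcases xv with _ | v'
        · rfl
        · change some _ = some (subst _ (u' * v') _)
          rw [subst_mul, if_pos (by omega)]
    · rw [entry_append_right (by omega)] at h
      rw [redsBefore_append_right (by omega), forgetBlue_mul, hv _ h]
      have := redsBefore_lt h
      have lv := length_forgetBlue v
      generalize forgetBlue v = xv at *
      rcases xv with _ | v'
      · simp [lettersOpt] at lv; omega
      · generalize forgetBlue u = xu at *
        rcases xu with _ | u'
        · rw [← lu]; simp [lettersOpt, join]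
        · change (letters u').length = _ at lu
          change some _ = some (subst _ (u' * v') _)
          rw [subst_mul, if_neg (by omega), ← lu, Nat.add_sub_cancel_left]

theorem forgetBlue_double_blue (u : FreeMagma Color) (i : ℕ) (h : entry (letters u) i = blue)
    (hi' : i < (letters u).length) : forgetBlue (doubleWord u i) = forgetBlue u := by
  induction u generalizing i with
  | ih1 a =>
    change i < 1 at hi'
    obtain rfl : i = 0 := by omega
    cases a
    · cases h
    · rfl
  | ih2 u v hu hv =>
    change entry (letters u ++ letters v) i = blue at h
    change i < (letters u ++ letters v).length at hi'
    rw [List.length_append] at hi'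
    change forgetBlue (subst _ (u * v) i) = join (forgetBlue u) (forgetBlue v)
    rw [subst_mul]
    split_ifs with hi
    · rw [entry_append_left hi] at h
      rw [forgetBlue_mul, hu i h hi]
    · rw [entry_append_right (by omega)] at h
      rw [forgetBlue_mul, hv _ h (by omega)]

/-- The word in which the letter at a given position is turned blue. -/
abbrev blueWord : FreeMagma Color → ℕ → FreeMagma Color := subst fun _ => .of blue

theorem length_blueWord (u : FreeMagma Color) (i : ℕ) :
    (letters (blueWord u i)).length = (letters u).length := length_subst _ 0 (fun _ => rfl) u i

theorem forgetBlue_forgetBlue (u : FreeMagma Color) :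
    (forgetBlue u).bind forgetBlue = forgetBlue u := by
  induction u with
  | ih1 a => cases a <;> rfl
  | ih2 u v hu hv =>
    change (join (forgetBlue u) (forgetBlue v)).bind forgetBlue = join (forgetBlue u) (forgetBlue v)
    rw [forgetBlue_join, hu, hv]

/-- The letter is turned blue in the word of poles and then removed from it. The result may be
empty, hence the `bind`. -/
theorem forgetBlue_blueWord (u : FreeMagma Color) (i : ℕ) (h : entry (letters u) i = red) :
    forgetBlue (blueWord u i) =
      (forgetBlue u).bind fun w => forgetBlue (blueWord w (redsBefore (letters u) i)) := by
  induction u generalizing i with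
  | ih1 a =>
    have := lt_length_of_red h
    change i < 1 at this
    obtain rfl : i = 0 := by omega
    cases a
    · rfl
    · cases h
  | ih2 u v hu hv =>
    change entry (letters u ++ letters v) i = red at h
    change forgetBlue (subst _ (u * v) i) = (join (forgetBlue u) (forgetBlue v)).bind fun w =>
      forgetBlue (blueWord w (redsBefore (letters u ++ letters v) i))
    rw [subst_mul]
    have lu := length_forgetBlue u
    have lv := length_forgetBlue v
    have fu := forgetBlue_forgetBlue u
    have fv := forgetBlue_forgetBlue v
    split_ifs with hi
    · rw [entry_append_left hi] at h
      rw [redsBefore_append_left hi.le, forgetBlue_mul, hu i h]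
      have := redsBefore_lt h
      generalize forgetBlue u = xu at *
      rcases xu with _ | u'
      · simp [lettersOpt] at lu; omega
      · change (letters u').length = _ at lu
        generalize forgetBlue v = xv at *
        rcases xv with _ | v'
        · exact join_none _
        · change forgetBlue v' = some v' at fv
          change _ = forgetBlue (subst _ (u' * v') _)
          rw [subst_mul, if_pos (by omega), forgetBlue_mul, fv]; rfl
    · rw [entry_append_right (by omega)] at h
      rw [redsBefore_append_right (by omega), forgetBlue_mul, hv _ h]
      have := redsBefore_lt h
      generalize forgetBlue v = xv at *
      rcases xv with _ | v'
      · simp [lettersOpt] at lv; omega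
      · generalize forgetBlue u = xu at *
        rcases xu with _ | u'
        · rw [← lu]; simp [lettersOpt, join]
        · change (letters u').length = _ at lu
          change forgetBlue u' = some u' at fu
          change _ = forgetBlue (subst _ (u' * v') _)
          rw [subst_mul, if_neg (by omega), ← lu, Nat.add_sub_cancel_left, forgetBlue_mul, fu]; rfl

theorem entry_double (u : FreeMagma Color) {i : ℕ} (h : i < (letters u).length) :
    entry (letters (doubleWord u i)) = dup i (entry (letters u)) := by
  induction u generalizing i with
  | ih1 a =>
    change i < 1 at h
    obtain rfl : i = 0 := by omega
    ext1 p
    rcases p with _ | _ | p <;> rfl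
  | ih2 u v hu hv =>
    change entry (letters (subst _ (u * v) i)) = dup i (entry (letters u ++ letters v))
    change i < (letters u ++ letters v).length at h
    rw [List.length_append] at h
    rw [subst_mul]
    ext1 p
    split_ifs with hi
    · have l : (letters (subst (fun a => .of a * .of a) u i)).length = _ := length_doubleWord u i
      rw [letters_mul]
      rcases Nat.lt_or_ge p ((letters u).length + 1) with hp | hp
      · rw [entry_append_left (by omega), hu hi, dup, dup]
        split_ifs with h'
        · rw [entry_append_left (by omega)]
        · rw [entry_append_left (by omega)]
      · rw [entry_append_right (by omega), dup, if_neg (by omega), entry_append_right (by omega), l]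
        congr 1; omega
    · rw [letters_mul]
      rcases Nat.lt_or_ge p (letters u).length with hp | hp
      · rw [entry_append_left (by omega), dup, if_pos (by omega), entry_append_left (by omega)]
      · rw [entry_append_right (by omega), hv (by omega), dup, dup]
        split_ifs with h1 h2 h2
        · rw [entry_append_right (by omega)]
        · omega
        · omega
        · rw [entry_append_right (by omega)]; congr 1; omega

theorem entry_blueWord (u : FreeMagma Color) {i : ℕ} (h : i < (letters u).length) :
    entry (letters (blueWord u i)) = Function.update (entry (letters u)) i blue := by
  induction u generalizing i with
  | ih1 a =>
    change i < 1 at h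
    obtain rfl : i = 0 := by omega
    ext1 p
    rcases p with _ | p <;> rfl
  | ih2 u v hu hv =>
    change entry (letters (subst _ (u * v) i)) =
      Function.update (entry (letters u ++ letters v)) i blue
    change i < (letters u ++ letters v).length at h
    rw [List.length_append] at h
    rw [subst_mul]
    ext1 p
    split_ifs with hi
    · have l : (letters (subst (fun _ => .of blue) u i)).length = _ := length_blueWord u i
      rw [letters_mul]
      rcases Nat.lt_or_ge p (letters u).length with hp | hp
      · rw [entry_append_left (by omega), hu hi]
        simp only [Function.update_apply, entry_append_left hp]
      · rw [entry_append_right (by omega), Function.update_of_ne (by omega),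
          entry_append_right (by omega), l]
    · rw [letters_mul]
      rcases Nat.lt_or_ge p (letters u).length with hp | hp
      · rw [entry_append_left (by omega), Function.update_of_ne (by omega),
          entry_append_left (by omega)]
      · rw [entry_append_right (by omega), hv (by omega)]
        simp only [Function.update_apply, entry_append_right hp]
        grind

end Bars

/-! ### The operadic operations on mixed braids. -/

section Ops

variable {l : ℕ}

theorem Par.tree_ne_none (O : Par l) (i : Fin l) : ∃ u, O.tree = some u := by
  obtain ⟨_ | u, h⟩ := O
  · subst h; exact i.elim0
  · exact ⟨u, rfl⟩

theorem Par.col_addLeft (O : Par l) (a : Color) :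
    tail (col (O.addLeft a).word) = col O.word ∧ col (O.addLeft a).word 0 = a := by
  rw [col_word, col_word, Par.addLeft, lettersOpt_join]
  exact ⟨rfl, rfl⟩

theorem Par.col_addRight (O : Par l) (a : Color) :
    (∀ p < l, col (O.addRight a).word p = col O.word p) ∧ col (O.addRight a).word l = a := by
  rw [col_word, col_word, Par.addRight, lettersOpt_join]
  refine ⟨fun p hp => entry_append_left (by rw [O.len]; exact hp), ?_⟩
  rw [entry_append_right (by rw [O.len]), O.len, Nat.sub_self]; rfl

theorem Par.col_double (O : Par l) (i : Fin l) :
    col (O.double i).word = dup i (col O.word) := by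
  obtain ⟨_ | u, h⟩ := O
  · subst h; exact i.elim0
  rw [col_word, col_word]
  exact entry_double u (i.isLt.trans_eq h.symm)

theorem Par.col_toBlue (O : Par l) (i : Fin l) :
    col (O.toBlue i).word = Function.update (col O.word) i blue := by
  obtain ⟨_ | u, h⟩ := O
  · subst h; exact i.elim0
  rw [col_word, col_word]
  exact entry_blueWord u (i.isLt.trans_eq h.symm)

theorem Par.bar_addLeft {O O' : Par l} (h : O.bar = O'.bar) (a : Color) :
    (O.addLeft a).bar = (O'.addLeft a).bar := by
  unfold Par.bar at *
  rw [Par.addLeft, Par.addLeft, forgetBlue_join, forgetBlue_join, h]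

theorem Par.bar_addRight {O O' : Par l} (h : O.bar = O'.bar) (a : Color) :
    (O.addRight a).bar = (O'.addRight a).bar := by
  unfold Par.bar at *
  rw [Par.addRight, Par.addRight, forgetBlue_join, forgetBlue_join, h]

/-- A mixed permutation preserves the colour of a letter and its rank among the red ones, so the
doubling affects the same letter of the common word of poles at both ends, or none. -/
theorem PaPerm.bar_double {O O' : Par l} (σ : PaPerm O O') (i : Fin l) :
    (O.double i).bar = (O'.double (σ.toPerm i)).bar := by
  obtain ⟨u, hu⟩ := O.tree_ne_none i
  obtain ⟨v, hv⟩ := O'.tree_ne_none i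
  have hb := σ.bar_eq
  have h1 := σ.mixed.color i
  have h2 := σ.mixed.rank i
  rw [rank_word, rank_word, hu, hv] at h2
  rw [← col_val O'.word, ← col_val O.word, col_word, col_word, hu, hv] at h1
  rw [← col_val O.word, col_word, hu] at h2
  have lu := O.len
  have lv := O'.len
  rw [hu] at lu
  rw [hv] at lv
  simp only [lettersOpt] at h1 h2 lu lv
  rw [Par.bar, Par.bar, hu, hv] at hb
  change (O.tree.map _).bind forgetBlue = (O'.tree.map _).bind forgetBlue
  rw [hu, hv]
  change forgetBlue u = forgetBlue v at hb
  change forgetBlue (doubleWord u i) = forgetBlue (doubleWord v (σ.toPerm i))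
  rcases e : entry (letters u) i with _ | _
  · rw [forgetBlue_double_red u _ e, forgetBlue_double_red v _ (h1.trans e), h2 e, hb]
  · rw [forgetBlue_double_blue u _ e (by omega), forgetBlue_double_blue v _ (h1.trans e) (by omega), hb]

theorem PaPerm.bar_toBlue {O O' : Par l} (σ : PaPerm O O') (i : Fin l) (hi : O.word i = red) :
    (O.toBlue i).bar = (O'.toBlue (σ.toPerm i)).bar := by
  obtain ⟨u, hu⟩ := O.tree_ne_none i
  obtain ⟨v, hv⟩ := O'.tree_ne_none i
  have hb := σ.bar_eq
  have h1 := σ.mixed.color i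
  have h2 := σ.mixed.rank i hi
  rw [rank_word, rank_word, hu, hv] at h2
  rw [hi, ← col_val O'.word, col_word, hv] at h1
  rw [← col_val O.word, col_word, hu] at hi
  simp only [lettersOpt] at h1 h2 hi
  rw [Par.bar, Par.bar, hu, hv] at hb
  change (O.tree.map _).bind forgetBlue = (O'.tree.map _).bind forgetBlue
  rw [hu, hv]
  change forgetBlue u = forgetBlue v at hb
  change forgetBlue (blueWord u i) = forgetBlue (blueWord v (σ.toPerm i))
  rw [forgetBlue_blueWord u _ hi, forgetBlue_blueWord v _ h1, h2, hb]

theorem isMixed_of_col {o o' : Fin l → Color} {b : BraidGroup l}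
    (h : col o' = labAct (perm b) (col o)) (h' : forget (redCount o) b o = 1) : IsMixed o o' b where
  color i := by rw [← col_val o', h, labAct_perm, col_val]
  trivial := h'

theorem IsMixed.col_eq {o o' : Fin l → Color} {b : BraidGroup l} (h : IsMixed o o' b) :
    col o' = labAct (perm b) (col o) := by rw [h.eq_colAct, col_colAct]

theorem isMixed_addLeft {O O' : Par l} {b : BraidGroup l} (h : IsMixed O.word O'.word b) (a : Color) :
    IsMixed (O.addLeft a).word (O'.addLeft a).word (addLeft b) := by
  obtain ⟨h1, h2⟩ := O.col_addLeft a
  obtain ⟨h3, h4⟩ := O'.col_addLeft a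
  have ht := tail_labAct_addLeft b (col (O.addLeft a).word)
  refine isMixed_of_col ?_ ?_
  · ext1 p
    rcases p with _ | p
    · rw [ht.2, h4, h2]
    · change tail (col (O'.addLeft a).word) p = tail (labAct _ (col (O.addLeft a).word)) p
      rw [ht.1, h3, h1, h.col_eq]
  · have r : redCount (O.addLeft a).word = redCount O.word + if a = red then 1 else 0 := by
      rw [redCount, rank_tail h1, rank_succ, rank_zero, h2, zero_add]; rfl
    cases a
    · rw [r, if_pos rfl, forget_addLeft_red b O.word _ rfl h1 h2, h.trivial, map_one]
    · rw [r, if_neg (by exact Color.noConfusion), add_zero,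
        forget_addLeft_blue b O.word _ rfl h1 h2, h.trivial]

theorem isMixed_addRight {O O' : Par l} {b : BraidGroup l} (h : IsMixed O.word O'.word b)
    (a : Color) : IsMixed (O.addRight a).word (O'.addRight a).word (addRight b) := by
  obtain ⟨h1, h2⟩ := O.col_addRight a
  obtain ⟨h3, h4⟩ := O'.col_addRight a
  refine isMixed_of_col ?_ ?_
  · ext1 p
    rw [labAct_addRight]
    rcases lt_trichotomy p l with hp | hp | hp
    · rw [h3 p hp, h.col_eq, labAct_lt (perm b) h1 p hp]
    · rw [hp, labAct_ge _ _ le_rfl, h4, h2]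
    · rw [labAct_ge _ _ hp.le, col, col, dif_neg (by omega), dif_neg (by omega)]
  · refine forget_addRight b O.word _ rfl rfl h1 ?_ h.trivial
    rw [redCount, rank_succ, rank_congr h1]
    split_ifs
    · exact .inl rfl
    · exact .inr rfl

theorem isMixed_double {O O' : Par l} {b : BraidGroup l} (h : IsMixed O.word O'.word b) (i : Fin l) :
    IsMixed (O.double i).word (O'.double (perm b i)).word (double b i) := by
  have h1 := O.col_double i
  refine isMixed_of_col ?_ ?_
  · rw [h1, O'.col_double, dup_labAct_double, h.col_eq]
  · have r := (rank_dup h1).2 l (by omega)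
    rw [redCount, r, col_val, show rank O.word l = redCount O.word from rfl]
    rcases e : O.word i with _ | _
    · have hi := rank_lt_redCount (c := O.word) (p := i) (by rw [col_val, e])
      rw [if_pos rfl, forget_double_red b O.word _ i ⟨_, hi⟩ rfl h1 e rfl, h.trivial, double_one]
    · rw [if_neg (by exact Color.noConfusion), add_zero,
        forget_double_blue b O.word _ i rfl h1 e, h.trivial]

theorem isMixed_toBlue {O O' : Par l} {b : BraidGroup l} (h : IsMixed O.word O'.word b) (i : Fin l)
    (hi : O.word i = red) : IsMixed (O.toBlue i).word (O'.toBlue (perm b i)).word b := by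
  refine isMixed_of_col ?_ ?_
  · rw [O.col_toBlue, O'.col_toBlue, h.col_eq]
    ext1 p
    rw [labAct_apply, Function.update_apply, Function.update_apply, labAct_apply]
    have : p = (perm b i).val ↔ extPerm (perm b)⁻¹ p = i.val := by
      rw [← extPerm_val, map_inv, Equiv.Perm.inv_eq_iff_eq, eq_comm]
    simp only [this]
  -- Forgetting in two stages: all strands are removed first, and then the one pole that has the
  -- rank of `i`.
  · have hd : col (O.toBlue i).word = expand blue O.word
        (col fun r : Fin (redCount O.word) => if r.val = rank O.word i then blue else red) := by
      rw [O.col_toBlue]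
      ext1 p
      rw [Function.update_apply, expand]
      by_cases hp : col O.word p = red
      · have hlt := rank_lt_redCount hp
        rw [if_pos hp, show rank O.word p = (⟨_, hlt⟩ : Fin (redCount O.word)).val from rfl, col_val]
        by_cases hpi : p = i.val
        · rw [if_pos hpi]; exact (if_pos (congrArg (rank O.word) hpi)).symm
        · rw [if_neg hpi, if_neg, hp]
          have hi' : col O.word i = red := by rw [col_val, hi]
          rcases Nat.lt_or_gt_of_ne hpi with h' | h'
          · exact (rank_lt h' hp).ne
          · exact (rank_lt h' hi').ne'
      · rw [if_neg hp]
        split_ifs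
        · rfl
        · rcases e : col O.word p with _ | _
          · exact absurd e hp
          · rfl
    rw [forget_forget b O.word _ _ rfl hd, h.trivial, forget_one]

end Ops

end

section

open Color PowerSeries

/-! ### Values of braids between parenthesised words. -/

section Values

variable {N l : ℕ} (Φ : Associator)

/-- The value of the change of parentheses to the left-normed word, for words that may be empty. -/
noncomputable def rebracketOpt (x : ℕ → Finset (Fin N)) : Option (FreeMagma Color) → ℕ → GrpN N
  | none, _ => 1
  | some u, k => rebracket Φ x u k

/-- The value of a braid between two parenthesised words, with labels `x` at the bottom. -/
noncomputable def wordValue (x : ℕ → Finset (Fin N)) (O : Option (FreeMagma Color))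
    (b : BraidGroup l) (O' : Option (FreeMagma Color)) : GrpN N :=
  rebracketOpt Φ x O 0 * braidValue Φ b x * (rebracketOpt Φ (labAct (perm b) x) O' 0)⁻¹

section

variable {x : ℕ → Finset (Fin N)}

theorem rebracketOpt_mem (O : Option (FreeMagma Color)) (k : ℕ) :
    rebracketOpt Φ x O k ∈ lieGroup (blueSpace N) := by
  cases O
  · exact one_mem _
  · exact rebracket_mem Φ x _ k

theorem wordValue_mem (O : Option (FreeMagma Color)) (b : BraidGroup l)
    (O' : Option (FreeMagma Color)) : wordValue Φ x O b O' ∈ lieGroup (blueSpace N) :=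
  mul_mem (mul_mem (rebracketOpt_mem Φ _ _) (braidValue_mem Φ b x)) (inv_mem (rebracketOpt_mem Φ _ _))

theorem wordValue_one (O : Option (FreeMagma Color)) :
    wordValue Φ x O (1 : BraidGroup l) O = 1 := by
  rw [wordValue, braidValue_one, perm_one, map_one, mul_one]; exact mul_inv_cancel _

theorem wordValue_mul (O O' O'' : Option (FreeMagma Color)) (a b : BraidGroup l) :
    wordValue Φ x O (a * b) O'' =
      wordValue Φ x O a O' * wordValue Φ (labAct (perm a) x) O' b O'' := by
  rw [wordValue, wordValue, wordValue, braidValue_mul, labAct_perm_mul]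
  group

theorem unitPull_rebracketOpt {M : ℕ} (f : Fin M → Option (Fin N)) (hx : Disj x)
    (O : Option (FreeMagma Color)) (k : ℕ) : unitPull f (rebracketOpt Φ x O k) =
      rebracketOpt Φ (fun p => preim f (x p)) O k := by
  cases O
  · exact map_one _
  · exact unitPull_rebracket Φ f hx _ _

theorem unitPull_wordValue {M : ℕ} (f : Fin M → Option (Fin N)) (hx : Disj x)
    (O : Option (FreeMagma Color)) (b : BraidGroup l) (O' : Option (FreeMagma Color)) :
    unitPull f (wordValue Φ x O b O') = wordValue Φ (fun p => preim f (x p)) O b O' := by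
  rw [wordValue, wordValue, map_mul, map_mul, map_inv, unitPull_rebracketOpt Φ f hx,
    unitPull_braidValue Φ f b hx, unitPull_rebracketOpt Φ f (hx.labAct _),
    labAct_comp (perm b) x (preim f)]

theorem wordValue_congr {x x' : ℕ → Finset (Fin N)} (hx : Disj x) (hx' : Disj x')
    (h : ∀ p < l, x p = x' p) (O O' : Par l) (b : BraidGroup l) :
    wordValue Φ x O.tree b O'.tree = wordValue Φ x' O.tree b O'.tree := by
  have H : ∀ (x x' : ℕ → Finset (Fin N)) (O : Par l), (∀ p < l, x p = x' p) →
      rebracketOpt Φ x O.tree 0 = rebracketOpt Φ x' O.tree 0 := by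
    intro x x' O h
    have hO := O.len
    generalize O.tree = T at hO
    rcases T with _ | u
    · rfl
    · exact rebracket_congr Φ fun q hq => h q (by
        rw [← hO]; change q < 0 + (letters u).length at hq; rw [zero_add] at hq; exact hq)
  rw [wordValue, wordValue, H x x' O h, braidValue_congr Φ b hx hx' h, H _ _ O' (labAct_lt _ h)]

theorem rebracketOpt_addRight (a : Color) (O : Option (FreeMagma Color)) :
    rebracketOpt Φ x (join O (some (.of a))) 0 = rebracketOpt Φ x O 0 := by
  rcases O with _ | u
  · rfl
  · change rebracket Φ x (u * .of a) 0 = rebracket Φ x u 0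
    rw [rebracket_mul, rebracket_of, seg, phi_empty_left]; simp

theorem wordValue_addRight (a a' : Color) (O O' : Option (FreeMagma Color)) (b : BraidGroup l) :
    wordValue Φ x (join O (some (.of a))) (addRight b) (join O' (some (.of a'))) =
      wordValue Φ x O b O' := by
  rw [wordValue, wordValue, braidValue_addRight, labAct_addRight, rebracketOpt_addRight,
    rebracketOpt_addRight]

theorem rebracketOpt_addLeft (hx : Disj x) (a : Color) (O : Par l) :
    rebracketOpt Φ x (join (some (.of a)) O.tree) 0 * tailPhi Φ x 0 l =
      rebracketOpt Φ (tail x) O.tree 0 := by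
  have hO := O.len
  generalize O.tree = T at hO
  rcases T with _ | u
  · change 0 = l at hO
    subst hO
    exact mul_one _
  · change (letters u).length = l at hO
    have := rebracket_tail Φ hx u 0
    rw [hO, seg, phi_empty_middle, one_mul] at this
    change rebracket Φ x (.of a * u) 0 * _ = rebracket Φ (tail x) u 0
    rw [rebracket_mul, rebracket_of, seg, phi_empty_left, inv_one, one_mul, one_mul, ← this]
    rfl

/-- The factors `tailPhi` that the braid contributes cancel against those of the two words. For
cabling the factors `mergePhi` cancel in the same way. -/
theorem wordValue_addLeft (hx : Disj x) (a a' : Color) (O O' : Par l) (b : BraidGroup l) :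
    wordValue Φ x (O.addLeft a).tree (addLeft b) (O'.addLeft a').tree =
      wordValue Φ (tail x) O.tree b O'.tree := by
  change wordValue Φ x (join _ O.tree) (addLeft b) (join _ O'.tree) = _
  rw [wordValue, wordValue, braidValue_addLeft Φ b hx, ← rebracketOpt_addLeft Φ hx a O,
    ← (tail_labAct_addLeft b x).1, ← rebracketOpt_addLeft Φ (hx.labAct _) a' O']
  group

theorem rebracketOpt_double (hx : Disj x) (O : Par l) (i : Fin l) :
    rebracketOpt Φ x (O.double i).tree 0 =
      rebracketOpt Φ (merge i x) O.tree 0 * (mergePhi Φ i x)⁻¹ := by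
  obtain ⟨_ | u, h⟩ := O
  · subst h; exact i.elim0
  · have := rebracket_double Φ hx u (i := i.val) (k := 0) (i.isLt.trans_eq h.symm)
    rw [zero_add] at this
    exact this

theorem wordValue_double (hx : Disj x) (O O' : Par l) (b : BraidGroup l) (i : Fin l) :
    wordValue Φ x (O.double i).tree (double b i) (O'.double (perm b i)).tree =
      wordValue Φ (merge i x) O.tree b O'.tree := by
  rw [wordValue, wordValue, braidValue_double Φ b i hx, rebracketOpt_double Φ hx,
    rebracketOpt_double Φ (hx.labAct _), merge_labAct_double]
  group

theorem rebracketOpt_toBlue (O : Par l) (i : Fin l) :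
    rebracketOpt Φ x (O.toBlue i).tree 0 = rebracketOpt Φ x O.tree 0 := by
  obtain ⟨_ | u, h⟩ := O
  · rfl
  · change rebracket Φ x (blueWord u i) 0 = rebracket Φ x u 0
    clear h
    generalize 0 = k, i.val = j
    induction u generalizing k j with
    | ih1 a => rfl
    | ih2 u v hu hv =>
      change rebracket Φ x (subst _ (u * v) j) k = rebracket Φ x (u * v) k
      rw [subst_mul]
      split_ifs with h
      · rw [rebracket_mul, rebracket_mul, length_blueWord, hu]
      · rw [rebracket_mul, rebracket_mul, length_blueWord, hv]

theorem wordValue_toBlue (O O' : Par l) (b : BraidGroup l) (i j : Fin l) :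
    wordValue Φ x (O.toBlue i).tree b (O'.toBlue j).tree = wordValue Φ x O.tree b O'.tree := by
  rw [wordValue, wordValue, rebracketOpt_toBlue, rebracketOpt_toBlue]

end

/-! ### Removing the strands -/

section

variable {m : ℕ} {c : Fin l → Color} {z : ℕ → Finset (Fin N)}

theorem Disj.expand (hz : Disj z) (c : Fin l → Color) : Disj (expand ∅ c z) := by
  intro p q h
  unfold MixedBraids.expand
  split_ifs with h1 h2
  · refine hz _ _ ?_
    rcases Nat.lt_or_gt_of_ne h with h' | h'
    · exact (rank_lt h' h1).ne
    · exact (rank_lt h' h2).ne'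
  all_goals simp

theorem seg_expand (c : Fin l → Color) (z : ℕ → Finset (Fin N)) (k : ℕ) {n : ℕ} :
    ∀ {r : ℕ}, rank c (k + n) = rank c k + r → seg (expand ∅ c z) k n = seg z (rank c k) r := by
  induction n with
  | zero => intro r hr; obtain rfl : r = 0 := by rw [add_zero] at hr; omega
            rfl
  | succ n ih =>
    intro r hr
    rw [← add_assoc, rank_succ] at hr
    rw [seg, expand]
    have := rank_mono c (show k ≤ k + n by omega)
    split_ifs at hr ⊢ with h
    · obtain ⟨r', rfl⟩ : ∃ r', r = r' + 1 := ⟨r - 1, by omega⟩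
      rw [seg, ih (r := r') (by omega)]
      congr 2; omega
    · rw [Finset.union_empty]; exact ih (by omega)

/-- A crossing with an empty bundle is trivial, since each of its factors has a zero argument, and
an empty bundle adds nothing to the prefix of another crossing. -/
theorem braidValue_expand (b : BraidGroup l) (hm : redCount c = m) (hz : Disj z) :
    braidValue Φ b (expand ∅ c z) = braidValue Φ (forget m b c) z := by
  induction b using braid_induction generalizing c z with
  | one => rw [forget_one, braidValue_one, braidValue_one]
  | gen j hj =>
    rw [forget_sig _ hj, braidValue_sig Φ hj, genValue_of_disj Φ (hz.expand c)]
    by_cases hc : col c j = red ∧ col c (j + 1) = red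
    · have h2 := rank_lt_redCount hc.2
      have r := rank_succ c j
      rw [if_pos hc.1] at r
      rw [forgetGen_red hm hc.1 hc.2, braidValue_sig Φ (by omega), genValue_of_disj Φ hz,
        seg_expand c z 0 (r := rank c j) (by rw [zero_add, rank_zero, zero_add]), expand, expand,
        if_pos hc.1, if_pos hc.2, r, rank_zero]
    · rw [forgetGen_one hc, braidValue_one]
      by_cases h1 : col c j = red
      · have h2 : expand ∅ c z (j + 1) = ∅ := if_neg fun h => hc ⟨h1, h⟩
        rw [h2, crossing, phi_empty_right, phi_empty_middle, cross_empty_right]; simp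
      · have h2 : expand ∅ c z j = ∅ := if_neg h1
        rw [h2, crossing, phi_empty_right, phi_empty_middle, cross_empty_left]; simp
  | mul a b ha hb =>
    rw [forget_mul, braidValue_mul, braidValue_mul, ha hm hz, expand_labAct ∅ a c z hm,
      hb ((redCount_perm a c).trans hm) (hz.labAct _)]
  | inv a ha =>
    have h := expand_labAct ∅ a (colAct (perm a).symm c)
      (labAct (perm (forget m a (colAct (perm a).symm c)))⁻¹ z) (colAct_inv_redCount a hm)
    rw [labAct_inv_right, colAct_inv_right] at h
    rw [forget_inv, braidValue_inv, braidValue_inv, ← ha (colAct_inv_redCount a hm) (hz.labAct _)]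
    congr 2
    rw [← labAct_injective_iff (perm a), labAct_inv_right, h]

theorem rank_add {u : FreeMagma Color} {k : ℕ} (h : ∀ q < (letters u).length,
    col c (k + q) = entry (letters u) q) :
    rank c (k + (letters u).length) = rank c k + (lettersOpt (forgetBlue u)).length := by
  have : ∀ n ≤ (letters u).length, rank c (k + n) = rank c k + redsBefore (letters u) n := by
    intro n hn
    induction n with
    | zero => rfl
    | succ n ih => rw [← add_assoc, rank_succ, ih (by omega), redsBefore_succ, h n (by omega), add_assoc]
  rw [this _ le_rfl, length_forgetBlue, redsBefore, List.take_length]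

theorem rebracket_expand (u : FreeMagma Color) {k : ℕ} (h : ∀ q < (letters u).length,
    col c (k + q) = entry (letters u) q) :
    rebracket Φ (expand ∅ c z) u k = rebracketOpt Φ z (forgetBlue u) (rank c k) := by
  induction u generalizing k with
  | ih1 a => cases a <;> rfl
  | ih2 u v hu hv =>
    change ∀ q < (letters u ++ letters v).length, col c (k + q) = entry (letters u ++ letters v) q at h
    rw [List.length_append] at h
    have h1 : ∀ q < (letters u).length, col c (k + q) = entry (letters u) q := fun q hq => by
      rw [h q (by omega), entry_append_left hq]
    have h2 : ∀ q < (letters v).length, col c (k + (letters u).length + q) = entry (letters v) q :=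
      fun q hq => by
        rw [add_assoc, h _ (by omega), entry_append_right (by omega), Nat.add_sub_cancel_left]
    have r1 := rank_add h1
    have r2 := rank_add h2
    change rebracket Φ (expand ∅ c z) (u * v) k = rebracketOpt Φ z (join (forgetBlue u) (forgetBlue v)) _
    rw [rebracket_mul, hu h1, hv h2, seg_expand c z k r1, seg_expand c z _ r2,
      seg_expand c z 0 (r := rank c k) (by rw [zero_add, rank_zero, zero_add]), r1, rank_zero]
    generalize forgetBlue u = u'
    generalize forgetBlue v = v'
    rcases u' with _ | u'
    · rw [show (lettersOpt none).length = 0 from rfl, seg, phi_empty_middle, inv_one, one_mul]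
      exact one_mul _
    · rcases v' with _ | v'
      · rw [show (lettersOpt none).length = 0 from rfl, seg, phi_empty_right, inv_one, one_mul]
        exact mul_one _
      · rfl

theorem rebracketOpt_expand (O : Par l) :
    rebracketOpt Φ (expand ∅ O.word z) O.tree 0 = rebracketOpt Φ z O.bar 0 := by
  have h := col_word O
  generalize O.word = c at h
  rw [Par.bar]
  generalize O.tree = T at h
  rcases T with _ | u
  · rfl
  · exact rebracket_expand Φ u fun q _ => by rw [zero_add, h]; rfl

/-- Once the blue strands are invisible, the value is that of the trivial braid between two equal
words of poles, whose changes of parentheses cancel. -/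
theorem wordValue_expand {O O' : Par l} {b : BraidGroup l} (hb : IsMixed O.word O'.word b)
    (hbar : O.bar = O'.bar) (hz : Disj z) :
    wordValue Φ (expand ∅ O.word z) O.tree b O'.tree = 1 := by
  rw [wordValue, rebracketOpt_expand, braidValue_expand Φ b rfl hz, hb.trivial, braidValue_one,
    expand_labAct ∅ b O.word z rfl, hb.trivial, ← hb.eq_colAct, rebracketOpt_expand, perm_one, map_one,
    hbar]
  simp

end

/-- Every position is labelled by itself. -/
def selfLabel (l : ℕ) (p : ℕ) : Finset (Fin l) := Finset.univ.filter fun x => x.val = p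

theorem mem_selfLabel {p : ℕ} {x : Fin l} : x ∈ selfLabel l p ↔ x.val = p := by simp [selfLabel]

theorem selfLabel_disj : Disj (selfLabel l) := fun p q h => by
  rw [Finset.disjoint_left]
  intro x hx hx'
  rw [mem_selfLabel] at hx hx'
  exact h (hx.symm.trans hx')

theorem preim_selfLabel (f : Fin N → Option (Fin l)) (p : ℕ) :
    preim f (selfLabel l p) = Finset.univ.filter fun x => ∃ i, f x = some i ∧ i.val = p := by
  ext x
  simp only [mem_preim, mem_selfLabel, Finset.mem_filter, Finset.mem_univ, true_and]
  grind

/-- The value of a braid between two parenthesised words, as a series in the chords between its strands,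
which are labelled by their positions at the bottom. -/
noncomputable def value (O : Par l) (b : BraidGroup l) (O' : Par l) : GrpN l :=
  wordValue Φ (selfLabel l) O.tree b O'.tree

theorem value_mem (O : Par l) (b : BraidGroup l) (O' : Par l) :
    value Φ O b O' ∈ lieGroup (blueSpace l) := wordValue_mem Φ _ _ _

theorem value_one (O : Par l) : value Φ O 1 O = 1 := wordValue_one Φ _

/-- Permuting the labels is a pullback along the permutation. The cocycle rule thereby becomes the
composition rule of chord diagrams. -/
theorem labAct_selfLabel (σ : Equiv.Perm (Fin l)) :
    labAct σ (selfLabel l) = fun p => preim (fun x => some (σ x)) (selfLabel l p) := by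
  ext1 p
  rw [preim_selfLabel, labAct_apply]
  ext x
  rw [mem_selfLabel, Finset.mem_filter]
  simp only [Finset.mem_univ, true_and, Option.some.injEq]
  rw [map_inv, Equiv.Perm.eq_inv_iff_eq, extPerm_val]
  simp

theorem value_mul (O O' O'' : Par l) (a b : BraidGroup l) : value Φ O (a * b) O'' =
    value Φ O a O' * unitPull (fun x => some (perm a x)) (value Φ O' b O'') := by
  rw [value, wordValue_mul Φ _ O'.tree, labAct_selfLabel, value, value,
    unitPull_wordValue Φ _ selfLabel_disj]

theorem value_addLeft (a a' : Color) (O O' : Par l) (b : BraidGroup l) :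
    value Φ (O.addLeft a) (addLeft b) (O'.addLeft a') =
      unitPull (Fin.cases none some) (value Φ O b O') := by
  rw [value, wordValue_addLeft Φ selfLabel_disj, value, unitPull_wordValue Φ _ selfLabel_disj]
  congr 1
  ext1 p
  rw [preim_selfLabel]
  ext x
  rw [tail, mem_selfLabel, Finset.mem_filter]
  refine Fin.cases ?_ (fun x => ?_) x <;> simp

theorem value_addRight (a a' : Color) (O O' : Par l) (b : BraidGroup l) :
    value Φ (O.addRight a) (addRight b) (O'.addRight a') =
      unitPull (Fin.lastCases none some) (value Φ O b O') := by
  refine (wordValue_addRight Φ a a' O.tree O'.tree b).trans ?_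
  rw [value, unitPull_wordValue Φ _ selfLabel_disj]
  -- The labellings differ at the position `l`, where one of them has the new strand and the other
  -- the empty set; the braid does not reach that position.
  refine wordValue_congr Φ selfLabel_disj (selfLabel_disj.preim _) (fun p hp => ?_) O O' b
  rw [preim_selfLabel]
  ext x
  rw [mem_selfLabel, Finset.mem_filter]
  refine Fin.lastCases ?_ (fun x => ?_) x
  · simp; omega
  · simp

theorem predAbove_val (i : Fin l) (x : Fin (l + 1)) :
    (i.predAbove x).val = if i.val < x.val then x.val - 1 else x.val := by
  rw [Fin.predAbove]
  simp only [Fin.lt_def]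
  split_ifs <;> first | rfl | (exfalso; simp_all)

theorem value_double (O O' : Par l) (b : BraidGroup l) (i : Fin l) :
    value Φ (O.double i) (double b i) (O'.double (perm b i)) =
      unitPull (fun x => some (i.predAbove x)) (value Φ O b O') := by
  rw [value, wordValue_double Φ selfLabel_disj, value, unitPull_wordValue Φ _ selfLabel_disj]
  congr 1
  ext1 p
  rw [preim_selfLabel]
  ext x
  rw [Finset.mem_filter, merge]
  simp only [Finset.mem_univ, true_and, Option.some.injEq, exists_eq_left', predAbove_val]
  split_ifs <;> simp only [Finset.mem_union, mem_selfLabel] <;> omega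

theorem value_toBlue (O O' : Par l) (b : BraidGroup l) (i j : Fin l) :
    value Φ (O.toBlue i) b (O'.toBlue j) = value Φ O b O' := wordValue_toBlue Φ O O' b i j

/-- Dropping the chords at blue positions is a pullback along a partial map and replaces the labels
of these positions by the empty set. -/
theorem dropBlue_value {O O' : Par l} {b : BraidGroup l} (hb : IsMixed O.word O'.word b)
    (hbar : O.bar = O'.bar) :
    PowerSeries.map (dropBlue O.word).toRingHom (value Φ O b O' : (BlueAlg l)⟦X⟧) = 1 := by
  have h := unitPull_wordValue Φ (fun x => if O.word x = red then some x else none)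
    (selfLabel_disj (l := l)) O.tree b O'.tree
  -- The red positions keep themselves as labels. Ranks of distinct red positions differ, so the
  -- labels are indexed by rank.
  have e : (fun p => preim (fun x => if O.word x = red then some x else none) (selfLabel l p)) =
      expand ∅ O.word fun r => Finset.univ.filter fun x => O.word x = red ∧ rank O.word x = r := by
    ext1 p
    rw [preim_selfLabel, expand]
    ext x
    rw [Finset.mem_filter]
    by_cases hp : col O.word p = red
    · rw [if_pos hp, Finset.mem_filter]
      simp only [Finset.mem_univ, true_and]
      constructor
      · rintro ⟨i, h1, rfl⟩
        rw [col_val] at hp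
        split_ifs at h1 with h2
        rw [← Option.some.inj h1]
        exact ⟨h2, rfl⟩
      · rintro ⟨h1, h2⟩
        refine ⟨x, if_pos h1, ?_⟩
        rw [← col_val O.word] at h1
        by_contra hne
        rcases Nat.lt_or_gt_of_ne hne with h' | h'
        · exact (rank_lt h' h1).ne h2
        · exact (rank_lt h' hp).ne' h2
    · rw [if_neg hp]
      simp only [Finset.mem_univ, true_and, Finset.notMem_empty, iff_false]
      rintro ⟨i, h1, rfl⟩
      split_ifs at h1 with h2
      rw [← Option.some.inj h1, col_val] at hp
      exact hp h2
  rw [e, wordValue_expand Φ hb hbar] at h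
  · exact congrArg Units.val h
  · intro r s hrs
    rw [Finset.disjoint_left]
    intro x hx hx'
    rw [Finset.mem_filter] at hx hx'
    exact hrs (hx.2.2.symm.trans hx'.2.2)

end Values

end

section

open Color PowerSeries

/-! ### Full twists of two strands. -/

section Twists

variable {N l m : ℕ} (Φ : Associator)

theorem perm_twistAux {i d : ℕ} (h : i + d + 1 < l) : perm (twistAux l i d) = 1 := by
  induction d with
  | zero =>
    rw [twistAux, perm_mul, perm_sig h]
    have := sw_inv (l := l) i
    change sw l i * sw l i = 1
    nth_rewrite 1 [← this]
    exact inv_mul_cancel _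
  | succ d ih =>
    rw [twistAux, perm_mul, perm_mul, ih (by omega), perm_inv]
    ext x; simp

theorem perm_twist {i j : Fin l} (h : i < j) : perm (twist i j) = 1 :=
  perm_twistAux (by have := j.isLt; rw [Fin.lt_def] at h; omega)

/-- If one of the two strands is blue, the twist in the middle disappears, and the crossings that
brought the strands together cancel. -/
theorem forget_twistAux {i d : ℕ} (h : i + d + 1 < l) (c : Fin l → Color)
    (hc : ¬ (col c i = red ∧ col c (i + d + 1) = red)) : forget m (twistAux l i d) c = 1 := by
  induction d generalizing c with
  | zero =>
    rw [twistAux, forget_mul, forget_sig m h, forget_sig m h, forgetGen_one hc, perm_sig h,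
      forgetGen_one, one_mul]
    rw [col_sw h, col_sw h, if_pos rfl, if_neg (by omega), if_pos rfl]
    exact fun h => hc h.symm
  | succ d ih =>
    have h' : i + d + 1 + 1 < l := by omega
    have e : forget m (twistAux l i d) (colAct (perm (sig l (i + d + 1))) c) = 1 := by
      refine ih (by omega) _ ?_
      rw [perm_sig h', col_sw h', col_sw h', if_neg (by omega), if_neg (by omega), if_pos rfl]
      exact hc
    rw [twistAux, forget_mul, forget_mul, e, forget_inv, perm_mul, perm_twistAux (by omega)]
    rw [show colAct (perm (sig l (i + d + 1))).symm
      (colAct ((perm (sig l (i + d + 1))).trans 1) c) = c from funext fun x =>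
        congrArg c ((perm (sig l (i + d + 1))).symm_apply_apply x), mul_one, mul_inv_cancel]

theorem isMixed_twist {c : Fin l → Color} {i j : Fin l} (h : i < j) (hc : Allowed c i j) :
    IsMixed c c (twist i j) where
  color x := by rw [perm_twist h]; rfl
  trivial := by
    have hj := j.isLt
    rw [Fin.lt_def] at h
    refine forget_twistAux (by omega) _ ?_
    rw [show i.val + (j.val - i.val - 1) + 1 = j.val by omega, col_val, col_val]
    rintro ⟨h1, h2⟩
    rcases hc.2 with h | h
    · rw [h1] at h; cases h
    · rw [h2] at h; cases h

/-- For neighbours the inner associators of the two crossings cancel, which leaves a conjugate of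
the squared exponential. Bringing distant strands together is one more conjugation. -/
theorem braidValue_twistAux {i d : ℕ} (h : i + d + 1 < l) {x : ℕ → Finset (Fin N)} (hx : Disj x) :
    ∃ g ∈ lieGroup (blueSpace N), braidValue Φ (twistAux l i d) x =
      g * (cross (x i) (x (i + d + 1)) * cross (x i) (x (i + d + 1))) * g⁻¹ := by
  induction d generalizing x with
  | zero =>
    refine ⟨_, phi_mem Φ (seg x 0 i) (x i) (x (i + 1)), ?_⟩
    rw [twistAux, braidValue_mul, braidValue_sig Φ h, braidValue_sig Φ h, perm_sig h,
      genValue_of_disj Φ hx, genValue_of_disj Φ (hx.labAct _), seg_labAct_sw_of_not_mem h (by omega),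
      labAct_sw h, labAct_sw h, if_pos rfl, if_neg (by omega), if_pos rfl, crossing, crossing,
      cross_symm (x (i + 1))]
    group
  | succ d ih =>
    have h' : i + d + 1 + 1 < l := by omega
    obtain ⟨g, hg, e⟩ := ih (by omega) (hx.labAct (perm (sig l (i + d + 1))))
    refine ⟨braidValue Φ (sig l (i + d + 1)) x * g, mul_mem (braidValue_mem Φ _ _) hg, ?_⟩
    have e2 : labAct (perm (sig l (i + d + 1)))⁻¹
        (labAct (perm (sig l (i + d + 1) * twistAux l i d)) x) = x := by
      rw [labAct_perm_mul, perm_twistAux (by omega), map_one, Equiv.Perm.one_apply,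
        ← Equiv.Perm.mul_apply, ← map_mul, inv_mul_cancel, map_one]; rfl
    rw [perm_sig h', labAct_sw h', labAct_sw h', if_neg (by omega), if_neg (by omega), if_pos rfl,
      ← perm_sig h'] at e
    rw [twistAux, braidValue_mul, braidValue_mul, e, braidValue_inv, e2]
    group

theorem selfLabel_val (i : Fin l) : selfLabel l i.val = {i} := by
  ext x; rw [mem_selfLabel, Finset.mem_singleton, Fin.ext_iff]

theorem braidValue_twist {i j : Fin l} (h : i < j) : ∃ g ∈ lieGroup (blueSpace l),
    braidValue Φ (twist i j) (selfLabel l) = g * (cross {i} {j} * cross {i} {j}) * g⁻¹ := by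
  have hj := j.isLt
  rw [Fin.lt_def] at h
  obtain ⟨g, hg, e⟩ := braidValue_twistAux Φ (l := l) (i := i.val) (d := j.val - i.val - 1)
    (by omega) selfLabel_disj
  refine ⟨g, hg, ?_⟩
  rw [show i.val + (j.val - i.val - 1) + 1 = j.val by omega, selfLabel_val, selfLabel_val] at e
  exact e

end Twists

/-! ### Leading terms of products. -/

section Series

variable {A B : Type*} [Ring A] [Algebra ℚ A] [Ring B] [Algebra ℚ B]

/-- A linear map, applied to the coefficients. -/
noncomputable def mapCoeff (f : A →ₗ[ℚ] B) : A⟦X⟧ →ₗ[ℚ] B⟦X⟧ where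
  toFun x := PowerSeries.mk fun d => f (coeff d x)
  map_add' x y := by ext d; simp
  map_smul' r x := by
    ext d
    rw [coeff_mk, RingHom.id_apply, PowerSeries.coeff_smul, PowerSeries.coeff_smul, coeff_mk, map_smul]

theorem coeff_mapCoeff (f : A →ₗ[ℚ] B) (x : A⟦X⟧) (d : ℕ) :
    coeff d (mapCoeff f x) = f (coeff d x) := by
  change coeff d (PowerSeries.mk fun d => f (coeff d x)) = _
  rw [coeff_mk]

theorem coeff_zero_lieGroup {V : Submodule ℚ A} {g : A⟦X⟧ˣ} (hg : g ∈ lieGroup V) :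
    coeff 0 (g : A⟦X⟧) = 1 := by
  obtain ⟨u, -, e⟩ := hg
  rw [e, coeff_zero_expSeries]

/-- Linear terms add when the constant terms are 1, and those of `g` and `g⁻¹` are opposite. -/
theorem coeff_one_conj {V : Submodule ℚ A} {g h : A⟦X⟧ˣ} (hg : g ∈ lieGroup V)
    (hh : coeff 0 (h : A⟦X⟧) = 1) : coeff 1 ((g * h * g⁻¹ : A⟦X⟧ˣ) : A⟦X⟧) = coeff 1 (h : A⟦X⟧) := by
  have h0 := coeff_zero_lieGroup hg
  have h1 := coeff_zero_lieGroup (inv_mem hg)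
  have h2 := Associator.coeff_one_mul h0 h1
  rw [← Units.val_mul, mul_inv_cancel, Units.val_one, coeff_one, if_neg one_ne_zero] at h2
  rw [Units.val_mul, Units.val_mul, Associator.coeff_one_mul (Associator.coeff_zero_mul h0 hh) h1,
    Associator.coeff_one_mul h0 hh, add_right_comm, ← h2, zero_add]

theorem Vanish.prod {w : List A⟦X⟧} (h : ∀ f ∈ w, Vanish 1 f) : Vanish w.length w.prod := by
  induction w with
  | nil => exact fun d hd => absurd hd (by simp)
  | cons f w ih =>
    rw [List.prod_cons, List.length_cons, add_comm]
    exact (h f (by simp)).mul (ih fun g hg => h g (by simp [hg]))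

theorem coeff_mul_of_vanish {f g : A⟦X⟧} {m n : ℕ} (hf : Vanish m f) (hg : Vanish n g) :
    coeff (m + n) (f * g) = coeff m f * coeff n g := by
  rw [coeff_mul, Finset.sum_eq_single (m, n)]
  · rintro ⟨p, q⟩ hpq hne
    have hpq' : p + q = m + n := Finset.HasAntidiagonal.mem_antidiagonal.1 hpq
    rcases Nat.lt_or_ge p m with h | h
    · simp only []; rw [hf p h, zero_mul]
    · rcases Nat.lt_or_ge q n with h' | h'
      · simp only []; rw [hg q h', mul_zero]
      · exact absurd (Prod.ext (by simp; omega) (by simp; omega)) hne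
  · intro h
    exact absurd (Finset.HasAntidiagonal.mem_antidiagonal.2
      (rfl : (m, n).1 + (m, n).2 = m + n)) h

theorem coeff_prod {w : List A⟦X⟧} (h : ∀ f ∈ w, Vanish 1 f) :
    coeff w.length w.prod = (w.map (coeff 1)).prod := by
  induction w with
  | nil => simp
  | cons f w ih =>
    have h' : ∀ g ∈ w, Vanish 1 g := fun g hg => h g (by simp [hg])
    rw [List.prod_cons, List.length_cons, add_comm, coeff_mul_of_vanish (h f (by simp)) (Vanish.prod h'),
      ih h', List.map_cons, List.prod_cons]

end Series

/-! ### Linear extension of the values, and passage to mixed series. -/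

section Linear

variable {l : ℕ} (Φ : Associator)

/-- The linear extension of `value` to linear combinations of braids. -/
noncomputable def valueLin (O O' : Par l) : BraidAlg l →ₗ[ℚ] (BlueAlg l)⟦X⟧ :=
  Finsupp.linearCombination ℚ (fun b => (value Φ O b O' : (BlueAlg l)⟦X⟧)) ∘ₗ
    (MonoidAlgebra.coeffLinearEquiv ℚ).toLinearMap

theorem valueLin_br (O O' : Par l) (b : BraidGroup l) :
    valueLin Φ O O' (br b) = (value Φ O b O' : (BlueAlg l)⟦X⟧) := by
  rw [valueLin, br, MonoidAlgebra.of_apply, LinearMap.comp_apply]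
  change Finsupp.linearCombination ℚ _ (Finsupp.single b 1) = _
  rw [Finsupp.linearCombination_single, one_smul]

/-- The homomorphism of series induced by a partial map of the positions. -/
noncomputable abbrev pullSeries {M N : ℕ} (f : Fin N → Option (Fin M)) :
    (BlueAlg M)⟦X⟧ →+* (BlueAlg N)⟦X⟧ := PowerSeries.map (bluePull f).toRingHom

theorem unitPull_val {M N : ℕ} (f : Fin N → Option (Fin M)) (g : GrpN M) :
    (unitPull f g : (BlueAlg N)⟦X⟧) = pullSeries f g := rfl

theorem map_smul_series {A B : Type*} [Ring A] [Algebra ℚ A] [Ring B] [Algebra ℚ B] (f : A →ₐ[ℚ] B)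
    (r : ℚ) (x : A⟦X⟧) : PowerSeries.map f.toRingHom (r • x) = r • PowerSeries.map f.toRingHom x := by
  ext d
  rw [coeff_map, PowerSeries.coeff_smul, PowerSeries.coeff_smul, coeff_map]
  exact map_smul f _ _

theorem valueLin_br_mul (O O' O'' : Par l) (a : BraidGroup l) (y : BraidAlg l) :
    valueLin Φ O O'' (br a * y) =
      valueLin Φ O O' (br a) * pullSeries (fun x => some (perm a x)) (valueLin Φ O' O'' y) := by
  induction y using MonoidAlgebra.induction_on with
  | of b =>
    change valueLin Φ O O'' (br a * br b) = _ * pullSeries _ (valueLin Φ O' O'' (br b))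
    rw [← br_mul, valueLin_br, valueLin_br, valueLin_br, value_mul Φ O O', Units.val_mul, unitPull_val]
  | add x y hx hy => rw [mul_add, map_add, map_add, map_add, mul_add, hx, hy]
  | smul r x hx => rw [mul_smul_comm, map_smul, map_smul, map_smul_series, hx, mul_smul_comm]

/-- All braids in `x` have the same permutation, so one relabelling of the second factor serves for
all of them. -/
theorem valueLin_mul (O O' O'' : Par l) {o o' : Fin l → Color} {σ : Equiv.Perm (Fin l)}
    {x : BraidAlg l} (hx : x ∈ MB o o' σ) (y : BraidAlg l) : valueLin Φ O O'' (x * y) =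
      valueLin Φ O O' x * pullSeries (fun x => some (σ x)) (valueLin Φ O' O'' y) := by
  induction hx using Submodule.span_induction with
  | zero => rw [zero_mul, map_zero, map_zero, zero_mul]
  | add u v _ _ hu hv => rw [add_mul, map_add, map_add, hu, hv, add_mul]
  | smul r u _ hu => rw [smul_mul_assoc, map_smul, map_smul, hu, smul_mul_assoc]
  | mem u hu =>
    obtain ⟨b, -, rfl, rfl⟩ := hu
    exact valueLin_br_mul Φ O O' O'' b y

theorem bluePull_id : bluePull (fun x : Fin l => some ((1 : Equiv.Perm (Fin l)) x)) = AlgHom.id ℚ _ :=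
  ChordAlg.hom_ext fun i j => pull_perm_t (σ := 1) (fun _ => rfl) _ i j

theorem pullSeries_one (x : (BlueAlg l)⟦X⟧) :
    pullSeries (fun x : Fin l => some ((1 : Equiv.Perm (Fin l)) x)) x = x := by
  ext d
  rw [coeff_map, bluePull_id]; rfl

theorem valueLin_pure_mul (O O' O'' : Par l) {o o' : Fin l → Color}
    {x : BraidAlg l} (hx : x ∈ MB o o' 1) (y : BraidAlg l) : valueLin Φ O O'' (x * y) =
      valueLin Φ O O' x * valueLin Φ O' O'' y := by
  rw [valueLin_mul Φ O O' O'' hx, pullSeries_one]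

theorem augIdeal_le (o : Fin l → Color) : augIdeal o ≤ MB o o 1 := by
  rw [augIdeal, Submodule.span_le]
  rintro _ ⟨p, hp, hp1, rfl⟩
  exact Submodule.sub_mem _ (br_mem_MB hp hp1) one_mem_MB

theorem valueLin_one (O : Par l) : valueLin Φ O O 1 = 1 := by
  rw [← br_one, valueLin_br, value_one, Units.val_one]

theorem vanish_br_sub_one (O : Par l) (p : BraidGroup l) : Vanish 1 (valueLin Φ O O (br p - 1)) := by
  refine vanish_one ?_
  rw [map_sub, valueLin_one, valueLin_br, map_sub, coeff_zero_lieGroup (value_mem Φ O p O), coeff_one,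
    if_pos rfl, sub_self]

theorem vanish_augIdeal (O : Par l) {o : Fin l → Color} {x : BraidAlg l} (hx : x ∈ augIdeal o) :
    Vanish 1 (valueLin Φ O O x) := by
  induction hx using Submodule.span_induction with
  | zero => rw [map_zero]; exact fun d _ => map_zero _
  | add u v _ _ hu hv => rw [map_add]; exact hu.add hv
  | smul r u _ hu => rw [map_smul]; exact hu.smul r
  | mem u hu =>
    obtain ⟨p, -, -, rfl⟩ := hu
    exact vanish_br_sub_one Φ O p

/-- The value of `p - 1` begins in degree one, and pure braids do not relabel what follows them, so
the orders of vanishing add up. -/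
theorem vanish_filt (O O' : Par l) {o o' : Fin l → Color} {σ : Equiv.Perm (Fin l)} (n : ℕ)
    {x : BraidAlg l} (hx : x ∈ filt n o o' σ) : Vanish n (valueLin Φ O O' x) := by
  induction n generalizing x with
  | zero => exact fun d hd => absurd hd (by omega)
  | succ n ih =>
    rw [filt, pow_succ', mul_assoc] at hx
    induction hx using Submodule.mul_induction_on' with
    | add u _ v _ hu hv => rw [map_add]; exact hu.add hv
    | mem_mul_mem u hu v hv =>
      rw [valueLin_pure_mul Φ O O O' (augIdeal_le o hu), add_comm]
      exact (vanish_augIdeal Φ O hu).mul (ih hv)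

/-- The forgetful map on series. -/
noncomputable abbrev toBlueSeries (c : Fin l → Color) : (ChordAlg ⊤ c)⟦X⟧ →+* (BlueAlg l)⟦X⟧ :=
  PowerSeries.map (toBlueAlg c).toRingHom

theorem toBlueSeries_injective (c : Fin l → Color) : Function.Injective (toBlueSeries c) :=
  fun x y h => by
    ext d
    have := congrArg (coeff d) h
    rw [coeff_map, coeff_map] at this
    exact toBlueAlg_injective this

/-- The retraction `retract` as a linear map. -/
noncomputable def retractLin (c : Fin l → Color) : BlueAlg l →ₗ[ℚ] ChordAlg ⊤ c where
  toFun := retract c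
  map_add' x y := by rw [retract, map_add]; rfl
  map_smul' r x := by rw [retract, map_smul]; rfl

/-- The values of linear combinations of mixed braids, as series of mixed chord diagrams. -/
noncomputable def mixedValue (O O' : Par l) : BraidAlg l →ₗ[ℚ] (ChordAlg ⊤ O.word)⟦X⟧ :=
  mapCoeff (retractLin O.word) ∘ₗ valueLin Φ O O'

theorem mixedValue_br {O O' : Par l} {b : BraidGroup l} (hb : IsMixed O.word O'.word b)
    (hbar : O.bar = O'.bar) : ∃ u, IsLieSeries (chordSpace ⊤ O.word) u ∧
      mixedValue Φ O O' (br b) = expSeries u ∧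
      toBlueSeries O.word (expSeries u) = valueLin Φ O O' (br b) := by
  obtain ⟨u, hu, e⟩ := exists_mixed_lieSeries (value_mem Φ O b O') (dropBlue_value Φ hb hbar)
  rw [← valueLin_br] at e
  refine ⟨u, hu, ?_, e⟩
  rw [mixedValue, LinearMap.comp_apply, ← e]
  ext d
  rw [coeff_mapCoeff, coeff_map]
  exact retract_toBlueAlg _

/-- The retraction is only linear, but on combinations of mixed braids it inverts the forgetful map,
because it does so on the exponential belonging to each single braid. Identities between mixed
values can then be verified in the algebra of all chords. -/
theorem mixedValue_mem {O O' : Par l} (hbar : O.bar = O'.bar) {σ : Equiv.Perm (Fin l)}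
    {x : BraidAlg l} (hx : x ∈ MB O.word O'.word σ) :
    mixedValue Φ O O' x ∈ hat (chordSpace ⊤ O.word) ∧
      toBlueSeries O.word (mixedValue Φ O O' x) = valueLin Φ O O' x := by
  induction hx using Submodule.span_induction with
  | zero => rw [map_zero, map_zero, map_zero]; exact ⟨Subalgebra.zero_mem _, rfl⟩
  | add u v _ _ hu hv =>
    rw [map_add, map_add, map_add, hu.2, hv.2]
    exact ⟨Subalgebra.add_mem _ hu.1 hv.1, rfl⟩
  | smul r u _ hu =>
    rw [LinearMap.map_smul (mixedValue Φ O O'), map_smul_series, hu.2,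
      LinearMap.map_smul (valueLin Φ O O')]
    exact ⟨Subalgebra.smul_mem _ hu.1 r, rfl⟩
  | mem u hu =>
    obtain ⟨b, hb, -, rfl⟩ := hu
    obtain ⟨u, hu, e1, e2⟩ := mixedValue_br Φ hb hbar
    rw [e1, e2]
    exact ⟨expSeries_mem_hat hu.1, rfl⟩

end Linear

end

section

open Color PowerSeries

/-! ### The filtration by the number of chords between strands. -/

section BlueFiltration

variable {l : ℕ} {c : Fin l → Color}

theorem blueSpan_mono {k : ℕ∞} {m n : ℕ} (h : m ≤ n) : blueSpan k c n ≤ blueSpan k c m :=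
  Submodule.span_mono fun _ ⟨w, hw, e⟩ => ⟨w, h.trans hw, e⟩

theorem t_mem_blueSpan {k : ℕ∞} {n : ℕ} {i j : Fin l}
    (h : n ≤ if c i = blue ∧ c j = blue then 1 else 0) : t k c i j ∈ blueSpan k c n := by
  refine Submodule.subset_span ⟨[(i, j)], h.trans ?_, by simp⟩
  split_ifs with hb
  · simp [blueCount, hb.1, hb.2]
  · exact Nat.zero_le _

theorem mul_mem_blueSpan {k : ℕ∞} {m n : ℕ} {x y : ChordAlg k c} (hx : x ∈ blueSpan k c m)
    (hy : y ∈ blueSpan k c n) : x * y ∈ blueSpan k c (m + n) :=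
  blueSpan_mul m n (Submodule.mul_mem_mul hx hy)

theorem bracketSwap_mem_blueSpan {r s : Fin l} (hr : c r = red) (hs : c s = red) {n : ℕ}
    {i j : Fin l} (h : n ≤ if c i = blue ∧ c j = blue then 1 else 0) :
    bracketSwap c r s i j ∈ blueSpan ⊤ c n := by
  split_ifs at h with hb
  · rw [bracketSwap_of_ne (ne_of_color hb.1 hr) (ne_of_color hb.1 hs) (ne_of_color hb.2 hr)
      (ne_of_color hb.2 hs)]
    exact Submodule.zero_mem _
  · have h0 : ∀ i j, t ⊤ c i j ∈ blueSpan ⊤ c 0 := fun i j => t_mem_blueSpan (Nat.zero_le _)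
    rw [Nat.le_zero.1 h, bracketSwap]
    exact Submodule.sub_mem _ (mul_mem_blueSpan (m := 0) (n := 0) (h0 _ _) (h0 _ _))
      (mul_mem_blueSpan (m := 0) (n := 0) (h0 _ _) (h0 _ _))

/-- The derivation kills the chords that are counted, those between strands, and the chords that it
does change are not counted; hence no word loses a counted chord. -/
theorem redDer_mem_blueSpan {r s : Fin l} (hr : c r = red) (hs : c s = red) {n : ℕ}
    {x : ChordAlg ⊤ c} (hx : x ∈ blueSpan ⊤ c n) : redDer hr hs x ∈ blueSpan ⊤ c n := by
  induction hx using Submodule.span_induction with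
  | zero => rw [map_zero]; exact Submodule.zero_mem _
  | add u v _ _ hu hv => rw [map_add]; exact Submodule.add_mem _ hu hv
  | smul q u _ hu => rw [map_smul]; exact Submodule.smul_mem _ _ hu
  | mem u hu =>
    obtain ⟨w, hw, rfl⟩ := hu
    refine blueSpan_mono hw ?_
    clear hw
    induction w with
    | nil =>
      rw [List.map_nil, List.prod_nil, ← map_one (algebraMap ℚ (ChordAlg ⊤ c)), redDer_algebraMap]
      exact Submodule.zero_mem _
    | cons p w ih =>
      have : blueCount c (p :: w) = (if c p.1 = blue ∧ c p.2 = blue then 1 else 0) +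
          blueCount c w := by
        rw [blueCount, List.countP_cons, add_comm]; simp [blueCount]
      rw [List.map_cons, List.prod_cons, redDer_mul, redDer_t, this]
      exact Submodule.add_mem _ (mul_mem_blueSpan (t_mem_blueSpan le_rfl) ih)
        (mul_mem_blueSpan (bracketSwap_mem_blueSpan hr hs le_rfl) (Submodule.subset_span ⟨w, le_rfl, rfl⟩))

/-- The elements whose action adds at least `k` chords between blue positions. -/
noncomputable def blueIdeal (c : Fin l → Color) (k : ℕ) : Submodule ℚ (BlueAlg l) where
  carrier := {y | ∀ n, ∀ a ∈ blueSpan ⊤ c n, redAct c y a ∈ blueSpan ⊤ c (n + k)}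
  zero_mem' n a _ := by rw [map_zero]; exact Submodule.zero_mem _
  add_mem' hx hy n a ha := by rw [map_add]; exact Submodule.add_mem _ (hx n a ha) (hy n a ha)
  smul_mem' r x hx n a ha := by rw [map_smul]; exact Submodule.smul_mem _ _ (hx n a ha)

/-- Chords between poles respect the filtration as well. Consequently each `blueIdeal c k` is stable
under multiplication by arbitrary elements on either side, which allows conjugation by associators
that involve such chords. -/
theorem blueIdeal_zero (y : BlueAlg l) : y ∈ blueIdeal c 0 := by
  induction y using ChordAlg.induction with
  | scalar r =>
    intro n a ha
    rw [AlgHom.commutes]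
    exact Submodule.smul_mem _ _ ha
  | gen i j =>
    intro n a ha
    rw [redAct_t]
    by_cases h : c i = red ∧ c j = red
    · rw [redActGen_red h.1 h.2]
      exact redDer_mem_blueSpan _ _ ha
    · rw [redActGen_not h, add_comm]
      exact mul_mem_blueSpan (t_mem_blueSpan (Nat.zero_le _)) ha
  | mul x y hx hy =>
    intro n a ha
    rw [map_mul]
    exact hx _ _ (hy _ _ ha)
  | add x y hx hy => exact Submodule.add_mem _ hx hy

theorem blueIdeal_mul {m n : ℕ} {x y : BlueAlg l} (hx : x ∈ blueIdeal c m) (hy : y ∈ blueIdeal c n) :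
    x * y ∈ blueIdeal c (m + n) := fun d a ha => by
  rw [map_mul, add_comm m n, ← add_assoc]
  exact hx _ _ (hy _ _ ha)

theorem tb_mem_blueIdeal {p q : Fin l} (hp : c p = blue) (hq : c q = blue) :
    tb p q ∈ blueIdeal c 1 := fun n a ha => by
  rw [redAct_t, redActGen_blue (Or.inl hp), add_comm]
  exact mul_mem_blueSpan (t_mem_blueSpan (by rw [if_pos ⟨hp, hq⟩])) ha

theorem one_mem_blueSpan : (1 : ChordAlg ⊤ c) ∈ blueSpan ⊤ c 0 :=
  Submodule.subset_span ⟨[], le_rfl, rfl⟩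

theorem retract_mem_blueSpan {k : ℕ} {y : BlueAlg l} (hy : y ∈ blueIdeal c k) :
    retract c y ∈ blueSpan ⊤ c k := by
  have := hy 0 1 one_mem_blueSpan
  rwa [zero_add] at this

/-- The series with coefficients in `blueIdeal`. -/
noncomputable def blueSeries (c : Fin l → Color) (k : ℕ) : Submodule ℚ (BlueAlg l)⟦X⟧ where
  carrier := {f | ∀ d, coeff d f ∈ blueIdeal c k}
  zero_mem' d := by rw [map_zero]; exact Submodule.zero_mem _
  add_mem' hf hg d := by rw [map_add]; exact Submodule.add_mem _ (hf d) (hg d)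
  smul_mem' r f hf d := by rw [PowerSeries.coeff_smul]; exact Submodule.smul_mem _ _ (hf d)

theorem blueSeries_zero (f : (BlueAlg l)⟦X⟧) : f ∈ blueSeries c 0 := fun _ => blueIdeal_zero _

theorem blueSeries_mul {m n : ℕ} {f g : (BlueAlg l)⟦X⟧} (hf : f ∈ blueSeries c m)
    (hg : g ∈ blueSeries c n) : f * g ∈ blueSeries c (m + n) := fun d => by
  rw [coeff_mul]
  exact Submodule.sum_mem _ fun p _ => blueIdeal_mul (hf _) (hg _)

theorem expSeries_sub_one_mem {u : (BlueAlg l)⟦X⟧} (hu : u ∈ blueSeries c 1) :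
    expSeries u - 1 ∈ blueSeries c 1 := fun d => by
  rw [map_sub, expSeries, coeff_mk, Finset.sum_range_succ', pow_zero, Nat.factorial_zero,
    Nat.cast_one, inv_one, one_smul, add_sub_cancel_right]
  refine Submodule.sum_mem _ fun n _ => Submodule.smul_mem _ _ ?_
  rw [pow_succ]
  have := blueSeries_mul (blueSeries_zero (c := c) (u ^ n)) hu
  rw [zero_add] at this
  exact this d

theorem mul_sub_one_mem {f g : (BlueAlg l)⟦X⟧} {n : ℕ} (hf : f - 1 ∈ blueSeries c n)
    (hg : g - 1 ∈ blueSeries c n) : f * g - 1 ∈ blueSeries c n := by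
  have e : f * g - 1 = (f - 1) * g + (g - 1) := by rw [sub_mul, one_mul]; abel
  rw [e]
  have := blueSeries_mul hf (blueSeries_zero (c := c) g)
  rw [add_zero] at this
  exact Submodule.add_mem _ this hg

theorem cross_sub_one_mem {p q : Fin l} (hp : c p = blue) (hq : c q = blue) :
    ((cross {p} {q} : GrpN l) : (BlueAlg l)⟦X⟧) - 1 ∈ blueSeries c 1 := by
  change expSeries (monomial 1 ((1 / 2 : ℚ) • chords {p} {q})) - 1 ∈ blueSeries c 1
  refine expSeries_sub_one_mem fun d => ?_
  rw [coeff_monomial, chords_singleton]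
  split_ifs
  · exact Submodule.smul_mem _ _ (tb_mem_blueIdeal hp hq)
  · exact Submodule.zero_mem _

theorem conj_sub_one_mem {g h : GrpN l} {n : ℕ} (hh : (h : (BlueAlg l)⟦X⟧) - 1 ∈ blueSeries c n) :
    ((g * h * g⁻¹ : GrpN l) : (BlueAlg l)⟦X⟧) - 1 ∈ blueSeries c n := by
  have e : ((g * h * g⁻¹ : GrpN l) : (BlueAlg l)⟦X⟧) - 1 =
      (g : (BlueAlg l)⟦X⟧) * ((h : (BlueAlg l)⟦X⟧) - 1) * (g⁻¹ : GrpN l) := by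
    rw [mul_sub, sub_mul, mul_one, Units.mul_inv, Units.val_mul, Units.val_mul]
  rw [e]
  have := blueSeries_mul (blueSeries_mul (blueSeries_zero (c := c) (g : (BlueAlg l)⟦X⟧)) hh)
    (blueSeries_zero (c := c) ((g⁻¹ : GrpN l) : (BlueAlg l)⟦X⟧))
  rwa [zero_add, add_zero] at this

end BlueFiltration

/-! ### Values of full twists transported along a braid. -/

section Twists

variable {l : ℕ} (Φ : Associator)

theorem value_twist (O : Par l) {i j : Fin l} (h : i < j) : ∃ g ∈ lieGroup (blueSpace l),
    value Φ O (twist i j) O = g * (cross {i} {j} * cross {i} {j}) * g⁻¹ := by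
  obtain ⟨g, hg, e⟩ := braidValue_twist Φ h
  refine ⟨rebracketOpt Φ (selfLabel l) O.tree 0 * g, mul_mem (rebracketOpt_mem Φ _ _) hg, ?_⟩
  rw [value, wordValue, e, perm_twist h, map_one, Equiv.Perm.one_apply]
  group

theorem preim_perm_singleton (σ : Equiv.Perm (Fin l)) (i : Fin l) :
    preim (fun x => some (σ x)) {i} = {σ.symm i} := by
  ext x
  rw [mem_preim]
  simp [Equiv.eq_symm_apply]

/-- The twist involves the two strands that `w` carries to `i` and `j`. Nothing is required of the
conjugating unit, because the ideals to which this is applied are two-sided. -/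
theorem value_conj_twist (O : Par l) (w : BraidGroup l) {i j : Fin l} (h : i < j) :
    ∃ g : GrpN l, value Φ O (w * twist i j * w⁻¹) O =
      g * (cross {(perm w).symm i} {(perm w).symm j} * cross {(perm w).symm i} {(perm w).symm j}) *
        g⁻¹ := by
  obtain ⟨g, -, e⟩ := value_twist Φ O h
  -- Values are defined for all braids and words, so `w` may be evaluated from `O` to `O` even if it
  -- does not match the colours.
  have e1 := value_mul Φ O O O w w⁻¹
  rw [mul_inv_cancel, value_one, eq_comm, ← _root_.eq_inv_iff_mul_eq_one] at e1
  have hd : Disjoint ({i} : Finset (Fin l)) {j} := Finset.disjoint_singleton.2 h.ne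
  have e2 : (fun x => some (perm (w * twist i j) x)) = fun x => some (perm w x) := by
    rw [perm_mul, perm_twist h]; rfl
  refine ⟨value Φ O w O * unitPull (fun x => some (perm w x)) g, ?_⟩
  rw [value_mul Φ O O O, value_mul Φ O O O, e, e2, ← preim_perm_singleton, ← preim_perm_singleton,
    ← unitPull_cross _ hd, map_mul, map_mul, map_mul, map_inv, e1]
  group

end Twists

/-! ### The ideal of blue twists and the truncated diagrams. -/

section Truncation

variable {l : ℕ} (Φ : Associator)

theorem color_of_isMixed_stdWord {o : Fin l → Color} {w : BraidGroup l}
    (h : IsMixed o (stdWord l (redCount o)) w) {i : Fin l} (hi : redCount o ≤ i.val) :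
    o ((perm w).symm i) = blue := by
  rw [← h.color, Equiv.apply_symm_apply, stdWord, if_neg (by omega)]

theorem idealJ_le (o : Fin l → Color) : idealJ o ≤ MB o o 1 := by
  refine Submodule.mul_le.2 fun x hx y hy => mul_mem_MB (σ := 1) (τ := 1) ?_ hy
  clear hy y
  revert x
  refine Submodule.mul_le.2 fun x hx y hy => mul_mem_MB (σ := 1) (τ := 1) hx ?_
  clear hx x
  revert y
  refine Submodule.span_le.2 ?_
  rintro _ ⟨w, i, j, hw, hi, hij, rfl⟩
  refine Submodule.sub_mem _ (br_mem_MB ((hw.mul (isMixed_twist hij ⟨hij.ne, ?_⟩)).mul hw.inv) ?_)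
    one_mem_MB
  · rw [stdWord, if_neg (by omega)]; exact Or.inl rfl
  · rw [perm_mul, perm_mul, perm_twist hij, perm_inv]
    ext x; simp

/-- A transported twist of two blue strands is conjugate to the square of exp(t_pq/2) with `p`, `q`
blue, so it differs from 1 by a series in the ideal. The factors from `MB` on both sides keep it
there. -/
theorem mem_blueSeries_of_mem_idealJ (O : Par l) {x : BraidAlg l} (hx : x ∈ idealJ O.word) :
    valueLin Φ O O x ∈ blueSeries O.word 1 := by
  induction hx using Submodule.mul_induction_on' with
  | add u _ v _ hu hv => rw [map_add]; exact Submodule.add_mem _ hu hv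
  | mem_mul_mem u hu v hv =>
    have hu' : u ∈ MB O.word O.word 1 ∧ valueLin Φ O O u ∈ blueSeries O.word 1 := by
      induction hu using Submodule.mul_induction_on' with
      | add u _ v _ hu hv =>
        rw [map_add]; exact ⟨Submodule.add_mem _ hu.1 hv.1, Submodule.add_mem _ hu.2 hv.2⟩
      | mem_mul_mem u hu v hv =>
        have hv' : v ∈ MB O.word O.word 1 ∧ valueLin Φ O O v ∈ blueSeries O.word 1 := by
          induction hv using Submodule.span_induction with
          | zero => rw [map_zero]; exact ⟨Submodule.zero_mem _, Submodule.zero_mem _⟩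
          | add u v _ _ hu hv =>
            rw [map_add]; exact ⟨Submodule.add_mem _ hu.1 hv.1, Submodule.add_mem _ hu.2 hv.2⟩
          | smul r u _ hu =>
            rw [map_smul]; exact ⟨Submodule.smul_mem _ _ hu.1, Submodule.smul_mem _ _ hu.2⟩
          | mem v hv =>
            refine ⟨?_, ?_⟩
            · have := idealJ_le O.word (Submodule.mul_mem_mul (Submodule.mul_mem_mul one_mem_MB
                (Submodule.subset_span hv)) one_mem_MB)
              rwa [one_mul, mul_one] at this
            · obtain ⟨w, i, j, hw, hi, hij, rfl⟩ := hv
              obtain ⟨g, e⟩ := value_conj_twist Φ O w hij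
              rw [map_sub, valueLin_br, valueLin_one, e]
              have hp := color_of_isMixed_stdWord hw hi
              have hq := color_of_isMixed_stdWord hw (hi.trans (Fin.le_def.1 hij.le))
              refine conj_sub_one_mem ?_
              rw [Units.val_mul]
              exact mul_sub_one_mem (cross_sub_one_mem hp hq) (cross_sub_one_mem hp hq)
        refine ⟨mul_mem_MB (σ := 1) (τ := 1) hu hv'.1, ?_⟩
        rw [valueLin_pure_mul Φ O O O hu]
        have := blueSeries_mul (blueSeries_zero (c := O.word) (valueLin Φ O O u)) hv'.2
        rwa [zero_add] at this
    rw [valueLin_pure_mul Φ O O O hu'.1]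
    have := blueSeries_mul hu'.2 (blueSeries_zero (c := O.word) (valueLin Φ O O v))
    rwa [add_zero] at this

theorem mem_blueSeries_of_mem_filtJ (O O' : Par l) {σ : Equiv.Perm (Fin l)} (k : ℕ) {x : BraidAlg l}
    (hx : x ∈ filtJ k O.word O'.word σ) : valueLin Φ O O' x ∈ blueSeries O.word k := by
  change x ∈ idealJ O.word ^ k * MB O.word O'.word σ at hx
  induction k generalizing x with
  | zero => exact blueSeries_zero _
  | succ k ih =>
    rw [pow_succ', mul_assoc] at hx
    induction hx using Submodule.mul_induction_on' with
    | add u _ v _ hu hv => rw [map_add]; exact Submodule.add_mem _ hu hv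
    | mem_mul_mem u hu v hv =>
      rw [valueLin_pure_mul Φ O O O' (idealJ_le _ hu), add_comm k]
      exact blueSeries_mul (mem_blueSeries_of_mem_idealJ Φ O hu) (ih hv)

/-- The projection from chord diagrams to their truncation, which may be trivial. -/
noncomputable def project (k : ℕ∞) (c : Fin l → Color) : ChordAlg ⊤ c →ₐ[ℚ] ChordAlg k c :=
  match k with
  | ⊤ => AlgHom.id ℚ _
  | (k : ℕ) => reduce k c

theorem project_t (k : ℕ∞) (c : Fin l → Color) (i j : Fin l) :
    project k c (t ⊤ c i j) = t k c i j := by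
  induction k with
  | top => rfl
  | coe k => exact RingQuot.liftAlgHom_mkAlgHom_apply _ _ _ _

theorem project_space (k : ℕ∞) (c : Fin l → Color) :
    (chordSpace ⊤ c).map (project k c).toLinearMap ≤ chordSpace k c := by
  rw [chordSpace, Submodule.map_span, Submodule.span_le]
  rintro _ ⟨_, ⟨i, j, rfl⟩, rfl⟩
  exact Submodule.subset_span ⟨i, j, (project_t k c i j).symm⟩

theorem project_blueSpan (k : ℕ) {c : Fin l → Color} {x : ChordAlg ⊤ c} (hx : x ∈ blueSpan ⊤ c k) :
    project k c x = 0 := by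
  induction hx using Submodule.span_induction with
  | zero => rw [map_zero]
  | add u v _ _ hu hv => rw [map_add, hu, hv, add_zero]
  | smul r u _ hu => rw [map_smul, hu, smul_zero]
  | mem u hu =>
    obtain ⟨w, hw, rfl⟩ := hu
    rw [map_list_prod, List.map_map]
    refine Eq.trans ?_ (t_trunc w (Nat.cast_le.2 hw))
    congr 1
    exact List.map_congr_left fun p _ => project_t _ _ _ _

/-- The map `project` on the completions. -/
noncomputable def projectHat (k : ℕ∞) (c : Fin l → Color) : Hat ⊤ c →+* Hat k c :=
  hatMap _ _ (project k c) (project_space k c)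

theorem projectHat_top (c : Fin l → Color) (x : Hat ⊤ c) : projectHat ⊤ c x = x := by
  ext d
  exact coeff_hatMap _ _ _ _ _ _

/-- The retraction evaluates the action at `1`. An element whose action adds at least `k` chords
between strands is thus sent to words with at least `k` of them, and these vanish after truncation.
For `⊤` there is nothing to kill. -/
theorem project_mixedValue (k : ℕ∞) (O O' : Par l) {σ : Equiv.Perm (Fin l)} {x : BraidAlg l}
    (hx : x ∈ filtJ k O.word O'.word σ) (d : ℕ) :
    project k O.word (coeff d (mixedValue Φ O O' x)) = 0 := by
  induction k with
  | top =>
    rw [(hx : x = 0), map_zero, map_zero, map_zero]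
  | coe k =>
    rw [mixedValue, LinearMap.comp_apply, coeff_mapCoeff]
    exact project_blueSpan k (retract_mem_blueSpan (mem_blueSeries_of_mem_filtJ Φ O O' k hx d))

end Truncation

end

section

open Color PowerSeries

/-! ### Compatibility of truncation, relabelling and the forgetful map. -/

section Naturality

variable {l l' : ℕ}

/-- Reduces every operadic identity and the composition rule for finite `k` to the untruncated case.
-/
theorem projectHat_pullHat (k : ℕ∞) {c : Fin l → Color} {c' : Fin l' → Color}
    {f : Fin l' → Option (Fin l)} (hf : ∀ x i, f x = some i → c i = blue → c' x = blue)
    (x : Hat ⊤ c) : projectHat k c' (pullHat ⊤ c c' f hf x) = pullHat k c c' f hf (projectHat k c x) := by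
  ext d
  rw [projectHat, projectHat, pullHat, pullHat, coeff_hatMap, coeff_hatMap, coeff_hatMap, coeff_hatMap,
    ← AlgHom.comp_apply, ← AlgHom.comp_apply]
  congr 1
  refine ChordAlg.hom_ext fun i j => ?_
  rw [AlgHom.comp_apply, AlgHom.comp_apply, pull_t, project_t, pull_t, pullGen, pullGen]
  split_ifs
  · simp only [map_sum, project_t]
  · exact map_zero _

theorem toBlueSeries_pullHat {c : Fin l → Color} {c' : Fin l' → Color}
    {f : Fin l' → Option (Fin l)} (hf : ∀ x i, f x = some i → c i = blue → c' x = blue)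
    (x : Hat ⊤ c) :
    toBlueSeries c' (pullHat ⊤ c c' f hf x).val = pullSeries f (toBlueSeries c x.val) := by
  ext d
  rw [coeff_map, coeff_map, coeff_map, pullHat, coeff_hatMap]
  change toBlueAlg c' (pull ⊤ c c' f hf _) = bluePull f (toBlueAlg c _)
  rw [← AlgHom.comp_apply, ← AlgHom.comp_apply]
  congr 1
  refine ChordAlg.hom_ext fun i j => ?_
  rw [AlgHom.comp_apply, AlgHom.comp_apply, pull_t, toBlueAlg_t, pullGen]
  by_cases h : Allowed c i j
  · rw [if_pos h, if_pos h, bluePull, pull_t, pullGen, if_pos ⟨h.1, Or.inl rfl⟩, map_sum]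
    refine Finset.sum_congr rfl fun x hx => ?_
    rw [map_sum]
    refine Finset.sum_congr rfl fun y hy => ?_
    rw [Finset.mem_filter] at hx hy
    exact toBlueAlg_allowed (allowed_of_pull c c' f hf h hx.2 hy.2)
  · rw [if_neg h, if_neg h, map_zero, map_zero]

theorem act_eq {k : ℕ∞} {c c' : Fin l → Color} {σ : Equiv.Perm (Fin l)}
    (h : ∀ i, c' (σ i) = c i) : act k h = pullHat k c' c (fun i => some (σ i)) (fun x i hx hi => by
      rw [← h, Option.some.inj hx, hi]) := rfl

theorem hat_ext {c : Fin l → Color} {x y : Hat ⊤ c}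
    (h : toBlueSeries c x.val = toBlueSeries c y.val) : x = y :=
  Subtype.ext (toBlueSeries_injective c h)

end Naturality

/-! ### The homomorphic expansion. -/

section Expansion

variable {l : ℕ} (Φ : Associator)

/-- The values of linear combinations of mixed braids. -/
noncomputable def mixedHat {O O' : Par l} (σ : PaPerm O O') :
    MB O.word O'.word σ.toPerm →ₗ[ℚ] Hat ⊤ O.word where
  toFun x := ⟨mixedValue Φ O O' x.val, (mixedValue_mem Φ σ.bar_eq x.2).1⟩
  map_add' x y := Subtype.ext (map_add _ _ _)
  map_smul' r x := Subtype.ext (LinearMap.map_smul _ _ _)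

theorem toBlueSeries_mixedHat {O O' : Par l} (σ : PaPerm O O')
    (x : MB O.word O'.word σ.toPerm) :
    toBlueSeries O.word (mixedHat Φ σ x).val = valueLin Φ O O' x.val :=
  (mixedValue_mem Φ σ.bar_eq x.2).2

/-- The map `projectHat` as a linear map. -/
noncomputable def projectLin (k : ℕ∞) (c : Fin l → Color) : Hat ⊤ c →ₗ[ℚ] Hat k c where
  toFun := projectHat k c
  map_add' := map_add _
  map_smul' r x := by
    ext d
    rw [projectHat, coeff_hatMap]
    change project k c (coeff d (r • x.val)) = coeff d (r • (projectHat k c x).val)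
    rw [PowerSeries.coeff_smul, PowerSeries.coeff_smul, map_smul, projectHat, coeff_hatMap]

/-- The values of the homomorphic expansion. -/
noncomputable def expansionVal (k : ℕ∞) {O O' : Par l} (σ : PaPerm O O') :
    MBQuot k O.word O'.word σ.toPerm →ₗ[ℚ] Hat k O.word :=
  Submodule.liftQ (M₂ := Hat k O.word)
      ((filtJ k O.word O'.word σ.toPerm).comap (MB O.word O'.word σ.toPerm).subtype)
      (projectLin k O.word ∘ₗ mixedHat Φ σ) fun x hx => by
    rw [LinearMap.mem_ker]
    ext d
    change coeff d (projectHat k O.word (mixedHat Φ σ x)).val = 0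
    rw [projectHat, coeff_hatMap]
    exact project_mixedValue Φ k O O' hx d

theorem expansionVal_cls (k : ℕ∞) {O O' : Par l} (σ : PaPerm O O') {x : BraidAlg l}
    (hx : x ∈ MB O.word O'.word σ.toPerm) :
    expansionVal Φ k σ (cls k x hx) = projectHat k O.word (mixedHat Φ σ ⟨x, hx⟩) := rfl

/-- One argument for all the operadic operations: on chords each of them is the pullback along a
partial map of positions, and after the colours are forgotten it is an identity between values of
braids. -/
theorem expansionVal_pull (k : ℕ∞) {l' : ℕ} {O O' : Par l} {P P' : Par l'} (β : PaBraid O O')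
    (γ : PaBraid P P') (f : Fin l' → Option (Fin l))
    (hf : ∀ x i, f x = some i → O.word i = blue → P.word x = blue)
    (h : value Φ P γ.braid P' = unitPull f (value Φ O β.braid O')) :
    expansionVal Φ k γ.toPaPerm (γ.cls k) =
      pullHat k O.word P.word f hf (expansionVal Φ k β.toPaPerm (β.cls k)) := by
  rw [PaBraid.cls, PaBraid.cls, expansionVal_cls, expansionVal_cls, ← projectHat_pullHat]
  congr 1
  refine hat_ext ?_
  rw [toBlueSeries_pullHat, toBlueSeries_mixedHat, toBlueSeries_mixedHat]
  change valueLin Φ P P' (br _) = pullSeries f (valueLin Φ O O' (br _))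
  rw [valueLin_br, valueLin_br, h, unitPull_val]

/-- The products `(A₁ - 1) ⋯ (Aₙ - 1)` for full twists `A₁, …, Aₙ`. -/
noncomputable def twistProd (w : List (Fin l × Fin l)) : BraidAlg l :=
  (w.map fun p => br (twist p.1 p.2) - 1).prod

theorem br_twist_sub_one_mem {o : Fin l → Color} {p : Fin l × Fin l}
    (h : p.1 < p.2 ∧ Allowed o p.1 p.2) : br (twist p.1 p.2) - 1 ∈ MB o o 1 :=
  Submodule.sub_mem _ (br_mem_MB (isMixed_twist h.1 h.2) (perm_twist h.1)) one_mem_MB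

theorem twistProd_mem {o : Fin l → Color} {w : List (Fin l × Fin l)}
    (hw : ∀ p ∈ w, p.1 < p.2 ∧ Allowed o p.1 p.2) : twistProd w ∈ MB o o 1 := by
  induction w with
  | nil => exact one_mem_MB
  | cons p w ih =>
    rw [twistProd, List.map_cons, List.prod_cons]
    exact mul_mem_MB (σ := 1) (τ := 1) (br_twist_sub_one_mem (hw p (by simp)))
      (ih fun q hq => hw q (by simp [hq]))

theorem valueLin_twistProd_mul {O O' : Par l} {w : List (Fin l × Fin l)}
    (hw : ∀ p ∈ w, p.1 < p.2 ∧ Allowed O.word p.1 p.2) (y : BraidAlg l) :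
    valueLin Φ O O' (twistProd w * y) =
      (w.map fun p => valueLin Φ O O (br (twist p.1 p.2) - 1)).prod * valueLin Φ O O' y := by
  induction w with
  | nil => rw [twistProd, List.map_nil, List.prod_nil, one_mul, List.map_nil, List.prod_nil, one_mul]
  | cons p w ih =>
    rw [twistProd, List.map_cons, List.prod_cons, List.map_cons, List.prod_cons, mul_assoc,
      valueLin_pure_mul Φ O O O' (br_twist_sub_one_mem (hw p (by simp))), mul_assoc]
    congr 1
    exact ih fun q hq => hw q (by simp [hq])

theorem coeff_one_cross (i j : Fin l) :
    coeff 1 ((cross {i} {j} * cross {i} {j} : GrpN l) : (BlueAlg l)⟦X⟧) = tb i j := by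
  have h : coeff 1 ((cross {i} {j} : GrpN l) : (BlueAlg l)⟦X⟧) = (1 / 2 : ℚ) • tb i j := by
    change coeff 1 (expSeries (monomial 1 ((1 / 2 : ℚ) • chords {i} {j}))) = _
    rw [Associator.coeff_one_expSeries, coeff_monomial, if_pos rfl, chords_singleton]
  have h0 : coeff 0 ((cross {i} {j} : GrpN l) : (BlueAlg l)⟦X⟧) = 1 := coeff_zero_expSeries _
  rw [Units.val_mul, Associator.coeff_one_mul h0 h0, h,
    ← add_smul, add_halves, one_smul]

theorem coeff_one_valueLin_twist (O : Par l) {i j : Fin l} (h : i < j) :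
    coeff 1 (valueLin Φ O O (br (twist i j) - 1)) = tb i j := by
  obtain ⟨g, hg, e⟩ := value_twist Φ O h
  rw [map_sub, valueLin_br, valueLin_one, e, map_sub, coeff_one_conj hg, coeff_one_cross, coeff_one,
    if_neg one_ne_zero, sub_zero]
  exact Associator.coeff_zero_mul (coeff_zero_expSeries _) (coeff_zero_expSeries _)

/-- Leading terms multiply: each factor contributes the linear term of a twist, and the final braid
contributes its constant term 1. -/
theorem coeff_valueLin_twistProd_mul {O O' : Par l} {b : BraidGroup l}
    {w : List (Fin l × Fin l)} (hw : ∀ p ∈ w, p.1 < p.2 ∧ Allowed O.word p.1 p.2) :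
    coeff w.length (valueLin Φ O O' (twistProd w * br b)) =
      toBlueAlg O.word (w.map fun p => t ⊤ O.word p.1 p.2).prod := by
  have hv : ∀ f ∈ w.map fun p => valueLin Φ O O (br (twist p.1 p.2) - 1), Vanish 1 f := by
    intro f hf
    obtain ⟨p, -, rfl⟩ := List.mem_map.1 hf
    exact vanish_br_sub_one Φ O _
  have h1 := Vanish.prod hv
  have h2 := coeff_prod hv
  rw [List.length_map] at h1 h2
  have h3 := coeff_mul_of_vanish h1 (g := valueLin Φ O O' (br b)) (n := 0)
    fun d hd => absurd hd (Nat.not_lt_zero d)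
  rw [add_zero] at h3
  rw [valueLin_twistProd_mul Φ hw, h3, h2, valueLin_br, coeff_zero_lieGroup (value_mem Φ O b O'), mul_one,
    map_list_prod, List.map_map, List.map_map]
  congr 1
  refine List.map_congr_left fun p hp => ?_
  exact (coeff_one_valueLin_twist Φ O (hw p hp).1).trans (toBlueAlg_allowed (hw p hp).2).symm

theorem StrandOp.word_position (θ : StrandOp l) (O : Par l) (x : Fin (l + 1)) (i : Fin l)
    (h : θ.position x = some i) : (θ.par O).word x = O.word i := by
  rw [← col_val (θ.par O).word x, ← col_val O.word i]
  cases θ with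
  | left a =>
    revert h
    refine Fin.cases (fun h => ?_) (fun x h => ?_) x
    · cases h
    · obtain rfl : x = i := Option.some.inj h
      exact congrFun (O.col_addLeft a).1 x.val
  | right a =>
    revert h
    refine Fin.lastCases (fun h => ?_) (fun x h => ?_) x
    · simp [StrandOp.position] at h
    · obtain rfl : x = i := by simpa [StrandOp.position] using h
      exact (O.col_addRight a).1 x.val x.isLt
  | double j =>
    obtain rfl : j.predAbove x = i := Option.some.inj h
    refine (congrFun (O.col_double j) x.val).trans ?_
    rw [dup, predAbove_val]
    split_ifs <;> first | rfl | omega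

/-- A mixed braid between words that agree once the blue letters are forgotten. -/
def PaBraid.ofIsMixed {O O' : Par l} {b : BraidGroup l} (h : IsMixed O.word O'.word b)
    (hbar : O.bar = O'.bar) : PaBraid O O' := ⟨⟨perm b, h.isMixedPerm, hbar⟩, b, h, rfl⟩

/-- The homomorphic expansion that comes from an associator. -/
noncomputable def expansion (k : ℕ∞) : HomExpansion k where
  val σ := expansionVal Φ k σ
  map_id O := by
    refine (expansionVal_cls Φ k (PaPerm.one O) one_mem_MB).trans ?_
    rw [← map_one (projectHat k O.word)]
    congr 1
    refine hat_ext ?_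
    rw [toBlueSeries_mixedHat]
    exact (valueLin_one Φ O).trans (map_one _).symm
  map_comp {l O O' O''} σ τ x y := by
    induction x using Quotient.ind with
    | _ x =>
    induction y using Quotient.ind with
    | _ y =>
    change projectHat k O.word (mixedHat Φ (σ.comp τ) ⟨x.val * y.val, mul_mem_MB x.2 y.2⟩) =
      projectHat k O.word (mixedHat Φ σ x) * act k σ.mixed.color (projectHat k O'.word (mixedHat Φ τ y))
    -- Both sides are projections of untruncated series, which are then compared in the algebra of
    -- all chords.
    rw [act_eq, ← projectHat_pullHat, ← map_mul]
    congr 1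
    refine hat_ext ?_
    change _ = toBlueSeries O.word ((mixedHat Φ σ x).val * (pullHat ⊤ _ _ _ _ (mixedHat Φ τ y)).val)
    rw [map_mul, toBlueSeries_pullHat, toBlueSeries_mixedHat, toBlueSeries_mixedHat, toBlueSeries_mixedHat]
    exact valueLin_mul Φ O O' O'' x.2 y.val
  filtered {l O O'} σ n x hx hn d hd := by
    rw [expansionVal_cls, projectHat, coeff_hatMap]
    have : coeff d (mixedHat Φ σ ⟨x, hx⟩).val = 0 := by
      change coeff d (mixedValue Φ O O' x) = 0
      rw [mixedValue, LinearMap.comp_apply, coeff_mapCoeff, vanish_filt Φ O O' n hn d hd, map_zero]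
    rw [this, map_zero]
  graded {l O O'} β w hw := by
    have hx : (w.map fun p => br (twist p.1 p.2) - 1).prod * br β.braid ∈
        MB O.word O'.word β.toPerm :=
      mul_mem_MB (σ := 1) (twistProd_mem hw) (br_mem_MB β.isMixed β.perm_eq)
    refine ⟨hx, ?_⟩
    rw [expansionVal_cls, projectHat, coeff_hatMap]
    have : coeff w.length (mixedHat Φ β.toPaPerm ⟨_, hx⟩).val =
        (w.map fun p => t ⊤ O.word p.1 p.2).prod := by
      refine toBlueAlg_injective (c := O.word) ?_
      rw [← coeff_valueLin_twistProd_mul Φ hw (b := β.braid) (O' := O')]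
      exact (coeff_map (toBlueAlg O.word).toRingHom _ _).symm.trans
        (congrArg (coeff w.length) (toBlueSeries_mixedHat Φ β.toPaPerm _))
    refine (congrArg (project k O.word) this).trans ?_
    rw [map_list_prod, List.map_map]
    congr 1
    exact List.map_congr_left fun p _ => project_t _ _ _ _
  groupLike {l O O'} β := by
    obtain ⟨u, hu, e, -⟩ := mixedValue_br Φ β.isMixed β.bar_eq
    refine ⟨_, hu.map (project k O.word) (project_space k O.word), ?_⟩
    rw [← map_expSeries, ← e]
    rfl
  strandOp {l O O'} β θ := by
    obtain ⟨⟨σ, hσ, hbar⟩, b, hb, hp⟩ := β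
    change perm b = σ at hp
    subst hp
    cases θ with
    | left a =>
      exact ⟨.ofIsMixed (isMixed_addLeft hb a) (Par.bar_addLeft hbar a),
        fun x i hx hi => (StrandOp.word_position (.left a) O x i hx).trans hi, rfl,
        expansionVal_pull Φ k _ _ _ _ (value_addLeft Φ a a O O' b)⟩
    | right a =>
      exact ⟨.ofIsMixed (isMixed_addRight hb a) (Par.bar_addRight hbar a),
        fun x i hx hi => (StrandOp.word_position (.right a) O x i hx).trans hi, rfl,
        expansionVal_pull Φ k _ _ _ _ (value_addRight Φ a a O O' b)⟩
    | double i =>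
      exact ⟨.ofIsMixed (isMixed_double hb i) (PaPerm.bar_double ⟨perm b, hσ, hbar⟩ i),
        fun x j hx hj => (StrandOp.word_position (.double i) O x j hx).trans hj, rfl,
        expansionVal_pull Φ k _ _ _ _ (value_double Φ O O' b i)⟩
  toBlue {l O O'} β i hi := by
    obtain ⟨⟨σ, hσ, hbar⟩, b, hb, hp⟩ := β
    change perm b = σ at hp
    subst hp
    have hc : ∀ x j, some x = some j → O.word j = blue → (O.toBlue i).word x = blue := by
      rintro x _ ⟨⟩ hx
      rw [← col_val (O.toBlue i).word, O.col_toBlue, Function.update_apply]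
      split_ifs
      · rfl
      · rw [col_val, hx]
    refine ⟨.ofIsMixed (isMixed_toBlue hb i hi) (PaPerm.bar_toBlue ⟨perm b, hσ, hbar⟩ i hi), hc, rfl,
      expansionVal_pull Φ k _ _ _ _ ?_⟩
    -- The values do not depend on the colours, and the map of positions is the identity.
    refine (value_toBlue Φ O O' b i (perm b i)).trans (Units.ext ?_)
    exact (pullSeries_one (value Φ O b O' : (BlueAlg l)⟦X⟧)).symm

/-- All truncations are projections of one construction: `projectHat ⊤` is the identity, and for
finite `k` the map `projectHat k` is `reduceHat k` by definition. -/
theorem isInducedBy_expansion (k : ℕ) : IsInducedBy (expansion Φ k) (expansion Φ ⊤) :=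
  fun σ x hx => congrArg (projectHat k _) (projectHat_top _ _).symm

theorem uncolour_val {c : Fin l → Color} (x : Hat ⊤ c) :
    (uncolour c x).val = toBlueSeries c x.val := by
  ext d
  rw [coeff_map, uncolour, pullHat, coeff_hatMap]
  rfl

theorem uncolour_expansion {O O' : Par l} (β : PaBraid O O') :
    (uncolour _ ((expansion Φ ⊤).val β.toPaPerm (β.cls ⊤))).val =
      (value Φ O β.braid O' : (BlueAlg l)⟦X⟧) := by
  rw [uncolour_val]
  refine (congrArg (fun x => toBlueSeries O.word x.val) (projectHat_top _ _)).trans ?_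
  exact (toBlueSeries_mixedHat Φ β.toPaPerm _).trans (valueLin_br Φ O O' β.braid)

end Expansion

/-! ### The values on a crossing and on a change of parentheses. -/

section Generators

variable (Φ : Associator)

theorem seg_selfLabel_one {l : ℕ} (i : Fin l) : seg (selfLabel l) i 1 = {i} := by
  ext x
  rw [mem_seg, Finset.mem_singleton, Fin.ext_iff]
  simp only [mem_selfLabel]
  constructor
  · rintro ⟨q, h1, h2, h3⟩; omega
  · intro h; exact ⟨x.val, by omega, by omega, rfl⟩

theorem isMixed_crossing {x y : Color} (h : x = blue ∨ y = blue) :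
    IsMixed (pair x y).word (pair y x).word (sig 2 0) := by
  refine isMixed_of_col ?_ ?_
  · rw [perm_sig (by decide)]
    ext1 p
    rw [labAct_sw (by decide), col_word, col_word]
    rcases p with _ | _ | p <;> rfl
  · rw [forget_sig _ (by decide), forgetGen, if_neg]
    rw [col_word]
    rintro ⟨-, h1, h2⟩
    rcases h with rfl | rfl
    · cases h1
    · cases h2

theorem bar_pair {x y : Color} (h : x = blue ∨ y = blue) : (pair x y).bar = (pair y x).bar := by
  rcases h with rfl | rfl
  · cases y <;> rfl
  · cases x <;> rfl

theorem bar_triple {x y z : Color} (h : x = blue ∨ y = blue ∨ z = blue) :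
    (leftTriple x y z).bar = (rightTriple x y z).bar := by
  cases x <;> cases y <;> cases z <;> first | rfl | simp at h

/-- Every associator that occurs has an empty first bundle, so only the exponential remains. -/
theorem value_crossing (x y : Color) :
    value Φ (pair x y) (sig 2 0) (pair y x) = cross {0} {1} := by
  have e : ∀ (z : ℕ → Finset (Fin 2)) (x y : Color), rebracketOpt Φ z (pair x y).tree 0 = 1 := by
    intro z x y
    change rebracket Φ z (.of x * .of y) 0 = 1
    rw [rebracket_mul]
    change (phi Φ ∅ _ _)⁻¹ * 1 * 1 = 1
    rw [phi_empty_left, inv_one, one_mul, one_mul]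
  rw [value, wordValue, e, e, braidValue_sig Φ (by decide), genValue_of_disj Φ selfLabel_disj, crossing]
  change 1 * (phi Φ ∅ _ _ * _ * (phi Φ ∅ _ _)⁻¹) * 1⁻¹ = _
  rw [phi_empty_left, phi_empty_left, inv_one, one_mul, mul_one, one_mul, mul_one]
  rw [show selfLabel 2 0 = {0} from selfLabel_val 0, show selfLabel 2 (0 + 1) = {1} from selfLabel_val 1]

/-- The word `(xy)z` is left-normed already. The associator is contributed by `x(yz)` alone,
inverted once in `rebracket` and once more because this word is at the top. -/
theorem value_rebracketing (x y z : Color) :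
    value Φ (leftTriple x y z) 1 (rightTriple x y z) = phi Φ {0} {1} {2} := by
  have e : ∀ q : Fin 3, seg (selfLabel 3) q.val 1 = {q} := seg_selfLabel_one
  have h1 : rebracketOpt Φ (selfLabel 3) (leftTriple x y z).tree 0 = 1 := by
    change rebracket Φ (selfLabel 3) (.of x * .of y * .of z) 0 = 1
    rw [rebracket_mul, rebracket_mul]
    change (phi Φ ∅ _ _)⁻¹ * ((phi Φ ∅ _ _)⁻¹ * 1 * 1) * 1 = 1
    rw [phi_empty_left, phi_empty_left, inv_one, one_mul, one_mul, one_mul, one_mul]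
  have h2 : rebracketOpt Φ (selfLabel 3) (rightTriple x y z).tree 0 = (phi Φ {0} {1} {2})⁻¹ := by
    change rebracket Φ (selfLabel 3) (.of x * (.of y * .of z)) 0 = _
    rw [rebracket_mul, rebracket_mul]
    change (phi Φ ∅ _ _)⁻¹ * 1 * ((phi Φ (seg (selfLabel 3) (0 : Fin 3).val 1)
      (seg (selfLabel 3) (1 : Fin 3).val 1) (seg (selfLabel 3) (2 : Fin 3).val 1))⁻¹ * 1 * 1) = _
    rw [phi_empty_left, e, e, e, inv_one, one_mul, one_mul, mul_one, mul_one]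
  rw [value, wordValue, perm_one, map_one, Equiv.Perm.one_apply, h1, h2, braidValue_one, inv_inv,
    one_mul, one_mul]

theorem comesFrom_expansion : ComesFrom (expSeries Φ.log) (expansion Φ ⊤) where
  crossing x y h := by
    refine ⟨.ofIsMixed (isMixed_crossing h) (bar_pair h), rfl, ?_⟩
    rw [uncolour_expansion]
    refine (congrArg Units.val (value_crossing Φ x y)).trans ?_
    rw [cross, chords_singleton]; rfl
  rebracketing x y z h := by
    have hm : IsMixed (leftTriple x y z).word (rightTriple x y z).word 1 :=
      IsMixed.one
    refine ⟨.ofIsMixed hm (bar_triple h), rfl, ?_⟩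
    rw [uncolour_expansion]
    refine (congrArg Units.val (value_rebracketing Φ x y z)).trans ?_
    rw [phi, chords_singleton, chords_singleton, Associator.coe_val]

end Generators

end

end MixedBraids

theorem proposition4p3 (Φ : PowerSeries (FreeAlgebra ℚ (Fin 2)))
    (hΦ : MixedBraids.IsAssociator Φ) :
    ∃ Z : MixedBraids.HomExpansion ⊤, MixedBraids.ComesFrom Φ Z ∧
      ∀ k : ℕ, 1 ≤ k → ∃ Z' : MixedBraids.HomExpansion (k : ℕ∞), MixedBraids.IsInducedBy Z' Z := by
  obtain ⟨φ, hφ, rfl⟩ := hΦ.groupLike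
  exact ⟨MixedBraids.expansion ⟨φ, hφ, hΦ⟩ ⊤, MixedBraids.comesFrom_expansion ⟨φ, hφ, hΦ⟩, fun k _ =>
    ⟨MixedBraids.expansion ⟨φ, hφ, hΦ⟩ k, MixedBraids.isInducedBy_expansion ⟨φ, hφ, hΦ⟩ k⟩⟩
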